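/- **Setting.** All functions take values in $\mathbb R^2$ unless said otherwise, $B_R\subset\mathbb R^2$ is the open disc of radius $R$ about $0$. *Potential.* $W:\mathbb R^2\to\mathbb R$ is a proper $C^3$ function whose local minima are exactly three points $c_1,c_2,c_3$, with $W(c_i)=0$ and $W''(c_i)$ positive definite; $W''(u)$ is positive semidefinite for $|u|>K_0$, for some $K_0>0$; and there are $K_1,K_2,m>0$, $p\ge 2$ with $K_1|u|^p\le W(u)\le K_2|u|^p$ for $|u|\ge m$. *The function $\phi$.* Let $0=\theta_0<\theta_1<\theta_2<\theta_3=2\pi$, let $0<\delta<\pi/2$, and for $i=1,2,3$ (with $c_4=c_1$) let $\zeta_{i,i+1}\in C^2(\mathbb R,\mathbb R^2)$ solve $-\zeta''+\tfrac12\nabla W(\zeta)=0$ with $\zeta(-\infty)=c_i$, $\zeta(+\infty)=c_{i+1}$. Let $\eta:\mathbb R^2\to\mathbb R$ be smooth with $\eta=1$ for $|x|\le\frac12$ and $\eta=0$ for $|x|\ge1$, and let $\eta_1,\dots,\eta_6\ge 0$ be smooth $2\pi$-periodic functions with $\sum_j\eta_j=1$ such that, modulo $2\pi$, $\eta_{2i}$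 vanishes outside $(\theta_i-\delta,\theta_i+\delta)$ and $\eta_{2i-1}$ vanishes outside $(\theta_{i-1}+\frac\delta2,\theta_i-\frac\delta2)$. With $\theta$ the polar angle of $x$ and $d_i(x)=-x_1\sin\theta_i+x_2\cos\theta_i$ (in the sector where $\eta_{2i}\ne0$, the signed distance to the half-line of direction $\theta_i$, positive on the counterclockwise side), put $$\phi(x)=(1-\eta(x))\sum_{i=1}^3\bigl(\eta_{2i}(\theta)\,\zeta_{i,i+1}(d_i(x))+\eta_{2i-1}(\theta)\,c_i\bigr).$$ *The function $V_q$.* Let $\mathcal Q=\{(\epsilon,\sigma,\alpha)\in(0,1]\times(0,1]\times[0,1]:\sigma\le\epsilon^{1-\alpha}\}$. Let $\chi:\mathbb R\to[0,\infty)$ be smooth with $\chi(s)=0$ for $s\le\frac12$ and $\chi(s)=1$ for $s\ge1$. For $q=(\epsilon,\sigma,\alpha)\in\mathcal Q$, $E>0$, and a classical solution $u_\sigma\in C^2(B_1)\cap C(\overline{B_1})$ of $$-\Delta u_\sigma+\frac{\nabla W(u_\sigma)}{2\sigma^2}=0\ \text{ in }B_1,\qquad u_\sigma(x)=\phi(x/\sigma)\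 \text{ on }\partial B_1,$$ put $v_\sigma(y)=u_\sigma(\sigma y)$, $\eta_\alpha(y)=\chi\bigl(\tfrac{\epsilon}{2E}|y|+1-\tfrac{\epsilon^\alpha}{2E}\bigr)$ and $V_q=\eta_\alpha\phi+(1-\eta_\alpha)v_\sigma$ on $B_{1/\epsilon}$ (where $1-\eta_\alpha=0$, the second term is read as $0$). *The Duhamel map.* Let $\mathcal H$ be the heat kernel of $B_{1/\epsilon}$ with zero Dirichlet data, i.e. $(\partial_t-\Delta_x)\mathcal H(x,y,t)=0$, $\mathcal H(x,y,t)=0$ for $x\in\partial B_{1/\epsilon}$, and $\mathcal H(\cdot,y,t)\to\delta_y$ as $t\to0^+$. For $\psi$ bounded and continuous on $B_{1/\epsilon}$, let $$F_q(h,\psi)(x,t)=\int_0^t\!\int_{B_{1/\epsilon}}\mathcal H(x,y,t-s)\Bigl(-\tfrac12\nabla W\bigl(h(y,s)+V_q(y)\bigr)+\Delta V_q(y)\Bigr)dy\,ds+\int_{B_{1/\epsilon}}\mathcal H(x,y,t)\psi(y)\,dy,$$ the last integral being read as $\psi(x)$ when $t=0$. For an interval $I$ let $\mathcal C_I$ be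 the set of bounded continuous functions $B_{1/\epsilon}\times I\to\mathbb R^2$. **Lemma.** Let $W$, $\phi$ and $\chi$ be as above. 1. For all $q\in\mathcal Q$, $E>0$, $u_\sigma$ as above and every bounded continuous $\psi$ on $B_{1/\epsilon}$, the map $F_q(\cdot,\psi)$ sends $\mathcal C_{[0,T]}$ into itself for each $T>0$, and there is $h_{q,\psi}\in\mathcal C_{[0,\infty)}$ with $F_q(h_{q,\psi},\psi)=h_{q,\psi}$ whose restriction to $[0,T]$ is, for each $T>0$, the unique fixed point of $F_q(\cdot,\psi)$ in $\mathcal C_{[0,T]}$. 2. For all $K,\Lambda>0$ there are $M>0$ and $\beta\in(0,1)$ (depending only on $K$, $\Lambda$, $W$, $\phi$, $\chi$) such that for all $q\in\mathcal Q$, $E>0$, $u_\sigma$ as above, all continuous $\psi$ on $B_{1/\epsilon}$ with $|\psi|\le\Lambda$, all $T\ge0$ and all continuous $w$ on $B_{1/\epsilon}\times[0,T+\frac{2\beta}M]$ with $|w|\le K$, $$\sup_{B_{1/\epsilon}\times[T,T+\frac{2\beta}{M}]}|w-h_{q,\psi}|\le\frac1{1-\beta}\Bigl(2\sup_{B_{1/\epsilon}\times[T,T+\frac{2\beta}{M}]}|F_q(w,\psi)-w|+\sup_{x\in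 B_{1/\epsilon}}|w-h_{q,\psi}|(x,T)\Bigr).$$ -/

import Mathlib

open Set Filter Topology MeasureTheory
open scoped ContDiff ENNReal

noncomputable section

namespace AllenCahn

/-- The Euclidean plane. -/
abbrev Plane := EuclideanSpace ℝ (Fin 2)

/-! ### The Dirichlet heat kernel and the Dirichlet heat semigroup of a disc -/

/-- `H x y t` is the heat kernel of the disc of radius `R` about the origin with zero Dirichlet
data: for each pole `y` it is a classical solution of the heat equation in `(x, t)`, vanishes for
`x` on the boundary circle, and converges to the Dirac mass at `y` as `t → 0+`. These properties
determine `H x y t` for all `x`, `y` in the closed disc and all `t > 0`. -/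
structure IsDirichletHeatKernel (R : ℝ) (H : Plane → Plane → ℝ → ℝ) : Prop where
  continuousOn : ContinuousOn (fun p : Plane × Plane × ℝ => H p.1 p.2.1 p.2.2)
    (Metric.closedBall 0 R ×ˢ Metric.closedBall 0 R ×ˢ Ioi 0)
  contDiffOn : ∀ y ∈ Metric.ball (0 : Plane) R, ∀ t : ℝ, 0 < t →
    ContDiffOn ℝ 2 (fun x => H x y t) (Metric.ball 0 R)
  heat_eq : ∀ x ∈ Metric.ball (0 : Plane) R, ∀ y ∈ Metric.ball (0 : Plane) R, ∀ t : ℝ, 0 < t →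
    HasDerivAt (fun s => H x y s) (Laplacian.laplacian (fun z => H z y t) x) t
  boundary : ∀ x ∈ Metric.sphere (0 : Plane) R, ∀ y ∈ Metric.ball (0 : Plane) R, ∀ t : ℝ, 0 < t →
    H x y t = 0
  initial : ∀ y ∈ Metric.ball (0 : Plane) R, ∀ f : Plane → ℝ, Continuous f →
    Tendsto (fun t => ∫ x in Metric.ball (0 : Plane) R, H x y t * f x) (𝓝[>] 0) (𝓝 (f y))

/-- The Dirichlet heat kernel of the disc of radius `R`, that is, the function with the properties
`IsDirichletHeatKernel R`. -/
def heatKernel (R : ℝ) : Plane → Plane → ℝ → ℝ :=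
  Classical.epsilon (IsDirichletHeatKernel R)

/-- The Dirichlet heat semigroup of the disc of radius `R`; at `t = 0` the kernel is the Dirac
mass, so that the integral is read as `ψ x`. -/
def heatSemigroup (R : ℝ) (ψ : Plane → Plane) (x : Plane) (t : ℝ) : Plane :=
  if t = 0 then ψ x else ∫ y in Metric.ball (0 : Plane) R, heatKernel R x y t • ψ y

/-! ### The potential and the connecting orbits -/

/-- The three-well potentials under consideration, with wells `c 0`, `c 1`, `c 2`. -/
structure IsThreeWell (W : Plane → ℝ) (c : Fin 3 → Plane) : Prop where
  contDiff : ContDiff ℝ 3 W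
  proper : IsProperMap W
  wells_injective : Function.Injective c
  isLocalMin_iff : ∀ u, IsLocalMin W u ↔ u ∈ range c
  wells_zero : ∀ i, W (c i) = 0
  wells_nondegenerate : ∀ i, ∀ v : Plane, v ≠ 0 → 0 < fderiv ℝ (fderiv ℝ W) (c i) v v
  hessian_nonneg : ∃ K : ℝ, 0 < K ∧ ∀ u : Plane, K < ‖u‖ → ∀ v : Plane,
    0 ≤ fderiv ℝ (fderiv ℝ W) u v v
  growth : ∃ K₁ K₂ m p : ℝ, 0 < K₁ ∧ 0 < K₂ ∧ 0 < m ∧ 2 ≤ p ∧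
    ∀ u : Plane, m ≤ ‖u‖ → K₁ * ‖u‖ ^ p ≤ W u ∧ W u ≤ K₂ * ‖u‖ ^ p

/-- `ζ` solves `-ζ'' + ∇W(ζ)/2 = 0` on the line and joins `a` (at `-∞`) to `b` (at `+∞`). -/
structure IsConnection (W : Plane → ℝ) (a b : Plane) (ζ : ℝ → Plane) : Prop where
  contDiff : ContDiff ℝ 2 ζ
  ode : ∀ τ, -deriv (deriv ζ) τ + (1 / 2 : ℝ) • gradient W (ζ τ) = 0
  tendsto_atBot : Tendsto ζ atBot (𝓝 a)
  tendsto_atTop : Tendsto ζ atTop (𝓝 b)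

/-! ### The function `φ` describing the triple junction at infinity -/

/-- A polar angle of a point of the plane. -/
def polarAngle (x : Plane) : ℝ := Complex.arg ⟨x 0, x 1⟩

/-- The distance of `x` to the half-line from the origin in direction `ϑ`, counted positively on
the counterclockwise side and negatively on the clockwise side, for `x` whose polar angle differs
from `ϑ` by at most `π / 2`. -/
def signedDist (ϑ : ℝ) (x : Plane) : ℝ := Real.cos ϑ * x 1 - Real.sin ϑ * x 0

/-- The choices entering the construction of `φ`. The half-lines have directions
`θ 1`, `θ 2`, `θ 3 = θ 0 + 2π`; the sector `(θ i, θ (i+1))` belongs to the well `c i`, and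
across the half-line of direction `θ (i+1)` one passes from `c i` to `c (i+1)` (cyclically). -/
structure JunctionData (W : Plane → ℝ) (c : Fin 3 → Plane) where
  /-- the angles -/
  θ : Fin 4 → ℝ
  θ_strictMono : StrictMono θ
  θ_zero : θ 0 = 0
  θ_three : θ 3 = 2 * Real.pi
  /-- the connecting orbits -/
  ζ : Fin 3 → ℝ → Plane
  ζ_connection : ∀ i, IsConnection W (c i) (c (i + 1)) (ζ i)
  /-- the cut-off near the origin -/
  η : Plane → ℝ
  η_smooth : ContDiff ℝ ∞ η
  η_one : ∀ x, ‖x‖ ≤ 1 / 2 → η x = 1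
  η_zero : ∀ x, 1 ≤ ‖x‖ → η x = 0
  /-- the angular opening of the neighbourhoods of the half-lines -/
  δ : ℝ
  δ_pos : 0 < δ
  δ_lt : δ < Real.pi / 2
  /-- the members of the angular partition of unity that live near the half-lines -/
  ray : Fin 3 → ℝ → ℝ
  /-- the members of the angular partition of unity that live inside the sectors -/
  sector : Fin 3 → ℝ → ℝ
  ray_smooth : ∀ i, ContDiff ℝ ∞ (ray i)
  sector_smooth : ∀ i, ContDiff ℝ ∞ (sector i)
  ray_periodic : ∀ i, Function.Periodic (ray i) (2 * Real.pi)
  sector_periodic : ∀ i, Function.Periodic (sector i) (2 * Real.pi)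
  ray_nonneg : ∀ i t, 0 ≤ ray i t
  sector_nonneg : ∀ i t, 0 ≤ sector i t
  sum_eq_one : ∀ t, ∑ i, (ray i t + sector i t) = 1
  ray_support : ∀ i t, ray i t ≠ 0 →
    ∃ k : ℤ, t + 2 * Real.pi * k ∈ Ioo (θ i.succ - δ) (θ i.succ + δ)
  sector_support : ∀ i t, sector i t ≠ 0 →
    ∃ k : ℤ, t + 2 * Real.pi * k ∈ Ioo (θ i.castSucc + δ / 2) (θ i.succ - δ / 2)

/-- The function `φ`: equal to the wells inside the sectors and to the connecting orbits, evaluated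
at the signed distance, near the half-lines. -/
def JunctionData.phi {W : Plane → ℝ} {c : Fin 3 → Plane} (d : JunctionData W c) (x : Plane) :
    Plane :=
  (1 - d.η x) • ∑ i : Fin 3, (d.ray i (polarAngle x) • d.ζ i (signedDist (d.θ i.succ) x) +
    d.sector i (polarAngle x) • c i)

/-! ### The approximate solution `V_q` -/

/-- The parameter set of all `q = (ε, σ, α)`. -/
def paramSet : Set (ℝ × ℝ × ℝ) :=
  {q | q.1 ∈ Ioc 0 1 ∧ q.2.1 ∈ Ioc 0 1 ∧ q.2.2 ∈ Icc 0 1 ∧ q.2.1 ≤ q.1 ^ (1 - q.2.2)}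

/-- `u` is a classical solution of `-Δu + ∇W(u)/(2σ²) = 0` in the unit disc with boundary values
`φ(x/σ)`. -/
structure IsEllipticSolution (W : Plane → ℝ) (φ : Plane → Plane) (σ : ℝ) (u : Plane → Plane) :
    Prop where
  contDiffOn : ContDiffOn ℝ 2 u (Metric.ball 0 1)
  continuousOn : ContinuousOn u (Metric.closedBall 0 1)
  equation : ∀ x ∈ Metric.ball (0 : Plane) 1,
    -Laplacian.laplacian u x + (1 / (2 * σ ^ 2)) • gradient W (u x) = 0
  boundary : ∀ x ∈ Metric.sphere (0 : Plane) 1, u x = φ (σ⁻¹ • x)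

/-- A smooth nonnegative cut-off profile on the line, `0` up to `1/2` and `1` from `1` on. -/
structure IsCutoff (χ : ℝ → ℝ) : Prop where
  smooth : ContDiff ℝ ∞ χ
  nonneg : ∀ s, 0 ≤ χ s
  eq_zero : ∀ s, s ≤ 1 / 2 → χ s = 0
  eq_one : ∀ s, 1 ≤ s → χ s = 1

/-- The radial cut-off with width parameter `L`: it is `1` for `‖y‖ ≥ ε ^ (α - 1)` and `0` for
`‖y‖ ≤ ε ^ (α - 1) - L / ε`. -/
def radialCutoff (χ : ℝ → ℝ) (L ε α : ℝ) (y : Plane) : ℝ :=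
  χ (ε / (2 * L) * ‖y‖ + 1 - ε ^ α / (2 * L))

/-- The function `V_q`, which interpolates between `φ` and `v_σ(y) = u_σ(σ y)`. -/
def approxSol (φ : Plane → Plane) (χ : ℝ → ℝ) (L : ℝ) (q : ℝ × ℝ × ℝ) (u : Plane → Plane)
    (y : Plane) : Plane :=
  radialCutoff χ L q.1 q.2.2 y • φ y + (1 - radialCutoff χ L q.1 q.2.2 y) • u (q.2.1 • y)

/-! ### The Duhamel map and its fixed points -/

/-- The Duhamel map `F(h, ψ)` on the disc of radius `R`, for the background function `V`. -/
def duhamel (R : ℝ) (W : Plane → ℝ) (V ψ : Plane → Plane) (h : Plane → ℝ → Plane)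
    (x : Plane) (t : ℝ) : Plane :=
  (∫ s in (0 : ℝ)..t, ∫ y in Metric.ball (0 : Plane) R,
    heatKernel R x y (t - s) •
      (-((1 / 2 : ℝ) • gradient W (h y s + V y)) + Laplacian.laplacian V y)) +
  heatSemigroup R ψ x t

/-- `h` is continuous and bounded on the product of the disc of radius `R` and the time set `S`. -/
def IsBddCont (R : ℝ) (S : Set ℝ) (h : Plane → ℝ → Plane) : Prop :=
  ContinuousOn (fun p : Plane × ℝ => h p.1 p.2) (Metric.ball 0 R ×ˢ S) ∧
    ∃ C : ℝ, ∀ x ∈ Metric.ball (0 : Plane) R, ∀ t ∈ S, ‖h x t‖ ≤ C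

/-- `h` is a fixed point of the Duhamel map among the bounded continuous functions on the product
of the disc of radius `R` and the time set `S` (used for `S = [0, T]` and `S = [0, ∞)`). -/
def IsFixedPointOn (R : ℝ) (W : Plane → ℝ) (V ψ : Plane → Plane) (S : Set ℝ)
    (h : Plane → ℝ → Plane) : Prop :=
  IsBddCont R S h ∧ ∀ x ∈ Metric.ball (0 : Plane) R, ∀ t ∈ S, duhamel R W V ψ h x t = h x t

/-- The supremum of `|f|` over the product of the disc of radius `R` and the time set `S`. -/
def supNorm (R : ℝ) (S : Set ℝ) (f : Plane → ℝ → Plane) : ℝ≥0∞ :=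
  ⨆ x ∈ Metric.ball (0 : Plane) R, ⨆ t ∈ S, ‖f x t‖ₑ

end AllenCahn

end

/-! Everything rests on one a priori bound. By the growth of `W` and its convexity far out, `⟨∇W(v),
v⟩ > 0` for large `|v|`, so for suitable large `ρ` and `lam` the map `v ↦ v - ∇W(v) / (2 lam)` sends
the ball of radius `ρ` into itself (`IsThreeWell.exists_reaction_add_le`). If `h` is a fixed point,
`h + V` formally solves `∂ₜz = Δz - ∇W(z)/2` with the boundary values of `V`; if `V` and the initial
value lie in that ball, `h + V` never leaves it (`IsRegularLimit.norm_mild_add_le`). Truncating the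
reaction term outside the ball makes it globally Lipschitz (`IsThreeWell.exists_truncation`), Picard
iteration in a norm weighted by `exp (2 lip t)` gives a global solution
(`IsRegularLimit.exists_mild`), and by invariance this solution does not see the truncation. Bounded
fixed points are unique because the reaction term is Lipschitz on bounded sets.

The functions `V_q` are bounded independently of the parameters (`exists_isRegularLimit_approxSol`):
`φ` is bounded, and the maximum principle for `|u|²` bounds the elliptic solutions. So `ρ` and the
Lipschitz constant `lip` on the ball depend only on the data allowed in the statement.

For stability, take `M = 2 lip` and `β = 1/2`, so that the window has length `1 / (2 lip)`.
Restarting `F(w)` and `h` at time `T`, their distance on the window is at most their distance at `T`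
plus half of `sup |w - h|`. The distance at `T` is at most `|F(w) - w| + |w - h|`, and the half is
absorbed (`supNorm_sub_le`).

Two analytic points carry the length. First, the heat kernel is given only by its properties, so its
existence and uniqueness have to be proved. The Green operator `K` of the disc is explicit and
positive on `L²`; formally the Green function with pole `x` is `K δ_x`, which suggests the kernel
`⟨G_x, K⁻² exp (-t K⁻¹) G_y⟩`, defined by continuous functional calculus. Interior regularity for
weak Laplacians makes it a classical solution, and the parabolic maximum principle gives positivity,
mass at most one and uniqueness (`heatKernel_eq`).

Second, `ΔV_q` need not be bounded: when `E > ε ^ α` the radial cut-off may have a cone point at the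
origin, which costs a term of size `1 / |y|`. Comparison with `R - |y|`, whose Laplacian is `-1 /
|y|`, shows that the heat kernel integrates `1 / |y|` over space-time with a bound that tends to
zero for short times (`integrable_heatKer_weight`). This comparison and the invariance of the ball
both follow from `heatKer_supersolution`. -/

noncomputable section

namespace AllenCahn

open Laplacian

/-! ### Calculus of the Laplacian in coordinates -/

/-- The standard basis of the plane. -/
abbrev basisVec (i : Fin 2) : Plane := EuclideanSpace.single i 1

lemma laplacian_eq_sum {F : Type*} [NormedAddCommGroup F] [NormedSpace ℝ F] (f : Plane → F)
    (x : Plane) :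
    laplacian f x = ∑ i, fderiv ℝ (fderiv ℝ f) x (basisVec i) (basisVec i) := by
  rw [InnerProductSpace.laplacian_eq_iteratedFDeriv_orthonormalBasis f
    (EuclideanSpace.basisFun (Fin 2) ℝ)]
  simp [iteratedFDeriv_two_apply]

section

variable {F : Type*} [NormedAddCommGroup F] [NormedSpace ℝ F]

lemma differentiableAt_fderiv {f : Plane → F} {x : Plane} (hf : ContDiffAt ℝ 2 f x) :
    DifferentiableAt ℝ (fderiv ℝ f) x :=
  (hf.fderiv_right (m := 1) (by norm_num)).differentiableAt (by norm_num)

lemma eventually_differentiableAt {f : Plane → F} {x : Plane} (hf : ContDiffAt ℝ 2 f x) :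
    ∀ᶠ y in 𝓝 x, DifferentiableAt ℝ f y :=
  (hf.eventually (by simp)).mono fun _ h => h.differentiableAt (by norm_num)

lemma fderiv_fderiv_apply {f : Plane → F} {x : Plane} (hf : ContDiffAt ℝ 2 f x) (v w : Plane) :
    fderiv ℝ (fun y => fderiv ℝ f y v) x w = fderiv ℝ (fderiv ℝ f) x w v := by
  rw [fderiv_clm_apply (differentiableAt_fderiv hf) (differentiableAt_const v)]
  simp

/-- The Laplacian computed from given first and second partial derivatives. -/
lemma laplacian_eq_of_hasFDerivAt {f : Plane → F} {x : Plane} (hf : ContDiffAt ℝ 2 f x)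
    {g : Fin 2 → Plane → F} (hg : ∀ i, ∀ᶠ y in 𝓝 x, fderiv ℝ f y (basisVec i) = g i y) :
    laplacian f x = ∑ i, fderiv ℝ (g i) x (basisVec i) := by
  rw [laplacian_eq_sum]
  refine Finset.sum_congr rfl fun i _ => ?_
  rw [← fderiv_fderiv_apply hf, (EventuallyEq.fderiv_eq (hg i) : _)]

lemma laplacian_smul_fun {a : Plane → ℝ} {f : Plane → F} {x : Plane} (ha : ContDiffAt ℝ 2 a x)
    (hf : ContDiffAt ℝ 2 f x) :
    laplacian (fun y => a y • f y) x = a x • laplacian f x +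
      (2 : ℝ) • ∑ i, fderiv ℝ a x (basisVec i) • fderiv ℝ f x (basisVec i) +
      laplacian a x • f x := by
  rw [laplacian_eq_of_hasFDerivAt (f := fun y => a y • f y) (ha.smul hf)
    (g := fun i y => a y • fderiv ℝ f y (basisVec i) + fderiv ℝ a y (basisVec i) • f y)]
  · have h1 : ∀ i : Fin 2, fderiv ℝ (fun y => a y • fderiv ℝ f y (basisVec i) +
        fderiv ℝ a y (basisVec i) • f y) x (basisVec i) =
        a x • fderiv ℝ (fderiv ℝ f) x (basisVec i) (basisVec i) +
        (2 : ℝ) • fderiv ℝ a x (basisVec i) • fderiv ℝ f x (basisVec i) +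
        fderiv ℝ (fderiv ℝ a) x (basisVec i) (basisVec i) • f x := by
      intro i
      have da := ha.differentiableAt (by norm_num)
      have df := hf.differentiableAt (by norm_num)
      have da' : DifferentiableAt ℝ (fun y => fderiv ℝ a y (basisVec i)) x :=
        (differentiableAt_fderiv ha).clm_apply (differentiableAt_const _)
      have df' : DifferentiableAt ℝ (fun y => fderiv ℝ f y (basisVec i)) x :=
        (differentiableAt_fderiv hf).clm_apply (differentiableAt_const _)
      have hs : fderiv ℝ (fun y => a y • fderiv ℝ f y (basisVec i) +
          fderiv ℝ a y (basisVec i) • f y) x = _ :=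
        ((da.hasFDerivAt.smul df'.hasFDerivAt).add (da'.hasFDerivAt.smul df.hasFDerivAt)).fderiv
      rw [hs]
      simp only [add_apply, smul_apply,
        ContinuousLinearMap.smulRight_apply, fderiv_fderiv_apply ha, fderiv_fderiv_apply hf]
      rw [two_smul]
      abel
    simp only [h1, laplacian_eq_sum, Finset.sum_add_distrib, Finset.smul_sum, Finset.sum_smul]
  · intro i
    filter_upwards [eventually_differentiableAt ha, eventually_differentiableAt hf] with y h1 h2
    rw [fderiv_fun_smul h1 h2]
    simp

lemma laplacian_comp {F : ℝ → ℝ} {q : Plane → ℝ} {x : Plane} (hF : ContDiffAt ℝ 2 F (q x))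
    (hq : ContDiffAt ℝ 2 q x) :
    laplacian (fun y => F (q y)) x =
      deriv (deriv F) (q x) * ∑ i, (fderiv ℝ q x (basisVec i)) ^ 2 +
        deriv F (q x) * laplacian q x := by
  rw [laplacian_eq_of_hasFDerivAt (f := fun y => F (q y)) (hF.comp x hq)
    (g := fun i y => deriv F (q y) * fderiv ℝ q y (basisVec i))]
  · have dF : DifferentiableAt ℝ (deriv F) (q x) := by
      have := (hF.fderiv_right (m := 1) (by norm_num)).differentiableAt (by norm_num)
      exact this.clm_apply (differentiableAt_const (1 : ℝ))
    have dq := hq.differentiableAt (by norm_num)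
    have h1 : ∀ i : Fin 2, fderiv ℝ (fun y => deriv F (q y) * fderiv ℝ q y (basisVec i)) x
        (basisVec i) = deriv (deriv F) (q x) * (fderiv ℝ q x (basisVec i)) ^ 2 +
          deriv F (q x) * fderiv ℝ (fderiv ℝ q) x (basisVec i) (basisVec i) := by
      intro i
      have dq' : DifferentiableAt ℝ (fun y => fderiv ℝ q y (basisVec i)) x :=
        (differentiableAt_fderiv hq).clm_apply (differentiableAt_const _)
      have hc : HasFDerivAt (fun y => deriv F (q y)) (deriv (deriv F) (q x) • fderiv ℝ q x) x :=
        dF.hasDerivAt.comp_hasFDerivAt x dq.hasFDerivAt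
      rw [fderiv_fun_mul hc.differentiableAt dq', hc.fderiv]
      simp only [add_apply, smul_apply,
        fderiv_fderiv_apply hq, smul_eq_mul]
      ring
    simp only [h1, laplacian_eq_sum, Finset.sum_add_distrib, Finset.mul_sum]
  · intro i
    have h3 : ∀ᶠ y in 𝓝 x, DifferentiableAt ℝ F (q y) :=
      hq.continuousAt.eventually
        ((hF.eventually (by simp)).mono fun _ h => h.differentiableAt (by norm_num))
    filter_upwards [h3, eventually_differentiableAt hq] with y h1 h2
    have := (h1.hasDerivAt.comp_hasFDerivAt y h2.hasFDerivAt).fderiv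
    simp only [Function.comp_def] at this
    rw [this]
    simp

lemma continuousOn_laplacian {f : Plane → F} {U : Set Plane} (hU : IsOpen U)
    (hf : ContDiffOn ℝ 2 f U) : ContinuousOn (laplacian f) U := by
  intro x hx
  have h := (hf.contDiffAt (hU.mem_nhds hx))
  have h2 : ContinuousAt (fderiv ℝ (fderiv ℝ f)) x :=
    ((h.fderiv_right (m := 1) (by norm_num)).fderiv_right (m := 0) (by norm_num)).continuousAt
  refine ContinuousAt.continuousWithinAt ?_
  have : laplacian f = fun x => ∑ i, fderiv ℝ (fderiv ℝ f) x (basisVec i) (basisVec i) :=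
    funext (laplacian_eq_sum f)
  rw [this]
  fun_prop

lemma laplacian_congr {f g : Plane → F} {x : Plane} (h : f =ᶠ[𝓝 x] g) :
    laplacian f x = laplacian g x :=
  (InnerProductSpace.laplacian_congr_nhds h).eq_of_nhds

lemma laplacian_fun_add {f g : Plane → F} {x : Plane} (hf : ContDiffAt ℝ 2 f x)
    (hg : ContDiffAt ℝ 2 g x) :
    laplacian (fun y => f y + g y) x = laplacian f x + laplacian g x :=
  ContDiffAt.laplacian_add hf hg

lemma laplacian_fun_sub {f g : Plane → F} {x : Plane} (hf : ContDiffAt ℝ 2 f x)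
    (hg : ContDiffAt ℝ 2 g x) :
    laplacian (fun y => f y - g y) x = laplacian f x - laplacian g x :=
  ContDiffAt.laplacian_sub hf hg

lemma laplacian_const_mul {f : Plane → ℝ} {x : Plane} (c : ℝ) (hf : ContDiffAt ℝ 2 f x) :
    laplacian (fun y => c * f y) x = c * laplacian f x :=
  InnerProductSpace.laplacian_smul c hf

/-- The Laplacian commutes with isometric reparametrisations permuting the axes up to sign. -/
lemma laplacian_comp_isometry {f : Plane → F} {x b : Plane} (r : Plane →L[ℝ] Plane)
    (hr : ∀ i, r (basisVec i) = basisVec i ∨ r (basisVec i) = -basisVec i)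
    (hf : ContDiffAt ℝ 2 f (b + r x)) :
    laplacian (fun y => f (b + r y)) x = laplacian f (b + r x) := by
  have hr' : ∀ y, HasFDerivAt (fun y => b + r y) r y := fun y => (r.hasFDerivAt).const_add b
  have hc : ContDiffAt ℝ 2 (fun y => f (b + r y)) x :=
    ContDiffAt.comp x hf (contDiffAt_const.add r.contDiff.contDiffAt)
  rw [laplacian_eq_of_hasFDerivAt hc (g := fun i y => fderiv ℝ f (b + r y) (r (basisVec i))),
    laplacian_eq_sum]
  · refine Finset.sum_congr rfl fun i _ => ?_
    have h2 : HasFDerivAt (fun y => fderiv ℝ f (b + r y))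
        ((fderiv ℝ (fderiv ℝ f) (b + r x)).comp r) x :=
      (differentiableAt_fderiv hf).hasFDerivAt.comp x (hr' x)
    rw [fderiv_clm_apply h2.differentiableAt (differentiableAt_const _), h2.fderiv]
    rcases hr i with h | h <;> simp [h]
  · intro i
    have h3 : ∀ᶠ y in 𝓝 x, DifferentiableAt ℝ f (b + r y) :=
      (hr' x).continuousAt.eventually (eventually_differentiableAt hf)
    filter_upwards [h3] with y hy
    have := (hy.hasFDerivAt.comp y (hr' y)).fderiv
    simp only [Function.comp_def] at this
    rw [this]
    simp

end

/-! ### Maximum principles -/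

/-- A positive second derivative would make the point a local minimum as well; the function would
then be locally constant and its second derivative zero. -/
lemma deriv_deriv_nonpos_of_isLocalMax {φ : ℝ → ℝ} {s : ℝ} (hc : ContinuousAt φ s)
    (h : IsLocalMax φ s) : deriv (deriv φ) s ≤ 0 := by
  by_contra! hpos
  have h1 := isLocalMin_of_deriv_deriv_pos hpos h.deriv_eq_zero hc
  have h2 : φ =ᶠ[𝓝 s] fun _ => φ s := by
    filter_upwards [h, h1] with y ha hb using le_antisymm ha hb
  have h3 : deriv φ =ᶠ[𝓝 s] fun _ => 0 := by
    have := h2.deriv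
    simpa using this
  have := h3.deriv_eq
  simp at this
  linarith

lemma hasDerivAt_line {F : Type*} [NormedAddCommGroup F] [NormedSpace ℝ F] {f : Plane → F}
    {x v : Plane} {s : ℝ} (hf : DifferentiableAt ℝ f (x + s • v)) :
    HasDerivAt (fun s : ℝ => f (x + s • v)) (fderiv ℝ f (x + s • v) v) s := by
  have h1 : HasDerivAt (fun s : ℝ => x + s • v) v s := by
    simpa using ((hasDerivAt_id s).smul_const v).const_add x
  exact hf.hasFDerivAt.comp_hasDerivAt s h1

lemma fderiv_fderiv_nonpos_of_isLocalMax {f : Plane → ℝ} {x : Plane} (hf : ContDiffAt ℝ 2 f x)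
    (h : IsLocalMax f x) (v : Plane) : fderiv ℝ (fderiv ℝ f) x v v ≤ 0 := by
  have hcont : Tendsto (fun s : ℝ => x + s • v) (𝓝 0) (𝓝 x) := by
    have : Continuous fun s : ℝ => x + s • v := by fun_prop
    simpa using this.tendsto 0
  have h1 : IsLocalMax (fun s : ℝ => f (x + s • v)) 0 := by
    have := hcont.eventually h
    filter_upwards [this] with s hs
    simpa using hs
  have h2 : deriv (fun s : ℝ => f (x + s • v)) =ᶠ[𝓝 0] fun s => fderiv ℝ f (x + s • v) v := by
    filter_upwards [hcont.eventually (eventually_differentiableAt hf)] with s hs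
    exact (hasDerivAt_line hs).deriv
  have h3 : HasDerivAt (fun s : ℝ => fderiv ℝ f (x + s • v) v)
      (fderiv ℝ (fderiv ℝ f) x v v) 0 := by
    have := hasDerivAt_line (f := fun y => fderiv ℝ f y v) (x := x) (v := v) (s := 0)
      (by simpa using (differentiableAt_fderiv hf).clm_apply (differentiableAt_const v))
    simpa [fderiv_fderiv_apply hf] using this
  have h4 : ContinuousAt (fun s : ℝ => f (x + s • v)) 0 :=
    ContinuousAt.comp (x := (0 : ℝ)) (g := f) (f := fun s : ℝ => x + s • v)
      (by simpa using hf.continuousAt) (by fun_prop)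
  have := deriv_deriv_nonpos_of_isLocalMax h4 h1
  rwa [h2.deriv_eq, h3.deriv] at this

lemma laplacian_nonpos_of_isLocalMax {f : Plane → ℝ} {x : Plane} (hf : ContDiffAt ℝ 2 f x)
    (h : IsLocalMax f x) : laplacian f x ≤ 0 := by
  rw [laplacian_eq_sum]
  exact Finset.sum_nonpos fun i _ => fderiv_fderiv_nonpos_of_isLocalMax hf h _

/-- `‖x‖²` in coordinates. -/
lemma norm_sq_eq (x : Plane) : ‖x‖ ^ 2 = x 0 ^ 2 + x 1 ^ 2 := by
  rw [EuclideanSpace.norm_sq_eq]; simp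

lemma fderiv_norm_sq_apply' (x v : Plane) :
    fderiv ℝ (fun y : Plane => ‖y‖ ^ 2) x v = 2 * inner ℝ x v := by
  simp [fderiv_norm_sq_apply]

lemma laplacian_norm_sq (x : Plane) : laplacian (fun y : Plane => ‖y‖ ^ 2) x = 4 := by
  rw [laplacian_eq_of_hasFDerivAt (contDiff_norm_sq ℝ).contDiffAt
    (g := fun i y => 2 * y i)]
  · have : ∀ i : Fin 2, fderiv ℝ (fun y : Plane => 2 * y i) x (basisVec i) = 2 := by
      intro i
      have h : HasFDerivAt (fun y : Plane => 2 * y i)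
        ((2 : ℝ) • (EuclideanSpace.proj i : Plane →L[ℝ] ℝ)) x := by
        simpa using ((EuclideanSpace.proj i : Plane →L[ℝ] ℝ).hasFDerivAt (x := x)).const_mul 2
      rw [h.fderiv]; simp
    simp [this]; norm_num
  · intro i
    refine Eventually.of_forall fun y => ?_
    rw [fderiv_norm_sq_apply']
    simp [EuclideanSpace.inner_single_right]

/-- Weak maximum principle for strict subsolutions. -/
lemma le_of_laplacian_pos {K U : Set Plane} (hK : IsCompact K) (hU : IsOpen U) (hUK : U ⊆ K)
    {f : Plane → ℝ} (hf : ContinuousOn f K) (hf2 : ContDiffOn ℝ 2 f U)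
    (hpos : ∀ x ∈ U, 0 < laplacian f x) {m : ℝ} (hm : ∀ x ∈ K \ U, f x ≤ m) :
    ∀ x ∈ K, f x ≤ m := by
  intro x hx
  obtain ⟨z, hz, hmax⟩ := hK.exists_isMaxOn ⟨x, hx⟩ hf
  by_cases hzU : z ∈ U
  · have h1 : IsLocalMax f z := by
      filter_upwards [hU.mem_nhds hzU] with y hy using hmax (hUK hy)
    exact absurd (laplacian_nonpos_of_isLocalMax (hf2.contDiffAt (hU.mem_nhds hzU)) h1)
      (not_le.2 (hpos z hzU))
  · exact (hmax hx).trans (hm z ⟨hz, hzU⟩)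

/-- Weak maximum principle for subsolutions. -/
lemma le_of_laplacian_nonneg {K U : Set Plane} (hK : IsCompact K) (hU : IsOpen U) (hUK : U ⊆ K)
    {f : Plane → ℝ} (hf : ContinuousOn f K) (hf2 : ContDiffOn ℝ 2 f U)
    (hpos : ∀ x ∈ U, 0 ≤ laplacian f x) {m : ℝ} (hm : ∀ x ∈ K \ U, f x ≤ m) :
    ∀ x ∈ K, f x ≤ m := by
  obtain ⟨C, hC⟩ := hK.isBounded.exists_norm_le
  intro x hx
  refine le_of_forall_pos_le_add fun η hη => ?_
  -- Adding `δ ‖x‖²` makes the subsolution strict, since its Laplacian is `4 δ`, and changes it by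
  -- at most `η` on `K`.
  set δ := η / (C ^ 2 + 1) with hδ
  have hδ0 : 0 < δ := by positivity
  have hδC : δ * C ^ 2 ≤ η := by
    rw [hδ, div_mul_eq_mul_div, div_le_iff₀ (by positivity)]; nlinarith [sq_nonneg C]
  have hb : ∀ y ∈ K, δ * ‖y‖ ^ 2 ≤ η := fun y hy => by
    have : ‖y‖ ^ 2 ≤ C ^ 2 := by gcongr; exact hC y hy
    nlinarith
  have := le_of_laplacian_pos hK hU hUK (f := fun y => f y + δ * ‖y‖ ^ 2)
    (hf.add (by fun_prop)) (hf2.add (contDiff_const.mul (contDiff_norm_sq ℝ)).contDiffOn)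
    (fun y hy => ?_) (m := m + η) (fun y hy => add_le_add (hm y hy) (hb y hy.1)) x hx
  · nlinarith [sq_nonneg ‖x‖]
  · have h1 := ContDiffAt.laplacian_add (f₁ := f) (f₂ := δ • fun y : Plane => ‖y‖ ^ 2) (x := y)
      (hf2.contDiffAt (hU.mem_nhds hy)) (contDiff_const.smul (contDiff_norm_sq ℝ)).contDiffAt
    rw [InnerProductSpace.laplacian_smul _ (contDiff_norm_sq ℝ).contDiffAt, laplacian_norm_sq] at h1
    have h2 : (f + δ • fun y : Plane => ‖y‖ ^ 2) = fun y => f y + δ * ‖y‖ ^ 2 := by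
      ext; simp
    rw [h2] at h1
    rw [h1]
    have := hpos y hy
    simp
    linarith

/-- Weak maximum principle for the heat equation on a disc. -/
lemma le_zero_of_heat {R T : ℝ} {v : Plane → ℝ → ℝ}
    (hc : ContinuousOn (fun p : Plane × ℝ => v p.1 p.2) (Metric.closedBall 0 R ×ˢ Icc 0 T))
    (h2 : ∀ t, 0 < t → t ≤ T → ContDiffOn ℝ 2 (fun x => v x t) (Metric.ball 0 R))
    (heat : ∀ x ∈ Metric.ball (0 : Plane) R, ∀ t, 0 < t → t ≤ T →
      HasDerivAt (fun s => v x s) (laplacian (fun z => v z t) x) t)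
    (hinit : ∀ x ∈ Metric.closedBall (0 : Plane) R, v x 0 ≤ 0)
    (hbdry : ∀ x ∈ Metric.sphere (0 : Plane) R, ∀ t, 0 < t → t ≤ T → v x t ≤ 0) :
    ∀ x ∈ Metric.closedBall (0 : Plane) R, ∀ t ∈ Icc 0 T, v x t ≤ 0 := by
  intro x hx t ht
  refine le_of_forall_pos_le_add fun η hη => ?_
  have hT : 0 ≤ T := ht.1.trans ht.2
  -- Subtracting `δ t` makes the subsolution strict at a cost of at most `η`. At a positive interior
  -- maximum the time derivative would then be negative, which contradicts maximality.
  set δ := η / (T + 1) with hδ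
  have hδ0 : 0 < δ := by positivity
  have hδT : δ * T ≤ η := by
    rw [hδ, div_mul_eq_mul_div, div_le_iff₀ (by positivity)]; nlinarith
  have hK : IsCompact (Metric.closedBall (0 : Plane) R ×ˢ Icc 0 T) :=
    (isCompact_closedBall _ _).prod isCompact_Icc
  obtain ⟨⟨z, s⟩, ⟨hz, hs⟩, hmax⟩ := hK.exists_isMaxOn ⟨(x, t), hx, ht⟩
    (f := fun p : Plane × ℝ => v p.1 p.2 - δ * p.2) (hc.sub (by fun_prop))
  change z ∈ Metric.closedBall (0 : Plane) R at hz
  change s ∈ Icc 0 T at hs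
  have hxt : v x t - δ * t ≤ v z s - δ * s := hmax (show (x, t) ∈ _ from ⟨hx, ht⟩)
  have key : v z s ≤ 0 := by
    rcases hs.1.eq_or_lt with h0 | h0
    · rw [← h0]; exact hinit z hz
    rcases (mem_closedBall_zero_iff.1 hz).eq_or_lt with hR | hR
    · exact hbdry z (by simpa using hR) s h0 hs.2
    exfalso
    have hzb : z ∈ Metric.ball (0 : Plane) R := by simpa using hR
    have hlap : laplacian (fun y => v y s) z ≤ 0 := by
      refine laplacian_nonpos_of_isLocalMax
        ((h2 s h0 hs.2).contDiffAt (Metric.isOpen_ball.mem_nhds hzb)) ?_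
      filter_upwards [Metric.isOpen_ball.mem_nhds hzb] with y hy
      have : v y s - δ * s ≤ v z s - δ * s :=
        hmax (show (y, s) ∈ _ from ⟨Metric.ball_subset_closedBall hy, hs⟩)
      linarith
    have hd := (heat z hzb s h0 hs.2).sub ((hasDerivAt_id s).const_mul δ)
    have hneg : laplacian (fun y => v y s) z - δ * 1 < 0 := by linarith
    have hslope := (hasDerivAt_iff_tendsto_slope.1 hd).eventually (gt_mem_nhds hneg)
    -- Only earlier times are compared, because the maximum may be attained at the final time `T`.
    have hl : ∀ᶠ r in 𝓝[<] s, slope ((fun s => v z s) - fun s => δ * id s) s r < 0 :=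
      hslope.filter_mono (nhdsWithin_mono _ fun r hr => ne_of_lt hr)
    have hpos : ∀ᶠ r in 𝓝[<] s, 0 < r := nhdsWithin_le_nhds (lt_mem_nhds h0)
    obtain ⟨r, hr1, hr2, hr3⟩ := (hl.and (hpos.and self_mem_nhdsWithin)).exists
    have hr3 : r < s := hr3
    have hr4 : v z r - δ * r ≤ v z s - δ * s :=
      hmax (show (z, r) ∈ _ from ⟨hz, hr2.le, hr3.le.trans hs.2⟩)
    rw [slope_def_field, div_neg_iff] at hr1
    simp only [Pi.sub_apply, id] at hr1
    rcases hr1 with h | h <;> linarith [h.1, h.2]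
  nlinarith [ht.1, ht.2, hs.1, mul_le_mul_of_nonneg_left ht.2 hδ0.le, mul_nonneg hδ0.le hs.1]

/-! ### Interior gradient estimate -/

/-- The reflection of the plane in the line orthogonal to the `i`-th axis. -/
def reflectAxis (i : Fin 2) : Plane →L[ℝ] Plane :=
  ContinuousLinearMap.id ℝ Plane -
    (2 : ℝ) • (EuclideanSpace.proj i : Plane →L[ℝ] ℝ).smulRight (basisVec i)

lemma reflectAxis_apply (i : Fin 2) (z : Plane) :
    reflectAxis i z = z - (2 * z i) • basisVec i := by
  simp [reflectAxis, smul_smul]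

lemma norm_reflectAxis (i : Fin 2) (z : Plane) : ‖reflectAxis i z‖ = ‖z‖ := by
  rw [← sq_eq_sq₀ (norm_nonneg _) (norm_nonneg _), norm_sq_eq, norm_sq_eq, reflectAxis_apply]
  fin_cases i <;> simp <;> ring

lemma reflectAxis_basisVec (i j : Fin 2) :
    reflectAxis i (basisVec j) = basisVec j ∨ reflectAxis i (basisVec j) = -basisVec j := by
  by_cases h : j = i
  · subst h
    right
    rw [reflectAxis_apply]
    simp [two_smul]
  · left
    rw [reflectAxis_apply]
    simp [Ne.symm h]

lemma reflectAxis_of_apply_eq_zero {i : Fin 2} {z : Plane} (h : z i = 0) :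
    reflectAxis i z = z := by
  simp [reflectAxis_apply, h]

lemma abs_apply_le_norm (z : Plane) (i : Fin 2) : |z i| ≤ ‖z‖ := by
  simpa using PiLp.norm_apply_le z i

lemma laplacian_apply_sq (i : Fin 2) (x : Plane) :
    laplacian (fun y : Plane => (y i) ^ 2) x = 2 := by
  have hd : ∀ y : Plane, HasFDerivAt (fun y : Plane => y i)
      (EuclideanSpace.proj i : Plane →L[ℝ] ℝ) y :=
    fun y => (EuclideanSpace.proj i : Plane →L[ℝ] ℝ).hasFDerivAt
  rw [laplacian_eq_of_hasFDerivAt (f := fun y : Plane => (y i) ^ 2) (by fun_prop)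
    (g := fun j y => 2 * y i * (if i = j then 1 else 0))]
  · have : ∀ j : Fin 2, fderiv ℝ (fun y : Plane => 2 * y i * (if i = j then (1 : ℝ) else 0)) x
        (basisVec j) = if i = j then 2 else 0 := by
      intro j
      rw [(((hd x).const_mul 2).mul_const (if i = j then (1 : ℝ) else 0)).fderiv]
      by_cases h : i = j <;> simp [h]
    rw [Finset.sum_congr rfl fun j _ => this j]
    simp
  · intro j
    refine Eventually.of_forall fun y => ?_
    rw [((hd y).pow 2).fderiv]
    by_cases h : i = j <;> simp [h]

lemma laplacian_apply_eq_zero (i : Fin 2) (x : Plane) :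
    laplacian (fun y : Plane => y i) x = 0 := by
  have hd : ∀ y : Plane, HasFDerivAt (fun y : Plane => y i)
      (EuclideanSpace.proj i : Plane →L[ℝ] ℝ) y :=
    fun y => (EuclideanSpace.proj i : Plane →L[ℝ] ℝ).hasFDerivAt
  rw [laplacian_eq_of_hasFDerivAt (f := fun y : Plane => y i) (by fun_prop)
    (g := fun j _ => (EuclideanSpace.proj i : Plane →L[ℝ] ℝ) (basisVec j))]
  · simp
  · intro j
    exact Eventually.of_forall fun y => by rw [(hd y).fderiv]

/-- Interior gradient estimate for the Poisson equation, by comparison with a quadratic barrier. -/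
lemma abs_fderiv_le_of_laplacian {f : Plane → ℝ} {x₀ : Plane} {d M N : ℝ} (hd : 0 < d)
    {U : Set Plane} (hU : IsOpen U) (hUd : Metric.closedBall x₀ d ⊆ U) (hf : ContDiffOn ℝ 2 f U)
    (hM : ∀ x ∈ Metric.closedBall x₀ d, |f x| ≤ M)
    (hN : ∀ x ∈ Metric.closedBall x₀ d, |laplacian f x| ≤ N) (i : Fin 2) :
    |fderiv ℝ f x₀ (basisVec i)| ≤ 2 * M / d + N * d / 2 := by
  have hM0 : 0 ≤ M := (abs_nonneg _).trans (hM x₀ (Metric.mem_closedBall_self hd.le))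
  have hN0 : 0 ≤ N := (abs_nonneg _).trans (hN x₀ (Metric.mem_closedBall_self hd.le))
  -- The comparison takes place on half of the disc, where the odd part of `f` in the `i`-th
  -- direction vanishes on the flat side; its slope at the centre is the derivative sought.
  set K : Set Plane := Metric.closedBall 0 d ∩ {z | 0 ≤ z i} with hKdef
  set O : Set Plane := Metric.ball 0 d ∩ {z | 0 < z i} with hOdef
  have hproj : Continuous fun z : Plane => z i := by fun_prop
  have hK : IsCompact K := (isCompact_closedBall _ _).inter_right (isClosed_le continuous_const hproj)
  have hO : IsOpen O := Metric.isOpen_ball.inter (isOpen_lt continuous_const hproj)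
  have hOK : O ⊆ K := fun z hz => ⟨Metric.ball_subset_closedBall hz.1, (show 0 < z i from hz.2).le⟩
  have mem1 : ∀ z ∈ Metric.closedBall (0 : Plane) d, x₀ + z ∈ Metric.closedBall x₀ d := by
    intro z hz; simpa using hz
  have mem2 : ∀ z ∈ Metric.closedBall (0 : Plane) d,
      x₀ + reflectAxis i z ∈ Metric.closedBall x₀ d := by
    intro z hz; simpa [norm_reflectAxis] using hz
  -- This `k` gives the barrier below the Laplacian `4 M / d² - 2 k = -N`.
  set k : ℝ := 2 * M / d ^ 2 + N / 2 with hk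
  have hk0 : 0 ≤ k := by positivity
  -- comparison on the half disc, for both signs
  have key : ∀ σ : ℝ, |σ| = 1 → ∀ z ∈ K, σ * (1 / 2) * (f (x₀ + z) - f (x₀ + reflectAxis i z)) ≤
      M / d ^ 2 * ‖z‖ ^ 2 + k * (d * z i - z i ^ 2) := by
    intro σ hσ
    have hcd1 : ∀ z ∈ Metric.closedBall (0 : Plane) d, ContDiffAt ℝ 2 (fun z => f (x₀ + z)) z := by
      intro z hz
      exact ContDiffAt.comp z (hf.contDiffAt (hU.mem_nhds (hUd (mem1 z hz))))
        (contDiffAt_const.add contDiffAt_id)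
    have hcd2 : ∀ z ∈ Metric.closedBall (0 : Plane) d,
        ContDiffAt ℝ 2 (fun z => f (x₀ + reflectAxis i z)) z := by
      intro z hz
      exact ContDiffAt.comp z (hf.contDiffAt (hU.mem_nhds (hUd (mem2 z hz))))
        (contDiffAt_const.add (reflectAxis i).contDiff.contDiffAt)
    -- The odd part `w` is bounded by `M` with Laplacian bounded by `N`. The barrier `b` is
    -- nonnegative on the flat side and at least `M` on the circular side, so `w - b` is subharmonic
    -- with nonpositive boundary values.
    set w : Plane → ℝ := fun z => σ * (1 / 2) * (f (x₀ + z) - f (x₀ + reflectAxis i z)) with hw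
    set b : Plane → ℝ := fun z => M / d ^ 2 * ‖z‖ ^ 2 + k * (d * z i - (z i) ^ 2) with hb
    have cw : ∀ z ∈ Metric.closedBall (0 : Plane) d, ContDiffAt ℝ 2 w z := fun z hz =>
      contDiffAt_const.mul ((hcd1 z hz).sub (hcd2 z hz))
    have c1 : ContDiff ℝ 2 (fun z : Plane => ‖z‖ ^ 2) := contDiff_norm_sq ℝ
    have c2 : ContDiff ℝ 2 (fun z : Plane => z i) := by fun_prop
    have c3 : ContDiff ℝ 2 (fun z : Plane => (z i) ^ 2) := by fun_prop
    have c4 : ContDiff ℝ 2 (fun z : Plane => d * z i - (z i) ^ 2) := (contDiff_const.mul c2).sub c3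
    have cb : ContDiff ℝ 2 b := (contDiff_const.mul c1).add (contDiff_const.mul c4)
    have lb : ∀ z, laplacian b z = 4 * (M / d ^ 2) - 2 * k := by
      intro z
      rw [hb, laplacian_fun_add (contDiff_const.mul c1).contDiffAt
        (contDiff_const.mul c4).contDiffAt, laplacian_const_mul _ c1.contDiffAt,
        laplacian_const_mul _ c4.contDiffAt,
        laplacian_fun_sub (contDiff_const.mul c2).contDiffAt c3.contDiffAt,
        laplacian_const_mul _ c2.contDiffAt, laplacian_norm_sq,
        laplacian_apply_eq_zero, laplacian_apply_sq]
      ring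
    have lw : ∀ z ∈ Metric.closedBall (0 : Plane) d, laplacian w z =
        σ * (1 / 2) * (laplacian f (x₀ + z) - laplacian f (x₀ + reflectAxis i z)) := by
      intro z hz
      rw [hw, laplacian_const_mul _ ((hcd1 z hz).sub (hcd2 z hz)),
        laplacian_fun_sub (hcd1 z hz) (hcd2 z hz)]
      rw [laplacian_comp_isometry (reflectAxis i) (reflectAxis_basisVec i)
        (hf.contDiffAt (hU.mem_nhds (hUd (mem2 z hz))))]
      have := laplacian_comp_isometry (f := f) (x := z) (b := x₀) (ContinuousLinearMap.id ℝ Plane)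
        (fun i => Or.inl rfl) (hf.contDiffAt (hU.mem_nhds (hUd (mem1 z hz))))
      simp only [ContinuousLinearMap.id_apply] at this
      rw [this]
    have hσ2 : ∀ a : ℝ, σ * a ≤ |a| := fun a => by
      calc σ * a ≤ |σ * a| := le_abs_self _
        _ = |a| := by rw [abs_mul, hσ, one_mul]
    have main := le_of_laplacian_nonneg hK hO hOK (f := w - b) (m := 0) ?_ ?_ ?_ ?_
    · intro z hz
      have := main z hz
      simp only [hw, hb, Pi.sub_apply] at this
      linarith
    · exact fun z hz => ((cw z hz.1).sub cb.contDiffAt).continuousAt.continuousWithinAt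
    · exact fun z hz =>
        ((cw z (Metric.ball_subset_closedBall hz.1)).sub cb.contDiffAt).contDiffWithinAt
    · intro z hz
      have hz1 := Metric.ball_subset_closedBall hz.1
      rw [ContDiffAt.laplacian_sub (cw z hz1) cb.contDiffAt, lb, lw z hz1]
      have e1 := abs_le.1 (hN _ (mem1 z hz1))
      have e2 := abs_le.1 (hN _ (mem2 z hz1))
      have e3 := hσ2 (-(laplacian f (x₀ + z) - laplacian f (x₀ + reflectAxis i z)))
      have e4 : |-(laplacian f (x₀ + z) - laplacian f (x₀ + reflectAxis i z))| ≤ 2 * N := by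
        rw [abs_le]; constructor <;> linarith
      have e5 : 4 * (M / d ^ 2) - 2 * k = -N := by rw [hk]; ring
      nlinarith
    · intro z hz
      have hz1 := hz.1.1
      have hzd : ‖z‖ ≤ d := by simpa using hz1
      have hzi : 0 ≤ z i := hz.1.2
      have hid : z i ≤ d := (le_abs_self _).trans ((abs_apply_le_norm z i).trans hzd)
      have hb2 : 0 ≤ k * (d * z i - z i ^ 2) := by
        apply mul_nonneg hk0; nlinarith
      simp only [hw, hb, Pi.sub_apply]
      by_cases h0 : z i = 0
      · rw [reflectAxis_of_apply_eq_zero h0, h0]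
        have : 0 ≤ M / d ^ 2 * ‖z‖ ^ 2 := by positivity
        simp
        linarith
      · have hzn : ‖z‖ = d := by
          by_contra hne
          exact hz.2 ⟨by simpa using lt_of_le_of_ne hzd hne, lt_of_le_of_ne hzi (Ne.symm h0)⟩
        have e1 := abs_le.1 (hM _ (mem1 z hz1))
        have e2 := abs_le.1 (hM _ (mem2 z hz1))
        have e3 := hσ2 (f (x₀ + z) - f (x₀ + reflectAxis i z))
        have e4 : |f (x₀ + z) - f (x₀ + reflectAxis i z)| ≤ 2 * M := by
          rw [abs_le]; constructor <;> linarith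
        have e5 : M / d ^ 2 * ‖z‖ ^ 2 = M := by rw [hzn]; field_simp
        rw [e5]
        linarith
  -- restriction to the axis
  have hdf : DifferentiableAt ℝ f x₀ :=
    (hf.contDiffAt (hU.mem_nhds (hUd (Metric.mem_closedBall_self hd.le)))).differentiableAt
      (by norm_num)
  have hline : ∀ v : Plane, HasDerivAt (fun s : ℝ => f (x₀ + s • v)) (fderiv ℝ f x₀ v) 0 := by
    intro v
    have := hasDerivAt_line (f := f) (x := x₀) (v := v) (s := 0) (by simpa using hdf)
    simpa using this
  have hD : HasDerivAt (fun s : ℝ => (1 / 2) * (f (x₀ + s • basisVec i) - f (x₀ + s • -basisVec i)))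
      (fderiv ℝ f x₀ (basisVec i)) 0 := by
    have := ((hline (basisVec i)).sub (hline (-basisVec i))).const_mul (1 / 2)
    refine this.congr_deriv ?_
    rw [map_neg]; ring
  have hT := hD.tendsto_slope_zero_right
  have hbound : ∀ σ : ℝ, |σ| = 1 → σ * fderiv ℝ f x₀ (basisVec i) ≤ 2 * M / d + N * d / 2 := by
    intro σ hσ
    -- On the `i`-th axis the barrier divided by `s` is this expression; its limit `k d` is the
    -- asserted bound.
    have h1 : Tendsto (fun s : ℝ => M / d ^ 2 * s + k * (d - s)) (𝓝[>] 0)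
        (𝓝 (2 * M / d + N * d / 2)) := by
      have : Continuous fun s : ℝ => M / d ^ 2 * s + k * (d - s) := by fun_prop
      have h := this.tendsto 0
      have e : M / d ^ 2 * 0 + k * (d - 0) = 2 * M / d + N * d / 2 := by rw [hk]; field_simp; ring
      rw [e] at h
      exact h.mono_left nhdsWithin_le_nhds
    refine le_of_tendsto_of_tendsto (hT.const_mul σ) h1 ?_
    filter_upwards [Ioc_mem_nhdsGT hd] with s hs
    have hsK : s • basisVec i ∈ K := by
      refine ⟨?_, ?_⟩
      · simp [norm_smul, abs_of_pos hs.1, hs.2]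
      · simp [hs.1.le]
    have h2 := key σ hσ _ hsK
    have h3 : reflectAxis i (s • basisVec i) = s • -basisVec i := by
      rw [reflectAxis_apply]
      simp only [PiLp.smul_apply, PiLp.single_apply, if_true, smul_eq_mul, mul_one]
      module
    have h4 : ‖s • basisVec i‖ = s := by simp [norm_smul, abs_of_pos hs.1]
    rw [h3, h4] at h2
    simp only [PiLp.smul_apply, PiLp.single_apply, if_true, smul_eq_mul, mul_one] at h2
    simp only [zero_add, zero_smul, sub_self, add_zero, smul_eq_mul, mul_zero, sub_zero]
    rw [← mul_assoc, mul_comm σ, mul_assoc, inv_mul_le_iff₀ hs.1]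
    nlinarith
  rw [abs_le]
  have a1 := hbound 1 (by simp)
  have a2 := hbound (-1) (by simp)
  constructor <;> linarith

/-! ### Integration by parts -/

/-- Off the support of `a` the product vanishes locally, so it is continuous on the whole plane
although `b` is controlled only on `U`. -/
lemma integrable_mul_of_tsupport {a b : Plane → ℝ} {U : Set Plane} (ha : Continuous a)
    (hc : HasCompactSupport a) (hU : tsupport a ⊆ U) (hUo : IsOpen U) (hb : ContinuousOn b U) :
    Integrable (fun x => a x * b x) := by
  have hcont : Continuous fun x => a x * b x := by
    refine continuous_iff_continuousAt.2 fun x => ?_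
    by_cases hx : x ∈ tsupport a
    · exact ha.continuousAt.mul (hb.continuousAt (hUo.mem_nhds (hU hx)))
    · have : (fun x => a x * b x) =ᶠ[𝓝 x] fun _ => 0 := by
        filter_upwards [notMem_tsupport_iff_eventuallyEq.1 hx] with y hy
        simp [hy]
      exact continuousAt_const.congr this.symm
  exact hcont.integrable_of_hasCompactSupport hc.mul_right

/-- Integration by parts in the direction `v`, one factor being compactly supported. -/
lemma integral_mul_fderiv_of_tsupport {a b : Plane → ℝ} {U : Set Plane} (hUo : IsOpen U)
    (ha : ContDiff ℝ 1 a) (hc : HasCompactSupport a) (hU : tsupport a ⊆ U)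
    (hb : ContDiffOn ℝ 1 b U) (v : Plane) :
    ∫ x, a x * fderiv ℝ b x v = -∫ x, fderiv ℝ a x v * b x := by
  have hb' : ContinuousOn (fun x => fderiv ℝ b x v) U :=
    (hb.continuousOn_fderiv_of_isOpen hUo le_rfl).clm_apply continuousOn_const
  have ha' : Continuous fun x => fderiv ℝ a x v :=
    (ha.continuous_fderiv one_ne_zero).clm_apply continuous_const
  have hca' : HasCompactSupport fun x => fderiv ℝ a x v := hc.fderiv_apply ℝ v
  have hsub : tsupport (fun x => fderiv ℝ a x v) ⊆ U :=
    (tsupport_fderiv_apply_subset ℝ v).trans hU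
  exact integral_mul_fderiv_eq_neg_fderiv_mul_of_integrable
    (integrable_mul_of_tsupport ha' hca' hsub hUo hb.continuousOn)
    (integrable_mul_of_tsupport ha.continuous hc hU hUo hb')
    (integrable_mul_of_tsupport ha.continuous hc hU hUo hb.continuousOn)
    (fun x _ => ha.differentiable one_ne_zero x)
    (fun x hx => (hb.contDiffAt (hUo.mem_nhds (hU hx))).differentiableAt one_ne_zero)

lemma laplacian_eq_sum_of_contDiffAt {f : Plane → ℝ} {x : Plane} (hf : ContDiffAt ℝ 2 f x) :
    laplacian f x = ∑ i, fderiv ℝ (fun y => fderiv ℝ f y (basisVec i)) x (basisVec i) := by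
  rw [laplacian_eq_sum]
  simp only [fderiv_fderiv_apply hf]

/-- Green's first identity. -/
lemma integral_mul_laplacian_eq_neg {a f : Plane → ℝ} {U : Set Plane} (hUo : IsOpen U)
    (ha : ContDiff ℝ 1 a) (hc : HasCompactSupport a) (hU : tsupport a ⊆ U)
    (hf : ContDiffOn ℝ 2 f U) :
    ∫ x, a x * laplacian f x =
      -∫ x, ∑ i, fderiv ℝ a x (basisVec i) * fderiv ℝ f x (basisVec i) := by
  have hfi : ∀ i : Fin 2, ContDiffOn ℝ 1 (fun y => fderiv ℝ f y (basisVec i)) U := fun i =>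
    (hf.fderiv_of_isOpen hUo (by norm_num)).clm_apply contDiffOn_const
  have ha' : ∀ i : Fin 2, Integrable fun x =>
      fderiv ℝ a x (basisVec i) * fderiv ℝ f x (basisVec i) := fun i =>
    integrable_mul_of_tsupport ((ha.continuous_fderiv one_ne_zero).clm_apply continuous_const)
      (hc.fderiv_apply ℝ _) ((tsupport_fderiv_apply_subset ℝ _).trans hU) hUo (hfi i).continuousOn
  have hi : ∀ i : Fin 2, Integrable fun x =>
      a x * fderiv ℝ (fun y => fderiv ℝ f y (basisVec i)) x (basisVec i) := fun i =>
    integrable_mul_of_tsupport ha.continuous hc hU hUo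
      (((hfi i).continuousOn_fderiv_of_isOpen hUo le_rfl).clm_apply continuousOn_const)
  have h1 : ∀ x, a x * laplacian f x =
      ∑ i, a x * fderiv ℝ (fun y => fderiv ℝ f y (basisVec i)) x (basisVec i) := by
    intro x
    by_cases hx : x ∈ tsupport a
    · rw [laplacian_eq_sum_of_contDiffAt (hf.contDiffAt (hUo.mem_nhds (hU hx))), Finset.mul_sum]
    · simp [image_eq_zero_of_notMem_tsupport hx]
  simp only [h1]
  rw [integral_finsetSum _ (fun i _ => hi i), integral_finsetSum _ (fun i _ => ha' i),
    ← Finset.sum_neg_distrib]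
  exact Finset.sum_congr rfl fun i _ => integral_mul_fderiv_of_tsupport hUo ha hc hU (hfi i) _

/-- Green's second identity. -/
lemma integral_mul_laplacian_comm {a f : Plane → ℝ} {U : Set Plane} (hUo : IsOpen U)
    (ha : ContDiff ℝ 2 a) (hc : HasCompactSupport a) (hU : tsupport a ⊆ U)
    (hf : ContDiffOn ℝ 2 f U) :
    ∫ x, a x * laplacian f x = ∫ x, laplacian a x * f x := by
  rw [integral_mul_laplacian_eq_neg hUo (ha.of_le (by norm_num)) hc hU hf]
  have hai : ∀ i : Fin 2, ContDiff ℝ 1 (fun y => fderiv ℝ a y (basisVec i)) := fun i =>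
    (ha.fderiv_right (by norm_num)).clm_apply contDiff_const
  have hcai : ∀ i : Fin 2, HasCompactSupport fun x => fderiv ℝ a x (basisVec i) :=
    fun i => hc.fderiv_apply ℝ _
  have hsub : ∀ i : Fin 2, tsupport (fun x => fderiv ℝ a x (basisVec i)) ⊆ U :=
    fun i => (tsupport_fderiv_apply_subset ℝ _).trans hU
  have hf1 : ContDiffOn ℝ 1 f U := hf.of_le (by norm_num)
  have hf' : ∀ i : Fin 2, ContinuousOn (fun x => fderiv ℝ f x (basisVec i)) U := fun i =>
    (hf1.continuousOn_fderiv_of_isOpen hUo le_rfl).clm_apply continuousOn_const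
  rw [integral_finsetSum _ (fun i _ =>
    integrable_mul_of_tsupport (hai i).continuous (hcai i) (hsub i) hUo (hf' i))]
  have h1 : ∀ x, laplacian a x * f x =
      ∑ i, fderiv ℝ (fun y => fderiv ℝ a y (basisVec i)) x (basisVec i) * f x := by
    intro x
    rw [laplacian_eq_sum_of_contDiffAt ha.contDiffAt, Finset.sum_mul]
  simp only [h1]
  rw [integral_finsetSum _ (fun i _ => integrable_mul_of_tsupport
    (((hai i).continuous_fderiv one_ne_zero).clm_apply continuous_const)
    ((hcai i).fderiv_apply ℝ _) ((tsupport_fderiv_apply_subset ℝ _).trans (hsub i)) hUo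
    hf.continuousOn), ← Finset.sum_neg_distrib]
  refine Finset.sum_congr rfl fun i _ => ?_
  rw [integral_mul_fderiv_of_tsupport hUo (hai i) (hcai i) (hsub i) hf1, neg_neg]

/-! ### Interior regularity -/

lemma contDiff_two_of_infty {E F : Type*} [NormedAddCommGroup E] [NormedSpace ℝ E]
    [NormedAddCommGroup F] [NormedSpace ℝ F] {f : E → F} (h : ContDiff ℝ ∞ f) : ContDiff ℝ 2 f :=
  h.of_le (WithTop.coe_le_coe.2 (le_top : (2 : ℕ∞) ≤ ⊤))

lemma norm_le_sum_basisVec (L : Plane →L[ℝ] ℝ) : ‖L‖ ≤ ∑ i, |L (basisVec i)| := by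
  refine L.opNorm_le_bound (Finset.sum_nonneg fun _ _ => abs_nonneg _) fun v => ?_
  have hv : v = ∑ i, v i • basisVec i := by
    ext j; fin_cases j <;> simp [Fin.sum_univ_two]
  have h1 : L v = ∑ i, v i * L (basisVec i) := by
    conv_lhs => rw [hv]
    simp
  rw [h1, Finset.sum_mul]
  refine (norm_sum_le _ _).trans (Finset.sum_le_sum fun i _ => ?_)
  rw [norm_mul, mul_comm]
  exact mul_le_mul_of_nonneg_left (abs_apply_le_norm v i) (abs_nonneg _)

lemma norm_fderiv_le_of_laplacian {f : Plane → ℝ} {x₀ : Plane} {d M N : ℝ} (hd : 0 < d)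
    {U : Set Plane} (hU : IsOpen U) (hUd : Metric.closedBall x₀ d ⊆ U) (hf : ContDiffOn ℝ 2 f U)
    (hM : ∀ x ∈ Metric.closedBall x₀ d, |f x| ≤ M)
    (hN : ∀ x ∈ Metric.closedBall x₀ d, |laplacian f x| ≤ N) :
    ‖fderiv ℝ f x₀‖ ≤ 4 * M / d + N * d := by
  refine (norm_le_sum_basisVec _).trans ?_
  rw [Fin.sum_univ_two]
  have h0 := abs_fderiv_le_of_laplacian hd hU hUd hf hM hN 0
  have h1 := abs_fderiv_le_of_laplacian hd hU hUd hf hM hN 1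
  have : 4 * M / d + N * d = (2 * M / d + N * d / 2) + (2 * M / d + N * d / 2) := by ring
  linarith

/-- If `u n → u` and `Δ (u n) → g` locally uniformly then the gradients converge locally
uniformly. -/
lemma tendsto_fderiv_of_laplacian {U : Set Plane} (hU : IsOpen U) {u : ℕ → Plane → ℝ}
    {v g : Plane → ℝ} (hu : ∀ n, ContDiffOn ℝ 2 (u n) U) (huv : TendstoLocallyUniformlyOn u v atTop U)
    (hug : TendstoLocallyUniformlyOn (fun n => laplacian (u n)) g atTop U) :
    TendstoLocallyUniformlyOn (fun n => fderiv ℝ (u n)) (fderiv ℝ v) atTop U ∧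
      ∀ x ∈ U, DifferentiableAt ℝ v x := by
  have hball : ∀ x ∈ U, ∃ r > 0, Metric.closedBall x (2 * r) ⊆ U := by
    intro x hx
    obtain ⟨ε, hε, h⟩ := Metric.nhds_basis_closedBall.mem_iff.1 (hU.mem_nhds hx)
    exact ⟨ε / 2, by positivity, by rwa [mul_div_cancel₀ _ two_ne_zero]⟩
  -- The gradient estimate is applied to the differences `u m - u n` on discs of radius `r`; values
  -- and Laplacians are uniformly Cauchy on the larger disc, hence so are the gradients on the
  -- smaller one.
  have cauchy : ∀ x ∈ U, ∀ r > 0, Metric.closedBall x (2 * r) ⊆ U →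
      UniformCauchySeqOn (fun n => fderiv ℝ (u n)) atTop (Metric.closedBall x r) := by
    intro x hx r hr hrU
    have hc := isCompact_closedBall x (2 * r)
    have h1 := ((tendstoLocallyUniformlyOn_iff_forall_isCompact hU).1 huv _ hrU
      hc).uniformCauchySeqOn
    have h2 := ((tendstoLocallyUniformlyOn_iff_forall_isCompact hU).1 hug _ hrU
      hc).uniformCauchySeqOn
    rw [Metric.uniformCauchySeqOn_iff] at h1 h2 ⊢
    intro ε hε
    set δ := ε / (2 * (4 / r + r)) with hδ
    have hδ0 : 0 < δ := by positivity
    obtain ⟨N1, hN1⟩ := h1 δ hδ0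
    obtain ⟨N2, hN2⟩ := h2 δ hδ0
    refine ⟨max N1 N2, fun m hm n hn y hy => ?_⟩
    have hyU : Metric.closedBall y r ⊆ Metric.closedBall x (2 * r) := by
      intro z hz
      rw [Metric.mem_closedBall] at *
      linarith [dist_triangle z y x]
    have hyy : y ∈ U := hrU (hyU (Metric.mem_closedBall_self hr.le))
    have hdm := ((hu m).contDiffAt (hU.mem_nhds hyy)).differentiableAt (by norm_num)
    have hdn := ((hu n).contDiffAt (hU.mem_nhds hyy)).differentiableAt (by norm_num)
    have := norm_fderiv_le_of_laplacian (f := fun z => u m z - u n z) (x₀ := y) (M := δ) (N := δ)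
      hr hU (hyU.trans hrU) ((hu m).sub (hu n)) (fun z hz => ?_) (fun z hz => ?_)
    · rw [fderiv_fun_sub hdm hdn] at this
      rw [dist_eq_norm]
      refine this.trans_lt ?_
      have : 4 * δ / r + δ * r = ε / 2 := by rw [hδ]; field_simp
      linarith
    · exact (hN1 m (le_of_max_le_left hm) n (le_of_max_le_left hn) z (hyU hz)).le
    · have hz' : z ∈ U := hrU (hyU hz)
      rw [laplacian_fun_sub ((hu m).contDiffAt (hU.mem_nhds hz'))
        ((hu n).contDiffAt (hU.mem_nhds hz'))]
      exact (hN2 m (le_of_max_le_right hm) n (le_of_max_le_right hn) z (hyU hz)).le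
  have hlim : ∀ x ∈ U, ∃ l, Tendsto (fun n => fderiv ℝ (u n) x) atTop (𝓝 l) := by
    intro x hx
    obtain ⟨r, hr, hrU⟩ := hball x hx
    exact cauchySeq_tendsto_of_complete
      ((cauchy x hx r hr hrU).cauchySeq (Metric.mem_closedBall_self hr.le))
  choose! l hl using hlim
  have hloc : TendstoLocallyUniformlyOn (fun n => fderiv ℝ (u n)) l atTop U := by
    rw [tendstoLocallyUniformlyOn_iff_forall_tendsto]
    intro x hx
    obtain ⟨r, hr, hrU⟩ := hball x hx
    have h := (cauchy x hx r hr hrU).tendstoUniformlyOn_of_tendsto (f := l)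
      (fun y hy => hl y (hrU (Metric.closedBall_subset_closedBall (by linarith) hy)))
    rw [tendstoUniformlyOn_iff_tendsto] at h
    refine h.mono_left ?_
    gcongr
    rw [hU.nhdsWithin_eq hx, le_principal_iff]
    exact Metric.closedBall_mem_nhds x hr
  have hder : ∀ x ∈ U, HasFDerivAt v (l x) x := fun x hx =>
    hasFDerivAt_of_tendstoLocallyUniformlyOn hU hloc
      (fun n y hy => (((hu n).contDiffAt (hU.mem_nhds hy)).differentiableAt
        (by norm_num)).hasFDerivAt)
      (fun y hy => huv.tendsto_at hy) hx
  exact ⟨hloc.congr_right fun x hx => (hder x hx).fderiv.symm,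
    fun x hx => (hder x hx).differentiableAt⟩

/-! ### Mollification and weak Laplacians -/

/-- The convolution of a test function with a locally integrable function. -/
def mollify (ρ f : Plane → ℝ) : Plane → ℝ :=
  convolution ρ f (ContinuousLinearMap.lsmul ℝ ℝ) volume

lemma mollify_apply (ρ f : Plane → ℝ) (x : Plane) : mollify ρ f x = ∫ t, ρ (x - t) * f t := by
  simp [mollify, convolution_eq_swap]

lemma contDiff_mollify {ρ f : Plane → ℝ} (hρ : ContDiff ℝ ∞ ρ) (hc : HasCompactSupport ρ)
    (hf : LocallyIntegrable f) : ContDiff ℝ ∞ (mollify ρ f) :=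
  hc.contDiff_convolution_left _ hρ hf

lemma fderiv_mollify {ρ f : Plane → ℝ} (hρ : ContDiff ℝ ∞ ρ) (hc : HasCompactSupport ρ)
    (hf : LocallyIntegrable f) (x v : Plane) :
    fderiv ℝ (mollify ρ f) x v = mollify (fun y => fderiv ℝ ρ y v) f x := by
  have h := hc.hasFDerivAt_convolution_left (ContinuousLinearMap.lsmul ℝ ℝ)
    (hρ.of_le (by simp)) hf x
  have hcont : Continuous (fderiv ℝ ρ) := hρ.continuous_fderiv (by simp)
  have hex : ConvolutionExistsAt (fderiv ℝ ρ) f x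
      ((ContinuousLinearMap.lsmul ℝ ℝ : ℝ →L[ℝ] ℝ →L[ℝ] ℝ).precompL Plane) volume :=
    (hc.fderiv ℝ).convolutionExists_left _ hcont hf x
  rw [mollify, h.fderiv, convolution_def, ContinuousLinearMap.integral_apply hex v]
  rfl

lemma contDiff_partial {ρ : Plane → ℝ} (hρ : ContDiff ℝ ∞ ρ) (v : Plane) :
    ContDiff ℝ ∞ fun y => fderiv ℝ ρ y v :=
  (hρ.fderiv_right (m := ∞) (by simp)).clm_apply contDiff_const

lemma laplacian_eq_sum_partial {f : Plane → ℝ} (hf : ContDiff ℝ ∞ f) :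
    laplacian f =
      fun x => ∑ i, fderiv ℝ (fun y => fderiv ℝ f y (basisVec i)) x (basisVec i) :=
  funext fun _ => laplacian_eq_sum_of_contDiffAt (contDiff_two_of_infty hf).contDiffAt

lemma contDiff_laplacian {f : Plane → ℝ} (hf : ContDiff ℝ ∞ f) : ContDiff ℝ ∞ (laplacian f) := by
  rw [laplacian_eq_sum_partial hf]
  exact ContDiff.sum fun i _ => contDiff_partial (contDiff_partial hf _) _

lemma tsupport_laplacian_subset (f : Plane → ℝ) : tsupport (laplacian f) ⊆ tsupport f := by
  refine closure_minimal (fun x hx => ?_) (isClosed_tsupport f)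
  by_contra h
  apply hx
  rw [laplacian_congr (notMem_tsupport_iff_eventuallyEq.1 h)]
  exact congrFun (InnerProductSpace.laplacian_const (E := Plane) (c := (0 : ℝ))) x

lemma hasCompactSupport_laplacian {f : Plane → ℝ} (hf : HasCompactSupport f) :
    HasCompactSupport (laplacian f) :=
  IsCompact.of_isClosed_subset hf (isClosed_tsupport _) (tsupport_laplacian_subset f)

lemma laplacian_mollify {ρ f : Plane → ℝ} (hρ : ContDiff ℝ ∞ ρ) (hc : HasCompactSupport ρ)
    (hf : LocallyIntegrable f) (x : Plane) :
    laplacian (mollify ρ f) x = mollify (laplacian ρ) f x := by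
  have h1 : ∀ i : Fin 2, (fun y => fderiv ℝ (mollify ρ f) y (basisVec i)) =
      mollify (fun y => fderiv ℝ ρ y (basisVec i)) f :=
    fun i => funext fun y => fderiv_mollify hρ hc hf y _
  rw [laplacian_eq_sum_partial (contDiff_mollify hρ hc hf)]
  simp only [h1]
  have h2 : ∀ i : Fin 2, fderiv ℝ (mollify (fun y => fderiv ℝ ρ y (basisVec i)) f) x (basisVec i) =
      mollify (fun y => fderiv ℝ (fun y => fderiv ℝ ρ y (basisVec i)) y (basisVec i)) f x :=
    fun i => fderiv_mollify (contDiff_partial hρ _) (hc.fderiv_apply ℝ _) hf x _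
  simp only [h2, mollify_apply, laplacian_eq_sum_partial hρ, Finset.sum_mul]
  rw [integral_finsetSum]
  intro i _
  have hcs : HasCompactSupport fun y =>
      fderiv ℝ (fun y => fderiv ℝ ρ y (basisVec i)) y (basisVec i) :=
    (hc.fderiv_apply ℝ _).fderiv_apply ℝ _
  have hex := hcs.convolutionExists_left (ContinuousLinearMap.lsmul ℝ ℝ)
    (contDiff_partial (contDiff_partial hρ _) _).continuous hf x
  have := hex.integrable_swap
  simpa using this

/-- Symmetry of second derivatives, used twice. It turns control of the Laplacian of `u` into
control of the Laplacian of its partial derivatives. -/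
lemma laplacian_partial {f : Plane → ℝ} (hf : ContDiff ℝ ∞ f) (v x : Plane) :
    laplacian (fun y => fderiv ℝ f y v) x = fderiv ℝ (laplacian f) x v := by
  have swap : ∀ {g : Plane → ℝ}, ContDiff ℝ ∞ g → ∀ a b : Plane,
      (fun x => fderiv ℝ (fun y => fderiv ℝ g y a) x b) =
        fun x => fderiv ℝ (fun y => fderiv ℝ g y b) x a := by
    intro g hg a b
    ext x
    have hg2 : ContDiffAt ℝ 2 g x := (contDiff_two_of_infty hg).contDiffAt
    rw [fderiv_fderiv_apply hg2, fderiv_fderiv_apply hg2]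
    exact hg2.isSymmSndFDerivAt (by simp) b a
  rw [laplacian_eq_sum_partial (contDiff_partial hf v), laplacian_eq_sum_partial hf]
  rw [fderiv_fun_sum fun i _ => (contDiff_partial (contDiff_partial hf _) _).differentiable
    (by simp) x]
  rw [sum_apply]
  refine Finset.sum_congr rfl fun i _ => ?_
  rw [swap hf v (basisVec i), congrFun (swap (contDiff_partial hf (basisVec i)) v (basisVec i)) x]

/-- `g` is the weak Laplacian of `u` on `U`. -/
def IsWeakLaplacian (U : Set Plane) (u g : Plane → ℝ) : Prop :=
  ∀ φ : Plane → ℝ, ContDiff ℝ ∞ φ → HasCompactSupport φ → tsupport φ ⊆ U →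
    ∫ x, u x * laplacian φ x = ∫ x, g x * φ x

lemma laplacian_comp_sub_left {φ : Plane → ℝ} (hφ : ContDiff ℝ 2 φ) (x y : Plane) :
    laplacian (fun t => φ (x - t)) y = laplacian φ (x - y) := by
  have := laplacian_comp_isometry (f := φ) (x := y) (b := x) (-ContinuousLinearMap.id ℝ Plane)
    (fun i => Or.inr rfl) hφ.contDiffAt
  simpa [← sub_eq_add_neg] using this

/-- For `x` in the disc of radius `2 r`, the function `t ↦ ρ (x - t)` is an admissible test function
supported in the disc of radius `3 r`, so the cut-off by the indicator is invisible and the weak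
identity can be applied to it. -/
lemma IsWeakLaplacian.laplacian_mollify {x₀ : Plane} {r : ℝ} {u g : Plane → ℝ} {U : Set Plane}
    (hU : Metric.closedBall x₀ (3 * r) ⊆ U) (h : IsWeakLaplacian U u g) {ρ : Plane → ℝ}
    (hρ : ContDiff ℝ ∞ ρ) (hc : HasCompactSupport ρ) (hsupp : ∀ z, r < ‖z‖ → ρ z = 0)
    (hu : LocallyIntegrable (indicator (Metric.closedBall x₀ (3 * r)) u)) {x : Plane}
    (hx : x ∈ Metric.ball x₀ (2 * r)) :
    laplacian (mollify ρ (indicator (Metric.closedBall x₀ (3 * r)) u)) x =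
      mollify ρ (indicator (Metric.closedBall x₀ (3 * r)) g) x := by
  rw [AllenCahn.laplacian_mollify hρ hc hu, mollify_apply, mollify_apply]
  have hmem : ∀ t, dist t x ≤ r → t ∈ Metric.closedBall x₀ (3 * r) := by
    intro t ht
    rw [Metric.mem_ball] at hx
    rw [Metric.mem_closedBall]
    linarith [dist_triangle t x x₀]
  have hzero : ∀ t, t ∉ Metric.closedBall x r → ρ (x - t) = 0 := by
    intro t ht
    apply hsupp
    rw [Metric.mem_closedBall, not_le, dist_comm, dist_eq_norm] at ht
    exact ht
  have hsub : tsupport (fun t => ρ (x - t)) ⊆ Metric.closedBall x r :=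
    closure_minimal (fun t ht => by_contra fun h => ht (hzero t h)) Metric.isClosed_closedBall
  have hw := h (fun t => ρ (x - t)) (hρ.comp (contDiff_const.sub contDiff_id))
    (IsCompact.of_isClosed_subset (isCompact_closedBall x r) (isClosed_tsupport _) hsub)
    (fun t ht => hU (hmem t (hsub ht)))
  have e1 : ∀ t, laplacian ρ (x - t) * indicator (Metric.closedBall x₀ (3 * r)) u t =
      u t * laplacian (fun t => ρ (x - t)) t := by
    intro t
    rw [laplacian_comp_sub_left (contDiff_two_of_infty hρ)]
    by_cases ht : t ∈ Metric.closedBall x₀ (3 * r)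
    · rw [indicator_of_mem ht]; ring
    · rw [indicator_of_notMem ht]
      have : t ∉ tsupport (laplacian fun t => ρ (x - t)) := fun h' =>
        ht (hmem t (hsub (tsupport_laplacian_subset _ h')))
      have h2 := image_eq_zero_of_notMem_tsupport this
      rw [laplacian_comp_sub_left (contDiff_two_of_infty hρ)] at h2
      rw [h2]; ring
  have e2 : ∀ t, ρ (x - t) * indicator (Metric.closedBall x₀ (3 * r)) g t = g t * ρ (x - t) := by
    intro t
    by_cases ht : t ∈ Metric.closedBall x₀ (3 * r)
    · rw [indicator_of_mem ht]; ring
    · rw [indicator_of_notMem ht, hzero t fun h' => ht (hmem t h')]; ring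
  simp only [e1, e2]
  exact hw

/-- A sequence of standard mollifiers supported in the disc of radius `r`. -/
def mollifier (r : ℝ) (hr : 0 < r) (n : ℕ) : ContDiffBump (0 : Plane) where
  rIn := r / (2 * (n + 1))
  rOut := r / (n + 1)
  rIn_pos := by positivity
  rIn_lt_rOut := by
    apply div_lt_div_of_pos_left hr (by positivity)
    have : (0 : ℝ) < n + 1 := by positivity
    linarith

lemma mollifier_normed_eq_zero (r : ℝ) (hr : 0 < r) (n : ℕ) {z : Plane} (hz : r < ‖z‖) :
    (mollifier r hr n).normed volume z = 0 := by
  by_contra h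
  have : z ∈ Function.support ((mollifier r hr n).normed volume) := h
  rw [ContDiffBump.support_normed_eq, mem_ball_zero_iff] at this
  have h2 : (mollifier r hr n).rOut ≤ r := by
    simp only [mollifier]
    apply div_le_self hr.le
    have : (0 : ℝ) ≤ n := by positivity
    linarith
  linarith

/-- At points of the disc of radius `2 r` the mollifier averages over values in the closed disc of
radius `3 r`, where `u` is uniformly continuous. -/
lemma tendsto_mollify {x₀ : Plane} {r : ℝ} (hr : 0 < r) {u : Plane → ℝ}
    (hu : ContinuousOn u (Metric.closedBall x₀ (3 * r))) :
    TendstoUniformlyOn (fun n => mollify ((mollifier r hr n).normed volume)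
      (indicator (Metric.closedBall x₀ (3 * r)) u)) u atTop (Metric.ball x₀ (2 * r)) := by
  rw [Metric.tendstoUniformlyOn_iff]
  intro ε hε
  have huc := (isCompact_closedBall x₀ (3 * r)).uniformContinuousOn_of_continuous hu
  rw [Metric.uniformContinuousOn_iff] at huc
  obtain ⟨δ, hδ, h⟩ := huc (ε / 2) (by positivity)
  have hlim : Tendsto (fun n : ℕ => r / ((n : ℝ) + 1)) atTop (𝓝 0) := by
    simpa [div_eq_mul_inv] using (tendsto_one_div_add_atTop_nhds_zero_nat (𝕜 := ℝ)).const_mul r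
  filter_upwards [hlim.eventually (gt_mem_nhds (lt_min hδ hr))] with n hn x hx
  have hxc : x ∈ Metric.closedBall x₀ (3 * r) := by
    rw [Metric.mem_ball] at hx; rw [Metric.mem_closedBall]; linarith
  have hms : AEStronglyMeasurable (indicator (Metric.closedBall x₀ (3 * r)) u) volume :=
    (aestronglyMeasurable_indicator_iff Metric.isClosed_closedBall.measurableSet).2
      (hu.aestronglyMeasurable Metric.isClosed_closedBall.measurableSet)
  have := ContDiffBump.dist_normed_convolution_le (φ := mollifier r hr n) (x₀ := x) (ε := ε / 2)
    hms (fun y hy => ?_)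
  · rw [indicator_of_mem hxc, dist_comm] at this
    exact lt_of_le_of_lt this (by linarith)
  · have hy' : dist y x < min δ r := lt_trans hy hn
    have hyc : y ∈ Metric.closedBall x₀ (3 * r) := by
      rw [Metric.mem_ball] at hx
      rw [Metric.mem_closedBall]
      linarith [dist_triangle y x x₀, lt_min_iff.1 hy']
    rw [indicator_of_mem hyc, indicator_of_mem hxc]
    exact (h y hyc x hxc (lt_min_iff.1 hy').1).le

/-- A continuous function whose weak Laplacian is continuous and again has a continuous weak
Laplacian is twice continuously differentiable. -/
theorem IsWeakLaplacian.contDiffOn {U : Set Plane} (hU : IsOpen U) {u g h : Plane → ℝ}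
    (hu : ContinuousOn u U) (hg : ContinuousOn g U) (hh : ContinuousOn h U)
    (hug : IsWeakLaplacian U u g) (hgh : IsWeakLaplacian U g h) :
    ContDiffOn ℝ 2 u U ∧ ∀ x ∈ U, laplacian u x = g x := by
  have main : ∀ x₀ ∈ U, ContDiffAt ℝ 2 u x₀ ∧ laplacian u x₀ = g x₀ := by
    intro x₀ hx₀
    obtain ⟨ε, hε, hεU⟩ := Metric.nhds_basis_closedBall.mem_iff.1 (hU.mem_nhds hx₀)
    set r := ε / 3 with hrdef
    have hr : 0 < r := by positivity
    have hrU : Metric.closedBall x₀ (3 * r) ⊆ U := by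
      rwa [hrdef, mul_div_cancel₀ _ three_ne_zero]
    set O := Metric.ball x₀ (2 * r) with hO
    have hOo : IsOpen O := Metric.isOpen_ball
    set S := Metric.closedBall x₀ (3 * r) with hS
    set ρ : ℕ → Plane → ℝ := fun n => (mollifier r hr n).normed volume with hρdef
    have hρ : ∀ n, ContDiff ℝ ∞ (ρ n) := fun n => (mollifier r hr n).contDiff_normed
    have hρc : ∀ n, HasCompactSupport (ρ n) := fun n => (mollifier r hr n).hasCompactSupport_normed
    have hρs : ∀ n z, r < ‖z‖ → ρ n z = 0 := fun n z => mollifier_normed_eq_zero r hr n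
    have hli : ∀ {f : Plane → ℝ}, ContinuousOn f U → LocallyIntegrable (indicator S f) := by
      intro f hf
      exact ((integrable_indicator_iff Metric.isClosed_closedBall.measurableSet).2
        ((hf.mono hrU).integrableOn_compact (isCompact_closedBall _ _))).locallyIntegrable
    have hconv : ∀ {f : Plane → ℝ}, ContinuousOn f U →
        TendstoLocallyUniformlyOn (fun n => mollify (ρ n) (indicator S f)) f atTop O :=
      fun hf => (tendsto_mollify hr (hf.mono hrU)).tendstoLocallyUniformlyOn
    have hsm : ∀ {f : Plane → ℝ}, ContinuousOn f U → ∀ n,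
        ContDiff ℝ ∞ (mollify (ρ n) (indicator S f)) :=
      fun hf n => contDiff_mollify (hρ n) (hρc n) (hli hf)
    have hsm2 : ∀ {f : Plane → ℝ}, ContinuousOn f U → ∀ n,
        ContDiffOn ℝ 2 (mollify (ρ n) (indicator S f)) O :=
      fun hf n => (contDiff_two_of_infty (hsm hf n)).contDiffOn
    have hΔu : ∀ n, ∀ x ∈ O, laplacian (mollify (ρ n) (indicator S u)) x =
        mollify (ρ n) (indicator S g) x := fun n x hx =>
      hug.laplacian_mollify hrU (hρ n) (hρc n) (hρs n) (hli hu) hx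
    have hΔg : ∀ n, ∀ x ∈ O, laplacian (mollify (ρ n) (indicator S g)) x =
        mollify (ρ n) (indicator S h) x := fun n x hx =>
      hgh.laplacian_mollify hrU (hρ n) (hρc n) (hρs n) (hli hg) hx
    -- The mollified `u` has the mollified `g` as its Laplacian, and both converge, so the gradients
    -- converge.
    obtain ⟨gu, du⟩ := tendsto_fderiv_of_laplacian hOo (hsm2 hu) (hconv hu)
      ((hconv hg).congr fun n x hx => (hΔu n x hx).symm)
    obtain ⟨gg, -⟩ := tendsto_fderiv_of_laplacian hOo (hsm2 hg) (hconv hg)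
      ((hconv hh).congr fun n x hx => (hΔg n x hx).symm)
    have happly : ∀ {F : ℕ → Plane → Plane →L[ℝ] ℝ} {f : Plane → Plane →L[ℝ] ℝ} (v : Plane),
        TendstoLocallyUniformlyOn F f atTop O →
        TendstoLocallyUniformlyOn (fun n x => F n x v) (fun x => f x v) atTop O := by
      intro F f v hF
      exact (ContinuousLinearMap.apply ℝ ℝ v).uniformContinuous.comp_tendstoLocallyUniformlyOn hF
    -- The same principle applies to the partial derivatives of the mollified `u`. Their Laplacians
    -- are partial derivatives of the mollified `g`, and these converge by `gg`; this is where the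
    -- continuous weak Laplacian `h` of `g` is needed.
    have second : ∀ i : Fin 2, _ := fun i : Fin 2 =>
      tendsto_fderiv_of_laplacian hOo
        (u := fun n x => fderiv ℝ (mollify (ρ n) (indicator S u)) x (basisVec i))
        (v := fun x => fderiv ℝ u x (basisVec i)) (g := fun x => fderiv ℝ g x (basisVec i))
        (fun n => (contDiff_two_of_infty (contDiff_partial (hsm hu n) _)).contDiffOn)
        (happly _ gu) ((happly (basisVec i) gg).congr fun n x hx => by
          rw [laplacian_partial (hsm hu n)]
          have : laplacian (mollify (ρ n) (indicator S u)) =ᶠ[𝓝 x]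
              mollify (ρ n) (indicator S g) := by
            filter_upwards [hOo.mem_nhds hx] with y hy using hΔu n y hy
          rw [this.fderiv_eq])
    have hx₀O : x₀ ∈ O := Metric.mem_ball_self (by positivity)
    have hCi : ∀ i : Fin 2, ContDiffOn ℝ 1 (fun x => fderiv ℝ u x (basisVec i)) O := by
      intro i
      have e : ((0 : WithTop ℕ∞) + 1) = 1 := by norm_num
      rw [← e, contDiffOn_succ_iff_fderiv_of_isOpen hOo]
      refine ⟨fun x hx => ((second i).2 x hx).differentiableWithinAt, by simp, ?_⟩
      rw [contDiffOn_zero]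
      refine (second i).1.continuousOn (Eventually.of_forall fun n => ?_).frequently
      exact ((contDiff_partial (hsm hu n) _).continuous_fderiv (by simp)).continuousOn
    have hC2 : ContDiffOn ℝ 2 u O := by
      have e : ((1 : WithTop ℕ∞) + 1) = 2 := by norm_num
      rw [← e, contDiffOn_succ_iff_fderiv_of_isOpen hOo]
      refine ⟨fun x hx => (du x hx).differentiableWithinAt, by simp, ?_⟩
      have : fderiv ℝ u = fun x => ∑ i : Fin 2, fderiv ℝ u x (basisVec i) •
          (EuclideanSpace.proj i : Plane →L[ℝ] ℝ) := by
        ext x v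
        have hv : v = ∑ i, v i • basisVec i := by
          ext j; fin_cases j <;> simp [Fin.sum_univ_two]
        conv_lhs => rw [hv]
        simp [mul_comm]
      rw [this]
      exact ContDiffOn.sum fun i _ => (hCi i).smul contDiffOn_const
    have hca : ContDiffAt ℝ 2 u x₀ := hC2.contDiffAt (hOo.mem_nhds hx₀O)
    refine ⟨hca, ?_⟩
    have l1 : Tendsto (fun n => laplacian (mollify (ρ n) (indicator S u)) x₀) atTop
        (𝓝 (laplacian u x₀)) := by
      rw [laplacian_eq_sum_of_contDiffAt hca]
      simp only [laplacian_eq_sum_partial (hsm hu _)]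
      exact tendsto_finsetSum _ fun i _ => (happly (basisVec i) (second i).1).tendsto_at hx₀O
    have l2 : Tendsto (fun n => laplacian (mollify (ρ n) (indicator S u)) x₀) atTop (𝓝 (g x₀)) :=
      ((hconv hg).tendsto_at hx₀O).congr fun n => (hΔu n x₀ hx₀O).symm
    exact tendsto_nhds_unique l1 l2
  exact ⟨fun x hx => (main x hx).1.contDiffWithinAt, fun x hx => (main x hx).2⟩

/-! ### Integrability of `1 / ‖y‖` -/

lemma finrank_plane : Module.finrank ℝ Plane = 2 := by simp

lemma integrableOn_inv_norm (r : ℝ) :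
    IntegrableOn (fun z : Plane => ‖z‖⁻¹) (Metric.ball 0 r) := by
  rw [integrableOn_fun_norm_addHaar volume (f := fun s => s⁻¹) (r := r), finrank_plane]
  refine (integrableOn_const (C := (1 : ℝ)) (by simp)).congr_fun (fun y hy => ?_) measurableSet_Ioo
  have : y ≠ 0 := hy.1.ne'
  simp [this]

lemma integrableOn_ball_const (c r : ℝ) :
    IntegrableOn (fun _ : Plane => c) (Metric.ball 0 r) :=
  integrableOn_const measure_ball_lt_top.ne

/-- A bound for the integral of `1 / ‖x - y‖` over the disc of radius `R`, uniform in `x`. -/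
def invNormBound (R : ℝ) : ℝ :=
  (∫ z in Metric.ball (0 : Plane) 1, ‖z‖⁻¹) + ∫ _ in Metric.ball (0 : Plane) R, (1 : ℝ)

lemma integrable_inv_norm_indicator :
    Integrable ((Metric.ball (0 : Plane) 1).indicator fun z => ‖z‖⁻¹) :=
  (integrable_indicator_iff Metric.isOpen_ball.measurableSet).2 (integrableOn_inv_norm 1)

lemma inv_norm_le (z : Plane) :
    ‖z‖⁻¹ ≤ (Metric.ball (0 : Plane) 1).indicator (fun z => ‖z‖⁻¹) z + 1 := by
  by_cases h : z ∈ Metric.ball (0 : Plane) 1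
  · rw [indicator_of_mem h]; linarith
  · rw [indicator_of_notMem h, zero_add]
    rw [mem_ball_zero_iff, not_lt] at h
    exact inv_le_one_of_one_le₀ h

lemma integrable_bound_inv_norm_sub (x : Plane) (R : ℝ) :
    Integrable (fun y => (Metric.ball (0 : Plane) 1).indicator (fun z => ‖z‖⁻¹) (x - y) + 1)
      (volume.restrict (Metric.ball (0 : Plane) R)) :=
  ((integrable_inv_norm_indicator.comp_sub_left x).restrict).add
    (integrableOn_ball_const _ _)

lemma integrableOn_inv_norm_sub (x : Plane) (R : ℝ) :
    IntegrableOn (fun y => ‖x - y‖⁻¹) (Metric.ball 0 R) := by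
  refine (integrable_bound_inv_norm_sub x R).mono' ?_ (Eventually.of_forall fun y => ?_)
  · exact (measurable_const.sub measurable_id).norm.inv.aestronglyMeasurable
  · rw [Real.norm_of_nonneg (by positivity)]
    exact inv_norm_le _

lemma integral_inv_norm_sub_le (x : Plane) (R : ℝ) :
    ∫ y in Metric.ball (0 : Plane) R, ‖x - y‖⁻¹ ≤ invNormBound R := by
  have h1 := (integrable_inv_norm_indicator.comp_sub_left x)
  refine (integral_mono (integrableOn_inv_norm_sub x R) (integrable_bound_inv_norm_sub x R)
    fun y => inv_norm_le _).trans ?_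
  rw [integral_add h1.restrict (integrableOn_ball_const _ _)]
  refine add_le_add ?_ le_rfl
  refine (setIntegral_le_integral h1 (Eventually.of_forall fun y =>
    indicator_nonneg (fun z _ => by positivity) _)).trans ?_
  rw [integral_sub_left_eq_self (fun y => (Metric.ball (0 : Plane) 1).indicator
    (fun z => ‖z‖⁻¹) y) volume x, integral_indicator Metric.isOpen_ball.measurableSet]

/-! ### The Green function of the disc -/

/-- The defining function of the disc, vanishing outside it. -/
def discWeight (R : ℝ) (x : Plane) : ℝ := max (R ^ 2 - ‖x‖ ^ 2) 0 / R

lemma discWeight_nonneg {R : ℝ} (hR : 0 < R) (x : Plane) : 0 ≤ discWeight R x :=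
  div_nonneg (le_max_right _ _) hR.le

lemma discWeight_le {R : ℝ} (hR : 0 < R) (x : Plane) : discWeight R x ≤ R := by
  rw [discWeight, div_le_iff₀ hR]
  exact max_le (by nlinarith [sq_nonneg ‖x‖]) (by positivity)

lemma continuous_discWeight (R : ℝ) : Continuous (discWeight R) := by
  unfold discWeight
  fun_prop

lemma discWeight_eq_zero {R : ℝ} {x : Plane} (hR : 0 < R) (hx : R ≤ ‖x‖) : discWeight R x = 0 := by
  rw [discWeight, max_eq_right (by nlinarith), zero_div]

/-- The Green function of the disc of radius `R`, regularised by `e ≥ 0`. -/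
def greenReg (R e : ℝ) (x y : Plane) : ℝ :=
  (4 * Real.pi)⁻¹ * (Real.log (‖x - y‖ ^ 2 + discWeight R x * discWeight R y + e) -
    Real.log (‖x - y‖ ^ 2 + e))

/-- The Green function of the disc of radius `R`. -/
def green (R : ℝ) (x y : Plane) : ℝ := greenReg R 0 x y

/-- For `x ≠ 0` and `y` in the disc, the argument of the first logarithm is `|x|² |y - x*|² / R²`
with `x* = R² x / |x|²` the reflected pole. Written with `discWeight` it is visibly symmetric, needs
no exception at `x = 0`, and gives a function vanishing as soon as one argument leaves the disc. -/
lemma green_symm (R : ℝ) (x y : Plane) : green R x y = green R y x := by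
  rw [green, green, greenReg, greenReg, norm_sub_rev, mul_comm (discWeight R x)]

lemma green_eq_zero {R : ℝ} (hR : 0 < R) {x : Plane} (hx : R ≤ ‖x‖) (y : Plane) :
    green R x y = 0 := by
  simp [green, greenReg, discWeight_eq_zero hR hx]

lemma continuous_greenReg {R e : ℝ} (hR : 0 < R) (he : 0 < e) :
    Continuous fun p : Plane × Plane => greenReg R e p.1 p.2 := by
  have h0 : Continuous fun p : Plane × Plane => discWeight R p.1 * discWeight R p.2 :=
    ((continuous_discWeight R).comp continuous_fst).mul
      ((continuous_discWeight R).comp continuous_snd)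
  refine continuous_const.mul (Continuous.sub (Continuous.log ?_ ?_) (Continuous.log ?_ ?_))
  · fun_prop
  · intro p
    have := mul_nonneg (discWeight_nonneg hR p.1) (discWeight_nonneg hR p.2)
    positivity
  · fun_prop
  · intro p; positivity

lemma measurable_green (R : ℝ) : Measurable fun p : Plane × Plane => green R p.1 p.2 := by
  have h0 : Measurable fun p : Plane × Plane => discWeight R p.1 * discWeight R p.2 :=
    (((continuous_discWeight R).comp continuous_fst).mul
      ((continuous_discWeight R).comp continuous_snd)).measurable
  have h1 : Measurable fun p : Plane × Plane => ‖p.1 - p.2‖ ^ 2 :=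
    (by fun_prop : Continuous fun p : Plane × Plane => ‖p.1 - p.2‖ ^ 2).measurable
  exact measurable_const.mul ((Real.measurable_log.comp ((h1.add h0).add measurable_const)).sub
    (Real.measurable_log.comp (h1.add measurable_const)))

/-- Since `1 + b ≤ (1 + √b)²`, taking a square root inside the logarithm costs a factor two; this is
done twice before `log (1 + s) ≤ s`. The fourth root makes the square of the Green function at most
a multiple of `1 / ‖x - y‖`, which is integrable in the plane. -/
lemma log_one_add_le {a : ℝ} (ha : 0 ≤ a) : Real.log (1 + a) ≤ 4 * √√a := by
  have key : ∀ b : ℝ, 0 ≤ b → Real.log (1 + b) ≤ 2 * Real.log (1 + √b) := by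
    intro b hb
    rw [← Real.log_rpow (by positivity)] 
    apply Real.log_le_log (by positivity)
    norm_num
    nlinarith [Real.sq_sqrt hb, Real.sqrt_nonneg b]
  have h3 : Real.log (1 + √√a) ≤ √√a := by
    have := Real.log_le_sub_one_of_pos (show 0 < 1 + √√a by positivity)
    linarith
  linarith [key a ha, key (√a) (Real.sqrt_nonneg a)]

lemma log_one_add_sq_le {a : ℝ} (ha : 0 ≤ a) : Real.log (1 + a) ^ 2 ≤ 16 * √a := by
  have h1 := log_one_add_le ha
  have h0 : 0 ≤ Real.log (1 + a) := Real.log_nonneg (by linarith)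
  have : √√a ^ 2 = √a := Real.sq_sqrt (Real.sqrt_nonneg a)
  nlinarith [Real.sqrt_nonneg (√a)]

lemma inv_four_pi_le : (4 * Real.pi)⁻¹ ≤ 1 / 4 := by
  rw [inv_le_comm₀ (by positivity) (by norm_num)]
  have := Real.pi_gt_three
  norm_num
  linarith

lemma sqrt_div_norm_sq {a : ℝ} (z : Plane) : √(a / ‖z‖ ^ 2) = √a * ‖z‖⁻¹ := by
  rw [Real.sqrt_div' _ (by positivity), Real.sqrt_sq (norm_nonneg z), div_eq_mul_inv]

lemma sq_mul_inv_four_pi_le {b c : ℝ} (h : b ^ 2 ≤ 16 * c) : ((4 * Real.pi)⁻¹ * b) ^ 2 ≤ c := by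
  rw [mul_pow]
  have h1 : ((4 * Real.pi)⁻¹) ^ 2 ≤ (1 / 4) ^ 2 := by
    gcongr; exact inv_four_pi_le
  nlinarith [sq_nonneg b, sq_nonneg ((4 * Real.pi)⁻¹)]

/-- The logarithmic singularity is traded for an integrable power, which bounds the `L²` norm of the
Green function uniformly in its pole. -/
lemma green_sq_le {R : ℝ} (hR : 0 < R) {x y : Plane} (hxy : x ≠ y) :
    green R x y ^ 2 ≤ R * ‖x - y‖⁻¹ := by
  have hs : 0 < ‖x - y‖ ^ 2 := by have := norm_pos_iff.2 (sub_ne_zero.2 hxy); positivity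
  have hm := mul_nonneg (discWeight_nonneg hR x) (discWeight_nonneg hR y)
  have hmR : discWeight R x * discWeight R y ≤ R ^ 2 := by
    rw [sq]; exact mul_le_mul (discWeight_le hR x) (discWeight_le hR y) (discWeight_nonneg hR y) hR.le
  apply sq_mul_inv_four_pi_le
  rw [add_zero, add_zero, ← Real.log_div (by positivity) (by positivity), add_div,
    div_self hs.ne']
  refine (log_one_add_sq_le (by positivity)).trans ?_
  have : √(discWeight R x * discWeight R y / ‖x - y‖ ^ 2) ≤ √(R ^ 2 / ‖x - y‖ ^ 2) :=
    Real.sqrt_le_sqrt (by gcongr)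
  rw [sqrt_div_norm_sq, sqrt_div_norm_sq, Real.sqrt_sq hR.le] at this
  rw [sqrt_div_norm_sq]
  linarith

/-- Up to the factor `1 / (4 π)`, the difference is `log (1 + e/s) - log (1 + e/(s+m))` with both
terms nonnegative and the first one larger, so the first one alone bounds it. The estimate is
uniform in the pole and tends to zero with `e`. -/
lemma green_sub_greenReg_sq_le {R e : ℝ} (hR : 0 < R) (he : 0 ≤ e) {x y : Plane} (hxy : x ≠ y) :
    (green R x y - greenReg R e x y) ^ 2 ≤ √e * ‖x - y‖⁻¹ := by
  have hs : 0 < ‖x - y‖ ^ 2 := by have := norm_pos_iff.2 (sub_ne_zero.2 hxy); positivity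
  have hm := mul_nonneg (discWeight_nonneg hR x) (discWeight_nonneg hR y)
  set s := ‖x - y‖ ^ 2 with hsdef
  set m := discWeight R x * discWeight R y with hmdef
  have e1 : green R x y - greenReg R e x y = (4 * Real.pi)⁻¹ *
      ((Real.log (s + e) - Real.log s) - (Real.log (s + m + e) - Real.log (s + m))) := by
    simp only [green, greenReg, add_zero, ← hsdef, ← hmdef]; ring
  rw [e1]
  apply sq_mul_inv_four_pi_le
  have a1 : Real.log (s + e) - Real.log s = Real.log (1 + e / s) := by
    rw [← Real.log_div (by positivity) (by positivity), add_div, div_self hs.ne']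
  have a2 : Real.log (s + m + e) - Real.log (s + m) = Real.log (1 + e / (s + m)) := by
    rw [← Real.log_div (by positivity) (by positivity), add_div, div_self (by positivity)]
  have a3 : Real.log (1 + e / (s + m)) ≤ Real.log (1 + e / s) := by
    apply Real.log_le_log (by positivity)
    gcongr
    linarith
  have a4 : 0 ≤ Real.log (1 + e / (s + m)) := Real.log_nonneg (by
    have : 0 ≤ e / (s + m) := by positivity
    linarith)
  rw [a1, a2]
  have a5 := log_one_add_sq_le (show 0 ≤ e / s by positivity)
  rw [hsdef, sqrt_div_norm_sq] at a5
  rw [hsdef] at a3 a4 ⊢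
  nlinarith

/-! ### The Green function inverts the Laplacian -/

lemma fderiv_quadratic_apply (a c : ℝ) (b y : Plane) (i : Fin 2) :
    fderiv ℝ (fun y : Plane => a * ‖y‖ ^ 2 + inner ℝ b y + c) y (basisVec i) =
      2 * a * y i + b i := by
  have h1 : HasFDerivAt (fun y : Plane => ‖y‖ ^ 2) (2 • innerSL ℝ y) y :=
    (hasStrictFDerivAt_norm_sq y).hasFDerivAt
  have h2 : HasFDerivAt (fun y : Plane => inner ℝ b y) (innerSL ℝ b) y :=
    (innerSL ℝ b).hasFDerivAt
  have h3 : fderiv ℝ (fun y : Plane => a * ‖y‖ ^ 2 + inner ℝ b y + c) y = _ :=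
    (((h1.const_mul a).add h2).add_const c).fderiv
  rw [h3]
  simp [EuclideanSpace.inner_single_right]
  ring

lemma contDiff_quadratic (a c : ℝ) (b : Plane) :
    ContDiff ℝ 2 (fun y : Plane => a * ‖y‖ ^ 2 + inner ℝ b y + c) :=
  ((contDiff_const.mul (contDiff_norm_sq ℝ)).add (innerSL ℝ b).contDiff).add contDiff_const

lemma laplacian_quadratic (a c : ℝ) (b x : Plane) :
    laplacian (fun y : Plane => a * ‖y‖ ^ 2 + inner ℝ b y + c) x = 4 * a := by
  rw [laplacian_eq_of_hasFDerivAt (contDiff_quadratic a c b).contDiffAt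
    (g := fun i y => 2 * a * y i + b i)
    (fun i => Eventually.of_forall fun y => fderiv_quadratic_apply a c b y i)]
  have : ∀ i : Fin 2, fderiv ℝ (fun y : Plane => 2 * a * y i + b i) x (basisVec i) = 2 * a := by
    intro i
    have h : fderiv ℝ (fun y : Plane => 2 * a * y i + b i) x = _ :=
      ((((EuclideanSpace.proj i : Plane →L[ℝ] ℝ).hasFDerivAt (x := x)).const_mul
        (2 * a)).add_const (b i)).fderiv
    rw [h]
    simp
  simp only [this]
  simp
  ring

/-- The numerator vanishes when the quadratic is a multiple of the squared distance to a point, and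
then its logarithm is harmonic. Both logarithms in the Green function are covered, as is the
regularisation, whose numerator is `4 e`. -/
lemma laplacian_log_quadratic {a c : ℝ} {b x : Plane}
    (h : 0 < a * ‖x‖ ^ 2 + inner ℝ b x + c) :
    laplacian (fun y : Plane => Real.log (a * ‖y‖ ^ 2 + inner ℝ b y + c)) x =
      (4 * a * c - ‖b‖ ^ 2) / (a * ‖x‖ ^ 2 + inner ℝ b x + c) ^ 2 := by
  rw [laplacian_comp (F := Real.log) (Real.contDiffAt_log.2 h.ne')
    (contDiff_quadratic a c b).contDiffAt, laplacian_quadratic, Real.deriv_log]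
  have hd : deriv (deriv Real.log) (a * ‖x‖ ^ 2 + inner ℝ b x + c) =
      -((a * ‖x‖ ^ 2 + inner ℝ b x + c) ^ 2)⁻¹ := by
    rw [Real.deriv_log', deriv_inv]
  rw [hd]
  simp only [fderiv_quadratic_apply]
  have hb : ‖b‖ ^ 2 = b 0 ^ 2 + b 1 ^ 2 := norm_sq_eq b
  have hx : ‖x‖ ^ 2 = x 0 ^ 2 + x 1 ^ 2 := norm_sq_eq x
  have hi : inner ℝ b x = b 0 * x 0 + b 1 * x 1 := by
    simp [PiLp.inner_apply, Fin.sum_univ_two, mul_comm]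
  rw [Fin.sum_univ_two]
  rw [hb]
  field_simp
  rw [hi, hx]
  ring

lemma norm_sub_sq_eq_quadratic (x y : Plane) (e : ℝ) :
    ‖x - y‖ ^ 2 + e = 1 * ‖y‖ ^ 2 + inner ℝ ((-2 : ℝ) • x) y + (‖x‖ ^ 2 + e) := by
  rw [norm_sub_sq_real, inner_smul_left]
  simp
  ring

/-- Integration of a test function against the Laplacian of a logarithmic potential. -/
lemma integral_log_quadratic_mul_laplacian {a c : ℝ} {b : Plane} {φ : Plane → ℝ}
    (hφ : ContDiff ℝ ∞ φ) (hc : HasCompactSupport φ)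
    (hs : ∀ y ∈ tsupport φ, 0 < a * ‖y‖ ^ 2 + inner ℝ b y + c) :
    ∫ y, Real.log (a * ‖y‖ ^ 2 + inner ℝ b y + c) * laplacian φ y =
      ∫ y, (4 * a * c - ‖b‖ ^ 2) / (a * ‖y‖ ^ 2 + inner ℝ b y + c) ^ 2 * φ y := by
  have hq := contDiff_quadratic a c b
  have hU : IsOpen {y : Plane | 0 < a * ‖y‖ ^ 2 + inner ℝ b y + c} :=
    isOpen_lt continuous_const hq.continuous
  have := integral_mul_laplacian_comm hU (contDiff_two_of_infty hφ) hc hs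
    (f := fun y => Real.log (a * ‖y‖ ^ 2 + inner ℝ b y + c))
    (fun y hy => (hq.contDiffAt.log (ne_of_gt hy)).contDiffWithinAt)
  simp only [mul_comm (laplacian φ _)] at this
  rw [← this]
  refine integral_congr_ae (Eventually.of_forall fun y => ?_)
  by_cases hy : y ∈ tsupport φ
  · simp only [laplacian_log_quadratic (hs y hy)]
    ring
  · simp [image_eq_zero_of_notMem_tsupport hy]

/-- In polar coordinates the integrand `r (1 + r²)⁻²` has the primitive `-(1/2) (1 + r²)⁻¹`. The
value fixes the constant `4 π` of the fundamental solution. -/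
lemma integral_inv_one_add_norm_sq_sq :
    Integrable (fun z : Plane => ((1 + ‖z‖ ^ 2) ^ 2)⁻¹) ∧
      ∫ z : Plane, ((1 + ‖z‖ ^ 2) ^ 2)⁻¹ = Real.pi := by
  have hd : ∀ r ∈ Ioi (0 : ℝ), HasDerivAt (fun r : ℝ => -(1 / 2) * (1 + r ^ 2)⁻¹)
      (r ^ (2 - 1) • ((1 + r ^ 2) ^ 2)⁻¹) r := by
    intro r _
    have h1 : HasDerivAt (fun r : ℝ => 1 + r ^ 2) (2 * r) r := by
      simpa using (hasDerivAt_pow 2 r).const_add 1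
    have h2 := (h1.inv (by positivity)).const_mul (-(1 / 2))
    refine h2.congr_deriv ?_
    simp
    field_simp
  have hlim : Tendsto (fun r : ℝ => -(1 / 2) * (1 + r ^ 2)⁻¹) atTop (𝓝 0) := by
    have : Tendsto (fun r : ℝ => (1 + r ^ 2)⁻¹) atTop (𝓝 0) :=
      tendsto_inv_atTop_zero.comp
        (tendsto_atTop_add_const_left _ _ (tendsto_pow_atTop two_ne_zero))
    rw [← mul_zero (-(1 / 2) : ℝ)]
    exact this.const_mul _
  have hc : ContinuousWithinAt (fun r : ℝ => -(1 / 2) * (1 + r ^ 2)⁻¹) (Ici 0) 0 := by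
    refine (ContinuousAt.mul continuousAt_const ?_).continuousWithinAt
    exact ContinuousAt.inv₀ (by fun_prop) (by positivity)
  have hpos : ∀ r ∈ Ioi (0 : ℝ), 0 ≤ r ^ (2 - 1) • ((1 + r ^ 2) ^ 2)⁻¹ := by
    intro r hr
    have : (0 : ℝ) < r := hr
    simp only [smul_eq_mul]; positivity
  have hint := integrableOn_Ioi_deriv_of_nonneg hc hd hpos hlim
  have hval := integral_Ioi_of_hasDerivAt_of_nonneg hc hd hpos hlim
  constructor
  · rw [integrable_fun_norm_addHaar volume (f := fun s : ℝ => ((1 + s ^ 2) ^ 2)⁻¹), finrank_plane]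
    exact hint
  · rw [integral_fun_norm_addHaar volume (fun s : ℝ => ((1 + s ^ 2) ^ 2)⁻¹), finrank_plane, hval]
    rw [Measure.real, EuclideanSpace.volume_ball_fin_two]
    simp [ENNReal.toReal_ofReal Real.pi_pos.le]
    ring

lemma abs_log_norm_sq_add_le {z : Plane} (hz : z ≠ 0) {e : ℝ} (he : 0 ≤ e) (he1 : e ≤ 1) :
    |Real.log (‖z‖ ^ 2 + e)| ≤ ‖z‖ ^ 2 + 1 + 2 * ‖z‖⁻¹ := by
  have hz' : 0 < ‖z‖ := norm_pos_iff.2 hz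
  have h1 := Real.log_le_sub_one_of_pos (show 0 < ‖z‖ ^ 2 + e by positivity)
  have h2 := Real.log_le_log (show 0 < ‖z‖ ^ 2 by positivity) (show ‖z‖ ^ 2 ≤ ‖z‖ ^ 2 + e by linarith)
  have h3 := Real.log_le_sub_one_of_pos (show 0 < ‖z‖⁻¹ by positivity)
  rw [Real.log_inv] at h3
  rw [Real.log_pow] at h2
  push_cast at h2
  have : 0 < ‖z‖⁻¹ := by positivity
  rw [abs_le]
  constructor <;> nlinarith [sq_nonneg ‖z‖]

/-- The logarithm is a fundamental solution of the Laplacian of the plane. -/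
lemma integral_log_norm_sq_mul_laplacian {φ : Plane → ℝ} (hφ : ContDiff ℝ ∞ φ)
    (hc : HasCompactSupport φ) (x : Plane) :
    ∫ y, Real.log (‖x - y‖ ^ 2) * laplacian φ y = 4 * Real.pi * φ x := by
  obtain ⟨Cφ, hCφ⟩ := hc.exists_bound_of_continuous hφ.continuous
  set δ : ℕ → ℝ := fun n => 1 / ((n : ℝ) + 1) with hδ
  have hδpos : ∀ n, 0 < δ n := fun n => by positivity
  have hδlim : Tendsto δ atTop (𝓝 0) := tendsto_one_div_add_atTop_nhds_zero_nat
  have hδ1 : ∀ n, δ n ≤ 1 := fun n => by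
    rw [hδ]; simp only
    rw [div_le_one (by positivity)]
    have : (0 : ℝ) ≤ n := by positivity
    linarith
  -- the regularised identity
  have h1 : ∀ n, ∫ y, Real.log (‖x - y‖ ^ 2 + δ n ^ 2) * laplacian φ y =
      4 * ∫ z, ((1 + ‖z‖ ^ 2) ^ 2)⁻¹ * φ (x + δ n • z) := by
    intro n
    have e0 := hδpos n
    simp only [norm_sub_sq_eq_quadratic]
    rw [integral_log_quadratic_mul_laplacian hφ hc]
    · have e1 : ∀ y, (4 * 1 * (‖x‖ ^ 2 + δ n ^ 2) - ‖(-2 : ℝ) • x‖ ^ 2) /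
          (1 * ‖y‖ ^ 2 + inner ℝ ((-2 : ℝ) • x) y + (‖x‖ ^ 2 + δ n ^ 2)) ^ 2 * φ y =
          4 * (δ n ^ 2 / (‖y - x‖ ^ 2 + δ n ^ 2) ^ 2 * φ (x + (y - x))) := by
        intro y
        rw [← norm_sub_sq_eq_quadratic, norm_smul, mul_pow, norm_sub_rev]
        norm_num
        ring
      simp only [e1]
      rw [integral_const_mul, integral_sub_right_eq_self
        (fun y => δ n ^ 2 / (‖y‖ ^ 2 + δ n ^ 2) ^ 2 * φ (x + y)) x]
      have e2 := Measure.integral_comp_smul_of_nonneg volume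
        (fun y : Plane => δ n ^ 2 / (‖y‖ ^ 2 + δ n ^ 2) ^ 2 * φ (x + y)) (δ n) (hR := e0.le)
      rw [finrank_plane] at e2
      have e3 : ∫ y : Plane, δ n ^ 2 / (‖y‖ ^ 2 + δ n ^ 2) ^ 2 * φ (x + y) =
          δ n ^ 2 * ∫ z : Plane, δ n ^ 2 / (‖δ n • z‖ ^ 2 + δ n ^ 2) ^ 2 * φ (x + δ n • z) := by
        rw [e2, smul_eq_mul, ← mul_assoc, mul_inv_cancel₀ (by positivity), one_mul]
      rw [e3, ← integral_const_mul]
      congr 1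
      refine integral_congr_ae (Eventually.of_forall fun z => ?_)
      simp only [norm_smul, mul_pow, Real.norm_eq_abs, sq_abs]
      have : δ n ^ 2 * ‖z‖ ^ 2 + δ n ^ 2 = δ n ^ 2 * (1 + ‖z‖ ^ 2) := by ring
      rw [this]
      field_simp
    · intro y _
      rw [← norm_sub_sq_eq_quadratic]
      positivity
  -- After scaling by `δ n`, the Laplacian of the regularised logarithm acts as an approximate
  -- identity of total mass `4 π`.
  have h2 : Tendsto (fun n => 4 * ∫ z, ((1 + ‖z‖ ^ 2) ^ 2)⁻¹ * φ (x + δ n • z)) atTop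
      (𝓝 (4 * ∫ z : Plane, ((1 + ‖z‖ ^ 2) ^ 2)⁻¹ * φ x)) := by
    refine Tendsto.const_mul _ (tendsto_integral_of_dominated_convergence
      (fun z => ((1 + ‖z‖ ^ 2) ^ 2)⁻¹ * Cφ) (fun n => ?_)
      (integral_inv_one_add_norm_sq_sq.1.mul_const _) (fun n => ?_) ?_)
    · refine Continuous.aestronglyMeasurable (Continuous.mul (Continuous.inv₀ (by fun_prop)
        fun z => by positivity) (hφ.continuous.comp (by fun_prop)))
    · refine Eventually.of_forall fun z => ?_
      rw [norm_mul, Real.norm_of_nonneg (by positivity)]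
      exact mul_le_mul_of_nonneg_left (hCφ _) (by positivity)
    · refine Eventually.of_forall fun z => Tendsto.const_mul _ ?_
      have : Tendsto (fun n => x + δ n • z) atTop (𝓝 (x + (0 : ℝ) • z)) :=
        tendsto_const_nhds.add (hδlim.smul_const z)
      rw [zero_smul, add_zero] at this
      exact (hφ.continuous.tendsto x).comp this
  have hΔ := (contDiff_laplacian hφ).continuous
  have hΔc := hasCompactSupport_laplacian hc
  obtain ⟨ρ, hρ⟩ := hΔc.isBounded.subset_ball (0 : Plane)
  have hzero : ∀ y, y ∉ Metric.ball (0 : Plane) ρ → laplacian φ y = 0 := fun y hy =>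
    image_eq_zero_of_notMem_tsupport fun h => hy (hρ h)
  have hset : ∀ f : Plane → ℝ, ∫ y, f y * laplacian φ y =
      ∫ y in Metric.ball 0 ρ, f y * laplacian φ y := fun f =>
    (setIntegral_eq_integral_of_forall_compl_eq_zero fun y hy => by rw [hzero y hy, mul_zero]).symm
  obtain ⟨CΔ, hCΔ⟩ := hΔc.exists_bound_of_continuous hΔ
  have h3 : Tendsto (fun n => ∫ y, Real.log (‖x - y‖ ^ 2 + δ n ^ 2) * laplacian φ y) atTop
      (𝓝 (∫ y, Real.log (‖x - y‖ ^ 2) * laplacian φ y)) := by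
    rw [hset]
    simp only [hset]
    have hne : ∀ᵐ y ∂(volume.restrict (Metric.ball (0 : Plane) ρ)), y ≠ x :=
      ae_restrict_of_ae (by simp [ae_iff])
    refine tendsto_integral_of_dominated_convergence
      (fun y => (((‖x‖ + ρ) ^ 2 + 1) + 2 * ‖x - y‖⁻¹) * CΔ) (fun n => ?_) ?_ (fun n => ?_) ?_
    · have e0 := hδpos n
      exact (Continuous.mul (Continuous.log (by fun_prop) fun y => by positivity)
        hΔ).aestronglyMeasurable
    · exact ((integrableOn_ball_const _ _).add
        ((integrableOn_inv_norm_sub x ρ).const_mul 2)).mul_const _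
    · filter_upwards [hne, ae_restrict_mem Metric.isOpen_ball.measurableSet] with y hy hyb
      rw [norm_mul]
      refine mul_le_mul ?_ (hCΔ y) (norm_nonneg _) (by positivity)
      rw [Real.norm_eq_abs]
      refine (abs_log_norm_sq_add_le (sub_ne_zero.2 hy.symm) (by positivity)
        (pow_le_one₀ (hδpos n).le (hδ1 n))).trans ?_
      have : ‖x - y‖ ≤ ‖x‖ + ρ := (norm_sub_le _ _).trans
        (add_le_add le_rfl (mem_ball_zero_iff.1 hyb).le)
      gcongr
    · filter_upwards [hne] with y hy
      refine Tendsto.mul_const _ ?_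
      have hpos : ‖x - y‖ ^ 2 ≠ 0 := by
        have := norm_pos_iff.2 (sub_ne_zero.2 hy.symm); positivity
      refine (Real.continuousAt_log hpos).tendsto.comp ?_
      have := (hδlim.pow 2).const_add (‖x - y‖ ^ 2)
      simpa using this
  have h4 := tendsto_nhds_unique h3 (h2.congr fun n => (h1 n).symm)
  rw [h4, integral_mul_const (φ x), integral_inv_one_add_norm_sq_sq.2]
  ring

/-- Representation of test functions through the Green function. -/
theorem integral_green_mul_laplacian {R : ℝ} (hR : 0 < R) {φ : Plane → ℝ} (hφ : ContDiff ℝ ∞ φ)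
    (hc : HasCompactSupport φ) (hs : tsupport φ ⊆ Metric.ball 0 R) (x : Plane) :
    ∫ y in Metric.ball (0 : Plane) R, green R x y * laplacian φ y = -φ x := by
  have hzero : ∀ y, y ∉ Metric.ball (0 : Plane) R → laplacian φ y = 0 := fun y hy =>
    image_eq_zero_of_notMem_tsupport fun h => hy (hs (tsupport_laplacian_subset φ h))
  rw [setIntegral_eq_integral_of_forall_compl_eq_zero (f := fun y => green R x y * laplacian φ y)
    fun y hy => by rw [hzero y hy, mul_zero]]
  by_cases hx : R ≤ ‖x‖
  · simp only [green_eq_zero hR hx, zero_mul, integral_zero]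
    rw [image_eq_zero_of_notMem_tsupport (f := φ) fun h => (mem_ball_zero_iff.1 (hs h)).not_ge hx,
      neg_zero]
  rw [not_le] at hx
  -- With this `a` the first argument is a quadratic in `y` that is positive in the disc and
  -- satisfies `4 a R² = ‖-2 x‖²`. Its logarithm is therefore harmonic there and contributes
  -- nothing, so only the fundamental solution remains.
  set a := ‖x‖ ^ 2 / R ^ 2 with ha
  have hq : ∀ y ∈ Metric.ball (0 : Plane) R, ‖x - y‖ ^ 2 + discWeight R x * discWeight R y =
      a * ‖y‖ ^ 2 + inner ℝ ((-2 : ℝ) • x) y + R ^ 2 := by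
    intro y hy
    rw [mem_ball_zero_iff] at hy
    rw [discWeight, discWeight, max_eq_left (by nlinarith [norm_nonneg x]),
      max_eq_left (by nlinarith [norm_nonneg y]), norm_sub_sq_real, inner_smul_left, ha]
    simp
    field_simp
    ring
  have hpos : ∀ y ∈ Metric.ball (0 : Plane) R,
      0 < a * ‖y‖ ^ 2 + inner ℝ ((-2 : ℝ) • x) y + R ^ 2 := by
    intro y hy
    rw [← hq y hy]
    rw [mem_ball_zero_iff] at hy
    have : ∀ z : Plane, ‖z‖ < R → 0 < discWeight R z := by
      intro z hz
      apply div_pos _ hR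
      rw [lt_max_iff]; left; nlinarith [norm_nonneg z]
    have := mul_pos (this x hx) (this y hy)
    positivity
  have hb : 4 * a * R ^ 2 - ‖(-2 : ℝ) • x‖ ^ 2 = 0 := by
    rw [norm_smul, mul_pow, ha]; norm_num; field_simp; ring
  have h1 := integral_log_quadratic_mul_laplacian hφ hc (a := a) (b := (-2 : ℝ) • x) (c := R ^ 2)
    (fun y hy => hpos y (hs hy))
  simp only [hb, zero_div, zero_mul, integral_zero] at h1
  have h2 := integral_log_norm_sq_mul_laplacian hφ hc x
  have hΔ := (contDiff_laplacian hφ).continuous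
  have hΔc := hasCompactSupport_laplacian hc
  have i1 : Integrable fun y => Real.log (a * ‖y‖ ^ 2 + inner ℝ ((-2 : ℝ) • x) y + R ^ 2) *
      laplacian φ y := by
    have := integrable_mul_of_tsupport hΔ hΔc ((tsupport_laplacian_subset φ).trans hs)
      Metric.isOpen_ball (b := fun y => Real.log (a * ‖y‖ ^ 2 + inner ℝ ((-2 : ℝ) • x) y + R ^ 2))
      (ContinuousOn.log (contDiff_quadratic _ _ _).continuous.continuousOn
        fun y hy => (hpos y hy).ne')
    simpa only [mul_comm] using this
  have i2 : Integrable fun y => Real.log (‖x - y‖ ^ 2) * laplacian φ y := by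
    obtain ⟨CΔ, hCΔ⟩ := hΔc.exists_bound_of_continuous hΔ
    refine (integrableOn_iff_integrable_of_support_subset (s := Metric.ball 0 R) ?_).1 ?_
    · intro y hy
      by_contra h
      exact hy (by simp [hzero y h])
    · have hne : ∀ᵐ y ∂(volume.restrict (Metric.ball (0 : Plane) R)), y ≠ x :=
        ae_restrict_of_ae (by simp [ae_iff])
      refine Integrable.mono' (g := fun y => (((‖x‖ + R) ^ 2 + 1) + 2 * ‖x - y‖⁻¹) * CΔ)
        (((integrableOn_ball_const _ _).add
          ((integrableOn_inv_norm_sub x R).const_mul 2)).mul_const _) ?_ ?_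
      · have hm : Measurable fun y : Plane => ‖x - y‖ ^ 2 :=
          (by fun_prop : Continuous fun y : Plane => ‖x - y‖ ^ 2).measurable
        exact ((Real.measurable_log.comp hm).mul hΔ.measurable).aestronglyMeasurable
      · filter_upwards [hne, ae_restrict_mem Metric.isOpen_ball.measurableSet] with y hy hyb
        rw [norm_mul]
        refine mul_le_mul ?_ (hCΔ y) (norm_nonneg _) (by positivity)
        rw [Real.norm_eq_abs]
        have := abs_log_norm_sq_add_le (sub_ne_zero.2 hy.symm) le_rfl zero_le_one
        rw [add_zero] at this
        refine this.trans ?_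
        have : ‖x - y‖ ≤ ‖x‖ + R := (norm_sub_le _ _).trans
          (add_le_add le_rfl (mem_ball_zero_iff.1 hyb).le)
        gcongr
  have h3 : ∀ y, green R x y * laplacian φ y = (4 * Real.pi)⁻¹ *
      (Real.log (a * ‖y‖ ^ 2 + inner ℝ ((-2 : ℝ) • x) y + R ^ 2) * laplacian φ y -
        Real.log (‖x - y‖ ^ 2) * laplacian φ y) := by
    intro y
    by_cases hy : y ∈ Metric.ball (0 : Plane) R
    · rw [← hq y hy, green, greenReg, add_zero, add_zero]; ring
    · rw [hzero y hy]; ring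
  simp only [h3]
  rw [integral_const_mul, integral_sub i1 i2, h1, h2]
  field_simp
  ring

/-! ### The Green function as a continuous family of square integrable functions -/

/-- Lebesgue measure on the disc of radius `R`. -/
abbrev discMeasure (R : ℝ) : Measure Plane := volume.restrict (Metric.ball (0 : Plane) R)

instance (R : ℝ) : IsFiniteMeasure (discMeasure R) :=
  ⟨by simpa using measure_ball_lt_top (μ := (volume : Measure Plane)) (x := 0) (r := R)⟩

/-- Complex valued square integrable functions on the disc of radius `R`. -/
abbrev discL2 (R : ℝ) : Type := Lp ℂ 2 (discMeasure R)

lemma measurable_green_right (R : ℝ) (x : Plane) : Measurable fun y => green R x y :=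
  Measurable.comp (g := fun p : Plane × Plane => green R p.1 p.2) (f := fun y => (x, y))
    (measurable_green R) measurable_prodMk_left

lemma ae_ne (R : ℝ) (x : Plane) : ∀ᵐ y ∂(discMeasure R), x ≠ y :=
  ae_restrict_of_ae (by
    have : ∀ᵐ y : Plane, y ≠ x := by simp [ae_iff]
    filter_upwards [this] with y hy using hy.symm)

lemma integrable_green_sq {R : ℝ} (hR : 0 < R) (x : Plane) :
    Integrable (fun y => green R x y ^ 2) (discMeasure R) := by
  refine ((integrableOn_inv_norm_sub x R).const_mul R).mono'
    ((measurable_green_right R x).pow_const 2).aestronglyMeasurable ?_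
  filter_upwards [ae_ne R x] with y hy
  rw [Real.norm_of_nonneg (sq_nonneg _)]
  exact green_sq_le hR hy

lemma integral_green_sq_le {R : ℝ} (hR : 0 < R) (x : Plane) :
    ∫ y, green R x y ^ 2 ∂(discMeasure R) ≤ R * invNormBound R := by
  refine (integral_mono_ae (integrable_green_sq hR x)
    ((integrableOn_inv_norm_sub x R).const_mul R) ?_).trans ?_
  · filter_upwards [ae_ne R x] with y hy using green_sq_le hR hy
  · rw [integral_const_mul]
    exact mul_le_mul_of_nonneg_left (integral_inv_norm_sub_le x R) hR.le

lemma invNormBound_nonneg (R : ℝ) : 0 ≤ invNormBound R :=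
  add_nonneg (integral_nonneg fun z => by positivity) (integral_nonneg fun z => zero_le_one)

lemma memLp_green {R : ℝ} (hR : 0 < R) (x : Plane) :
    MemLp (fun y => (green R x y : ℂ)) 2 (discMeasure R) := by
  have hm : AEStronglyMeasurable (fun y => (green R x y : ℂ)) (discMeasure R) :=
    (measurable_green_right R x).complex_ofReal.aestronglyMeasurable
  rw [memLp_two_iff_integrable_sq_norm hm]
  simpa using integrable_green_sq hR x

/-- The Green function with pole `x` as an element of `L²`. -/
def greenVec {R : ℝ} (hR : 0 < R) (x : Plane) : discL2 R := (memLp_green hR x).toLp _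

lemma norm_toLp_sq {R : ℝ} {f : Plane → ℂ} (hf : MemLp f 2 (discMeasure R)) :
    ‖hf.toLp f‖ ^ 2 = ∫ y, ‖f y‖ ^ 2 ∂(discMeasure R) := by
  rw [← @inner_self_eq_norm_sq ℂ, L2.inner_def, ← integral_re (L2.integrable_inner _ _)]
  refine integral_congr_ae ?_
  filter_upwards [hf.coeFn_toLp] with y hy
  rw [hy, inner_self_eq_norm_sq]

lemma norm_greenVec_sq_le {R : ℝ} (hR : 0 < R) (x : Plane) :
    ‖greenVec hR x‖ ^ 2 ≤ R * invNormBound R := by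
  rw [greenVec, norm_toLp_sq]
  simpa using integral_green_sq_le hR x

lemma norm_greenVec_le {R : ℝ} (hR : 0 < R) (x : Plane) :
    ‖greenVec hR x‖ ≤ √(R * invNormBound R) :=
  Real.le_sqrt_of_sq_le (norm_greenVec_sq_le hR x)

lemma continuous_greenReg_right {R e : ℝ} (hR : 0 < R) (he : 0 < e) (x : Plane) :
    Continuous fun y => greenReg R e x y :=
  Continuous.comp (g := fun p : Plane × Plane => greenReg R e p.1 p.2) (f := fun y => (x, y))
    (continuous_greenReg hR he) (by fun_prop)

lemma continuous_greenReg_left {R e : ℝ} (hR : 0 < R) (he : 0 < e) (y : Plane) :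
    Continuous fun x => greenReg R e x y :=
  Continuous.comp (g := fun p : Plane × Plane => greenReg R e p.1 p.2) (f := fun x => (x, y))
    (continuous_greenReg hR he) (by fun_prop)

lemma memLp_of_continuous {R : ℝ} {f : Plane → ℂ} (hf : Continuous f) :
    MemLp f 2 (discMeasure R) := by
  obtain ⟨C, hC⟩ := (isCompact_closedBall (0 : Plane) R).exists_bound_of_continuousOn
    hf.continuousOn
  refine MemLp.of_bound hf.aestronglyMeasurable C ?_
  filter_upwards [ae_restrict_mem Metric.isOpen_ball.measurableSet] with y hy
  exact hC y (Metric.ball_subset_closedBall hy)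

/-- The regularised Green functions are jointly continuous, so their `L²` classes depend
continuously on the pole by dominated convergence. They converge to the Green function in `L²`
uniformly in the pole. -/
lemma continuous_greenVec {R : ℝ} (hR : 0 < R) : Continuous (greenVec hR) := by
  have hreg : ∀ e > 0, ∀ x, MemLp (fun y => (greenReg R e x y : ℂ)) 2 (discMeasure R) :=
    fun e he x => memLp_of_continuous
      (Complex.continuous_ofReal.comp (continuous_greenReg_right hR he x))
  set A : ℕ → Plane → discL2 R := fun n x =>
    (hreg (1 / ((n : ℝ) + 1)) (by positivity) x).toLp _ with hA
  have hAc : ∀ n, Continuous (A n) := by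
    intro n
    set e : ℝ := 1 / ((n : ℝ) + 1) with he
    have he0 : 0 < e := by positivity
    rw [continuous_iff_continuousAt]
    intro x₀
    rw [ContinuousAt, tendsto_iff_norm_sub_tendsto_zero]
    have hsq : Tendsto (fun x => ‖A n x - A n x₀‖ ^ 2) (𝓝 x₀) (𝓝 0) := by
      have heq : ∀ x, ‖A n x - A n x₀‖ ^ 2 =
          ∫ y, (greenReg R e x y - greenReg R e x₀ y) ^ 2 ∂(discMeasure R) := by
        intro x
        simp only [hA]
        rw [← MemLp.toLp_sub, norm_toLp_sq]
        refine integral_congr_ae (Eventually.of_forall fun y => ?_)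
        simp only [Pi.sub_apply]
        rw [← Complex.ofReal_sub, Complex.norm_real, Real.norm_eq_abs, sq_abs]
      simp only [heq]
      obtain ⟨C, hC⟩ := ((isCompact_closedBall x₀ 1).prod
        (isCompact_closedBall (0 : Plane) R)).exists_bound_of_continuousOn
        (continuous_greenReg hR he0).continuousOn
      have hlim : Tendsto (fun x => ∫ y, (greenReg R e x y - greenReg R e x₀ y) ^ 2
          ∂(discMeasure R)) (𝓝 x₀) (𝓝 (∫ y, (0 : ℝ) ∂(discMeasure R))) := by
        refine tendsto_integral_filter_of_dominated_convergence (fun _ => (C + C) ^ 2)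
          (Eventually.of_forall fun x => ?_) ?_ (integrable_const _) ?_
        · exact (((continuous_greenReg_right hR he0 x).sub
            (continuous_greenReg_right hR he0 x₀)).pow 2).aestronglyMeasurable
        · filter_upwards [Metric.closedBall_mem_nhds x₀ one_pos] with x hx
          filter_upwards [ae_restrict_mem Metric.isOpen_ball.measurableSet] with y hy
          have hy' := Metric.ball_subset_closedBall hy
          rw [norm_pow]
          gcongr
          exact (norm_sub_le _ _).trans (add_le_add (hC (x, y) ⟨hx, hy'⟩)
            (hC (x₀, y) ⟨Metric.mem_closedBall_self zero_le_one, hy'⟩))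
        · refine Eventually.of_forall fun y => ?_
          have : Continuous fun x => (greenReg R e x y - greenReg R e x₀ y) ^ 2 :=
            ((continuous_greenReg_left hR he0 y).sub continuous_const).pow 2
          have h := this.tendsto x₀
          simpa using h
      simpa using hlim
    have := hsq.sqrt
    simpa [Real.sqrt_sq] using this
  have hunif : TendstoUniformly A (greenVec hR) atTop := by
    rw [Metric.tendstoUniformly_iff]
    intro ε hε
    have hlim : Tendsto (fun n : ℕ => √(√(1 / ((n : ℝ) + 1)) * invNormBound R)) atTop (𝓝 0) := by
      have h := ((tendsto_one_div_add_atTop_nhds_zero_nat (𝕜 := ℝ)).sqrt.mul_const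
        (invNormBound R)).sqrt
      simpa using h
    filter_upwards [hlim.eventually (gt_mem_nhds hε)] with n hn x
    rw [dist_eq_norm]
    refine lt_of_le_of_lt (Real.le_sqrt_of_sq_le ?_) hn
    set e : ℝ := 1 / ((n : ℝ) + 1) with he
    have he0 : 0 < e := by positivity
    simp only [greenVec, hA]
    rw [← MemLp.toLp_sub, norm_toLp_sq]
    have hpt : ∀ᵐ y ∂(discMeasure R), ‖((fun y => (green R x y : ℂ)) -
        fun y => (greenReg R e x y : ℂ)) y‖ ^ 2 ≤ √e * ‖x - y‖⁻¹ := by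
      filter_upwards [ae_ne R x] with y hy
      simp only [Pi.sub_apply]
      rw [← Complex.ofReal_sub, Complex.norm_real, Real.norm_eq_abs, sq_abs]
      exact green_sub_greenReg_sq_le hR he0.le hy
    refine (integral_mono_of_nonneg (Eventually.of_forall fun y => by positivity)
      ((integrableOn_inv_norm_sub x R).const_mul (√e)) hpt).trans ?_
    rw [integral_const_mul]
    exact mul_le_mul_of_nonneg_left (integral_inv_norm_sub_le x R) (Real.sqrt_nonneg e)
  exact hunif.continuous (Eventually.of_forall hAc).frequently

lemma greenVec_eq_zero {R : ℝ} (hR : 0 < R) {x : Plane} (hx : R ≤ ‖x‖) : greenVec hR x = 0 := by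
  have : ‖greenVec hR x‖ ^ 2 = 0 := by
    rw [greenVec, norm_toLp_sq]
    simp [green_eq_zero hR hx]
  simpa using this

/-! ### The Green operator -/

/-- The solution operator of `-Δ u = f` with zero boundary values on the disc of radius `R`. -/
def greenOp {F : Type*} [NormedAddCommGroup F] [NormedSpace ℝ F] (R : ℝ) (f : Plane → F)
    (x : Plane) : F :=
  ∫ y in Metric.ball (0 : Plane) R, green R x y • f y

lemma integrable_green_smul {F : Type*} [NormedAddCommGroup F] [NormedSpace ℝ F] {R : ℝ}
    (hR : 0 < R) {f : Plane → F} (hf : MemLp f 2 (discMeasure R)) (x : Plane) :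
    Integrable (fun y => green R x y • f y) (discMeasure R) := by
  have hf2 : Integrable (fun y => ‖f y‖ ^ 2) (discMeasure R) :=
    (memLp_two_iff_integrable_sq_norm hf.1).1 hf
  refine ((integrable_green_sq hR x).add hf2).mono'
    ((measurable_green_right R x).aestronglyMeasurable.smul hf.1) (Eventually.of_forall fun y => ?_)
  rw [norm_smul, Real.norm_eq_abs, Pi.add_apply, ← sq_abs]
  nlinarith [sq_nonneg (|green R x y| - ‖f y‖), sq_nonneg (|green R x y|), sq_nonneg ‖f y‖]

lemma integral_norm_green_smul_le {F : Type*} [NormedAddCommGroup F] [NormedSpace ℝ F] {R : ℝ}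
    (hR : 0 < R) {f : Plane → F} (hf : MemLp f 2 (discMeasure R)) (x : Plane) :
    ∫ y, ‖green R x y • f y‖ ∂(discMeasure R) ≤
      R * invNormBound R + ∫ y, ‖f y‖ ^ 2 ∂(discMeasure R) := by
  have hf2 : Integrable (fun y => ‖f y‖ ^ 2) (discMeasure R) :=
    (memLp_two_iff_integrable_sq_norm hf.1).1 hf
  refine le_trans ?_ (add_le_add_left (integral_green_sq_le hR x) _)
  rw [← integral_add (integrable_green_sq hR x) hf2]
  refine integral_mono (integrable_green_smul hR hf x).norm ((integrable_green_sq hR x).add hf2)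
    fun y => ?_
  rw [norm_smul, Real.norm_eq_abs, ← sq_abs (green R x y)]
  nlinarith [sq_nonneg (|green R x y| - ‖f y‖), sq_nonneg (|green R x y|), sq_nonneg ‖f y‖]

/-- Fubini and the symmetry of the Green function. Integrability on the product comes from the bound
on `∫ |G(x, y) f(y)| dy`, which is uniform in `x`. -/
lemma integral_greenOp_mul {𝕜 : Type*} [RCLike 𝕜] {R : ℝ} (hR : 0 < R) {f g : Plane → 𝕜}
    (hf : MemLp f 2 (discMeasure R)) (hg : MemLp g 2 (discMeasure R)) :
    ∫ x, greenOp R f x * g x ∂(discMeasure R) = ∫ x, f x * greenOp R g x ∂(discMeasure R) := by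
  have hgi : Integrable g (discMeasure R) := hg.integrable (by norm_num)
  have hint : Integrable (Function.uncurry fun x y => green R x y • (f y * g x))
      ((discMeasure R).prod (discMeasure R)) := by
    have hm : AEStronglyMeasurable (Function.uncurry fun x y => green R x y • (f y * g x))
        ((discMeasure R).prod (discMeasure R)) :=
      (measurable_green R).aestronglyMeasurable.smul (hf.1.comp_snd.mul hg.1.comp_fst)
    rw [integrable_prod_iff hm]
    constructor
    · refine Eventually.of_forall fun x => ?_
      have := (integrable_green_smul hR hf x).mul_const (g x)
      simpa [Function.uncurry, smul_mul_assoc] using this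
    · refine (hgi.norm.mul_const (R * invNormBound R + ∫ y, ‖f y‖ ^ 2 ∂(discMeasure R))).mono'
        hm.norm.integral_prod_right' (Eventually.of_forall fun x => ?_)
      rw [Real.norm_of_nonneg (integral_nonneg fun y => norm_nonneg _)]
      have : ∀ y, ‖Function.uncurry (fun x y => green R x y • (f y * g x)) (x, y)‖ =
          ‖g x‖ * ‖green R x y • f y‖ := by
        intro y
        simp only [Function.uncurry, norm_smul, norm_mul]; ring
      simp only [this]
      rw [integral_const_mul]
      exact mul_le_mul_of_nonneg_left (integral_norm_green_smul_le hR hf x) (norm_nonneg _)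
  have h := integral_integral_swap hint
  have e1 : ∀ x, ∫ y, green R x y • (f y * g x) ∂(discMeasure R) = greenOp R f x * g x := by
    intro x
    rw [greenOp, ← integral_mul_const]
    simp only [smul_mul_assoc]
  have e2 : ∀ y, ∫ x, green R x y • (f y * g x) ∂(discMeasure R) = f y * greenOp R g y := by
    intro y
    rw [greenOp, ← integral_const_mul]
    refine integral_congr_ae (Eventually.of_forall fun x => ?_)
    simp only [green_symm R x y, mul_smul_comm]
  simpa only [e1, e2] using h

/-- Pairing with `greenVec hR x` evaluates the Green potential of an `L²` class at every point, so
it selects a continuous representative. -/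
lemma inner_greenVec {R : ℝ} (hR : 0 < R) (F : discL2 R) (x : Plane) :
    inner ℂ (greenVec hR x) F = greenOp R F x := by
  rw [L2.inner_def, greenOp]
  refine integral_congr_ae ?_
  filter_upwards [(memLp_green hR x).coeFn_toLp] with y hy
  rw [greenVec, hy]
  simp [mul_comm]

lemma greenOp_congr {F : Type*} [NormedAddCommGroup F] [NormedSpace ℝ F] {R : ℝ}
    {f g : Plane → F} (h : f =ᵐ[discMeasure R] g) : greenOp R f = greenOp R g := by
  ext x
  refine integral_congr_ae ?_
  filter_upwards [h] with y hy
  rw [hy]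

lemma greenOp_ofReal (R : ℝ) (f : Plane → ℝ) (x : Plane) :
    greenOp R (fun y => ((f y : ℝ) : ℂ)) x = ((greenOp R f x : ℝ) : ℂ) := by
  have := integral_ofReal (𝕜 := ℂ) (μ := discMeasure R) (f := fun y => green R x y • f y)
  rw [greenOp, greenOp]
  refine Eq.trans ?_ this
  simp

lemma re_greenOp {R : ℝ} (hR : 0 < R) {f : Plane → ℂ} (hf : MemLp f 2 (discMeasure R))
    (x : Plane) : (greenOp R f x).re = greenOp R (fun y => (f y).re) x := by
  have := integral_re (integrable_green_smul hR hf x)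
  simp only [RCLike.re_to_complex] at this
  rw [greenOp, ← this, greenOp]
  simp

lemma memLp_ofReal {R : ℝ} {f : Plane → ℝ} (hf : MemLp f 2 (discMeasure R)) :
    MemLp (fun y => (f y : ℂ)) 2 (discMeasure R) := hf.ofReal

lemma continuous_greenOp_complex {R : ℝ} (hR : 0 < R) {f : Plane → ℂ}
    (hf : MemLp f 2 (discMeasure R)) : Continuous (greenOp R f) := by
  have : greenOp R f = fun x => inner ℂ (greenVec hR x) (hf.toLp f) := by
    ext x
    rw [inner_greenVec, greenOp_congr hf.coeFn_toLp]
  rw [this]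
  exact (continuous_greenVec hR).inner continuous_const

lemma continuous_greenOp {R : ℝ} (hR : 0 < R) {f : Plane → ℝ} (hf : MemLp f 2 (discMeasure R)) :
    Continuous (greenOp R f) := by
  have h := Complex.continuous_re.comp (continuous_greenOp_complex hR (memLp_ofReal hf))
  refine h.congr fun x => ?_
  simp [greenOp_ofReal]

lemma greenOp_eq_zero {F : Type*} [NormedAddCommGroup F] [NormedSpace ℝ F] {R : ℝ} (hR : 0 < R)
    (f : Plane → F) {x : Plane} (hx : R ≤ ‖x‖) : greenOp R f x = 0 := by
  simp [greenOp, green_eq_zero hR hx]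

lemma memLp_of_continuous_real {R : ℝ} {f : Plane → ℝ} (hf : Continuous f) :
    MemLp f 2 (discMeasure R) := by
  have := (memLp_of_continuous (R := R) (Complex.continuous_ofReal.comp hf)).re
  simpa using this

lemma setIntegral_ball_eq {R : ℝ} {f : Plane → ℝ} {φ : Plane → ℝ}
    (hs : tsupport φ ⊆ Metric.ball 0 R) :
    ∫ y in Metric.ball (0 : Plane) R, f y * φ y = ∫ y, f y * φ y :=
  setIntegral_eq_integral_of_forall_compl_eq_zero fun y hy => by
    rw [image_eq_zero_of_notMem_tsupport fun h => hy (hs h), mul_zero]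

/-- Moving the Green operator onto `Δφ` by symmetry, the representation of test functions gives
`-φ`. -/
lemma isWeakLaplacian_greenOp {R : ℝ} (hR : 0 < R) {f : Plane → ℝ}
    (hf : MemLp f 2 (discMeasure R)) :
    IsWeakLaplacian (Metric.ball 0 R) (greenOp R f) fun x => -f x := by
  intro φ hφ hc hs
  rw [← setIntegral_ball_eq ((tsupport_laplacian_subset φ).trans hs), ← setIntegral_ball_eq hs,
    integral_greenOp_mul hR hf (memLp_of_continuous_real (contDiff_laplacian hφ).continuous)]
  refine integral_congr_ae (Eventually.of_forall fun x => ?_)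
  have := integral_green_mul_laplacian hR hφ hc hs x
  simp only [greenOp, smul_eq_mul, this]
  ring

lemma isWeakLaplacian_of_contDiffOn {U : Set Plane} (hU : IsOpen U) {f : Plane → ℝ}
    (hf : ContDiffOn ℝ 2 f U) : IsWeakLaplacian U f (laplacian f) := by
  intro φ hφ hc hs
  have := integral_mul_laplacian_comm hU (contDiff_two_of_infty hφ) hc hs hf
  simp only [mul_comm (f _), mul_comm (laplacian f _)]
  exact this.symm

lemma IsWeakLaplacian.neg {U : Set Plane} {u g : Plane → ℝ} (h : IsWeakLaplacian U u g) :
    IsWeakLaplacian U (fun x => -u x) fun x => -g x := by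
  intro φ hφ hc hs
  simp only [neg_mul, integral_neg, h φ hφ hc hs]

/-- The Green operator applied to the Green potential of a continuous function. -/
lemma contDiffOn_greenOp_greenOp {R : ℝ} (hR : 0 < R) {f : Plane → ℝ} (hf : Continuous f) :
    ContDiffOn ℝ 2 (greenOp R (greenOp R f)) (Metric.ball 0 R) ∧
      ∀ x ∈ Metric.ball (0 : Plane) R,
        laplacian (greenOp R (greenOp R f)) x = -greenOp R f x := by
  -- A single Green potential of a continuous function need not be `C²`. Applying the operator twice
  -- gives a weak Laplacian that itself has a continuous weak Laplacian, as the regularity theorem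
  -- requires.
  have h1 := continuous_greenOp hR (memLp_of_continuous_real hf)
  have h2 := continuous_greenOp hR (memLp_of_continuous_real h1)
  exact IsWeakLaplacian.contDiffOn Metric.isOpen_ball h2.continuousOn h1.neg.continuousOn
    (h := fun x => - -f x) (by simpa using hf.continuousOn)
    (isWeakLaplacian_greenOp hR (memLp_of_continuous_real h1))
    (isWeakLaplacian_greenOp hR (memLp_of_continuous_real hf)).neg

lemma contDiffOn_greenOp_of_contDiff {R : ℝ} (hR : 0 < R) {f : Plane → ℝ} (hf : ContDiff ℝ ∞ f) :
    ContDiffOn ℝ 2 (greenOp R f) (Metric.ball 0 R) ∧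
      ∀ x ∈ Metric.ball (0 : Plane) R, laplacian (greenOp R f) x = -f x := by
  have h1 := continuous_greenOp hR (memLp_of_continuous_real hf.continuous)
  exact IsWeakLaplacian.contDiffOn Metric.isOpen_ball h1.continuousOn
    hf.continuous.neg.continuousOn (h := fun x => -laplacian f x)
    (contDiff_laplacian hf).continuous.neg.continuousOn
    (isWeakLaplacian_greenOp hR (memLp_of_continuous_real hf.continuous))
    (isWeakLaplacian_of_contDiffOn Metric.isOpen_ball (contDiff_two_of_infty hf).contDiffOn).neg

lemma greenOp_laplacian {R : ℝ} (hR : 0 < R) {φ : Plane → ℝ} (hφ : ContDiff ℝ ∞ φ)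
    (hc : HasCompactSupport φ) (hs : tsupport φ ⊆ Metric.ball 0 R) :
    greenOp R (fun x => -laplacian φ x) = φ := by
  ext x
  have := integral_green_mul_laplacian hR hφ hc hs x
  simp only [greenOp, smul_eq_mul, mul_neg, integral_neg, this, neg_neg]

/-! ### The heat semigroup generated by the inverse of a positive operator -/

/-- The function `s ↦ s⁻ᵏ exp (-t/s)`, extended by zero to `s ≤ 0`. -/
def heatFun (k : ℕ) (t s : ℝ) : ℝ := if s ≤ 0 then 0 else s⁻¹ ^ k * Real.exp (-(t * s⁻¹))

lemma heatFun_of_nonpos (k : ℕ) (t : ℝ) {s : ℝ} (hs : s ≤ 0) : heatFun k t s = 0 := if_pos hs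

lemma heatFun_of_pos (k : ℕ) (t : ℝ) {s : ℝ} (hs : 0 < s) :
    heatFun k t s = s⁻¹ ^ k * Real.exp (-(t * s⁻¹)) := if_neg hs.not_ge

lemma heatFun_nonneg (k : ℕ) (t s : ℝ) : 0 ≤ heatFun k t s := by
  rcases le_or_gt s 0 with hs | hs
  · rw [heatFun_of_nonpos k t hs]
  · rw [heatFun_of_pos k t hs]; positivity

/-- This is `x ^ k / k! ≤ exp x` at `x = t / s`. The bound is uniform in `s`, so `K⁻ᵏ exp (-t K⁻¹)`
makes sense as a bounded operator for `t > 0` although `K⁻¹` may be unbounded. -/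
lemma heatFun_le (k : ℕ) {t : ℝ} (ht : 0 < t) (s : ℝ) : heatFun k t s ≤ k.factorial / t ^ k := by
  rcases le_or_gt s 0 with hs | hs
  · rw [heatFun_of_nonpos k t hs]; positivity
  · rw [heatFun_of_pos k t hs, Real.exp_neg, le_div_iff₀ (by positivity)]
    have h := Real.pow_div_factorial_le_exp (t * s⁻¹) (by positivity) k
    rw [div_le_iff₀ (by positivity)] at h
    calc s⁻¹ ^ k * (Real.exp (t * s⁻¹))⁻¹ * t ^ k = (t * s⁻¹) ^ k * (Real.exp (t * s⁻¹))⁻¹ := by ring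
      _ ≤ (Real.exp (t * s⁻¹) * k.factorial) * (Real.exp (t * s⁻¹))⁻¹ := by gcongr
      _ = k.factorial := by field_simp

lemma mul_heatFun_succ (k : ℕ) (t s : ℝ) : s * heatFun (k + 1) t s = heatFun k t s := by
  rcases le_or_gt s 0 with hs | hs
  · simp [heatFun_of_nonpos _ t hs]
  · rw [heatFun_of_pos _ t hs, heatFun_of_pos _ t hs]
    linear_combination (s⁻¹ ^ k * Real.exp (-(t * s⁻¹))) * mul_inv_cancel₀ hs.ne'

lemma heatFun_mul (j k : ℕ) (t r s : ℝ) :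
    heatFun j t s * heatFun k r s = heatFun (j + k) (t + r) s := by
  rcases le_or_gt s 0 with hs | hs
  · simp [heatFun_of_nonpos _ _ hs]
  · rw [heatFun_of_pos _ _ hs, heatFun_of_pos _ _ hs, heatFun_of_pos _ _ hs, add_mul, neg_add,
      Real.exp_add, pow_add]
    ring

/-- Only `s = 0` needs an argument: there the function is `s` times the bounded function `heatFun (k
+ 1) t`. -/
lemma continuous_heatFun (k : ℕ) {t : ℝ} (ht : 0 < t) : Continuous (heatFun k t) := by
  rw [continuous_iff_continuousAt]
  intro s
  rcases lt_trichotomy s 0 with hs | hs | hs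
  · refine continuousAt_const.congr (f := fun _ => (0 : ℝ)) ?_
    filter_upwards [gt_mem_nhds hs] with r hr using (heatFun_of_nonpos k t (le_of_lt hr)).symm
  · subst hs
    rw [ContinuousAt, heatFun_of_nonpos k t le_rfl]
    have hb : Tendsto (fun s : ℝ => |s| * ((k + 1).factorial / t ^ (k + 1))) (𝓝 0) (𝓝 0) := by
      have : Continuous fun s : ℝ => |s| * ((k + 1).factorial / t ^ (k + 1)) := by fun_prop
      simpa using this.tendsto 0
    refine squeeze_zero (fun s => heatFun_nonneg k t s) (fun s => ?_) hb
    rw [← mul_heatFun_succ]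
    exact mul_le_mul (le_abs_self s) (heatFun_le _ ht s) (heatFun_nonneg _ _ _) (abs_nonneg s)
  · have : ContinuousAt (fun s : ℝ => s⁻¹ ^ k * Real.exp (-(t * s⁻¹))) s := by
      have h := continuousAt_inv₀ hs.ne'
      exact (h.pow k).mul (Real.continuous_exp.continuousAt.comp (continuousAt_const.mul h).neg)
    refine this.congr ?_
    filter_upwards [lt_mem_nhds hs] with r hr using (heatFun_of_pos k t hr).symm

/-- At `s = 0` the function is `s²` times the bounded function `heatFun (k + 2) t`, so its
derivative vanishes. This serves the truncation `softPlus`, which is built from the same functions.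
-/
lemma hasDerivAt_heatFun (k : ℕ) {t : ℝ} (ht : 0 < t) (s : ℝ) :
    HasDerivAt (heatFun k t) (t * heatFun (k + 2) t s - k * heatFun (k + 1) t s) s := by
  rcases lt_trichotomy s 0 with hs | hs | hs
  · rw [heatFun_of_nonpos _ _ hs.le, heatFun_of_nonpos _ _ hs.le, mul_zero, mul_zero, sub_zero]
    refine (hasDerivAt_const s (0 : ℝ)).congr_of_eventuallyEq ?_
    filter_upwards [gt_mem_nhds hs] with r hr using heatFun_of_nonpos k t (le_of_lt hr)
  · subst hs
    rw [heatFun_of_nonpos _ _ le_rfl, heatFun_of_nonpos _ _ le_rfl, mul_zero, mul_zero, sub_zero,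
      hasDerivAt_iff_isLittleO]
    have hb : (fun r => heatFun k t r - heatFun k t 0 - (r - 0) • (0 : ℝ)) =O[𝓝 0]
        fun r => r ^ 2 := by
      refine Asymptotics.IsBigO.of_bound ((k + 2).factorial / t ^ (k + 2))
        (Eventually.of_forall fun r => ?_)
      rw [heatFun_of_nonpos _ _ le_rfl, smul_zero, sub_zero, sub_zero, ← mul_heatFun_succ,
        ← mul_heatFun_succ, ← mul_assoc, ← pow_two, norm_mul, mul_comm,
        Real.norm_of_nonneg (heatFun_nonneg _ _ _)]
      gcongr
      exact heatFun_le _ ht r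
    have := hb.trans_isLittleO (Asymptotics.isLittleO_pow_id (𝕜 := ℝ) (n := 2) (by norm_num))
    simpa using this
  · have h1 : HasDerivAt (fun s : ℝ => s⁻¹ ^ k * Real.exp (-(t * s⁻¹))) _ s :=
      ((hasDerivAt_inv hs.ne').pow k).mul (((hasDerivAt_inv hs.ne').const_mul t).neg.exp)
    have h2 := h1.congr_of_eventuallyEq (f₁ := heatFun k t)
      (by filter_upwards [lt_mem_nhds hs] with r hr using heatFun_of_pos k t hr)
    refine h2.congr_deriv ?_
    rw [heatFun_of_pos _ _ hs, heatFun_of_pos _ _ hs]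
    simp only [Pi.pow_apply, Pi.neg_apply]
    rcases k with _ | k
    · simp; ring
    · simp only [Nat.add_sub_cancel, inv_pow]
      push_cast
      field_simp
      ring

/-- Convexity makes the first order remainder nonnegative; `1 + x ≤ exp x` at `±(b - a)` bounds it
from above. -/
lemma abs_exp_neg_sub_le (a b : ℝ) :
    |Real.exp (-b) - Real.exp (-a) + (b - a) * Real.exp (-a)| ≤
      (b - a) ^ 2 * Real.exp (-min a b) := by
  have ha := Real.exp_pos (-a)
  have hb := Real.exp_pos (-b)
  have h1 : Real.exp (-a) * (1 - (b - a)) ≤ Real.exp (-b) := by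
    have h := Real.add_one_le_exp (-(b - a))
    calc Real.exp (-a) * (1 - (b - a)) ≤ Real.exp (-a) * Real.exp (-(b - a)) := by
          gcongr; linarith
      _ = _ := by rw [← Real.exp_add]; ring_nf
  have h2 : Real.exp (-b) * (1 + (b - a)) ≤ Real.exp (-a) := by
    have h := Real.add_one_le_exp (b - a)
    calc Real.exp (-b) * (1 + (b - a)) ≤ Real.exp (-b) * Real.exp (b - a) := by
          gcongr; linarith
      _ = _ := by rw [← Real.exp_add]; ring_nf
  rw [abs_of_nonneg (by nlinarith)]
  rcases le_total a b with h | h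
  · rw [min_eq_left h]
    nlinarith [mul_nonneg (sub_nonneg.2 h) (sub_nonneg.2 h1), mul_nonneg (sub_nonneg.2 h) hb.le]
  · rw [min_eq_right h]
    nlinarith [mul_nonneg (sub_nonneg.2 h) (sub_nonneg.2 h2), mul_nonneg (sub_nonneg.2 h) ha.le]

/-- A first order expansion in time with an error uniform in `s`. For `r ≥ t/2` both exponentials
are at most `exp (-t/(2s))`, which absorbs the factor `s⁻¹ ^ (k + 2)` of the quadratic remainder. -/
lemma abs_heatFun_sub_le (k : ℕ) {t r : ℝ} (ht : 0 < t) (hr : t / 2 ≤ r) (s : ℝ) :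
    |heatFun k r s - heatFun k t s - (r - t) * -heatFun (k + 1) t s| ≤
      (k + 2).factorial / (t / 2) ^ (k + 2) * (r - t) ^ 2 := by
  rcases le_or_gt s 0 with hs | hs
  · simp only [heatFun_of_nonpos _ _ hs, sub_self, neg_zero, mul_zero, abs_zero]; positivity
  · have hle := heatFun_le (k + 2) (half_pos ht) s
    rw [heatFun_of_pos _ _ hs] at hle
    rw [heatFun_of_pos _ _ hs, heatFun_of_pos _ _ hs, heatFun_of_pos _ _ hs]
    have hi : 0 < s⁻¹ := by positivity
    have e : s⁻¹ ^ k * Real.exp (-(r * s⁻¹)) - s⁻¹ ^ k * Real.exp (-(t * s⁻¹)) -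
        (r - t) * -(s⁻¹ ^ (k + 1) * Real.exp (-(t * s⁻¹))) =
        s⁻¹ ^ k * (Real.exp (-(r * s⁻¹)) - Real.exp (-(t * s⁻¹)) +
          (r * s⁻¹ - t * s⁻¹) * Real.exp (-(t * s⁻¹))) := by ring
    rw [e, abs_mul, abs_of_pos (by positivity : 0 < s⁻¹ ^ k)]
    have hmin : t / 2 * s⁻¹ ≤ min (t * s⁻¹) (r * s⁻¹) :=
      le_min (by nlinarith) (by nlinarith)
    calc _ ≤ s⁻¹ ^ k * ((r * s⁻¹ - t * s⁻¹) ^ 2 * Real.exp (-min (t * s⁻¹) (r * s⁻¹))) := by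
          gcongr; exact abs_exp_neg_sub_le _ _
      _ ≤ s⁻¹ ^ k * ((r * s⁻¹ - t * s⁻¹) ^ 2 * Real.exp (-(t / 2 * s⁻¹))) := by gcongr
      _ = s⁻¹ ^ (k + 2) * Real.exp (-(t / 2 * s⁻¹)) * (r - t) ^ 2 := by ring
      _ ≤ _ := by gcongr

variable {E : Type*} [NormedAddCommGroup E] [InnerProductSpace ℂ E] [CompleteSpace E]

/-- The operator `K⁻ᵏ exp (-t K⁻¹)` for a positive operator `K`. -/
def heatOp (K : E →L[ℂ] E) (k : ℕ) (t : ℝ) : E →L[ℂ] E := cfc (heatFun k t) K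

lemma isSelfAdjoint_heatOp (K : E →L[ℂ] E) (k : ℕ) (t : ℝ) : IsSelfAdjoint (heatOp K k t) :=
  IsSelfAdjoint.cfc

lemma inner_heatOp_left (K : E →L[ℂ] E) (k : ℕ) (t : ℝ) (x y : E) :
    inner ℂ (heatOp K k t x) y = inner ℂ x (heatOp K k t y) :=
  (isSelfAdjoint_heatOp K k t).isSymmetric x y

lemma heatOp_mul {K : E →L[ℂ] E} (j k : ℕ) {t r : ℝ} (ht : 0 < t) (hr : 0 < r) :
    heatOp K j t * heatOp K k r = heatOp K (j + k) (t + r) := by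
  rw [heatOp, heatOp, ← cfc_mul _ _ K (continuous_heatFun j ht).continuousOn
    (continuous_heatFun k hr).continuousOn]
  simp only [heatFun_mul]
  rfl

lemma mul_heatOp_succ {K : E →L[ℂ] E} (_hK : IsSelfAdjoint K) (k : ℕ) {t : ℝ} (ht : 0 < t) :
    K * heatOp K (k + 1) t = heatOp K k t := by
  have h := cfc_mul (fun s : ℝ => s) (heatFun (k + 1) t) K continuousOn_id
    (continuous_heatFun (k + 1) ht).continuousOn
  rw [cfc_id' ℝ K] at h
  simp only [mul_heatFun_succ] at h
  exact h.symm

lemma heatOp_succ_mul {K : E →L[ℂ] E} (_hK : IsSelfAdjoint K) (k : ℕ) {t : ℝ} (ht : 0 < t) :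
    heatOp K (k + 1) t * K = heatOp K k t := by
  have h := cfc_mul (heatFun (k + 1) t) (fun s : ℝ => s) K
    (continuous_heatFun (k + 1) ht).continuousOn continuousOn_id
  rw [cfc_id' ℝ K] at h
  simp only [mul_comm (heatFun (k + 1) t _), mul_heatFun_succ] at h
  exact h.symm

/-- The norm in the functional calculus is at most the supremum on the spectrum, so the uniform
expansion of `heatFun` becomes differentiability in operator norm. -/
lemma hasDerivAt_heatOp {K : E →L[ℂ] E} (_hK : IsSelfAdjoint K) (k : ℕ) {t : ℝ} (ht : 0 < t) :
    HasDerivAt (heatOp K k) (-heatOp K (k + 1) t) t := by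
  rw [hasDerivAt_iff_isLittleO]
  set C : ℝ := (k + 2).factorial / (t / 2) ^ (k + 2) with hC
  have hC0 : 0 ≤ C := by positivity
  have hb : (fun r => heatOp K k r - heatOp K k t - (r - t) • -heatOp K (k + 1) t) =O[𝓝 t]
      fun r => (r - t) ^ 2 := by
    refine Asymptotics.IsBigO.of_bound C ?_
    filter_upwards [lt_mem_nhds (half_lt_self ht)] with r hr
    have hr0 : 0 < r := (half_pos ht).trans hr
    have e : heatOp K k r - heatOp K k t - (r - t) • -heatOp K (k + 1) t =
        cfc (fun s => heatFun k r s - heatFun k t s - (r - t) * -heatFun (k + 1) t s) K := by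
      have c1 := continuous_heatFun k hr0
      have c2 := continuous_heatFun k ht
      have c3 := continuous_heatFun (k + 1) ht
      rw [cfc_sub (fun s => heatFun k r s - heatFun k t s)
        (fun s => (r - t) * -heatFun (k + 1) t s) K (by fun_prop) (by fun_prop),
        cfc_sub (heatFun k r) (heatFun k t) K (by fun_prop) (by fun_prop),
        cfc_const_mul (r - t) (fun s => -heatFun (k + 1) t s) K (by fun_prop),
        cfc_neg (heatFun (k + 1) t) K]
      rfl
    rw [e, Real.norm_of_nonneg (sq_nonneg _)]
    exact norm_cfc_le (by positivity) fun s _ => abs_heatFun_sub_le k ht hr.le s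
  refine hb.trans_isLittleO ?_
  have := (Asymptotics.isLittleO_pow_id (𝕜 := ℝ) (n := 2) (by norm_num)).comp_tendsto
    ((by fun_prop : Continuous fun r : ℝ => r - t).tendsto' t 0 (sub_self t))
  exact this

/-- On the spectrum `s ≥ 0`, and `s (1 - exp (-t/s)) ≤ t`. Near `t = 0` the semigroup has no rate in
operator norm by itself; on the range of `K` it has the rate `t`. -/
lemma norm_heatOp_zero_mul_sub_le {K : E →L[ℂ] E} (hK : K.IsPositive) {t : ℝ} (ht : 0 < t) :
    ‖heatOp K 0 t * K - K‖ ≤ t := by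
  have hs : IsSelfAdjoint K := hK.isSelfAdjoint
  have e : heatOp K 0 t * K - K = cfc (fun s => heatFun 0 t s * s - s) K := by
    have c := continuous_heatFun 0 ht
    rw [cfc_sub (fun s => heatFun 0 t s * s) (fun s => s) K (by fun_prop) (by fun_prop),
      cfc_mul (heatFun 0 t) (fun s => s) K (by fun_prop) (by fun_prop), cfc_id' ℝ K]
    rfl
  rw [e]
  refine norm_cfc_le ht.le fun s hsK => ?_
  have hs0 : 0 ≤ s :=
    spectrum_nonneg_of_nonneg ((ContinuousLinearMap.nonneg_iff_isPositive K).2 hK) hsK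
  rcases hs0.eq_or_lt with rfl | hpos
  · simpa using ht.le
  · rw [heatFun_of_pos _ _ hpos, pow_zero, one_mul, Real.norm_eq_abs, abs_le]
    have h1 := Real.add_one_le_exp (-(t * s⁻¹))
    have h2 : Real.exp (-(t * s⁻¹)) ≤ 1 := Real.exp_le_one_iff.2 (by simp; positivity)
    have h3 : (-(t * s⁻¹) + 1) * s ≤ Real.exp (-(t * s⁻¹)) * s := by gcongr
    have h4 : (-(t * s⁻¹) + 1) * s = s - t := by field_simp; ring
    constructor <;> nlinarith

/-! ### A smooth convex approximation of the positive part -/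

/-- A convex `C²` approximation of the positive part, vanishing for `s ≤ κ`. -/
def softPlus (κ s : ℝ) : ℝ := (s - κ) * heatFun 0 κ (s - κ)

/-- The derivative of `softPlus`. -/
def softPlusDeriv (κ s : ℝ) : ℝ := heatFun 0 κ (s - κ) + κ * heatFun 1 κ (s - κ)

lemma softPlus_eq_zero {κ s : ℝ} (hs : s ≤ κ) : softPlus κ s = 0 := by
  rw [softPlus, heatFun_of_nonpos _ _ (by linarith), mul_zero]

lemma softPlus_nonneg (κ s : ℝ) : 0 ≤ softPlus κ s := by
  rcases le_or_gt s κ with hs | hs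
  · rw [softPlus_eq_zero hs]
  · exact mul_nonneg (by linarith) (heatFun_nonneg _ _ _)

lemma softPlusDeriv_nonneg {κ : ℝ} (hκ : 0 < κ) (s : ℝ) : 0 ≤ softPlusDeriv κ s :=
  add_nonneg (heatFun_nonneg _ _ _) (mul_nonneg hκ.le (heatFun_nonneg _ _ _))

lemma softPlusDeriv_le_one (κ : ℝ) (s : ℝ) : softPlusDeriv κ s ≤ 1 := by
  rcases le_or_gt s κ with hs | hs
  · rw [softPlusDeriv, heatFun_of_nonpos _ _ (by linarith), heatFun_of_nonpos _ _ (by linarith)]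
    norm_num
  · have h : 0 < s - κ := by linarith
    rw [softPlusDeriv, heatFun_of_pos _ _ h, heatFun_of_pos _ _ h, pow_zero, pow_one, one_mul,
      Real.exp_neg, ← mul_assoc, ← one_add_mul, ← div_eq_mul_inv, div_le_one (Real.exp_pos _),
      add_comm]
    exact Real.add_one_le_exp _

lemma hasDerivAt_softPlus {κ : ℝ} (hκ : 0 < κ) (s : ℝ) :
    HasDerivAt (softPlus κ) (softPlusDeriv κ s) s := by
  have h1 : HasDerivAt (fun s => s - κ) 1 s := (hasDerivAt_id s).sub_const κ
  have h2 := h1.mul ((hasDerivAt_heatFun 0 hκ (s - κ)).comp s h1)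
  refine h2.congr_deriv ?_
  have := mul_heatFun_succ 1 κ (s - κ)
  simp only [Function.comp, softPlusDeriv]
  push_cast
  linear_combination κ * this

/-- The terms with `heatFun 2` cancel and a nonnegative function is left, which is the convexity of
`softPlus`. -/
lemma hasDerivAt_softPlusDeriv {κ : ℝ} (hκ : 0 < κ) (s : ℝ) :
    HasDerivAt (softPlusDeriv κ) (κ ^ 2 * heatFun 3 κ (s - κ)) s := by
  have h1 : HasDerivAt (fun s => s - κ) 1 s := (hasDerivAt_id s).sub_const κ
  have h2 := ((hasDerivAt_heatFun 0 hκ (s - κ)).comp s h1).add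
    (((hasDerivAt_heatFun 1 hκ (s - κ)).comp s h1).const_mul κ)
  refine h2.congr_deriv ?_
  push_cast
  ring

lemma deriv_softPlus {κ : ℝ} (hκ : 0 < κ) : deriv (softPlus κ) = softPlusDeriv κ :=
  funext fun s => (hasDerivAt_softPlus hκ s).deriv

lemma deriv_softPlusDeriv {κ : ℝ} (hκ : 0 < κ) :
    deriv (softPlusDeriv κ) = fun s => κ ^ 2 * heatFun 3 κ (s - κ) :=
  funext fun s => (hasDerivAt_softPlusDeriv hκ s).deriv

lemma deriv_deriv_softPlus_nonneg {κ : ℝ} (hκ : 0 < κ) (s : ℝ) :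
    0 ≤ deriv (deriv (softPlus κ)) s := by
  rw [deriv_softPlus hκ, deriv_softPlusDeriv hκ]
  exact mul_nonneg (sq_nonneg κ) (heatFun_nonneg _ _ _)

lemma contDiff_softPlus {κ : ℝ} (hκ : 0 < κ) : ContDiff ℝ 2 (softPlus κ) := by
  rw [show (2 : WithTop ℕ∞) = 1 + 1 by norm_num, contDiff_succ_iff_deriv]
  refine ⟨fun s => (hasDerivAt_softPlus hκ s).differentiableAt, by simp, ?_⟩
  rw [deriv_softPlus hκ, show (1 : WithTop ℕ∞) = 0 + 1 by norm_num, contDiff_succ_iff_deriv]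
  refine ⟨fun s => (hasDerivAt_softPlusDeriv hκ s).differentiableAt, by simp, ?_⟩
  rw [deriv_softPlusDeriv hκ, contDiff_zero]
  have := continuous_heatFun 3 hκ
  fun_prop

lemma continuous_softPlusDeriv {κ : ℝ} (hκ : 0 < κ) : Continuous (softPlusDeriv κ) :=
  continuous_iff_continuousAt.2 fun s => (hasDerivAt_softPlusDeriv hκ s).continuousAt

lemma softPlus_le {κ : ℝ} (hκ : 0 ≤ κ) (s : ℝ) : softPlus κ s ≤ max s 0 := by
  rcases le_or_gt s κ with hs | hs
  · rw [softPlus_eq_zero hs]; exact le_max_right _ _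
  · have h : 0 < s - κ := by linarith
    refine le_trans ?_ (le_max_left _ _)
    rw [softPlus, heatFun_of_pos _ _ h, pow_zero, one_mul]
    have : Real.exp (-(κ * (s - κ)⁻¹)) ≤ 1 := Real.exp_le_one_iff.2 (by simp; positivity)
    nlinarith

lemma le_softPlus {κ : ℝ} (hκ : 0 ≤ κ) (s : ℝ) : max s 0 - 2 * κ ≤ softPlus κ s := by
  rcases le_or_gt s κ with hs | hs
  · rw [softPlus_eq_zero hs]
    have : max s 0 ≤ κ := max_le hs hκ
    linarith
  · have h : 0 < s - κ := by linarith
    rw [max_eq_left (by linarith), softPlus, heatFun_of_pos _ _ h, pow_zero, one_mul]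
    have h1 := Real.add_one_le_exp (-(κ * (s - κ)⁻¹))
    have h2 : (s - κ) * (-(κ * (s - κ)⁻¹) + 1) ≤ (s - κ) * Real.exp (-(κ * (s - κ)⁻¹)) := by
      gcongr
    have h3 : (s - κ) * (-(κ * (s - κ)⁻¹) + 1) = s - 2 * κ := by field_simp; ring
    linarith

lemma abs_softPlus_sub_le {κ : ℝ} (hκ : 0 ≤ κ) (s : ℝ) : |softPlus κ s - max s 0| ≤ 2 * κ := by
  have h1 := softPlus_le hκ s
  have h2 := le_softPlus hκ s
  rw [abs_le]
  constructor <;> linarith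

/-! ### Truncations of functions vanishing outside a disc -/

lemma tsupport_softPlus_subset {κ : ℝ} {u : Plane → ℝ} (hu : Continuous u) :
    tsupport (fun x => softPlus κ (u x)) ⊆ {x | κ ≤ u x} := by
  refine closure_minimal (fun x hx => ?_) (isClosed_le continuous_const hu)
  by_contra h
  exact hx (softPlus_eq_zero (le_of_not_ge h))

/-- The truncation vanishes below the level `κ`, hence near the boundary circle. It turns a function
that is zero only on the boundary into one with compact support in the open disc, so integration by
parts has no boundary terms. -/
lemma tsupport_softPlus_subset_ball {κ R : ℝ} (hκ : 0 < κ) {u : Plane → ℝ} (hu : Continuous u)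
    (h0 : ∀ x, R ≤ ‖x‖ → u x = 0) :
    tsupport (fun x => softPlus κ (u x)) ⊆ Metric.ball 0 R := by
  intro x hx
  have h1 : κ ≤ u x := tsupport_softPlus_subset hu hx
  by_contra h
  rw [mem_ball_zero_iff, not_lt] at h
  rw [h0 x h] at h1
  linarith

lemma hasCompactSupport_of_subset_ball {R : ℝ} {f : Plane → ℝ}
    (h : tsupport f ⊆ Metric.ball 0 R) : HasCompactSupport f :=
  (isCompact_closedBall (0 : Plane) R).of_isClosed_subset (isClosed_tsupport f)
    (h.trans Metric.ball_subset_closedBall)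

lemma contDiff_softPlus_comp {κ R : ℝ} (hκ : 0 < κ) {u : Plane → ℝ} (hu : Continuous u)
    (h0 : ∀ x, R ≤ ‖x‖ → u x = 0) (h2 : ContDiffOn ℝ 2 u (Metric.ball 0 R)) :
    ContDiff ℝ 2 fun x => softPlus κ (u x) := by
  rw [contDiff_iff_contDiffAt]
  intro x
  by_cases hx : x ∈ Metric.ball (0 : Plane) R
  · exact (contDiff_softPlus hκ).contDiffAt.comp x
      ((h2 x hx).contDiffAt (Metric.isOpen_ball.mem_nhds hx))
  · have hx' : x ∉ tsupport fun x => softPlus κ (u x) := fun h =>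
      hx (tsupport_softPlus_subset_ball hκ hu h0 h)
    exact contDiffAt_const.congr_of_eventuallyEq
      (notMem_tsupport_iff_eventuallyEq.1 hx')

lemma fderiv_softPlus_comp {κ : ℝ} (hκ : 0 < κ) {u : Plane → ℝ} {x : Plane}
    (hu : DifferentiableAt ℝ u x) (v : Plane) :
    fderiv ℝ (fun x => softPlus κ (u x)) x v = softPlusDeriv κ (u x) * fderiv ℝ u x v := by
  have := (hasDerivAt_softPlus hκ (u x)).comp_hasFDerivAt x hu.hasFDerivAt
  simp only [Function.comp_def] at this
  rw [this.fderiv]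
  simp

/-- The energy identity for truncations, as an inequality. -/
lemma integral_softPlus_mul_laplacian_nonpos {κ R : ℝ} (hκ : 0 < κ) {u : Plane → ℝ}
    (hu : Continuous u) (h0 : ∀ x, R ≤ ‖x‖ → u x = 0)
    (h2 : ContDiffOn ℝ 2 u (Metric.ball 0 R)) :
    ∫ x in Metric.ball (0 : Plane) R, softPlus κ (u x) * laplacian u x ≤ 0 := by
  have hs := tsupport_softPlus_subset_ball hκ hu h0
  have hc := hasCompactSupport_of_subset_ball hs
  have h := integral_mul_laplacian_eq_neg Metric.isOpen_ball
    ((contDiff_softPlus_comp hκ hu h0 h2).of_le (by norm_num)) hc hs h2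
  have e : ∫ x in Metric.ball (0 : Plane) R, softPlus κ (u x) * laplacian u x =
      ∫ x, softPlus κ (u x) * laplacian u x :=
    setIntegral_eq_integral_of_forall_compl_eq_zero fun x hx => by
      rw [image_eq_zero_of_notMem_tsupport (f := fun x => softPlus κ (u x)) fun h => hx (hs h),
        zero_mul]
  rw [e, h, Left.neg_nonpos_iff]
  refine integral_nonneg fun x => Finset.sum_nonneg fun i _ => ?_
  by_cases hx : x ∈ tsupport fun x => softPlus κ (u x)
  · have hd : DifferentiableAt ℝ u x :=
      ((h2 x (hs hx)).contDiffAt (Metric.isOpen_ball.mem_nhds (hs hx))).differentiableAt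
        (by norm_num)
    rw [fderiv_softPlus_comp hκ hd, mul_assoc]
    exact mul_nonneg (softPlusDeriv_nonneg hκ _) (mul_self_nonneg _)
  · have := (notMem_tsupport_iff_eventuallyEq.1 hx).fderiv_eq (𝕜 := ℝ)
    rw [this]
    simp

lemma tendsto_integral_softPlus_mul {R : ℝ} {u f : Plane → ℝ} (hu : Continuous u)
    (hf : Integrable f (discMeasure R)) :
    Tendsto (fun κ => ∫ x, softPlus κ (u x) * f x ∂(discMeasure R)) (𝓝[>] 0)
      (𝓝 (∫ x, max (u x) 0 * f x ∂(discMeasure R))) := by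
  obtain ⟨C, hC⟩ := (isCompact_closedBall (0 : Plane) R).exists_bound_of_continuousOn
    hu.continuousOn
  refine tendsto_integral_filter_of_dominated_convergence (fun x => C * ‖f x‖) ?_ ?_
    (hf.norm.const_mul C) ?_
  · filter_upwards [self_mem_nhdsWithin] with κ hκ
    exact (((contDiff_softPlus hκ).continuous.comp hu).aestronglyMeasurable).mul hf.1
  · filter_upwards [self_mem_nhdsWithin] with κ hκ
    filter_upwards [ae_restrict_mem Metric.isOpen_ball.measurableSet] with x hx
    rw [norm_mul, Real.norm_of_nonneg (softPlus_nonneg _ _)]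
    gcongr
    have h1 := hC x (Metric.ball_subset_closedBall hx)
    refine (softPlus_le (le_of_lt hκ) _).trans (max_le ((le_abs_self _).trans h1) ?_)
    exact (norm_nonneg _).trans h1
  · refine Eventually.of_forall fun x => Tendsto.mul_const _ ?_
    rw [tendsto_iff_norm_sub_tendsto_zero]
    have hb : Tendsto (fun κ : ℝ => 2 * κ) (𝓝[>] 0) (𝓝 0) := by
      have : Continuous fun κ : ℝ => 2 * κ := by fun_prop
      exact (this.tendsto' 0 0 (by simp)).mono_left nhdsWithin_le_nhds
    refine squeeze_zero' (Eventually.of_forall fun κ => norm_nonneg _) ?_ hb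
    filter_upwards [self_mem_nhdsWithin] with κ hκ using abs_softPlus_sub_le (le_of_lt hκ) _

/-! ### Positivity of the Green operator -/

/-- With `u` the Green potential of `f` one has `f = -Δu`. Testing with `softPlus κ (u)` gives a
nonnegative energy, and `κ → 0` yields the positive part. -/
lemma integral_posPart_greenOp_mul_nonneg {R : ℝ} (hR : 0 < R) {f : Plane → ℝ}
    (hf : ContDiff ℝ ∞ f) : 0 ≤ ∫ x, max (greenOp R f x) 0 * f x ∂(discMeasure R) := by
  have hu := continuous_greenOp hR (memLp_of_continuous_real (R := R) hf.continuous)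
  obtain ⟨h2, hlap⟩ := contDiffOn_greenOp_of_contDiff hR hf
  have hfi : Integrable f (discMeasure R) :=
    (memLp_of_continuous_real hf.continuous).integrable (by norm_num)
  refine ge_of_tendsto (tendsto_integral_softPlus_mul hu hfi) ?_
  filter_upwards [self_mem_nhdsWithin] with κ hκ
  have h := integral_softPlus_mul_laplacian_nonpos (R := R) hκ hu
    (fun x hx => greenOp_eq_zero hR f hx) h2
  have e : ∫ x in Metric.ball (0 : Plane) R, softPlus κ (greenOp R f x) *
      laplacian (greenOp R f) x = -∫ x, softPlus κ (greenOp R f x) * f x ∂(discMeasure R) := by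
    rw [← integral_neg]
    refine setIntegral_congr_fun Metric.isOpen_ball.measurableSet fun x hx => ?_
    simp only [hlap x hx]
    ring
  linarith

lemma greenOp_neg (R : ℝ) (f : Plane → ℝ) (x : Plane) :
    greenOp R (fun y => -f y) x = -greenOp R f x := by
  simp only [greenOp, smul_neg, integral_neg]

/-- The energy splits into the positive part of the potential tested with `f` and that of its
negative tested with `-f`; both are nonnegative. -/
lemma integral_greenOp_mul_nonneg {R : ℝ} (hR : 0 < R) {f : Plane → ℝ}
    (hf : ContDiff ℝ ∞ f) : 0 ≤ ∫ x, greenOp R f x * f x ∂(discMeasure R) := by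
  have h1 := integral_posPart_greenOp_mul_nonneg hR hf
  have h2 := integral_posPart_greenOp_mul_nonneg hR hf.neg
  have hu := continuous_greenOp hR (memLp_of_continuous_real (R := R) hf.continuous)
  have hi : ∀ g : Plane → ℝ, Continuous g → Integrable g (discMeasure R) := fun g hg =>
    (memLp_of_continuous_real hg).integrable (by norm_num)
  have i1 : Integrable (fun x => max (greenOp R f x) 0 * f x) (discMeasure R) :=
    hi _ ((hu.max continuous_const).mul hf.continuous)
  have i2 : Integrable (fun x => max (greenOp R (fun y => -f y) x) 0 * -f x) (discMeasure R) := by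
    simp only [greenOp_neg]
    exact hi _ ((hu.neg.max continuous_const).mul hf.continuous.neg)
  have h := add_nonneg h1 h2
  rw [← integral_add i1 i2] at h
  refine h.trans_eq (integral_congr_ae (Eventually.of_forall fun x => ?_))
  simp only [greenOp_neg]
  rcases le_total (greenOp R f x) 0 with h | h
  · rw [max_eq_right h, max_eq_left (by linarith)]; ring
  · rw [max_eq_left h, max_eq_right (by linarith)]; ring

lemma continuous_inner_greenVec {R : ℝ} (hR : 0 < R) (F : discL2 R) :
    Continuous fun x => inner ℂ (greenVec hR x) F :=
  (continuous_greenVec hR).inner continuous_const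

/-- The Green operator as a bounded operator on `L²`. -/
def greenL2 {R : ℝ} (hR : 0 < R) : discL2 R →L[ℂ] discL2 R :=
  LinearMap.mkContinuous
    { toFun := fun F => (memLp_of_continuous (R := R) (continuous_inner_greenVec hR F)).toLp _
      map_add' := fun F G => by
        rw [← MemLp.toLp_add]
        exact MemLp.toLp_congr _ _ (Eventually.of_forall fun x => inner_add_right _ _ _)
      map_smul' := fun a F => by
        rw [RingHom.id_apply, ← MemLp.toLp_const_smul]
        exact MemLp.toLp_congr _ _ (Eventually.of_forall fun x => inner_smul_right _ _ _) }
    (√(R * invNormBound R * (discMeasure R).real univ)) (fun F => by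
      refine abs_le_of_sq_le_sq' ?_ (by positivity) |>.2
      have hb := mul_nonneg hR.le (invNormBound_nonneg R)
      rw [mul_pow, Real.sq_sqrt (mul_nonneg hb measureReal_nonneg)]
      simp only [LinearMap.coe_mk, AddHom.coe_mk]
      rw [norm_toLp_sq]
      have : ∀ x, ‖inner ℂ (greenVec hR x) F‖ ^ 2 ≤ R * invNormBound R * ‖F‖ ^ 2 := fun x => by
        calc _ ≤ (‖greenVec hR x‖ * ‖F‖) ^ 2 := by gcongr; exact norm_inner_le_norm _ _
          _ = ‖greenVec hR x‖ ^ 2 * ‖F‖ ^ 2 := mul_pow _ _ _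
          _ ≤ _ := by gcongr; exact norm_greenVec_sq_le hR x
      refine (integral_mono_of_nonneg (Eventually.of_forall fun x => by positivity)
        (integrable_const _) (Eventually.of_forall this)).trans_eq ?_
      rw [integral_const, smul_eq_mul]
      ring)

lemma coeFn_greenL2 {R : ℝ} (hR : 0 < R) (F : discL2 R) :
    greenL2 hR F =ᵐ[discMeasure R] fun x => inner ℂ (greenVec hR x) F :=
  (memLp_of_continuous (R := R) (continuous_inner_greenVec hR F)).coeFn_toLp

lemma coeFn_greenL2' {R : ℝ} (hR : 0 < R) (F : discL2 R) :
    greenL2 hR F =ᵐ[discMeasure R] greenOp R F := by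
  filter_upwards [coeFn_greenL2 hR F] with x hx
  rw [hx, inner_greenVec]

lemma memLp_conj {R : ℝ} {f : Plane → ℂ} (hf : MemLp f 2 (discMeasure R)) :
    MemLp (fun x => (starRingEnd ℂ) (f x)) 2 (discMeasure R) :=
  hf.star

lemma greenOp_conj (R : ℝ) (f : Plane → ℂ) (x : Plane) :
    greenOp R (fun y => (starRingEnd ℂ) (f y)) x = (starRingEnd ℂ) (greenOp R f x) := by
  rw [greenOp, greenOp, ← integral_conj]
  simp

lemma isSymmetric_greenL2 {R : ℝ} (hR : 0 < R) :
    (greenL2 hR : discL2 R →ₗ[ℂ] discL2 R).IsSymmetric := by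
  intro F G
  simp only [ContinuousLinearMap.coe_coe, L2.inner_def]
  have h := integral_greenOp_mul hR (memLp_conj (Lp.memLp F)) (Lp.memLp G)
  refine Eq.trans ?_ (h.trans ?_)
  · refine integral_congr_ae ?_
    filter_upwards [coeFn_greenL2' hR F] with x hx
    rw [hx, greenOp_conj]
    simp [mul_comm]
  · refine integral_congr_ae ?_
    filter_upwards [coeFn_greenL2' hR G] with x hx
    rw [hx]
    simp [mul_comm]

/-- The Green function is real, so the real part of the quadratic form is the sum of the forms of
the real and imaginary parts. -/
lemma re_inner_greenL2_nonneg_of_contDiff {R : ℝ} (hR : 0 < R) {g : Plane → ℂ}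
    (hg : ContDiff ℝ ∞ g) {F : discL2 R} (hF : F =ᵐ[discMeasure R] g) :
    0 ≤ (inner ℂ (greenL2 hR F) F).re := by
  have hre : ContDiff ℝ ∞ fun x => (g x).re := Complex.reCLM.contDiff.comp hg
  have him : ContDiff ℝ ∞ fun x => (g x).im := Complex.imCLM.contDiff.comp hg
  have hgL : MemLp g 2 (discMeasure R) := memLp_of_continuous hg.continuous
  rw [L2.inner_def]
  have h1 := integral_re (L2.integrable_inner (𝕜 := ℂ) (greenL2 hR F) F)
  simp only [RCLike.re_to_complex] at h1
  rw [← h1]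
  have hi : ∀ g : Plane → ℝ, Continuous g → Integrable g (discMeasure R) := fun g hg =>
    (memLp_of_continuous_real hg).integrable (by norm_num)
  have hc1 := continuous_greenOp hR (memLp_of_continuous_real (R := R) hre.continuous)
  have hc2 := continuous_greenOp hR (memLp_of_continuous_real (R := R) him.continuous)
  have h := add_nonneg (integral_greenOp_mul_nonneg hR hre) (integral_greenOp_mul_nonneg hR him)
  rw [← integral_add
    (hi (fun x => greenOp R (fun y => (g y).re) x * (g x).re) (hc1.mul hre.continuous))
    (hi (fun x => greenOp R (fun y => (g y).im) x * (g x).im) (hc2.mul him.continuous))] at h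
  refine h.trans_eq (integral_congr_ae ?_)
  have him' : ∀ x, (greenOp R g x).im = greenOp R (fun y => (g y).im) x := fun x => by
    have := integral_im (integrable_green_smul hR hgL x)
    simp only [RCLike.im_to_complex] at this
    rw [greenOp, ← this, greenOp]
    simp
  filter_upwards [coeFn_greenL2' hR F, hF] with x hx hx'
  rw [hx, hx', greenOp_congr hF, ← re_greenOp hR hgL, ← him']
  simp [mul_comm]

/-- Nonnegativity of the quadratic form is a closed condition, and smooth functions are dense. -/
lemma isPositive_greenL2 {R : ℝ} (hR : 0 < R) : (greenL2 hR).IsPositive := by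
  rw [ContinuousLinearMap.isPositive_def]
  refine ⟨isSymmetric_greenL2 hR, fun F => ?_⟩
  have hcl : IsClosed {F : discL2 R | 0 ≤ (greenL2 hR).reApplyInnerSelf F} :=
    isClosed_le continuous_const (greenL2 hR).reApplyInnerSelf_continuous
  have hd := Lp.dense_hasCompactSupport_contDiff (E := Plane) (F := ℂ) (μ := discMeasure R)
    (p := 2) (by norm_num)
  refine (hcl.closure_subset_iff.2 ?_) (hd F)
  rintro G ⟨g, hg, -, hgs⟩
  exact re_inner_greenL2_nonneg_of_contDiff hR hgs hg

lemma isSelfAdjoint_greenL2 {R : ℝ} (hR : 0 < R) : IsSelfAdjoint (greenL2 hR) :=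
  (isPositive_greenL2 hR).isSelfAdjoint

/-! ### Solutions of the heat equation with square integrable initial data -/

/-- The continuous representative of `K ^ (1 - k) exp (-t K⁻¹) F`, where `K` is the Green
operator of the disc. -/
def heatApply {R : ℝ} (hR : 0 < R) (k : ℕ) (t : ℝ) (F : discL2 R) (x : Plane) : ℂ :=
  inner ℂ (greenVec hR x) (heatOp (greenL2 hR) k t F)

section heatApply

variable {R : ℝ} (hR : 0 < R)

lemma continuousOn_heatApply_comp {X : Type*} [TopologicalSpace X] (k : ℕ) {f : X → Plane}
    {F : X → discL2 R} {τ : X → ℝ} (hf : Continuous f) (hF : Continuous F) (hτ : Continuous τ) :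
    ContinuousOn (fun p => heatApply hR k (τ p) (F p) (f p)) {p | 0 < τ p} := by
  have h1 : ContinuousOn (fun p => heatOp (greenL2 hR) k (τ p)) {p | 0 < τ p} := by
    intro p hp
    have h := (hasDerivAt_heatOp (isSelfAdjoint_greenL2 hR) k hp).continuousAt
    exact (ContinuousAt.comp (f := τ) h hτ.continuousAt).continuousWithinAt
  exact ((continuous_greenVec hR).comp hf).continuousOn.inner (h1.clm_apply hF.continuousOn)

lemma continuous_heatApply (k : ℕ) (t : ℝ) (F : discL2 R) : Continuous (heatApply hR k t F) :=
  continuous_inner_greenVec hR _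

lemma heatApply_eq_zero (k : ℕ) (t : ℝ) (F : discL2 R) {x : Plane} (hx : R ≤ ‖x‖) :
    heatApply hR k t F x = 0 := by
  rw [heatApply, greenVec_eq_zero hR hx, inner_zero_left]

lemma hasDerivAt_heatApply (k : ℕ) {t : ℝ} (ht : 0 < t) (F : discL2 R) (x : Plane) :
    HasDerivAt (fun t => heatApply hR k t F x) (-heatApply hR (k + 1) t F x) t := by
  have h := (((innerSL ℂ (greenVec hR x)).comp
    (ContinuousLinearMap.apply ℂ (discL2 R) F)).restrictScalars ℝ).hasFDerivAt.comp_hasDerivAt t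
    (hasDerivAt_heatOp (isSelfAdjoint_greenL2 hR) k ht)
  simpa [heatApply, Function.comp_def, inner_neg_right] using h

/-- `K⁻ᵏ exp (-t K⁻¹) F` is `K` applied to the same expression with `k + 1`, and `K` takes values in
continuous functions through `greenVec`. This explains the shift of the index in `heatApply`. -/
lemma coeFn_heatOp (k : ℕ) {t : ℝ} (ht : 0 < t) (F : discL2 R) :
    heatOp (greenL2 hR) k t F =ᵐ[discMeasure R] heatApply hR (k + 1) t F := by
  have h := coeFn_greenL2 hR (heatOp (greenL2 hR) (k + 1) t F)
  rwa [← mul_apply_eq_comp, mul_heatOp_succ (isSelfAdjoint_greenL2 hR) k ht] at h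

lemma heatApply_eq_greenOp (k : ℕ) {t : ℝ} (ht : 0 < t) (F : discL2 R) :
    heatApply hR k t F = greenOp R (heatApply hR (k + 1) t F) := by
  rw [← greenOp_congr (coeFn_heatOp hR k ht F)]
  ext x
  rw [heatApply, inner_greenVec]

lemma clm_greenOp {R : ℝ} (hR : 0 < R) {f : Plane → ℂ} (hf : MemLp f 2 (discMeasure R)) (L : ℂ →L[ℝ] ℝ) (x : Plane) :
    L (greenOp R f x) = greenOp R (fun y => L (f y)) x := by
  rw [greenOp, ← L.integral_comp_comm (integrable_green_smul hR hf x), greenOp]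
  simp only [map_smul]

lemma clm_heatApply (L : ℂ →L[ℝ] ℝ) (k : ℕ) {t : ℝ} (ht : 0 < t) (F : discL2 R) :
    (fun x => L (heatApply hR k t F x)) = greenOp R fun x => L (heatApply hR (k + 1) t F x) := by
  ext x
  rw [heatApply_eq_greenOp hR k ht, clm_greenOp hR
    (memLp_of_continuous (continuous_heatApply hR (k + 1) t F))]

/-- The function of index `k` is the Green operator applied twice to the continuous function of
index `k + 2`, so the regularity of double Green potentials applies. The real functional `L` treats
real and imaginary parts at once. -/
lemma contDiffOn_clm_heatApply (L : ℂ →L[ℝ] ℝ) (k : ℕ) {t : ℝ} (ht : 0 < t) (F : discL2 R) :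
    ContDiffOn ℝ 2 (fun x => L (heatApply hR k t F x)) (Metric.ball 0 R) ∧
      ∀ x ∈ Metric.ball (0 : Plane) R, laplacian (fun x => L (heatApply hR k t F x)) x =
        -L (heatApply hR (k + 1) t F x) := by
  have h := contDiffOn_greenOp_greenOp hR
    (L.continuous.comp (continuous_heatApply hR (k + 2) t F))
  simp only [Function.comp_def] at h
  rw [← clm_heatApply hR L (k + 1) ht F, ← clm_heatApply hR L k ht F] at h
  exact h

lemma hasDerivAt_clm_heatApply (L : ℂ →L[ℝ] ℝ) (k : ℕ) {t : ℝ} (ht : 0 < t) (F : discL2 R)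
    {x : Plane} (hx : x ∈ Metric.ball 0 R) :
    HasDerivAt (fun t => L (heatApply hR k t F x))
      (laplacian (fun x => L (heatApply hR k t F x)) x) t := by
  rw [(contDiffOn_clm_heatApply hR L k ht F).2 x hx, ← map_neg]
  exact L.hasFDerivAt.comp_hasDerivAt t (hasDerivAt_heatApply hR k ht F x)

/-- A continuous function as an element of `L²`. -/
def contVec (R : ℝ) {f : Plane → ℝ} (hf : Continuous f) : discL2 R :=
  (memLp_of_continuous (R := R) (Complex.continuous_ofReal.comp hf)).toLp _

lemma coeFn_contVec {f : Plane → ℝ} (hf : Continuous f) :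
    contVec R hf =ᵐ[discMeasure R] fun x => ((f x : ℝ) : ℂ) :=
  (memLp_of_continuous (R := R) (Complex.continuous_ofReal.comp hf)).coeFn_toLp

lemma inner_greenVec_contVec {f : Plane → ℝ} (hf : Continuous f) (x : Plane) :
    inner ℂ (greenVec hR x) (contVec R hf) = ((greenOp R f x : ℝ) : ℂ) := by
  rw [inner_greenVec, greenOp_congr (coeFn_contVec hf), greenOp_ofReal]

lemma greenL2_contVec {f g : Plane → ℝ} (hf : Continuous f) (hg : Continuous g)
    (h : greenOp R f = g) : greenL2 hR (contVec R hf) = contVec R hg := by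
  refine Lp.ext ?_
  filter_upwards [coeFn_greenL2 hR (contVec R hf), coeFn_contVec hg] with x hx hx'
  rw [hx, hx', inner_greenVec_contVec, h]

/-- Uniform convergence to smooth initial data with compact support. -/
lemma exists_norm_heatApply_sub_le {φ : Plane → ℝ} (hφ : ContDiff ℝ ∞ φ)
    (hc : HasCompactSupport φ) (hs : tsupport φ ⊆ Metric.ball 0 R) :
    ∃ C, 0 ≤ C ∧ ∀ t, 0 < t → ∀ x,
      ‖heatApply hR 1 t (contVec R hφ.continuous) x - ((φ x : ℝ) : ℂ)‖ ≤ C * t := by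
  -- A test function is `φ = K φ₁` with `φ₁ = -Δφ = K φ₂` and `φ₂ = Δ²φ`. The error at `x` is
  -- therefore `exp (-t K⁻¹) K - K` applied to `φ₂` and paired with the Green function, which has
  -- size `t`.
  have hφ1 : ContDiff ℝ ∞ fun x => -laplacian φ x := (contDiff_laplacian hφ).neg
  have hs1 : tsupport (fun x => -laplacian φ x) ⊆ Metric.ball 0 R := by
    have : tsupport (fun x => -laplacian φ x) = tsupport (laplacian φ) := by
      rw [tsupport, tsupport]; congr 1; ext x; simp
    rw [this]
    exact (tsupport_laplacian_subset φ).trans hs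
  have hc1 := hasCompactSupport_of_subset_ball hs1
  have hφ2 : ContDiff ℝ ∞ fun x => -laplacian (fun x => -laplacian φ x) x :=
    (contDiff_laplacian hφ1).neg
  have e1 := greenL2_contVec hR hφ1.continuous hφ.continuous (greenOp_laplacian hR hφ hc hs)
  have e2 := greenL2_contVec hR hφ2.continuous hφ1.continuous (greenOp_laplacian hR hφ1 hc1 hs1)
  refine ⟨√(R * invNormBound R) * ‖contVec R hφ2.continuous‖, by positivity, fun t ht x => ?_⟩
  have e3 : heatApply hR 1 t (contVec R hφ.continuous) x - ((φ x : ℝ) : ℂ) =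
      inner ℂ (greenVec hR x) ((heatOp (greenL2 hR) 0 t * greenL2 hR - greenL2 hR)
        (contVec R hφ2.continuous)) := by
    rw [sub_apply, mul_apply_eq_comp, e2, inner_sub_right,
      inner_greenVec_contVec hR hφ1.continuous, greenOp_laplacian hR hφ hc hs, heatApply, ← e1,
      ← mul_apply_eq_comp, heatOp_succ_mul (isSelfAdjoint_greenL2 hR) 0 ht]
  rw [e3]
  calc _ ≤ ‖greenVec hR x‖ * (‖heatOp (greenL2 hR) 0 t * greenL2 hR - greenL2 hR‖ *
        ‖contVec R hφ2.continuous‖) :=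
        (norm_inner_le_norm _ _).trans (by gcongr; exact ContinuousLinearMap.le_opNorm _ _)
    _ ≤ √(R * invNormBound R) * (t * ‖contVec R hφ2.continuous‖) := by
        gcongr
        · exact norm_greenVec_le hR x
        · exact norm_heatOp_zero_mul_sub_le (isPositive_greenL2 hR) ht
    _ = _ := by ring

/-- Maximum principle for solutions with test functions as initial data. -/
lemma clm_heatApply_le (L : ℂ →L[ℝ] ℝ) {φ : Plane → ℝ} (hφ : ContDiff ℝ ∞ φ)
    (hs : tsupport φ ⊆ Metric.ball 0 R) {m : ℝ} (hm : 0 ≤ m)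
    (hL : ∀ x, L ((φ x : ℝ) : ℂ) ≤ m) {t : ℝ} (ht : 0 < t) (x : Plane) :
    L (heatApply hR 1 t (contVec R hφ.continuous) x) ≤ m := by
  by_cases hxR : R ≤ ‖x‖
  · rw [heatApply_eq_zero hR _ _ _ hxR, map_zero]; exact hm
  obtain ⟨C, hC0, hC⟩ := exists_norm_heatApply_sub_le hR hφ (hasCompactSupport_of_subset_ball hs) hs
  set F := contVec R hφ.continuous with hF
  -- The solution is extended by its initial value at `t = 0`; continuity there follows from the
  -- rate `C t`, uniform in `x`.
  set v : Plane → ℝ → ℝ := fun x t =>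
    (if t ≤ 0 then L ((φ x : ℝ) : ℂ) else L (heatApply hR 1 t F x)) - m with hv
  have hvpos : ∀ x t, 0 < t → v x t = L (heatApply hR 1 t F x) - m := fun x t ht => by
    simp [hv, not_le.2 ht]
  have hcont : ContinuousOn (fun p : Plane × ℝ => v p.1 p.2)
      (Metric.closedBall 0 R ×ˢ Icc 0 t) := by
    rintro ⟨x, r⟩ ⟨-, hr⟩
    rcases hr.1.eq_or_lt with h0 | h0
    · simp only at h0
      subst h0
      have hb : ∀ p : Plane × ℝ, p.2 ∈ Icc 0 t →
          ‖v p.1 p.2 - (L ((φ p.1 : ℝ) : ℂ) - m)‖ ≤ ‖L‖ * (C * p.2) := by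
        rintro ⟨y, r⟩ hr
        simp only [hv]
        split_ifs with h
        · have : r = 0 := le_antisymm h hr.1
          simp [this]
        · rw [sub_sub_sub_cancel_right, ← map_sub]
          refine (L.le_opNorm _).trans ?_
          gcongr
          exact hC r (not_le.1 h) y
      have h1 : Tendsto (fun p : Plane × ℝ => v p.1 p.2 - (L ((φ p.1 : ℝ) : ℂ) - m))
          (𝓝[Metric.closedBall 0 R ×ˢ Icc 0 t] (x, 0)) (𝓝 0) := by
        refine squeeze_zero_norm' ?_ (a := fun p : Plane × ℝ => ‖L‖ * (C * p.2)) ?_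
        · filter_upwards [self_mem_nhdsWithin] with p hp using hb p hp.2
        · have : Continuous fun p : Plane × ℝ => ‖L‖ * (C * p.2) := by fun_prop
          exact (this.tendsto' (x, 0) 0 (by simp)).mono_left nhdsWithin_le_nhds
      have h2 : Tendsto (fun p : Plane × ℝ => L ((φ p.1 : ℝ) : ℂ) - m)
          (𝓝[Metric.closedBall 0 R ×ˢ Icc 0 t] (x, 0)) (𝓝 (L ((φ x : ℝ) : ℂ) - m)) := by
        have hφc := hφ.continuous
        have : Continuous fun p : Plane × ℝ => L ((φ p.1 : ℝ) : ℂ) - m := by fun_prop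
        exact (this.tendsto (x, 0)).mono_left nhdsWithin_le_nhds
      have h3 := h1.add h2
      rw [zero_add] at h3
      simp only [sub_add_cancel] at h3
      rw [ContinuousWithinAt]
      convert h3 using 2
      simp [hv]
    · refine ContinuousAt.continuousWithinAt ?_
      have h1 := continuousOn_heatApply_comp hR 1 (continuous_fst (X := Plane) (Y := ℝ))
        (continuous_const (y := F)) (continuous_snd (X := Plane) (Y := ℝ))
      have hmem : {p : Plane × ℝ | 0 < p.2} ∈ 𝓝 (x, r) :=
        (isOpen_lt continuous_const continuous_snd).mem_nhds h0
      have h2 := (L.continuous.continuousAt.comp (h1.continuousAt hmem)).sub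
        (continuousAt_const (y := m))
      refine h2.congr ?_
      filter_upwards [hmem] with p hp using (hvpos _ _ hp).symm
  have key := le_zero_of_heat hcont ?_ ?_ ?_ ?_ x (by simpa using (not_le.1 hxR).le) t
    ⟨ht.le, le_rfl⟩
  · rw [hvpos x t ht] at key; linarith
  · intro r hr _
    simp only [hvpos _ r hr]
    exact (contDiffOn_clm_heatApply hR L 1 hr F).1.sub contDiffOn_const
  · intro y hy r hr _
    have e : (fun z => v z r) = fun z => L (heatApply hR 1 r F z) - m :=
      funext fun z => hvpos z r hr
    have hcd := ((contDiffOn_clm_heatApply hR L 1 hr F).1 y hy).contDiffAt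
      (Metric.isOpen_ball.mem_nhds hy)
    rw [e, laplacian_fun_sub hcd contDiffAt_const]
    have : laplacian (fun _ : Plane => m) y = 0 := by
      rw [laplacian_eq_sum]; simp
    rw [this, sub_zero]
    refine ((hasDerivAt_clm_heatApply hR L 1 hr F hy).sub_const m).congr_of_eventuallyEq ?_
    filter_upwards [lt_mem_nhds hr] with s hs using hvpos y s hs
  · intro y _
    simp only [hv, le_refl, if_true]
    linarith [hL y]
  · intro y hy r h0 _
    · rw [hvpos y r h0, heatApply_eq_zero hR _ _ _ (by simpa using hy.ge), map_zero]
      linarith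

end heatApply

/-! ### The heat kernel of a disc, its positivity and its mass -/

/-- The functions `(-Δ) ^ (k - 2) H(x, y, t)`, where `H` is the Dirichlet heat kernel. -/
def heatKer {R : ℝ} (hR : 0 < R) (k : ℕ) (x y : Plane) (t : ℝ) : ℝ :=
  (heatApply hR k t (greenVec hR y) x).re

section heatKer

variable {R : ℝ} (hR : 0 < R)

lemma continuousOn_heatKer_comp {X : Type*} [TopologicalSpace X] (k : ℕ) {f g : X → Plane}
    {τ : X → ℝ} (hf : Continuous f) (hg : Continuous g) (hτ : Continuous τ) :
    ContinuousOn (fun p => heatKer hR k (f p) (g p) (τ p)) {p | 0 < τ p} :=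
  Complex.continuous_re.comp_continuousOn
    (continuousOn_heatApply_comp hR k hf ((continuous_greenVec hR).comp hg) hτ)

/-- Self-adjointness of the heat operator exchanges the two points; this becomes the symmetry of the
kernel. -/
lemma conj_heatApply (k : ℕ) (t : ℝ) (x y : Plane) :
    (starRingEnd ℂ) (heatApply hR k t (greenVec hR y) x) = heatApply hR k t (greenVec hR x) y := by
  rw [heatApply, heatApply, inner_conj_symm, inner_heatOp_left]

lemma heatKer_symm (k : ℕ) (x y : Plane) (t : ℝ) : heatKer hR k x y t = heatKer hR k y x t := by
  rw [heatKer, heatKer, ← conj_heatApply, Complex.conj_re]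

lemma heatKer_eq_zero_left (k : ℕ) {x : Plane} (hx : R ≤ ‖x‖) (y : Plane) (t : ℝ) :
    heatKer hR k x y t = 0 := by
  rw [heatKer, heatApply_eq_zero hR _ _ _ hx, Complex.zero_re]

lemma heatKer_eq_zero_right (k : ℕ) (x : Plane) {y : Plane} (hy : R ≤ ‖y‖) (t : ℝ) :
    heatKer hR k x y t = 0 := by
  rw [heatKer_symm, heatKer_eq_zero_left hR k hy]

lemma hasDerivAt_heatKer (k : ℕ) (x y : Plane) {t : ℝ} (ht : 0 < t) :
    HasDerivAt (fun t => heatKer hR k x y t) (-heatKer hR (k + 1) x y t) t := by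
  have h := Complex.reCLM.hasFDerivAt.comp_hasDerivAt t
    (hasDerivAt_heatApply hR k ht (greenVec hR y) x)
  exact (h : HasDerivAt (fun t => heatKer hR k x y t) _ t).congr_deriv (by simp [heatKer])

lemma contDiffOn_heatKer (k : ℕ) (y : Plane) {t : ℝ} (ht : 0 < t) :
    ContDiffOn ℝ 2 (fun x => heatKer hR k x y t) (Metric.ball 0 R) :=
  (contDiffOn_clm_heatApply hR Complex.reCLM k ht (greenVec hR y)).1

lemma laplacian_heatKer (k : ℕ) {x : Plane} (hx : x ∈ Metric.ball (0 : Plane) R) (y : Plane)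
    {t : ℝ} (ht : 0 < t) :
    laplacian (fun x => heatKer hR k x y t) x = -heatKer hR (k + 1) x y t :=
  (contDiffOn_clm_heatApply hR Complex.reCLM k ht (greenVec hR y)).2 x hx

/-- As a function of its second variable the kernel is, up to conjugation, the continuous
representative of `heatOp` of index one applied to `greenVec hR x`. Integrating against it is thus
an inner product. -/
lemma integral_heatApply_mul {t : ℝ} (ht : 0 < t) (F : discL2 R) (x : Plane) :
    ∫ y, heatApply hR 2 t (greenVec hR y) x * F y ∂(discMeasure R) = heatApply hR 1 t F x := by
  rw [heatApply, ← inner_heatOp_left, L2.inner_def]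
  refine integral_congr_ae ?_
  filter_upwards [coeFn_heatOp hR 1 ht (greenVec hR x)] with y hy
  rw [hy, RCLike.inner_apply, conj_heatApply, mul_comm]

lemma integral_clm_heatApply_mul (L : ℂ →L[ℝ] ℝ) {t : ℝ} (ht : 0 < t) {φ : Plane → ℝ}
    (hφ : Continuous φ) (x : Plane) :
    ∫ y, L (heatApply hR 2 t (greenVec hR y) x) * φ y ∂(discMeasure R) =
      L (heatApply hR 1 t (contVec R hφ) x) := by
  have hc : Continuous fun y => heatApply hR 2 t (greenVec hR y) x :=
    (continuous_heatApply hR 2 t (greenVec hR x)).star.congr fun y =>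
      conj_heatApply hR 2 t y x
  have hm : MemLp (fun y => heatApply hR 2 t (greenVec hR y) x * ((φ y : ℝ) : ℂ)) 2
      (discMeasure R) := memLp_of_continuous (hc.mul (Complex.continuous_ofReal.comp hφ))
  rw [← integral_heatApply_mul hR ht]
  have e : ∫ y, heatApply hR 2 t (greenVec hR y) x * contVec R hφ y ∂(discMeasure R) =
      ∫ y, heatApply hR 2 t (greenVec hR y) x * ((φ y : ℝ) : ℂ) ∂(discMeasure R) := by
    refine integral_congr_ae ?_
    filter_upwards [coeFn_contVec hφ] with y hy
    rw [hy]
  rw [e, ← L.integral_comp_comm (hm.integrable (by norm_num))]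
  refine integral_congr_ae (Eventually.of_forall fun y => ?_)
  have : heatApply hR 2 t (greenVec hR y) x * ((φ y : ℝ) : ℂ) =
      φ y • heatApply hR 2 t (greenVec hR y) x := by
    rw [Complex.real_smul, mul_comm]
  simp only [this, map_smul, smul_eq_mul, mul_comm]

lemma nonneg_of_integral_mul_nonneg {U : Set Plane} (hU : IsOpen U) {g : Plane → ℝ}
    (hg : Continuous g)
    (h : ∀ φ : Plane → ℝ, ContDiff ℝ ∞ φ → tsupport φ ⊆ U → (∀ x, 0 ≤ φ x) → (∀ x, φ x ≤ 1) →
      0 ≤ ∫ x in U, g x * φ x) : ∀ x ∈ U, 0 ≤ g x := by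
  intro x hx
  by_contra hneg
  rw [not_le] at hneg
  have hV : U ∩ {y | g y < 0} ∈ 𝓝 x :=
    (hU.inter (isOpen_lt hg continuous_const)).mem_nhds ⟨hx, hneg⟩
  obtain ⟨φ, hs, hc, hφ, hr, h1⟩ := exists_contDiff_tsupport_subset (n := ⊤) hV
  have hφ0 : ∀ y, 0 ≤ φ y := fun y => (hr (mem_range_self y)).1
  have hi := h φ hφ (hs.trans inter_subset_left) hφ0 fun y => (hr (mem_range_self y)).2
  have hpos : 0 < ∫ y, -(g y * φ y) := by
    refine Continuous.integral_pos_of_hasCompactSupport_nonneg_nonzero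
      (x := x) (hg.mul hφ.continuous).neg ?_ ?_ ?_
    · exact hc.mono fun y hy hy0 => hy (by simp [hy0])
    · intro y
      by_cases hy : y ∈ tsupport φ
      · have := (hs hy).2
        simp only [mem_ofPred_eq] at this
        simp only [Pi.zero_apply]
        nlinarith [hφ0 y]
      · simp [image_eq_zero_of_notMem_tsupport hy]
    · rw [h1]; simp only [mul_one]; linarith
  rw [integral_neg, ← setIntegral_eq_integral_of_forall_compl_eq_zero (s := U)
    (fun y hy => by
      rw [image_eq_zero_of_notMem_tsupport (fun hy' => hy (hs hy').1), mul_zero])] at hpos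
  linarith

lemma continuous_clm_heatApply_right (L : ℂ →L[ℝ] ℝ) (t : ℝ) (x : Plane) :
    Continuous fun y => L (heatApply hR 2 t (greenVec hR y) x) :=
  L.continuous.comp ((continuous_heatApply hR 2 t (greenVec hR x)).star.congr fun y =>
      conj_heatApply hR 2 t y x)

/-- By the maximum principle the integral of the kernel against every nonnegative test function is
nonnegative, and the kernel is continuous in `y`. A general `L` is allowed so that the imaginary
part is covered too. -/
lemma clm_heatApply_nonneg (L : ℂ →L[ℝ] ℝ) (hL : ∀ a : ℝ, 0 ≤ a → 0 ≤ L (a : ℂ)) {t : ℝ}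
    (ht : 0 < t) (x y : Plane) : 0 ≤ L (heatApply hR 2 t (greenVec hR y) x) := by
  by_cases hy : R ≤ ‖y‖
  · rw [greenVec_eq_zero hR hy, heatApply, map_zero, inner_zero_right, map_zero]
  refine nonneg_of_integral_mul_nonneg (U := Metric.ball 0 R) Metric.isOpen_ball
    (continuous_clm_heatApply_right hR L t x) (fun φ hφ hs h0 _ => ?_) y (by simpa using hy)
  have h := clm_heatApply_le hR (-L) hφ hs le_rfl
    (fun x => by simpa using hL _ (h0 x)) ht x
  rw [integral_clm_heatApply_mul hR L ht hφ.continuous]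
  simpa using h

/-- Both `Im` and `-Im` vanish on real numbers, so the sign statement applies to each of them. -/
lemma im_heatApply {t : ℝ} (ht : 0 < t) (x y : Plane) :
    (heatApply hR 2 t (greenVec hR y) x).im = 0 := by
  have h1 := clm_heatApply_nonneg hR Complex.imCLM (by simp) ht x y
  have h2 := clm_heatApply_nonneg hR (-Complex.imCLM) (by simp) ht x y
  simp only [neg_apply, Complex.imCLM_apply] at h1 h2
  linarith

lemma heatKer_nonneg {t : ℝ} (ht : 0 < t) (x y : Plane) : 0 ≤ heatKer hR 2 x y t :=
  clm_heatApply_nonneg hR Complex.reCLM (by simp) ht x y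

lemma ofReal_heatKer {t : ℝ} (ht : 0 < t) (x y : Plane) :
    ((heatKer hR 2 x y t : ℝ) : ℂ) = heatApply hR 2 t (greenVec hR y) x :=
  Complex.ext (by simp [heatKer]) (by simp [im_heatApply hR ht])

lemma continuous_heatKer_right (k : ℕ) {t : ℝ} (ht : 0 < t) (x : Plane) :
    Continuous fun y => heatKer hR k x y t := by
  have := continuousOn_heatKer_comp hR k (continuous_const (y := x)) continuous_id
    (continuous_const (y := t))
  simpa [ht] using this

lemma integrable_of_continuous {f : Plane → ℝ} (hf : Continuous f) :
    Integrable f (discMeasure R) :=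
  (memLp_of_continuous_real hf).integrable (by norm_num)

lemma integrable_heatKer {t : ℝ} (ht : 0 < t) (x : Plane) :
    Integrable (fun y => heatKer hR 2 x y t) (discMeasure R) :=
  integrable_of_continuous (continuous_heatKer_right hR 2 ht x)

/-- The Chapman-Kolmogorov identity. -/
lemma integral_heatKer_mul_heatKer {s t : ℝ} (hs : 0 < s) (ht : 0 < t) (x y : Plane) :
    ∫ z, heatKer hR 2 x z t * heatKer hR 2 z y s ∂(discMeasure R) = heatKer hR 2 x y (t + s) := by
  have h := integral_heatApply_mul hR ht (heatOp (greenL2 hR) 1 s (greenVec hR y)) x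
  have e : heatApply hR 1 t (heatOp (greenL2 hR) 1 s (greenVec hR y)) x =
      heatApply hR 2 (t + s) (greenVec hR y) x := by
    rw [heatApply, ← mul_apply_eq_comp, heatOp_mul _ _ ht hs, heatApply]
  rw [e, ← ofReal_heatKer hR (by positivity)] at h
  have e2 : ∫ y_1, heatApply hR 2 t (greenVec hR y_1) x *
      (heatOp (greenL2 hR) 1 s (greenVec hR y)) y_1 ∂(discMeasure R) =
      ∫ z, ((heatKer hR 2 x z t * heatKer hR 2 z y s : ℝ) : ℂ) ∂(discMeasure R) := by
    refine integral_congr_ae ?_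
    filter_upwards [coeFn_heatOp hR 1 hs (greenVec hR y)] with z hz
    rw [hz, Complex.ofReal_mul, ofReal_heatKer hR ht, ofReal_heatKer hR hs]
  rw [e2, integral_complex_ofReal] at h
  exact_mod_cast h

lemma integral_heatKer_mul_test {t : ℝ} (ht : 0 < t) {φ : Plane → ℝ} (hφ : Continuous φ)
    (x : Plane) : ∫ y, heatKer hR 2 x y t * φ y ∂(discMeasure R) =
      (heatApply hR 1 t (contVec R hφ) x).re :=
  integral_clm_heatApply_mul hR Complex.reCLM ht hφ x

lemma exists_abs_integral_heatKer_sub_le {φ : Plane → ℝ} (hφ : ContDiff ℝ ∞ φ)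
    (hs : tsupport φ ⊆ Metric.ball 0 R) :
    ∃ C, 0 ≤ C ∧ ∀ t, 0 < t → ∀ x,
      |∫ y, heatKer hR 2 x y t * φ y ∂(discMeasure R) - φ x| ≤ C * t := by
  obtain ⟨C, hC0, hC⟩ := exists_norm_heatApply_sub_le hR hφ (hasCompactSupport_of_subset_ball hs) hs
  refine ⟨C, hC0, fun t ht x => ?_⟩
  rw [integral_heatKer_mul_test hR ht hφ.continuous]
  refine le_trans ?_ (hC t ht x)
  have := Complex.abs_re_le_norm
    (heatApply hR 1 t (contVec R hφ.continuous) x - ((φ x : ℝ) : ℂ))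
  simpa using this

lemma integral_heatKer_mul_test_le {φ : Plane → ℝ} (hφ : ContDiff ℝ ∞ φ)
    (hs : tsupport φ ⊆ Metric.ball 0 R) {m : ℝ} (hm : 0 ≤ m) (hφm : ∀ x, φ x ≤ m)
    {t : ℝ} (ht : 0 < t) (x : Plane) :
    ∫ y, heatKer hR 2 x y t * φ y ∂(discMeasure R) ≤ m := by
  rw [integral_heatKer_mul_test hR ht hφ.continuous]
  exact clm_heatApply_le hR Complex.reCLM hφ hs hm (by simpa using hφm) ht x

/-- The heat kernel has mass at most one. -/
lemma integral_heatKer_le_one {t : ℝ} (ht : 0 < t) (x : Plane) :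
    ∫ y, heatKer hR 2 x y t ∂(discMeasure R) ≤ 1 := by
  -- The disc is exhausted by smaller closed discs. On each of them the kernel is dominated by its
  -- product with a test function bounded by one, to which the maximum principle applies.
  set f : ℕ → Plane → ℝ := fun n y =>
    indicator (Metric.closedBall (0 : Plane) (R - 1 / ((n : ℝ) + 1)))
      (fun y => heatKer hR 2 x y t) y with hf
  have hlim : Tendsto (fun n => ∫ y, f n y ∂(discMeasure R)) atTop
      (𝓝 (∫ y, heatKer hR 2 x y t ∂(discMeasure R))) := by
    refine tendsto_integral_of_dominated_convergence (fun y => heatKer hR 2 x y t) (fun n => ?_)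
      (integrable_heatKer hR ht x) (fun n => Eventually.of_forall fun y => ?_) ?_
    · exact ((continuous_heatKer_right hR 2 ht x).stronglyMeasurable.indicator
        Metric.isClosed_closedBall.measurableSet).aestronglyMeasurable
    · refine (norm_indicator_le_norm_self _ _).trans_eq ?_
      exact Real.norm_of_nonneg (heatKer_nonneg hR ht x y)
    · filter_upwards [ae_restrict_mem Metric.isOpen_ball.measurableSet] with y hy
      rw [mem_ball_zero_iff] at hy
      refine tendsto_const_nhds.congr' ?_
      have h1 := (tendsto_one_div_add_atTop_nhds_zero_nat (𝕜 := ℝ)).eventually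
        (gt_mem_nhds (sub_pos.2 hy))
      filter_upwards [h1] with n hn
      simp only [hf]
      rw [indicator_of_mem]
      rw [mem_closedBall_zero_iff]
      linarith
  refine le_of_tendsto hlim (Eventually.of_forall fun n => ?_)
  set r : ℝ := R - 1 / ((n : ℝ) + 1) with hr
  have hrR : Metric.closedBall (0 : Plane) r ⊆ Metric.ball 0 R := by
    refine Metric.closedBall_subset_ball ?_
    have : 0 < 1 / ((n : ℝ) + 1) := by positivity
    linarith
  obtain ⟨φ, hφ, hφr, hφ1⟩ : ∃ φ : Plane → ℝ, ContDiff ℝ ∞ φ ∧ tsupport φ ⊆ Metric.ball 0 R ∧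
      (∀ y, 0 ≤ φ y ∧ φ y ≤ 1) ∧ ∀ y ∈ Metric.closedBall (0 : Plane) r, φ y = 1 := by
    set r' : ℝ := R - 1 / ((n : ℝ) + 1) / 2 with hr'
    have h1 : 0 < 1 / ((n : ℝ) + 1) := by positivity
    rcases le_or_gt r 0 with h0 | h0
    · let b : ContDiffBump (0 : Plane) := ⟨R / 4, R / 2, by positivity, by linarith⟩
      refine ⟨b, b.contDiff, ?_, fun y => ⟨b.nonneg, b.le_one⟩, fun y hy => ?_⟩
      · rw [b.tsupport_eq]; exact Metric.closedBall_subset_ball (by simp [b]; linarith)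
      · refine b.one_of_mem_closedBall ?_
        exact Metric.closedBall_subset_closedBall (by simp [b]; linarith) hy
    · let b : ContDiffBump (0 : Plane) := ⟨r, r', h0, by linarith⟩
      refine ⟨b, b.contDiff, ?_, fun y => ⟨b.nonneg, b.le_one⟩, fun y hy => ?_⟩
      · rw [b.tsupport_eq]; exact Metric.closedBall_subset_ball (by simp [b]; linarith)
      · exact b.one_of_mem_closedBall hy
  refine le_trans (integral_mono ?_ (integrable_of_continuous
    ((continuous_heatKer_right hR 2 ht x).mul hφ.continuous)) fun y => ?_)
    (integral_heatKer_mul_test_le hR hφ hφr zero_le_one (fun y => (hφ1.1 y).2) ht x)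
  · exact (integrable_heatKer hR ht x).indicator Metric.isClosed_closedBall.measurableSet
  · simp only [hf]
    by_cases hy : y ∈ Metric.closedBall (0 : Plane) r
    · rw [indicator_of_mem hy, Pi.mul_apply, hφ1.2 y hy, mul_one]
    · rw [indicator_of_notMem hy]
      exact mul_nonneg (heatKer_nonneg hR ht x y) (hφ1.1 y).1

end heatKer

/-! ### Existence and uniqueness of the Dirichlet heat kernel -/

section heatKernel

variable {R : ℝ} (hR : 0 < R)

lemma integrable_heatKer_smul {F : Type*} [NormedAddCommGroup F] [NormedSpace ℝ F] {ψ : Plane → F}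
    {t : ℝ} (ht : 0 < t) (x : Plane) (hψ : Integrable ψ (discMeasure R)) :
    Integrable (fun y => heatKer hR 2 x y t • ψ y) (discMeasure R) := by
  obtain ⟨C, hC⟩ := (isCompact_closedBall (0 : Plane) R).exists_bound_of_continuousOn
    (continuous_heatKer_right hR 2 ht x).continuousOn
  refine hψ.bdd_smul C (continuous_heatKer_right hR 2 ht x).aestronglyMeasurable ?_
  filter_upwards [ae_restrict_mem Metric.isOpen_ball.measurableSet] with y hy
  exact hC y (Metric.ball_subset_closedBall hy)

lemma norm_integral_heatKer_smul_le {F : Type*} [NormedAddCommGroup F] [NormedSpace ℝ F]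
    {ψ : Plane → F} {t : ℝ} (ht : 0 < t) (x : Plane) {B : ℝ} (hB0 : 0 ≤ B)
    (hB : ∀ᵐ y ∂(discMeasure R), ‖ψ y‖ ≤ B) :
    ‖∫ y, heatKer hR 2 x y t • ψ y ∂(discMeasure R)‖ ≤ B := by
  calc _ ≤ ∫ y, heatKer hR 2 x y t * B ∂(discMeasure R) := by
        refine norm_integral_le_of_norm_le ((integrable_heatKer hR ht x).mul_const B) ?_
        filter_upwards [hB] with y hy
        rw [norm_smul, Real.norm_of_nonneg (heatKer_nonneg hR ht x y)]
        exact mul_le_mul_of_nonneg_left hy (heatKer_nonneg hR ht x y)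
    _ = (∫ y, heatKer hR 2 x y t ∂(discMeasure R)) * B := integral_mul_const _ _
    _ ≤ 1 * B := by gcongr; exact integral_heatKer_le_one hR ht x
    _ = B := one_mul B

/-- Convergence to bounded initial data at points of continuity. -/
lemma tendsto_integral_heatKer_smul {F : Type*} [NormedAddCommGroup F] [NormedSpace ℝ F]
    [CompleteSpace F] {ψ : Plane → F} {x₀ : Plane} (hx₀ : x₀ ∈ Metric.ball (0 : Plane) R)
    (hm : AEStronglyMeasurable ψ (discMeasure R)) {B : ℝ}
    (hB : ∀ y ∈ Metric.ball (0 : Plane) R, ‖ψ y‖ ≤ B) (hψ : ContinuousAt ψ x₀) :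
    Tendsto (fun p : Plane × ℝ => ∫ y, heatKer hR 2 p.1 y p.2 • ψ y ∂(discMeasure R))
      (𝓝 x₀ ×ˢ 𝓝[>] 0) (𝓝 (ψ x₀)) := by
  have hB0 : 0 ≤ B := (norm_nonneg _).trans (hB x₀ hx₀)
  have hψi : Integrable ψ (discMeasure R) := by
    refine Integrable.of_bound hm B ?_
    filter_upwards [ae_restrict_mem Metric.isOpen_ball.measurableSet] with y hy using hB y hy
  rw [Metric.tendsto_nhds]
  intro ε hε
  obtain ⟨r, hr, hrψ⟩ := Metric.eventually_nhds_iff_ball.1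
    ((Metric.tendsto_nhds.1 hψ (ε / 2) (half_pos hε)).and (Metric.isOpen_ball.mem_nhds hx₀))
  -- For `x` within `r/3` of `x₀` the bump equals one at `x`, so it captures kernel mass at least `1
  -- - C t`. This bounds both the missing mass and the mass outside the disc of radius `r`, each by
  -- `C t`.
  let b : ContDiffBump x₀ := ⟨r / 3, r / 2, by positivity, by linarith⟩
  have hbs : tsupport b ⊆ Metric.ball x₀ r := by
    rw [b.tsupport_eq]
    exact Metric.closedBall_subset_ball (by simp [b]; linarith)
  obtain ⟨C, hC0, hC⟩ := exists_abs_integral_heatKer_sub_le hR (φ := b) b.contDiff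
    (hbs.trans fun y hy => (hrψ y hy).2)
  have hlim : Tendsto (fun t : ℝ => ε / 2 + 3 * B * (C * t)) (𝓝[>] 0) (𝓝 (ε / 2)) := by
    have : Continuous fun t : ℝ => ε / 2 + 3 * B * (C * t) := by fun_prop
    exact (this.tendsto' 0 _ (by simp)).mono_left nhdsWithin_le_nhds
  have hev := (Metric.ball_mem_nhds x₀ (by positivity : 0 < r / 3))
  filter_upwards [(eventually_mem_set.2 hev).prod_mk
    ((hlim.eventually (gt_mem_nhds (half_lt_self hε))).and self_mem_nhdsWithin)]
  rintro ⟨x, t⟩ ⟨hx, hlt, ht⟩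
  simp only at ht
  have hx1 : b x = 1 := b.one_of_mem_closedBall (Metric.ball_subset_closedBall hx)
  have hφ := (abs_le.1 (hC t ht x)).1
  rw [hx1] at hφ
  set H : Plane → ℝ := fun y => heatKer hR 2 x y t with hH
  have hHi : Integrable H (discMeasure R) := integrable_heatKer hR ht x
  have hHb : Integrable (fun y => H y * b y) (discMeasure R) :=
    integrable_of_continuous ((continuous_heatKer_right hR 2 ht x).mul b.continuous)
  have hH0 : ∀ y, 0 ≤ H y := heatKer_nonneg hR ht x
  have hm1 : ∫ y, H y ∂(discMeasure R) ≤ 1 := integral_heatKer_le_one hR ht x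
  have hmb : ∫ y, H y * b y ∂(discMeasure R) ≤ ∫ y, H y ∂(discMeasure R) :=
    integral_mono hHb hHi fun y => mul_le_of_le_one_right (hH0 y) b.le_one
  have e : ∫ y, H y • ψ y ∂(discMeasure R) - ψ x₀ = ∫ y, H y • (ψ y - ψ x₀) ∂(discMeasure R) -
      (1 - ∫ y, H y ∂(discMeasure R)) • ψ x₀ := by
    simp only [smul_sub]
    rw [integral_sub (integrable_heatKer_smul hR ht x hψi) (hHi.smul_const _), integral_smul_const,
      sub_smul, one_smul]
    abel
  have h1 : ‖∫ y, H y • (ψ y - ψ x₀) ∂(discMeasure R)‖ ≤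
      ∫ y, (H y * (ε / 2) + 2 * B * (H y - H y * b y)) ∂(discMeasure R) := by
    refine norm_integral_le_of_norm_le ((hHi.mul_const _).add ((hHi.sub hHb).const_mul _)) ?_
    filter_upwards [ae_restrict_mem Metric.isOpen_ball.measurableSet] with y hy
    rw [norm_smul, Real.norm_of_nonneg (hH0 y)]
    have hb1 : 0 ≤ 1 - b y := sub_nonneg.2 b.le_one
    by_cases hyr : y ∈ Metric.ball x₀ r
    · have := (hrψ y hyr).1
      rw [dist_eq_norm] at this
      have h2 : 0 ≤ 2 * B * (H y * (1 - b y)) := by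
        have := hH0 y
        positivity
      nlinarith [hH0 y]
    · have hb0 : b y = 0 := image_eq_zero_of_notMem_tsupport fun h => hyr (hbs h)
      have h2 : ‖ψ y - ψ x₀‖ ≤ 2 * B :=
        (norm_sub_le _ _).trans (by linarith [hB y hy, hB x₀ hx₀])
      rw [hb0]
      nlinarith [hH0 y]
  have h2 : ∫ y, (H y * (ε / 2) + 2 * B * (H y - H y * b y)) ∂(discMeasure R) =
      (∫ y, H y ∂(discMeasure R)) * (ε / 2) + 2 * B * (∫ y, H y ∂(discMeasure R) -
        ∫ y, H y * b y ∂(discMeasure R)) := by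
    rw [← integral_sub hHi hHb, ← integral_const_mul, ← integral_mul_const]
    exact integral_add (hHi.mul_const _) ((hHi.sub hHb).const_mul _)
  rw [h2] at h1
  set m := ∫ y, H y ∂(discMeasure R)
  set mb := ∫ y, H y * b y ∂(discMeasure R)
  have h3 : ‖(1 - m) • ψ x₀‖ ≤ C * t * B := by
    rw [norm_smul, Real.norm_of_nonneg (sub_nonneg.2 hm1)]
    gcongr
    · linarith
    · exact hB x₀ hx₀
  have h4 : 2 * B * (m - mb) ≤ 2 * B * (C * t) := by gcongr; linarith
  have h5 : m * (ε / 2) ≤ 1 * (ε / 2) := by gcongr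
  have h6 := norm_sub_le (∫ y, H y • (ψ y - ψ x₀) ∂(discMeasure R)) ((1 - m) • ψ x₀)
  rw [← e] at h6
  rw [dist_eq_norm]
  simp only at hlt
  refine lt_of_le_of_lt (h6.trans (add_le_add (h1.trans (add_le_add h5 h4)) h3)) ?_
  linarith

/-- Two solutions of the heat equation with the same initial and boundary values agree. -/
lemma heat_unique {R T : ℝ} {a b : Plane → ℝ → ℝ}
    (hca : ContinuousOn (fun p : Plane × ℝ => a p.1 p.2) (Metric.closedBall 0 R ×ˢ Icc 0 T))
    (hcb : ContinuousOn (fun p : Plane × ℝ => b p.1 p.2) (Metric.closedBall 0 R ×ˢ Icc 0 T))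
    (ha2 : ∀ t, 0 < t → ContDiffOn ℝ 2 (fun x => a x t) (Metric.ball 0 R))
    (hb2 : ∀ t, 0 < t → ContDiffOn ℝ 2 (fun x => b x t) (Metric.ball 0 R))
    (ha : ∀ x ∈ Metric.ball (0 : Plane) R, ∀ t, 0 < t →
      HasDerivAt (fun s => a x s) (laplacian (fun z => a z t) x) t)
    (hb : ∀ x ∈ Metric.ball (0 : Plane) R, ∀ t, 0 < t →
      HasDerivAt (fun s => b x s) (laplacian (fun z => b z t) x) t)
    (hinit : ∀ x ∈ Metric.closedBall (0 : Plane) R, a x 0 = b x 0)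
    (hbdry : ∀ x ∈ Metric.sphere (0 : Plane) R, ∀ t, 0 < t → a x t = b x t) :
    ∀ x ∈ Metric.closedBall (0 : Plane) R, ∀ t ∈ Icc 0 T, a x t = b x t := by
  have hlap : ∀ {f g : Plane → ℝ → ℝ},
      (∀ t, 0 < t → ContDiffOn ℝ 2 (fun x => f x t) (Metric.ball 0 R)) →
      (∀ t, 0 < t → ContDiffOn ℝ 2 (fun x => g x t) (Metric.ball 0 R)) →
      (∀ x ∈ Metric.ball (0 : Plane) R, ∀ t, 0 < t →
        HasDerivAt (fun s => f x s) (laplacian (fun z => f z t) x) t) →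
      (∀ x ∈ Metric.ball (0 : Plane) R, ∀ t, 0 < t →
        HasDerivAt (fun s => g x s) (laplacian (fun z => g z t) x) t) →
      ∀ x ∈ Metric.ball (0 : Plane) R, ∀ t, 0 < t → t ≤ T →
        HasDerivAt (fun s => f x s - g x s) (laplacian (fun z => f z t - g z t) x) t := by
    intro f g hf2 hg2 hf hg x hx t ht _
    have hn := Metric.isOpen_ball.mem_nhds hx
    rw [laplacian_fun_sub ((hf2 t ht).contDiffAt hn) ((hg2 t ht).contDiffAt hn)]
    exact (hf x hx t ht).sub (hg x hx t ht)
  intro x hx t ht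
  refine le_antisymm ?_ ?_
  · have := le_zero_of_heat (v := fun x t => a x t - b x t) (hca.sub hcb)
      (fun t ht _ => (ha2 t ht).sub (hb2 t ht)) (hlap ha2 hb2 ha hb)
      (fun x hx => by rw [hinit x hx, sub_self]) (fun x hx t ht _ => by
        rw [hbdry x hx t ht, sub_self]) x hx t ht
    linarith
  · have := le_zero_of_heat (v := fun x t => b x t - a x t) (hcb.sub hca)
      (fun t ht _ => (hb2 t ht).sub (ha2 t ht)) (hlap hb2 ha2 hb ha)
      (fun x hx => by rw [hinit x hx, sub_self]) (fun x hx t ht _ => by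
        rw [hbdry x hx t ht, sub_self]) x hx t ht
    linarith

/-- A continuous function vanishing outside the disc is a uniform limit of test functions. -/
lemma exists_test_approx {f : Plane → ℝ} (hf : Continuous f) (h0 : ∀ x, R ≤ ‖x‖ → f x = 0)
    {ε : ℝ} (hε : 0 < ε) :
    ∃ φ : Plane → ℝ, ContDiff ℝ ∞ φ ∧ tsupport φ ⊆ Metric.ball 0 R ∧ ∀ x, |f x - φ x| ≤ ε := by
  -- The truncation costs `4 κ` and the smooth approximation `κ`.
  set κ := ε / 5 with hκ
  have hκ0 : 0 < κ := by positivity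
  set g : Plane → ℝ := fun x => softPlus κ (f x) - softPlus κ (-f x) with hg
  have hsc := (contDiff_softPlus hκ0).continuous
  have hgc : Continuous g := (hsc.comp hf).sub (hsc.comp hf.neg)
  have hgf : ∀ x, |f x - g x| ≤ 4 * κ := by
    intro x
    have h1 := abs_le.1 (abs_softPlus_sub_le hκ0.le (f x))
    have h2 := abs_le.1 (abs_softPlus_sub_le hκ0.le (-f x))
    have h3 : max (f x) 0 - max (-f x) 0 = f x := by
      rcases le_total (f x) 0 with h | h
      · rw [max_eq_right h, max_eq_left (by linarith)]; ring
      · rw [max_eq_left h, max_eq_right (by linarith)]; ring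
    simp only [hg]
    rw [abs_le]
    constructor <;> linarith [h1.1, h1.2, h2.1, h2.2]
  have hgs : tsupport g ⊆ Metric.ball 0 R := by
    have h1 : IsClosed {x | κ ≤ |f x|} := isClosed_le continuous_const hf.abs
    refine (closure_minimal (fun x hx => ?_) h1).trans fun x hx => ?_
    · by_contra h
      rw [mem_ofPred_eq, not_le, abs_lt] at h
      refine hx ?_
      simp only [hg]
      rw [softPlus_eq_zero h.2.le, softPlus_eq_zero (by linarith [h.1]), sub_zero]
    · by_contra h
      rw [mem_ball_zero_iff, not_lt] at h
      rw [mem_ofPred_eq, h0 x h, abs_zero] at hx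
      linarith
  obtain ⟨φ, hφ, hd, hsup⟩ := hgc.exists_contDiff_approx (ε := fun _ => κ) ⊤ continuous_const
    fun _ => hκ0
  refine ⟨φ, hφ, (closure_mono hsup).trans hgs, fun x => ?_⟩
  have h1 := hd x
  rw [Real.dist_eq, abs_lt] at h1
  have h2 := abs_le.1 (hgf x)
  rw [abs_le]
  constructor <;> linarith [h1.1, h1.2, h2.1, h2.2]

/-- Uniform convergence to continuous initial data vanishing outside the disc. -/
lemma exists_abs_integral_heatKer_sub_le_add {f : Plane → ℝ} (hf : Continuous f)
    (h0 : ∀ x, R ≤ ‖x‖ → f x = 0) {ε : ℝ} (hε : 0 < ε) :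
    ∃ C, 0 ≤ C ∧ ∀ t, 0 < t → ∀ x,
      |∫ y, heatKer hR 2 x y t * f y ∂(discMeasure R) - f x| ≤ ε + C * t := by
  obtain ⟨φ, hφ, hs, hfφ⟩ := exists_test_approx hf h0 (half_pos hε)
  obtain ⟨C, hC0, hC⟩ := exists_abs_integral_heatKer_sub_le hR hφ hs
  refine ⟨C, hC0, fun t ht x => ?_⟩
  have h1 := norm_integral_heatKer_smul_le hR ht x (half_pos hε).le (ψ := fun y => f y - φ y)
    (Eventually.of_forall hfφ)
  have hi := integrable_heatKer_smul hR ht x (integrable_of_continuous hf)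
  have hi' := integrable_heatKer_smul hR ht x (integrable_of_continuous hφ.continuous)
  simp only [smul_eq_mul] at h1 hi hi'
  simp only [mul_sub] at h1
  rw [integral_sub hi hi', Real.norm_eq_abs] at h1
  have h2 := abs_le.1 (hC t ht x)
  have h3 := abs_le.1 (hfφ x)
  have h4 := abs_le.1 h1
  rw [abs_le]
  constructor <;> linarith [h2.1, h2.2, h3.1, h3.2, h4.1, h4.2]

lemma isDirichletHeatKernel_heatKer : IsDirichletHeatKernel R (heatKer hR 2) where
  continuousOn := (continuousOn_heatKer_comp hR 2 continuous_fst
    (continuous_fst.comp continuous_snd) (continuous_snd.comp continuous_snd)).mono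
    fun p hp => hp.2.2
  contDiffOn := fun y _ t ht => contDiffOn_heatKer hR 2 y ht
  heat_eq := fun x hx y _ t ht => by
    rw [laplacian_heatKer hR 2 hx y ht]
    exact hasDerivAt_heatKer hR 2 x y ht
  boundary := fun x hx y _ t _ => heatKer_eq_zero_left hR 2 (mem_sphere_zero_iff_norm.1 hx).ge y t
  initial := fun y hy f hf => by
    obtain ⟨B, hB⟩ := (isCompact_closedBall (0 : Plane) R).exists_bound_of_continuousOn
      hf.continuousOn
    have h := tendsto_integral_heatKer_smul hR hy hf.aestronglyMeasurable
      (fun z hz => hB z (Metric.ball_subset_closedBall hz)) hf.continuousAt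
    have h2 := h.comp (tendsto_const_nhds.prodMk tendsto_id : Tendsto (fun t : ℝ => (y, t))
      (𝓝[>] 0) (𝓝 y ×ˢ 𝓝[>] 0))
    refine h2.congr fun t => ?_
    simp only [Function.comp, smul_eq_mul, heatKer_symm hR 2 y]

/-- The evolution of the values of a heat kernel. -/
lemma IsDirichletHeatKernel.eq_integral {G : Plane → Plane → ℝ → ℝ}
    (hG : IsDirichletHeatKernel R G) {y : Plane} (hy : y ∈ Metric.ball (0 : Plane) R) {τ t : ℝ}
    (hτ : 0 < τ) (ht : 0 < t) {x : Plane} (hx : x ∈ Metric.ball (0 : Plane) R) :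
    G x y (τ + t) = ∫ z in Metric.ball (0 : Plane) R, heatKer hR 2 x z t * G z y τ := by
  have hyc := Metric.ball_subset_closedBall hy
  have hcont : ContinuousOn (fun p : Plane × ℝ => G p.1 y (τ + p.2))
      (Metric.closedBall 0 R ×ˢ Icc 0 t) := by
    refine hG.continuousOn.comp (f := fun p : Plane × ℝ => (p.1, y, τ + p.2)) (by fun_prop) ?_
    rintro ⟨z, s⟩ ⟨hz, hs⟩
    exact ⟨hz, hyc, by simp only [mem_Ioi]; linarith [hs.1]⟩
  -- Since `G` vanishes on the boundary circle, its slice at time `τ` extended by zero is continuous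
  -- and can serve as initial value for the constructed kernel; both evolutions then agree by
  -- uniqueness.
  set f : Plane → ℝ := indicator (Metric.ball 0 R) fun z => G z y τ with hf
  have hfeq : ∀ z ∈ Metric.closedBall (0 : Plane) R, f z = G z y τ := by
    intro z hz
    by_cases h : z ∈ Metric.ball (0 : Plane) R
    · rw [hf, indicator_of_mem h]
    · rw [hf, indicator_of_notMem h]
      refine (hG.boundary z ?_ y hy τ hτ).symm
      rw [mem_ball_zero_iff, not_lt] at h
      exact mem_sphere_zero_iff_norm.2 (le_antisymm (mem_closedBall_zero_iff.1 hz) h)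
  have hfc : Continuous f := by
    refine continuous_indicator (fun z hz => ?_) ?_
    · rw [frontier_ball _ hR.ne'] at hz
      exact hG.boundary z hz y hy τ hτ
    · rw [closure_ball _ hR.ne']
      refine hG.continuousOn.comp (f := fun z : Plane => (z, y, τ)) (by fun_prop) ?_
      exact fun z hz => ⟨hz, hyc, hτ⟩
  have hf0 : ∀ z, R ≤ ‖z‖ → f z = 0 := fun z hz => indicator_of_notMem (by simpa using hz) _
  set b : Plane → ℝ → ℝ := fun z s =>
    if s ≤ 0 then f z else (heatApply hR 1 s (contVec R hfc) z).re with hb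
  have hbpos : ∀ z s, 0 < s → b z s = (heatApply hR 1 s (contVec R hfc) z).re :=
    fun z s hs => by simp [hb, not_le.2 hs]
  have hb0 : ∀ z, b z 0 = f z := fun z => by simp [hb]
  have hbc : ContinuousOn (fun p : Plane × ℝ => b p.1 p.2) (Metric.closedBall 0 R ×ˢ Icc 0 t) := by
    rintro ⟨z, s⟩ ⟨-, hs⟩
    rcases hs.1.eq_or_lt with h | h
    · simp only at h
      subst h
      rw [ContinuousWithinAt, Metric.tendsto_nhds]
      intro ε hε
      obtain ⟨C, hC0, hC⟩ := exists_abs_integral_heatKer_sub_le_add hR hfc hf0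
        (by positivity : 0 < ε / 3)
      have h1 : ∀ᶠ p : Plane × ℝ in 𝓝 (z, 0), C * p.2 < ε / 3 := by
        have : Continuous fun p : Plane × ℝ => C * p.2 := by fun_prop
        refine (this.tendsto' (z, 0) 0 (by simp)).eventually (gt_mem_nhds (by positivity))
      have h2 : ∀ᶠ p : Plane × ℝ in 𝓝 (z, 0), dist (f p.1) (f z) < ε / 3 :=
        Metric.tendsto_nhds.1 ((hfc.comp continuous_fst).tendsto (z, (0 : ℝ))) _ (by positivity)
      filter_upwards [nhdsWithin_le_nhds h1, nhdsWithin_le_nhds h2, self_mem_nhdsWithin]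
      rintro ⟨w, s⟩ h1 h2 ⟨-, hs⟩
      simp only [hb0] at h1 h2 ⊢
      rcases hs.1.eq_or_lt with h | h
      · simp only at h
        rw [← h, hb0]
        linarith
      · have h3 := hC s h w
        rw [integral_heatKer_mul_test hR h hfc, ← hbpos w s h, ← Real.dist_eq] at h3
        have := dist_triangle (b w s) (f w) (f z)
        linarith
    · refine ContinuousAt.continuousWithinAt ?_
      have h1 := continuousOn_heatApply_comp hR 1 (continuous_fst (X := Plane) (Y := ℝ))
        (continuous_const (y := contVec R hfc)) (continuous_snd (X := Plane) (Y := ℝ))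
      have hmem : {p : Plane × ℝ | 0 < p.2} ∈ 𝓝 (z, s) :=
        (isOpen_lt continuous_const continuous_snd).mem_nhds h
      refine (Complex.continuous_re.continuousAt.comp (h1.continuousAt hmem)).congr ?_
      filter_upwards [hmem] with p hp using (hbpos _ _ hp).symm
  have key := heat_unique (a := fun z s => G z y (τ + s)) (b := b) hcont hbc ?_ ?_ ?_ ?_ ?_ ?_ x
    (Metric.ball_subset_closedBall hx) t ⟨ht.le, le_rfl⟩
  · rw [key, hbpos x t ht, ← integral_heatKer_mul_test hR ht hfc]
    refine setIntegral_congr_fun Metric.isOpen_ball.measurableSet fun z hz => ?_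
    simp only [hfeq z (Metric.ball_subset_closedBall hz)]
  · exact fun s hs => hG.contDiffOn y hy (τ + s) (by positivity)
  · intro s hs
    simp only [hbpos _ s hs]
    exact (contDiffOn_clm_heatApply hR Complex.reCLM 1 hs _).1
  · intro z hz s hs
    have := hG.heat_eq z hz y hy (τ + s) (by positivity)
    simpa using HasDerivAt.comp_const_add τ s this
  · intro z hz s hs
    have e : (fun z => b z s) = fun z => Complex.reCLM (heatApply hR 1 s (contVec R hfc) z) :=
      funext fun z => hbpos z s hs
    rw [e]
    refine (hasDerivAt_clm_heatApply hR Complex.reCLM 1 hs _ hz).congr_of_eventuallyEq ?_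
    filter_upwards [lt_mem_nhds hs] with r hr using hbpos z r hr
  · intro z hz
    simp only [hb0, add_zero, hfeq z hz]
  · intro z hz s hs
    rw [hG.boundary z hz y hy _ (by positivity), hbpos z s hs,
      heatApply_eq_zero hR _ _ _ (mem_sphere_zero_iff_norm.1 hz).ge, Complex.zero_re]

/-- Uniqueness of the Dirichlet heat kernel. -/
lemma IsDirichletHeatKernel.eq_heatKer {G : Plane → Plane → ℝ → ℝ}
    (hG : IsDirichletHeatKernel R G) {x y : Plane} (hx : x ∈ Metric.ball (0 : Plane) R)
    (hy : y ∈ Metric.ball (0 : Plane) R) {t : ℝ} (ht : 0 < t) :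
    G x y t = heatKer hR 2 x y t := by
  have h1 : Tendsto (fun τ => G x y (τ + t)) (𝓝[>] 0) (𝓝 (G x y t)) := by
    have hd : HasDerivAt (fun s => G x y s) _ t := hG.heat_eq x hx y hy t ht
    have hc : Tendsto (fun τ : ℝ => τ + t) (𝓝[>] 0) (𝓝 t) :=
      ((by fun_prop : Continuous fun τ : ℝ => τ + t).tendsto' 0 t (by simp)).mono_left
        nhdsWithin_le_nhds
    exact hd.continuousAt.tendsto.comp hc
  -- The initial condition of `G` is tested with the constructed kernel itself: as `τ → 0` the
  -- integral formula tends to that kernel, while `G x y (τ + t)` tends to `G x y t`.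
  have h2 := hG.initial y hy (fun z => heatKer hR 2 x z t) (continuous_heatKer_right hR 2 ht x)
  refine tendsto_nhds_unique h1 (h2.congr' ?_)
  filter_upwards [self_mem_nhdsWithin] with τ hτ
  rw [hG.eq_integral hR hy hτ ht hx]
  simp only [mul_comm]

/-- The choice behind `heatKernel` is legitimate because `heatKer hR 2` has the required properties,
and uniqueness then identifies the two for interior points and positive times. -/
lemma heatKernel_eq {x y : Plane} (hx : x ∈ Metric.ball (0 : Plane) R)
    (hy : y ∈ Metric.ball (0 : Plane) R) {t : ℝ} (ht : 0 < t) :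
    heatKernel R x y t = heatKer hR 2 x y t :=
  IsDirichletHeatKernel.eq_heatKer hR
    (Classical.epsilon_spec ⟨_, isDirichletHeatKernel_heatKer hR⟩) hx hy ht

end heatKernel

/-! ### A supersolution inequality for the heat kernel -/

section supersolution

variable {R : ℝ} (hR : 0 < R)

/-- Space-time measure on the product of the time interval `(0, t]` and the disc. -/
abbrev spaceTime (R t : ℝ) : Measure (ℝ × Plane) :=
  (volume.restrict (Ioc 0 t)).prod (discMeasure R)

lemma spaceTime_eq (R t : ℝ) :
    spaceTime R t = (volume : Measure (ℝ × Plane)).restrict (Ioc 0 t ×ˢ Metric.ball 0 R) :=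
  Measure.prod_restrict _ _

lemma measurableSet_spaceTime (R t : ℝ) :
    MeasurableSet (Ioc (0 : ℝ) t ×ˢ Metric.ball (0 : Plane) R) :=
  measurableSet_Ioc.prod Metric.isOpen_ball.measurableSet

lemma ae_spaceTime (R t : ℝ) :
    ∀ᵐ p ∂(spaceTime R t), p.1 ∈ Ioc 0 t ∧ p.2 ∈ Metric.ball (0 : Plane) R := by
  rw [spaceTime_eq]
  exact ae_restrict_mem (measurableSet_spaceTime R t)

lemma aestronglyMeasurable_heatKer (k : ℕ) (x : Plane) (t : ℝ) :
    AEStronglyMeasurable (fun p : ℝ × Plane => heatKer hR k x p.2 p.1) (spaceTime R t) := by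
  rw [spaceTime_eq]
  refine ContinuousOn.aestronglyMeasurable ?_ (measurableSet_spaceTime R t)
  exact (continuousOn_heatKer_comp hR k continuous_const continuous_snd continuous_fst).mono
    fun p hp => hp.1.1

lemma continuous_softPlus {κ : ℝ} (hκ : 0 < κ) : Continuous (softPlus κ) :=
  (contDiff_softPlus hκ).continuous

lemma integrable_bdd_mul {f g : Plane → ℝ} (hg : Continuous g)
    (hf : ContinuousOn f (Metric.ball 0 R)) {B : ℝ}
    (hB : ∀ y ∈ Metric.ball (0 : Plane) R, |f y| ≤ B) :
    Integrable (fun y => g y * f y) (discMeasure R) := by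
  have hfi : Integrable f (discMeasure R) := by
    refine Integrable.of_bound (hf.aestronglyMeasurable Metric.isOpen_ball.measurableSet) B ?_
    filter_upwards [ae_restrict_mem Metric.isOpen_ball.measurableSet] with y hy using hB y hy
  obtain ⟨C, hC⟩ := (isCompact_closedBall (0 : Plane) R).exists_bound_of_continuousOn
    hg.continuousOn
  refine hfi.bdd_mul (c := C) hg.aestronglyMeasurable ?_
  filter_upwards [ae_restrict_mem Metric.isOpen_ball.measurableSet] with y hy
  exact hC y (Metric.ball_subset_closedBall hy)

/-- The truncated kernel tested against a nonnegative function. -/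
lemma integral_softPlusDeriv_mul_le {κ : ℝ} (hκ : 0 < κ) {f : Plane → ℝ} {B : ℝ}
    (hf : ContDiffOn ℝ 2 f (Metric.ball 0 R))
    (h0 : ∀ y ∈ Metric.ball (0 : Plane) R, 0 ≤ f y)
    (hB : ∀ y ∈ Metric.ball (0 : Plane) R, |f y| ≤ B) (x : Plane) {r : ℝ} (hr : 0 < r) :
    ∫ y, softPlusDeriv κ (heatKer hR 2 x y r) * -heatKer hR 3 x y r * f y ∂(discMeasure R) ≤
      ∫ y, softPlus κ (heatKer hR 2 x y r) * laplacian f y ∂(discMeasure R) := by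
  set u : Plane → ℝ := fun y => heatKer hR 2 x y r with hu
  have huc : Continuous u := continuous_heatKer_right hR 2 hr x
  have hu0 : ∀ y, R ≤ ‖y‖ → u y = 0 := fun y hy => heatKer_eq_zero_right hR 2 x hy r
  have husymm : u = fun y => heatKer hR 2 y x r := funext fun y => heatKer_symm hR 2 x y r
  have hu2 : ContDiffOn ℝ 2 u (Metric.ball 0 R) := husymm ▸ contDiffOn_heatKer hR 2 x hr
  have hulap : ∀ y ∈ Metric.ball (0 : Plane) R, laplacian u y = -heatKer hR 3 x y r := by
    intro y hy
    rw [husymm, laplacian_heatKer hR 2 hy x hr, heatKer_symm]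
  set a : Plane → ℝ := fun y => softPlus κ (u y) with ha
  have ha2 : ContDiff ℝ 2 a := contDiff_softPlus_comp hκ huc hu0 hu2
  have has : tsupport a ⊆ Metric.ball 0 R := tsupport_softPlus_subset_ball hκ huc hu0
  have hac := hasCompactSupport_of_subset_ball has
  have h := integral_mul_laplacian_comm Metric.isOpen_ball ha2 hac has hf
  have e1 : ∫ y, a y * laplacian f y ∂(discMeasure R) = ∫ y, a y * laplacian f y :=
    setIntegral_eq_integral_of_forall_compl_eq_zero fun y hy => by
      rw [image_eq_zero_of_notMem_tsupport (f := a) fun h => hy (has h), zero_mul]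
  have e2 : ∫ y, laplacian a y * f y ∂(discMeasure R) = ∫ y, laplacian a y * f y :=
    setIntegral_eq_integral_of_forall_compl_eq_zero fun y hy => by
      rw [image_eq_zero_of_notMem_tsupport (f := laplacian a)
        fun h => hy (has (tsupport_laplacian_subset a h)), zero_mul]
  rw [e1, h, ← e2]
  have hlc : Continuous (laplacian a) := by
    rw [← continuousOn_univ]
    exact continuousOn_laplacian isOpen_univ ha2.contDiffOn
  have hgc : Continuous fun y => softPlusDeriv κ (u y) * -heatKer hR 3 x y r :=
    ((continuous_softPlusDeriv hκ).comp huc).mul (continuous_heatKer_right hR 3 hr x).neg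
  refine setIntegral_mono_on (integrable_bdd_mul hgc hf.continuousOn hB)
    (integrable_bdd_mul hlc hf.continuousOn hB) Metric.isOpen_ball.measurableSet fun y hy => ?_
  refine mul_le_mul_of_nonneg_right ?_ (h0 y hy)
  -- Convexity of `softPlus`: the term with the squared gradient is nonnegative and is dropped.
  rw [ha, laplacian_comp (contDiff_softPlus hκ).contDiffAt
    ((hu2 y hy).contDiffAt (Metric.isOpen_ball.mem_nhds hy)), ← hulap y hy, deriv_softPlus hκ,
    ← deriv_softPlus hκ]
  exact le_add_of_nonneg_left (mul_nonneg (deriv_deriv_softPlus_nonneg hκ _)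
    (Finset.sum_nonneg fun i _ => sq_nonneg _))

/-- Differentiation under the integral sign: near `r > 0` the time derivative of the kernel is
bounded, and the slope of `softPlus` is at most one. -/
lemma hasDerivAt_integral_softPlus {κ : ℝ} (hκ : 0 < κ) {f : Plane → ℝ} {B : ℝ}
    (hf : ContinuousOn f (Metric.ball 0 R))
    (hB : ∀ y ∈ Metric.ball (0 : Plane) R, |f y| ≤ B) (x : Plane) {r : ℝ} (hr : 0 < r) :
    HasDerivAt (fun r => ∫ y, softPlus κ (heatKer hR 2 x y r) * f y ∂(discMeasure R))
      (∫ y, softPlusDeriv κ (heatKer hR 2 x y r) * -heatKer hR 3 x y r * f y ∂(discMeasure R))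
      r := by
  have hc3 := (continuousOn_heatKer_comp hR 3 (continuous_const (y := x))
    (continuous_snd (X := ℝ) (Y := Plane)) continuous_fst)
  obtain ⟨C, hC⟩ := (isCompact_Icc.prod (isCompact_closedBall (0 : Plane)
    R)).exists_bound_of_continuousOn (s := Icc (r / 2) (2 * r) ×ˢ Metric.closedBall (0 : Plane) R)
    (hc3.mono fun p hp => (half_pos hr).trans_le hp.1.1)
  have hB0 : 0 ≤ B := (abs_nonneg _).trans (hB 0 (by simpa using hR))
  have hfm := hf.aestronglyMeasurable (μ := volume) Metric.isOpen_ball.measurableSet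
  refine (hasDerivAt_integral_of_dominated_loc_of_deriv_le (bound := fun _ => C * B)
    (F' := fun r y => softPlusDeriv κ (heatKer hR 2 x y r) * -heatKer hR 3 x y r * f y)
    (Icc_mem_nhds (half_lt_self hr) (by linarith : r < 2 * r)) ?_ ?_ ?_ ?_
    (integrable_const _) ?_).2
  · filter_upwards [lt_mem_nhds hr] with s hs
    exact ((continuous_softPlus hκ).comp
      (continuous_heatKer_right hR 2 hs x)).aestronglyMeasurable.mul hfm
  · exact integrable_bdd_mul ((continuous_softPlus hκ).comp
      (continuous_heatKer_right hR 2 hr x)) hf hB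
  · exact (((continuous_softPlusDeriv hκ).comp (continuous_heatKer_right hR 2 hr x)).mul
      (continuous_heatKer_right hR 3 hr x).neg).aestronglyMeasurable.mul hfm
  · filter_upwards [ae_restrict_mem Metric.isOpen_ball.measurableSet] with y hy s hs
    have h1 := hC (s, y) ⟨hs, Metric.ball_subset_closedBall hy⟩
    have h2 : ‖softPlusDeriv κ (heatKer hR 2 x y s)‖ ≤ 1 := by
      rw [Real.norm_of_nonneg (softPlusDeriv_nonneg hκ _)]
      exact softPlusDeriv_le_one κ _
    rw [norm_mul, norm_mul, norm_neg]
    rw [← one_mul C]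
    exact mul_le_mul (mul_le_mul h2 h1 (norm_nonneg _) zero_le_one) (hB y hy) (norm_nonneg _)
      (by simpa using (norm_nonneg _).trans h1)
  · refine Eventually.of_forall fun y s hs => ?_
    have hs0 : 0 < s := (half_pos hr).trans_le hs.1
    exact ((hasDerivAt_softPlus hκ _).comp s (hasDerivAt_heatKer hR 2 x y hs0)).mul_const _

lemma intervalIntegrable_of_bdd {g : ℝ → ℝ} {t B : ℝ}
    (hm : AEStronglyMeasurable g (volume.restrict (Ioc 0 t))) (hB : ∀ r ∈ Ioc 0 t, |g r| ≤ B) :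
    IntegrableOn g (Ioc 0 t) := by
  refine Integrable.of_bound hm B ?_
  filter_upwards [ae_restrict_mem measurableSet_Ioc] with r hr using hB r hr

lemma aestronglyMeasurable_integral_heatKer {β : ℝ → ℝ} (hβ : Continuous β) {g : Plane → ℝ}
    (hg : AEStronglyMeasurable g (discMeasure R)) (lam : ℝ) (x : Plane) (t : ℝ) :
    AEStronglyMeasurable
      (fun r => Real.exp (-(lam * r)) * ∫ y, β (heatKer hR 2 x y r) * g y ∂(discMeasure R))
      (volume.restrict (Ioc 0 t)) := by
  have h1 : AEStronglyMeasurable (fun p : ℝ × Plane => β (heatKer hR 2 x p.2 p.1) * g p.2)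
      (spaceTime R t) :=
    (hβ.comp_aestronglyMeasurable (aestronglyMeasurable_heatKer hR 2 x t)).mul hg.comp_snd
  exact (by fun_prop : Continuous fun r : ℝ =>
    Real.exp (-(lam * r))).aestronglyMeasurable.mul h1.integral_prod_right'

lemma abs_integral_le_of_le_heatKer {β : ℝ → ℝ} (hβ : ∀ s, 0 ≤ s → 0 ≤ β s ∧ β s ≤ s)
    {g : Plane → ℝ} {N : ℝ} (hN0 : 0 ≤ N) (hN : ∀ y ∈ Metric.ball (0 : Plane) R, |g y| ≤ N)
    {lam : ℝ} (hl : 0 ≤ lam) (x : Plane) {r : ℝ} (hr : 0 < r) :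
    |Real.exp (-(lam * r)) * ∫ y, β (heatKer hR 2 x y r) * g y ∂(discMeasure R)| ≤ N := by
  have h1 : |∫ y, β (heatKer hR 2 x y r) * g y ∂(discMeasure R)| ≤ 1 * N := by
    rw [← Real.norm_eq_abs]
    refine (norm_integral_le_of_norm_le ((integrable_heatKer hR hr x).mul_const N) ?_).trans ?_
    · filter_upwards [ae_restrict_mem Metric.isOpen_ball.measurableSet] with y hy
      have h := hβ _ (heatKer_nonneg hR hr x y)
      rw [norm_mul, Real.norm_of_nonneg h.1]
      exact mul_le_mul h.2 (hN y hy) (norm_nonneg _) (heatKer_nonneg hR hr x y)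
    · rw [integral_mul_const]
      gcongr
      exact integral_heatKer_le_one hR hr x
  rw [abs_mul, abs_of_pos (Real.exp_pos _)]
  have h2 : Real.exp (-(lam * r)) ≤ 1 := Real.exp_le_one_iff.2 (by simp; positivity)
  calc _ ≤ 1 * (1 * N) := mul_le_mul h2 h1 (abs_nonneg _) zero_le_one
    _ = N := by ring

lemma tendsto_integral_heatKer_mul_time {f : Plane → ℝ} {B : ℝ}
    (hf : ContinuousOn f (Metric.ball 0 R)) (hB : ∀ y ∈ Metric.ball (0 : Plane) R, |f y| ≤ B)
    {x : Plane} (hx : x ∈ Metric.ball (0 : Plane) R) :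
    Tendsto (fun τ => ∫ y, heatKer hR 2 x y τ * f y ∂(discMeasure R)) (𝓝[>] 0) (𝓝 (f x)) := by
  have h := tendsto_integral_heatKer_smul hR hx
    (hf.aestronglyMeasurable Metric.isOpen_ball.measurableSet) hB
    (hf.continuousAt (Metric.isOpen_ball.mem_nhds hx))
  simp only [smul_eq_mul] at h
  exact Tendsto.comp (f := fun t : ℝ => (x, t)) h (tendsto_const_nhds.prodMk tendsto_id)

lemma tendsto_primitive_left {g : ℝ → ℝ} {t : ℝ} (ht : 0 < t) (hg : IntegrableOn g (Ioc 0 t)) :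
    Tendsto (fun τ => ∫ r in τ..t, g r) (𝓝[>] 0) (𝓝 (∫ r in (0 : ℝ)..t, g r)) := by
  have h1 : IntegrableOn g (uIcc t 0) := by
    rwa [uIcc_of_ge ht.le, integrableOn_Icc_iff_integrableOn_Ioc]
  have h2 := (intervalIntegral.continuousOn_primitive_interval h1) 0 right_mem_uIcc
  rw [uIcc_of_ge ht.le] at h2
  have hle : 𝓝[>] (0 : ℝ) ≤ 𝓝[Icc 0 t] 0 :=
    nhdsWithin_le_of_mem (mem_of_superset (Ioo_mem_nhdsGT ht) Ioo_subset_Icc_self)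
  have h3 := h2.tendsto.neg.mono_left hle
  simpa only [← intervalIntegral.integral_symm] using h3

set_option maxHeartbeats 800000 in
/-- A nonnegative function `f` dominates the discounted evolution with source `λ f - Δ f`. -/
theorem heatKer_supersolution {f : Plane → ℝ} {B N : ℝ}
    (hf : ContDiffOn ℝ 2 f (Metric.ball 0 R))
    (h0 : ∀ y ∈ Metric.ball (0 : Plane) R, 0 ≤ f y)
    (hB : ∀ y ∈ Metric.ball (0 : Plane) R, |f y| ≤ B)
    (hN : ∀ y ∈ Metric.ball (0 : Plane) R, |laplacian f y| ≤ N) {lam : ℝ} (hl : 0 ≤ lam)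
    {x : Plane} (hx : x ∈ Metric.ball (0 : Plane) R) {t : ℝ} (ht : 0 < t) :
    Real.exp (-(lam * t)) * ∫ y, heatKer hR 2 x y t * f y ∂(discMeasure R) +
      ∫ r in (0 : ℝ)..t, Real.exp (-(lam * r)) *
        ∫ y, heatKer hR 2 x y r * (lam * f y - laplacian f y) ∂(discMeasure R) ≤ f x := by
  have hmem0 : (0 : Plane) ∈ Metric.ball (0 : Plane) R := by simpa using hR
  have hB0 : 0 ≤ B := (abs_nonneg _).trans (hB 0 hmem0)
  have hN0 : 0 ≤ N := (abs_nonneg _).trans (hN 0 hmem0)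
  set g : Plane → ℝ := fun y => lam * f y - laplacian f y with hg
  have hgc : ContinuousOn g (Metric.ball 0 R) :=
    (continuousOn_const.mul hf.continuousOn).sub (continuousOn_laplacian Metric.isOpen_ball hf)
  have hgm := hgc.aestronglyMeasurable (μ := volume) Metric.isOpen_ball.measurableSet
  have hgb : ∀ y ∈ Metric.ball (0 : Plane) R, |g y| ≤ lam * B + N := by
    intro y hy
    refine (abs_sub _ _).trans (add_le_add ?_ (hN y hy))
    rw [abs_mul, abs_of_nonneg hl]
    exact mul_le_mul_of_nonneg_left (hB y hy) hl
  have hgN : 0 ≤ lam * B + N := by positivity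
  have hgi : Integrable g (discMeasure R) := by
    refine Integrable.of_bound hgm (lam * B + N) ?_
    filter_upwards [ae_restrict_mem Metric.isOpen_ball.measurableSet] with y hy using hgb y hy
  have hfi : Integrable f (discMeasure R) := by
    refine Integrable.of_bound
      (hf.continuousOn.aestronglyMeasurable Metric.isOpen_ball.measurableSet) B ?_
    filter_upwards [ae_restrict_mem Metric.isOpen_ball.measurableSet] with y hy using hB y hy
  have hsp : ∀ κ, 0 < κ → ∀ s : ℝ, 0 ≤ s → 0 ≤ softPlus κ s ∧ softPlus κ s ≤ s := fun κ hκ s hs =>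
    ⟨softPlus_nonneg κ s, (softPlus_le hκ.le s).trans_eq (max_eq_left hs)⟩
  have hmint : ∀ κ, 0 < κ → IntegrableOn (fun r => Real.exp (-(lam * r)) *
      ∫ y, softPlus κ (heatKer hR 2 x y r) * g y ∂(discMeasure R)) (Ioc 0 t) := fun κ hκ =>
    intervalIntegrable_of_bdd (aestronglyMeasurable_integral_heatKer hR (continuous_softPlus hκ)
      hgm lam x t) fun r hr => abs_integral_le_of_le_heatKer hR (hsp κ hκ) hgN hgb hl x hr.1
  have hint : IntegrableOn (fun r => Real.exp (-(lam * r)) *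
      ∫ y, heatKer hR 2 x y r * g y ∂(discMeasure R)) (Ioc 0 t) :=
    intervalIntegrable_of_bdd (aestronglyMeasurable_integral_heatKer hR continuous_id hgm lam x t)
      fun r hr => abs_integral_le_of_le_heatKer hR (fun s hs => ⟨hs, le_rfl⟩) hgN hgb hl x hr.1
  have hmax : ∀ r, 0 < r → ∀ k : Plane → ℝ, (∫ y, max (heatKer hR 2 x y r) 0 * k y
      ∂(discMeasure R)) = ∫ y, heatKer hR 2 x y r * k y ∂(discMeasure R) := fun r hr k => by
    simp only [max_eq_left (heatKer_nonneg hR hr x _)]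
  have hlimκ : ∀ r, 0 < r → ∀ k : Plane → ℝ, Integrable k (discMeasure R) →
      Tendsto (fun κ => ∫ y, softPlus κ (heatKer hR 2 x y r) * k y ∂(discMeasure R)) (𝓝[>] 0)
        (𝓝 (∫ y, heatKer hR 2 x y r * k y ∂(discMeasure R))) := fun r hr k hk => by
    rw [← hmax r hr]
    exact tendsto_integral_softPlus_mul (continuous_heatKer_right hR 2 hr x) hk
  -- The discounted integral of `softPlus κ (H) f` decreases at least as fast as its source term
  -- requires. Truncating `H` is what permits integration by parts, as `f` need not vanish on the
  -- boundary.
  have stepA : ∀ κ, 0 < κ → ∀ τ, 0 < τ → τ ≤ t →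
      Real.exp (-(lam * t)) * ∫ y, softPlus κ (heatKer hR 2 x y t) * f y ∂(discMeasure R) -
      Real.exp (-(lam * τ)) * ∫ y, softPlus κ (heatKer hR 2 x y τ) * f y ∂(discMeasure R) ≤
      ∫ r in τ..t, -(Real.exp (-(lam * r)) *
        ∫ y, softPlus κ (heatKer hR 2 x y r) * g y ∂(discMeasure R)) := by
    intro κ hκ τ hτ hτt
    have hd : ∀ r, 0 < r → HasDerivAt (fun r => Real.exp (-(lam * r)) *
        ∫ y, softPlus κ (heatKer hR 2 x y r) * f y ∂(discMeasure R)) _ r := fun r hr =>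
      (((hasDerivAt_id r).const_mul lam).neg.exp).mul
        (hasDerivAt_integral_softPlus hR hκ hf.continuousOn hB x hr)
    refine intervalIntegral.sub_le_integral_of_hasDeriv_right_of_le hτt
      (fun r hr => (hd r (hτ.trans_le hr.1)).continuousAt.continuousWithinAt)
      (fun r hr => (hd r (hτ.trans hr.1)).hasDerivWithinAt) ?_ fun r hr => ?_
    · exact ((hmint κ hκ).mono_set fun r hr => ⟨hτ.trans_le hr.1, hr.2⟩).neg
    · have hr0 : 0 < r := hτ.trans hr.1
      have h1 := integral_softPlusDeriv_mul_le hR hκ hf h0 hB x hr0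
      have hc : Continuous fun y => softPlus κ (heatKer hR 2 x y r) :=
        (continuous_softPlus hκ).comp (continuous_heatKer_right hR 2 hr0 x)
      have h2 : ∫ y, softPlus κ (heatKer hR 2 x y r) * g y ∂(discMeasure R) =
          lam * ∫ y, softPlus κ (heatKer hR 2 x y r) * f y ∂(discMeasure R) -
          ∫ y, softPlus κ (heatKer hR 2 x y r) * laplacian f y ∂(discMeasure R) := by
        rw [← integral_const_mul, ← integral_sub
          ((integrable_bdd_mul hc hf.continuousOn hB).const_mul lam)
          (integrable_bdd_mul hc (continuousOn_laplacian Metric.isOpen_ball hf) hN)]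
        refine integral_congr_ae (Eventually.of_forall fun y => ?_)
        simp only [hg]; ring
      rw [h2]
      have hexp : 0 < Real.exp (-(lam * r)) := Real.exp_pos _
      simp only [Pi.neg_apply, id, mul_one]
      nlinarith [mul_le_mul_of_nonneg_left h1 hexp.le]
  -- Passage to the limit `κ → 0` in `stepA`; the bound on the source term does not depend on `κ`.
  have stepB : ∀ τ, 0 < τ → τ ≤ t →
      Real.exp (-(lam * t)) * ∫ y, heatKer hR 2 x y t * f y ∂(discMeasure R) -
      Real.exp (-(lam * τ)) * ∫ y, heatKer hR 2 x y τ * f y ∂(discMeasure R) ≤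
      ∫ r in τ..t, -(Real.exp (-(lam * r)) *
        ∫ y, heatKer hR 2 x y r * g y ∂(discMeasure R)) := by
    intro τ hτ hτt
    have hsub : Ioc τ t ⊆ Ioc 0 t := Ioc_subset_Ioc_left hτ.le
    refine le_of_tendsto_of_tendsto (b := 𝓝[>] (0 : ℝ))
      (((hlimκ t ht f hfi).const_mul _).sub ((hlimκ τ hτ f hfi).const_mul _)) ?_
      (by filter_upwards [self_mem_nhdsWithin] with κ hκ using stepA κ hκ τ hτ hτt)
    refine intervalIntegral.tendsto_integral_filter_of_dominated_convergence
      (fun _ => lam * B + N) ?_ ?_ intervalIntegrable_const ?_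
    · filter_upwards [self_mem_nhdsWithin] with κ hκ
      rw [uIoc_of_le hτt]
      exact ((hmint κ hκ).mono_set hsub).1.neg
    · filter_upwards [self_mem_nhdsWithin] with κ hκ
      refine Eventually.of_forall fun r hr => ?_
      rw [uIoc_of_le hτt] at hr
      rw [norm_neg]
      exact abs_integral_le_of_le_heatKer hR (hsp κ hκ) hgN hgb hl x (hτ.trans hr.1)
    · refine Eventually.of_forall fun r hr => ?_
      rw [uIoc_of_le hτt] at hr
      exact ((hlimκ r (hτ.trans hr.1) g hgi).const_mul _).neg
  have hx0 := tendsto_integral_heatKer_mul_time hR hf.continuousOn hB hx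
  have hexp0 : Tendsto (fun τ : ℝ => Real.exp (-(lam * τ))) (𝓝[>] 0) (𝓝 1) :=
    ((by fun_prop : Continuous fun τ : ℝ => Real.exp (-(lam * τ))).tendsto' 0 1
      (by simp)).mono_left nhdsWithin_le_nhds
  -- Finally `τ → 0`, where the kernel concentrates at the interior point `x`.
  have hprim := tendsto_primitive_left ht hint.neg
  have hfin := le_of_tendsto_of_tendsto
    (tendsto_const_nhds.sub (hexp0.mul hx0)) hprim
    (by filter_upwards [Ioo_mem_nhdsGT ht] with τ hτ using stepB τ hτ.1 hτ.2.le)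
  simp only [Pi.neg_apply, intervalIntegral.integral_neg] at hfin
  linarith

end supersolution

/-! ### The regularized distance to the origin -/

/-- The smooth approximation `√(‖y‖² + k²)` of the norm. -/
def regNorm (k : ℝ) (y : Plane) : ℝ := √(‖y‖ ^ 2 + k ^ 2)

lemma regNorm_pos {k : ℝ} (hk : 0 < k) (y : Plane) : 0 < regNorm k y := by
  unfold regNorm; positivity

lemma regNorm_sq (k : ℝ) (y : Plane) : regNorm k y ^ 2 = ‖y‖ ^ 2 + k ^ 2 :=
  Real.sq_sqrt (by positivity)

lemma norm_le_regNorm (k : ℝ) (y : Plane) : ‖y‖ ≤ regNorm k y :=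
  Real.le_sqrt_of_sq_le (by nlinarith [sq_nonneg k])

lemma regNorm_le {k : ℝ} (hk : 0 ≤ k) (y : Plane) : regNorm k y ≤ ‖y‖ + k := by
  refine Real.sqrt_le_iff.2 ⟨by positivity, ?_⟩
  nlinarith [mul_nonneg (norm_nonneg y) hk]

lemma le_regNorm (k : ℝ) (y : Plane) : k ≤ regNorm k y :=
  Real.le_sqrt_of_sq_le (by nlinarith [sq_nonneg ‖y‖])

lemma contDiff_regNorm {k : ℝ} (hk : 0 < k) {n : WithTop ℕ∞} : ContDiff ℝ n (regNorm k) :=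
  ((contDiff_norm_sq ℝ).add contDiff_const).sqrt fun y => by positivity

lemma tendsto_regNorm (y : Plane) : Tendsto (fun k => regNorm k y) (𝓝 0) (𝓝 ‖y‖) := by
  have : Continuous fun k => regNorm k y := by unfold regNorm; fun_prop
  exact this.tendsto' 0 _ (by simp [regNorm])

lemma continuous_regNorm (k : ℝ) : Continuous (regNorm k) := by unfold regNorm; fun_prop

lemma contDiffAt_regNorm {k : ℝ} {y : Plane} (h : 0 < regNorm k y) {n : WithTop ℕ∞} :
    ContDiffAt ℝ n (regNorm k) y :=
  (((contDiff_norm_sq ℝ).add contDiff_const).contDiffAt).sqrt (Real.sqrt_pos.1 h).ne'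

lemma fderiv_regNorm {k : ℝ} {y : Plane} (h : 0 < regNorm k y) (v : Plane) :
    fderiv ℝ (regNorm k) y v = inner ℝ y v / regNorm k y := by
  have hq : DifferentiableAt ℝ (fun y : Plane => ‖y‖ ^ 2 + k ^ 2) y :=
    ((contDiff_norm_sq ℝ (n := 1)).differentiable (by norm_num) y).add_const _
  have e : fderiv ℝ (regNorm k) y = _ := fderiv_sqrt hq (Real.sqrt_pos.1 h).ne'
  rw [e, smul_apply, fderiv_add_const, fderiv_norm_sq_apply', smul_eq_mul]
  simp only [regNorm]
  field_simp

lemma fderiv_regNorm_basisVec {k : ℝ} {y : Plane} (h : 0 < regNorm k y) (i : Fin 2) :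
    fderiv ℝ (regNorm k) y (basisVec i) = y i * (regNorm k y)⁻¹ := by
  rw [fderiv_regNorm h, div_eq_mul_inv]
  simp [basisVec, EuclideanSpace.inner_single_right]

/-- Both terms are nonnegative, so the Laplacian of the regularised norm dominates the inverse of
that norm. -/
lemma laplacian_regNorm {k : ℝ} {y : Plane} (h : 0 < regNorm k y) :
    laplacian (regNorm k) y = (regNorm k y)⁻¹ + k ^ 2 * (regNorm k y)⁻¹ ^ 3 := by
  have hc : ContDiffAt ℝ 2 (regNorm k) y := contDiffAt_regNorm h
  rw [laplacian_eq_of_hasFDerivAt hc (g := fun i z => z i * (regNorm k z)⁻¹)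
    fun i => ((continuous_regNorm k).continuousAt.eventually (lt_mem_nhds h)).mono fun z hz =>
      fderiv_regNorm_basisVec hz i]
  have hterm : ∀ i : Fin 2, fderiv ℝ (fun z : Plane => z i * (regNorm k z)⁻¹) y (basisVec i) =
      (regNorm k y)⁻¹ - y i ^ 2 * (regNorm k y)⁻¹ ^ 3 := by
    intro i
    have h1 : HasFDerivAt (fun z : Plane => z i)
        (EuclideanSpace.proj i : Plane →L[ℝ] ℝ) y :=
      (EuclideanSpace.proj i : Plane →L[ℝ] ℝ).hasFDerivAt
    have h2 : HasFDerivAt (regNorm k) (fderiv ℝ (regNorm k) y) y :=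
      (hc.differentiableAt (by norm_num)).hasFDerivAt
    have h3 := h1.mul ((hasDerivAt_inv h.ne').comp_hasFDerivAt y h2)
    have e : fderiv ℝ (fun z : Plane => z i * (regNorm k z)⁻¹) y = _ := h3.fderiv
    rw [e]
    simp only [add_apply, smul_apply, fderiv_regNorm_basisVec h, smul_eq_mul, Function.comp]
    have : (EuclideanSpace.proj i : Plane →L[ℝ] ℝ) (basisVec i) = 1 := by simp [basisVec]
    rw [this]
    have := h.ne'
    field_simp
    ring
  simp only [hterm, Fin.sum_univ_two]
  have h1 := regNorm_sq k y
  rw [norm_sq_eq] at h1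
  have h2 := h.ne'
  have h3 : (regNorm k y)⁻¹ = (y 0 ^ 2 + y 1 ^ 2 + k ^ 2) * (regNorm k y)⁻¹ ^ 3 := by
    rw [← h1]; field_simp
  linear_combination h3

/-! ### Weighted integrability of the heat kernel -/

section weight

variable {R : ℝ} (hR : 0 < R)

/-- The defect `(R - ‖x‖) - S_t (R - ‖·‖) (x)`. -/
def heatDefect (x : Plane) (t : ℝ) : ℝ :=
  (R - ‖x‖) - ∫ y, heatKer hR 2 x y t * (R - ‖y‖) ∂(discMeasure R)

/-- The weight `1 + 1 / ‖y‖`. -/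
def weight (y : Plane) : ℝ := 1 + ‖y‖⁻¹

lemma weight_nonneg (y : Plane) : 0 ≤ weight y := by unfold weight; positivity

lemma one_le_weight (y : Plane) : 1 ≤ weight y := by
  unfold weight; linarith [inv_nonneg.2 (norm_nonneg y)]

lemma heatDefect_le {x : Plane} {t : ℝ} (ht : 0 < t) : heatDefect hR x t ≤ R := by
  have : 0 ≤ ∫ y, heatKer hR 2 x y t * (R - ‖y‖) ∂(discMeasure R) := by
    refine setIntegral_nonneg Metric.isOpen_ball.measurableSet fun y hy => ?_
    exact mul_nonneg (heatKer_nonneg hR ht x y) (by linarith [mem_ball_zero_iff.1 hy])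
  unfold heatDefect
  linarith [norm_nonneg x]

/-- The convergence is joint in `(x, t)`. This makes short-time contributions small uniformly near a
point in `continuousOn_potential`. -/
lemma tendsto_heatDefect {x₀ : Plane} (hx₀ : x₀ ∈ Metric.ball (0 : Plane) R) :
    Tendsto (fun p : Plane × ℝ => heatDefect hR p.1 p.2) (𝓝 x₀ ×ˢ 𝓝[>] 0) (𝓝 0) := by
  have hc : Continuous fun y : Plane => R - ‖y‖ := by fun_prop
  have h1 := tendsto_integral_heatKer_smul hR hx₀ hc.aestronglyMeasurable (B := R) (fun y hy => by
    rw [Real.norm_of_nonneg (by linarith [mem_ball_zero_iff.1 hy])]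
    linarith [norm_nonneg y]) hc.continuousAt
  have h2 : Tendsto (fun p : Plane × ℝ => R - ‖p.1‖) (𝓝 x₀ ×ˢ 𝓝[>] 0) (𝓝 (R - ‖x₀‖)) :=
    (hc.tendsto x₀).comp tendsto_fst
  simpa [heatDefect] using h2.sub h1

lemma integrable_spaceTime_of_bdd {g : Plane → ℝ} (hg : AEStronglyMeasurable g (discMeasure R))
    {N : ℝ} (hN : ∀ᵐ y ∂(discMeasure R), |g y| ≤ N) (x : Plane) (t : ℝ) :
    Integrable (fun p : ℝ × Plane => heatKer hR 2 x p.2 p.1 * g p.2) (spaceTime R t) := by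
  have hm := (aestronglyMeasurable_heatKer hR 2 x t).mul
    (hg.comp_snd (μ := volume.restrict (Ioc 0 t)))
  have hgi : Integrable g (discMeasure R) := Integrable.of_bound hg N hN
  refine (integrable_prod_iff hm).2 ⟨?_, ?_⟩
  · filter_upwards [ae_restrict_mem measurableSet_Ioc] with r hr
    exact integrable_heatKer_smul hR hr.1 x hgi
  · refine Integrable.of_bound hm.norm.integral_prod_right' |N| ?_
    filter_upwards [ae_restrict_mem measurableSet_Ioc] with r hr
    rw [Real.norm_of_nonneg (integral_nonneg fun y => norm_nonneg _)]
    have h := norm_integral_heatKer_smul_le hR hr.1 x (abs_nonneg N) (ψ := fun y => |g y|)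
      (by filter_upwards [hN] with y hy; simpa using hy.trans (le_abs_self N))
    refine le_trans (le_of_eq ?_) ((le_abs_self _).trans h)
    refine integral_congr_ae (Eventually.of_forall fun y => ?_)
    simp only [Pi.mul_apply, norm_mul, Real.norm_of_nonneg (heatKer_nonneg hR hr.1 x y),
      smul_eq_mul, Real.norm_eq_abs]

lemma integral_spaceTime_eq {F : Type*} [NormedAddCommGroup F] [NormedSpace ℝ F]
    {f : ℝ × Plane → F} {t : ℝ} (ht : 0 ≤ t) (hf : Integrable f (spaceTime R t)) :
    ∫ p, f p ∂(spaceTime R t) = ∫ r in (0 : ℝ)..t, ∫ y, f (r, y) ∂(discMeasure R) := by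
  rw [integral_prod f hf, intervalIntegral.integral_of_le ht]

/-- The supersolution inequality without discount, for `f = R + k - regNorm k`: this `f` is
nonnegative on the disc and `-Δf` is at least `1 / regNorm k`. The error `2 k` accounts for
replacing `regNorm k` by the norm twice. -/
lemma integral_heatKer_inv_regNorm_le {k : ℝ} (hk : 0 < k) {x : Plane}
    (hx : x ∈ Metric.ball (0 : Plane) R) {t : ℝ} (ht : 0 < t) :
    ∫ p, heatKer hR 2 x p.2 p.1 * (regNorm k p.2)⁻¹ ∂(spaceTime R t) ≤
      heatDefect hR x t + 2 * k := by
  set f : Plane → ℝ := fun y => (R + k) - regNorm k y with hf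
  have hfc : ContDiff ℝ 2 f := contDiff_const.sub (contDiff_regNorm hk)
  have hlap : ∀ y, laplacian f y = -((regNorm k y)⁻¹ + k ^ 2 * (regNorm k y)⁻¹ ^ 3) := by
    intro y
    rw [hf, laplacian_fun_sub contDiffAt_const (contDiff_regNorm hk).contDiffAt,
      laplacian_regNorm (regNorm_pos hk _)]
    have : laplacian (fun _ : Plane => R + k) y = 0 := by rw [laplacian_eq_sum]; simp
    rw [this, zero_sub]
  have hki : ∀ y, (regNorm k y)⁻¹ ≤ k⁻¹ := fun y => inv_anti₀ hk (le_regNorm k y)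
  have hi0 : ∀ y, 0 ≤ (regNorm k y)⁻¹ := fun y => (inv_pos.2 (regNorm_pos hk y)).le
  have hf0 : ∀ y ∈ Metric.ball (0 : Plane) R, 0 ≤ f y := fun y hy => by
    have := regNorm_le hk.le y
    have := mem_ball_zero_iff.1 hy
    simp only [hf]; linarith
  have key := heatKer_supersolution hR hfc.contDiffOn hf0 (B := R + k) (fun y hy => by
      rw [abs_of_nonneg (hf0 y hy)]
      simp only [hf]; linarith [regNorm_pos hk y])
    (N := k⁻¹ + k ^ 2 * k⁻¹ ^ 3) (fun y _ => by
      rw [hlap, abs_neg, abs_of_nonneg (by have := hi0 y; positivity)]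
      have := hki y
      have := hi0 y
      gcongr) le_rfl hx ht
  simp only [zero_mul, neg_zero, Real.exp_zero, one_mul, zero_sub] at key
  have hcr : Continuous fun y => (regNorm k y)⁻¹ :=
    (contDiff_regNorm (n := 0) hk).continuous.inv₀ fun y => (regNorm_pos hk y).ne'
  have hI1 := integrable_spaceTime_of_bdd hR hcr.aestronglyMeasurable (N := k⁻¹)
    (Eventually.of_forall fun y => by rw [abs_of_nonneg (hi0 y)]; exact hki y) x t
  have hcl : Continuous fun y => -laplacian f y := by
    simp only [hlap, neg_neg]
    fun_prop
  have hI2 := integrable_spaceTime_of_bdd hR hcl.aestronglyMeasurable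
    (N := k⁻¹ + k ^ 2 * k⁻¹ ^ 3)
    (Eventually.of_forall fun y => by
      rw [hlap, neg_neg, abs_of_nonneg (by have := hi0 y; positivity)]
      have := hki y
      have := hi0 y
      gcongr) x t
  have h1 : ∫ p, heatKer hR 2 x p.2 p.1 * (regNorm k p.2)⁻¹ ∂(spaceTime R t) ≤
      ∫ p, heatKer hR 2 x p.2 p.1 * -laplacian f p.2 ∂(spaceTime R t) := by
    refine integral_mono_ae hI1 hI2 ?_
    filter_upwards [ae_spaceTime R t] with p hp
    refine mul_le_mul_of_nonneg_left ?_ (heatKer_nonneg hR hp.1.1 x p.2)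
    rw [hlap, neg_neg]
    have := hi0 p.2
    exact le_add_of_nonneg_right (by positivity)
  rw [integral_spaceTime_eq ht.le hI2] at h1
  have hfint : ∀ g : Plane → ℝ, Continuous g →
      Integrable (fun y => heatKer hR 2 x y t * g y) (discMeasure R) := fun g hg =>
    integrable_of_continuous ((continuous_heatKer_right hR 2 ht x).mul hg)
  have h2 : ∫ y, heatKer hR 2 x y t * (R - ‖y‖) ∂(discMeasure R) - k ≤
      ∫ y, heatKer hR 2 x y t * f y ∂(discMeasure R) := by
    have h3 := norm_integral_heatKer_smul_le hR ht x hk.le (ψ := fun y => (R - ‖y‖) - f y)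
      (Eventually.of_forall fun y => by
        have h1 := regNorm_le hk.le y
        have h2 := norm_le_regNorm k y
        simp only [hf, Real.norm_eq_abs, abs_le]
        constructor <;> linarith)
    simp only [smul_eq_mul] at h3
    simp only [mul_sub (heatKer hR 2 x _ t) (R - ‖_‖)] at h3
    rw [integral_sub (hfint _ (by fun_prop)) (hfint _ hfc.continuous), Real.norm_eq_abs] at h3
    linarith [(abs_le.1 h3).2]
  have h4 : f x ≤ R + k - ‖x‖ := by simp only [hf]; linarith [norm_le_regNorm k x]
  unfold heatDefect
  linarith

/-- Fatou's lemma along `k = 1 / (n + 1)`, as no integrability of the limit is known beforehand. -/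
lemma lintegral_heatKer_inv_norm_le {x : Plane} (hx : x ∈ Metric.ball (0 : Plane) R) {t : ℝ}
    (ht : 0 < t) :
    ∫⁻ p, ENNReal.ofReal (heatKer hR 2 x p.2 p.1 * ‖p.2‖⁻¹) ∂(spaceTime R t) ≤
      ENNReal.ofReal (heatDefect hR x t) := by
  set k : ℕ → ℝ := fun n => 1 / ((n : ℝ) + 1) with hk
  have hk0 : ∀ n, 0 < k n := fun n => by simp only [hk]; positivity
  have hklim : Tendsto k atTop (𝓝 0) := tendsto_one_div_add_atTop_nhds_zero_nat
  have hcr : ∀ n, Continuous fun y => (regNorm (k n) y)⁻¹ := fun n =>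
    (contDiff_regNorm (n := 0) (hk0 n)).continuous.inv₀ fun y => (regNorm_pos (hk0 n) y).ne'
  have hmeas : ∀ n, AEMeasurable (fun p : ℝ × Plane =>
      ENNReal.ofReal (heatKer hR 2 x p.2 p.1 * (regNorm (k n) p.2)⁻¹)) (spaceTime R t) := fun n =>
    (((aestronglyMeasurable_heatKer hR 2 x t).mul
      ((hcr n).comp continuous_snd).aestronglyMeasurable).aemeasurable).ennreal_ofReal
  have hbound : ∀ n, ∫⁻ p, ENNReal.ofReal (heatKer hR 2 x p.2 p.1 * (regNorm (k n) p.2)⁻¹)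
      ∂(spaceTime R t) ≤ ENNReal.ofReal (heatDefect hR x t + 2 * k n) := by
    intro n
    have hI := integrable_spaceTime_of_bdd hR (hcr n).aestronglyMeasurable (N := (k n)⁻¹)
      (Eventually.of_forall fun y => by
        rw [abs_of_pos (inv_pos.2 (regNorm_pos (hk0 n) y))]
        exact inv_anti₀ (hk0 n) (le_regNorm (k n) y)) x t
    rw [← ofReal_integral_eq_lintegral_ofReal hI]
    · refine ENNReal.ofReal_le_ofReal ?_
      exact integral_heatKer_inv_regNorm_le hR (hk0 n) hx ht
    · filter_upwards [ae_spaceTime R t] with p hp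
      exact mul_nonneg (heatKer_nonneg hR hp.1.1 x p.2) (inv_pos.2 (regNorm_pos (hk0 n) _)).le
  have hlim : Tendsto (fun n => ENNReal.ofReal (heatDefect hR x t + 2 * k n)) atTop
      (𝓝 (ENNReal.ofReal (heatDefect hR x t))) := by
    have := (hklim.const_mul 2).const_add (heatDefect hR x t)
    rw [mul_zero, add_zero] at this
    exact ENNReal.tendsto_ofReal this
  calc _ = ∫⁻ p, liminf (fun n => ENNReal.ofReal
        (heatKer hR 2 x p.2 p.1 * (regNorm (k n) p.2)⁻¹)) atTop ∂(spaceTime R t) := by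
        have hne : ∀ᵐ p ∂(spaceTime R t), p.2 ≠ 0 := by
          have h := Measure.quasiMeasurePreserving_snd (μ := volume.restrict (Ioc 0 t))
            (ν := discMeasure R) |>.ae (ae_ne R 0)
          filter_upwards [h] with p hp using hp.symm
        refine lintegral_congr_ae ?_
        filter_upwards [hne] with p hp
        refine (Tendsto.liminf_eq ?_).symm
        refine ENNReal.tendsto_ofReal (Tendsto.const_mul _ ?_)
        exact ((tendsto_regNorm p.2).comp hklim).inv₀ (norm_ne_zero_iff.2 hp)
    _ ≤ liminf (fun n => ∫⁻ p, ENNReal.ofReal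
        (heatKer hR 2 x p.2 p.1 * (regNorm (k n) p.2)⁻¹) ∂(spaceTime R t)) atTop :=
        lintegral_liminf_le' hmeas
    _ ≤ liminf (fun n => ENNReal.ofReal (heatDefect hR x t + 2 * k n)) atTop :=
        liminf_le_liminf (Eventually.of_forall hbound)
    _ = _ := hlim.liminf_eq

/-- The heat kernel is integrable against the weight `1 + 1 / ‖y‖` in space-time. -/
lemma integrable_heatKer_weight {x : Plane} (hx : x ∈ Metric.ball (0 : Plane) R) {t : ℝ}
    (ht : 0 < t) :
    Integrable (fun p : ℝ × Plane => heatKer hR 2 x p.2 p.1 * weight p.2) (spaceTime R t) ∧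
      ∫ p, heatKer hR 2 x p.2 p.1 * weight p.2 ∂(spaceTime R t) ≤
        t + max (heatDefect hR x t) 0 := by
  have hm : AEStronglyMeasurable (fun p : ℝ × Plane => heatKer hR 2 x p.2 p.1 * ‖p.2‖⁻¹)
      (spaceTime R t) := (aestronglyMeasurable_heatKer hR 2 x t).mul
    (by fun_prop : Measurable fun p : ℝ × Plane => ‖p.2‖⁻¹).aestronglyMeasurable
  have hnn : 0 ≤ᵐ[spaceTime R t] fun p => heatKer hR 2 x p.2 p.1 * ‖p.2‖⁻¹ := by
    filter_upwards [ae_spaceTime R t] with p hp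
    exact mul_nonneg (heatKer_nonneg hR hp.1.1 x p.2) (by positivity)
  have hle := lintegral_heatKer_inv_norm_le hR hx ht
  have hI1 : Integrable (fun p : ℝ × Plane => heatKer hR 2 x p.2 p.1 * ‖p.2‖⁻¹)
      (spaceTime R t) := by
    refine ⟨hm, ?_⟩
    rw [hasFiniteIntegral_iff_ofReal hnn]
    exact hle.trans_lt ENNReal.ofReal_lt_top
  have hv1 : ∫ p, heatKer hR 2 x p.2 p.1 * ‖p.2‖⁻¹ ∂(spaceTime R t) ≤
      max (heatDefect hR x t) 0 := by
    rw [integral_eq_lintegral_of_nonneg_ae hnn hm]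
    refine ENNReal.toReal_le_of_le_ofReal (le_max_right _ _) (hle.trans ?_)
    exact ENNReal.ofReal_le_ofReal (le_max_left _ _)
  have hI2 := integrable_spaceTime_of_bdd hR (g := fun _ => (1 : ℝ)) aestronglyMeasurable_const
    (N := 1) (Eventually.of_forall fun y => by simp) x t
  have hv2 : ∫ p, heatKer hR 2 x p.2 p.1 * 1 ∂(spaceTime R t) ≤ t := by
    rw [integral_spaceTime_eq ht.le hI2]
    have h := intervalIntegral.norm_integral_le_of_norm_le_const (a := 0) (b := t) (C := 1)
      (f := fun r => ∫ y, heatKer hR 2 x y r * 1 ∂(discMeasure R)) (fun r hr => by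
        rw [uIoc_of_le ht.le] at hr
        have := norm_integral_heatKer_smul_le hR hr.1 x zero_le_one (ψ := fun _ => (1 : ℝ))
          (Eventually.of_forall fun y => by simp)
        simpa using this)
    rw [sub_zero, one_mul, abs_of_pos ht] at h
    exact (le_abs_self _).trans h
  have e : (fun p : ℝ × Plane => heatKer hR 2 x p.2 p.1 * weight p.2) = fun p =>
      heatKer hR 2 x p.2 p.1 * 1 + heatKer hR 2 x p.2 p.1 * ‖p.2‖⁻¹ := by
    funext p; unfold weight; ring
  rw [e]
  refine ⟨hI2.add hI1, ?_⟩
  rw [integral_add hI2 hI1]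
  exact add_le_add hv2 hv1

end weight

/-! ### Space-time potentials -/

section potential

variable {F : Type*} [NormedAddCommGroup F] {R : ℝ} (hR : 0 < R)

/-- A source term on the disc for times in `[0, T]`: the sum of a bounded continuous function and
of a time independent function dominated by `1 + 1 / ‖y‖`. -/
def IsSource (R T : ℝ) (f : Plane → ℝ → F) : Prop :=
  ∃ (g : Plane → ℝ → F) (b : Plane → F) (C : ℝ), 0 ≤ C ∧
    ContinuousOn (fun p : Plane × ℝ => g p.1 p.2) (Metric.ball 0 R ×ˢ Icc 0 T) ∧
    (∀ y ∈ Metric.ball (0 : Plane) R, ∀ s ∈ Icc 0 T, ‖g y s‖ ≤ C) ∧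
    AEStronglyMeasurable b (discMeasure R) ∧
    (∀ᵐ y ∂(discMeasure R), ‖b y‖ ≤ C * weight y) ∧
    ∀ y ∈ Metric.ball (0 : Plane) R, ∀ s ∈ Icc 0 T, f y s = g y s + b y

lemma IsSource.exists_bound {T : ℝ} {f : Plane → ℝ → F} (hf : IsSource R T f) :
    ∃ C, 0 ≤ C ∧ ∀ᵐ y ∂(discMeasure R), ∀ s ∈ Icc 0 T, ‖f y s‖ ≤ C * weight y := by
  obtain ⟨g, b, C, hC, -, hg, -, hb, h⟩ := hf
  refine ⟨2 * C, by positivity, ?_⟩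
  filter_upwards [hb, ae_restrict_mem Metric.isOpen_ball.measurableSet] with y hy hyR s hs
  rw [h y hyR s hs]
  refine (norm_add_le _ _).trans ?_
  nlinarith [hg y hyR s hs, one_le_weight y]

lemma IsSource.continuousOn {T : ℝ} {f : Plane → ℝ → F} (hf : IsSource R T f) {y : Plane}
    (hy : y ∈ Metric.ball (0 : Plane) R) : ContinuousOn (f y) (Icc 0 T) := by
  obtain ⟨g, b, C, -, hgc, -, -, -, h⟩ := hf
  have h1 : ContinuousOn (fun s => g y s) (Icc 0 T) :=
    hgc.comp (f := fun s : ℝ => (y, s)) (by fun_prop) fun s hs => ⟨hy, hs⟩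
  exact (h1.add continuousOn_const).congr fun s hs => h y hy s hs

lemma IsSource.aestronglyMeasurable {T : ℝ} {f : Plane → ℝ → F} (hf : IsSource R T f) {t : ℝ}
    (ht : t ≤ T) :
    AEStronglyMeasurable (fun p : ℝ × Plane => f p.2 (t - p.1)) (spaceTime R t) := by
  obtain ⟨g, b, C, -, hgc, -, hbm, -, h⟩ := hf
  have h1 : AEStronglyMeasurable (fun p : ℝ × Plane => g p.2 (t - p.1)) (spaceTime R t) := by
    rw [spaceTime_eq]
    refine ContinuousOn.aestronglyMeasurable ?_ (measurableSet_spaceTime R t)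
    refine hgc.comp (f := fun p : ℝ × Plane => (p.2, t - p.1)) (by fun_prop) ?_
    rintro ⟨r, y⟩ ⟨hr, hy⟩
    exact ⟨hy, by simp only; linarith [hr.2], by simp only; linarith [hr.1]⟩
  refine (h1.add (hbm.comp_snd (μ := volume.restrict (Ioc 0 t)))).congr ?_
  filter_upwards [ae_spaceTime R t] with p hp
  exact (h p.2 hp.2 _ ⟨by linarith [hp.1.2], by linarith [hp.1.1]⟩).symm

lemma IsSource.shift {T T₀ : ℝ} (h₀ : 0 ≤ T₀) {f : Plane → ℝ → F} (hf : IsSource R T f) :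
    IsSource R (T - T₀) fun y s => f y (T₀ + s) := by
  obtain ⟨g, b, C, hC, hgc, hg, hbm, hb, hfg⟩ := hf
  have hmem : ∀ s ∈ Icc 0 (T - T₀), T₀ + s ∈ Icc 0 T := fun s hs =>
    ⟨by linarith [hs.1], by linarith [hs.2]⟩
  refine ⟨fun y s => g y (T₀ + s), b, C, hC, ?_, fun y hy s hs => hg y hy _ (hmem s hs), hbm, hb,
    fun y hy s hs => hfg y hy _ (hmem s hs)⟩
  exact hgc.comp (f := fun p : Plane × ℝ => (p.1, T₀ + p.2)) (by fun_prop)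
    fun p hp => ⟨hp.1, hmem _ hp.2⟩

variable [NormedSpace ℝ F]

/-- The integral of the source `f` against the heat kernel over the time interval `[0, t]`. -/
def potential (f : Plane → ℝ → F) (x : Plane) (t : ℝ) : F :=
  ∫ r in (0 : ℝ)..t, ∫ y, heatKer hR 2 x y r • f y (t - r) ∂(discMeasure R)

lemma potential_zero (f : Plane → ℝ → F) (x : Plane) : potential hR f x 0 = 0 := by
  simp [potential]

lemma ae_spaceTime_snd {t : ℝ} {p : Plane → Prop} (h : ∀ᵐ y ∂(discMeasure R), p y) :
    ∀ᵐ q ∂(spaceTime R t), p q.2 :=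
  (Measure.quasiMeasurePreserving_snd (μ := volume.restrict (Ioc 0 t))
    (ν := discMeasure R)).ae h

lemma integrable_potential {T : ℝ} {f : Plane → ℝ → F} (hf : IsSource R T f) {C : ℝ}
    (hC : ∀ᵐ y ∂(discMeasure R), ∀ s ∈ Icc 0 T, ‖f y s‖ ≤ C * weight y) {x : Plane}
    (hx : x ∈ Metric.ball (0 : Plane) R) {t : ℝ} (ht0 : 0 < t) (ht : t ≤ T) :
    Integrable (fun p : ℝ × Plane => heatKer hR 2 x p.2 p.1 • f p.2 (t - p.1)) (spaceTime R t) ∧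
      ∫ p, ‖heatKer hR 2 x p.2 p.1 • f p.2 (t - p.1)‖ ∂(spaceTime R t) ≤
        ∫ p, C * (heatKer hR 2 x p.2 p.1 * weight p.2) ∂(spaceTime R t) := by
  have hw := ((integrable_heatKer_weight hR hx ht0).1).const_mul C
  have hb : ∀ᵐ p ∂(spaceTime R t), ‖heatKer hR 2 x p.2 p.1 • f p.2 (t - p.1)‖ ≤
      C * (heatKer hR 2 x p.2 p.1 * weight p.2) := by
    filter_upwards [ae_spaceTime R t, ae_spaceTime_snd (t := t) hC] with p hp hp2
    have hH := heatKer_nonneg hR hp.1.1 x p.2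
    rw [norm_smul, Real.norm_of_nonneg hH]
    have := hp2 (t - p.1) ⟨by linarith [hp.1.2], by linarith [hp.1.1]⟩
    nlinarith
  have hI : Integrable (fun p : ℝ × Plane => heatKer hR 2 x p.2 p.1 • f p.2 (t - p.1))
      (spaceTime R t) :=
    hw.mono' ((aestronglyMeasurable_heatKer hR 2 x t).smul (hf.aestronglyMeasurable ht)) hb
  exact ⟨hI, integral_mono_ae hI.norm hw hb⟩

lemma potential_eq_integral {T : ℝ} {f : Plane → ℝ → F} (hf : IsSource R T f) {x : Plane}
    (hx : x ∈ Metric.ball (0 : Plane) R) {t : ℝ} (ht0 : 0 < t) (ht : t ≤ T) :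
    potential hR f x t =
      ∫ p, heatKer hR 2 x p.2 p.1 • f p.2 (t - p.1) ∂(spaceTime R t) := by
  obtain ⟨C, -, hC⟩ := hf.exists_bound
  exact (integral_spaceTime_eq ht0.le (integrable_potential hR hf hC hx ht0 ht).1).symm

lemma norm_potential_le {T : ℝ} {f : Plane → ℝ → F} (hf : IsSource R T f) {C : ℝ} (hC0 : 0 ≤ C)
    (hC : ∀ᵐ y ∂(discMeasure R), ∀ s ∈ Icc 0 T, ‖f y s‖ ≤ C * weight y) {x : Plane}
    (hx : x ∈ Metric.ball (0 : Plane) R) {t : ℝ} (ht0 : 0 < t) (ht : t ≤ T) :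
    ‖potential hR f x t‖ ≤ C * (t + R) := by
  rw [potential_eq_integral hR hf hx ht0 ht]
  refine (norm_integral_le_integral_norm _).trans
    ((integrable_potential hR hf hC hx ht0 ht).2.trans ?_)
  rw [integral_const_mul]
  refine mul_le_mul_of_nonneg_left ((integrable_heatKer_weight hR hx ht0).2.trans ?_) hC0
  gcongr
  exact max_le (heatDefect_le hR ht0) hR.le

/-- A bound on the difference that depends on time alone passes through the kernel because its mass
is at most one; the singular parts of the sources enter only through integrability. -/
lemma norm_potential_sub_le {T : ℝ} {f₁ f₂ : Plane → ℝ → F} (hf₁ : IsSource R T f₁)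
    (hf₂ : IsSource R T f₂) {x : Plane} (hx : x ∈ Metric.ball (0 : Plane) R) {t : ℝ} (ht0 : 0 ≤ t)
    (ht : t ≤ T) {β : ℝ → ℝ} (hβ : Continuous β)
    (hb : ∀ y ∈ Metric.ball (0 : Plane) R, ∀ s ∈ Icc 0 t, ‖f₁ y s - f₂ y s‖ ≤ β s) :
    ‖potential hR f₁ x t - potential hR f₂ x t‖ ≤ ∫ s in (0 : ℝ)..t, β s := by
  rcases ht0.eq_or_lt with rfl | ht0
  · simp [potential_zero]
  obtain ⟨C₁, -, hC₁⟩ := hf₁.exists_bound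
  obtain ⟨C₂, -, hC₂⟩ := hf₂.exists_bound
  have hI₁ := (integrable_potential hR hf₁ hC₁ hx ht0 ht).1
  have hI₂ := (integrable_potential hR hf₂ hC₂ hx ht0 ht).1
  rw [potential_eq_integral hR hf₁ hx ht0 ht, potential_eq_integral hR hf₂ hx ht0 ht,
    ← integral_sub hI₁ hI₂]
  refine (congrArg norm (integral_spaceTime_eq ht0.le (hI₁.sub hI₂))).trans_le ?_
  simp only [Pi.sub_apply]
  have hrefl : ∫ s in (0 : ℝ)..t, β s = ∫ r in (0 : ℝ)..t, β (t - r) := by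
    rw [intervalIntegral.integral_comp_sub_left, sub_self, sub_zero]
  rw [hrefl]
  refine intervalIntegral.norm_integral_le_of_norm_le ht0.le (Eventually.of_forall fun r hr => ?_)
    ((by fun_prop : Continuous fun r => β (t - r)).intervalIntegrable _ _)
  have hmem : t - r ∈ Icc 0 t := ⟨by linarith [hr.2], by linarith [hr.1]⟩
  simp only [← smul_sub]
  refine norm_integral_heatKer_smul_le hR hr.1 x
    ((norm_nonneg _).trans (hb 0 (by simpa using hR) _ hmem)) ?_
  filter_upwards [ae_restrict_mem Metric.isOpen_ball.measurableSet] with y hy using hb y hy _ hmem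

lemma spaceTime_restrict {t T : ℝ} (ht : t ≤ T) :
    spaceTime R t = (spaceTime R T).restrict (Iic t ×ˢ univ) := by
  rw [spaceTime_eq, spaceTime_eq, Measure.restrict_restrict (measurableSet_Iic.prod .univ),
    prod_inter_prod, univ_inter]
  congr 2
  ext r
  simp only [mem_Ioc, mem_inter_iff, mem_Iic]
  constructor
  · rintro ⟨h1, h2⟩; exact ⟨h2, h1, h2.trans ht⟩
  · rintro ⟨h1, h2, -⟩; exact ⟨h2, h1⟩

/-- Joint continuity of space-time potentials up to the initial time. -/
theorem continuousOn_potential {T : ℝ} {f : Plane → ℝ → F} (hf : IsSource R T f) :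
    ContinuousOn (fun p : Plane × ℝ => potential hR f p.1 p.2) (Metric.ball 0 R ×ˢ Icc 0 T) := by
  obtain ⟨C, hC0, hC⟩ := hf.exists_bound
  rcases le_or_gt T 0 with hT | hT
  · refine (continuousOn_const (c := (0 : F))).congr fun p hp => ?_
    rw [le_antisymm (hp.2.2.trans hT) hp.2.1, potential_zero]
  rintro ⟨x₀, t₀⟩ ⟨hx₀, ht₀⟩
  simp only at hx₀ ht₀
  set l := 𝓝[Metric.ball (0 : Plane) R ×ˢ Icc 0 T] (x₀, t₀) with hl
  have hlx : ∀ᶠ q in l, q.1 ∈ Metric.ball (0 : Plane) R ∧ q.2 ∈ Icc 0 T :=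
    eventually_mem_nhdsWithin
  have hlfst : Tendsto Prod.fst l (𝓝 x₀) := (continuous_fst.tendsto _).mono_left nhdsWithin_le_nhds
  have hlsnd : Tendsto Prod.snd l (𝓝 t₀) := (continuous_snd.tendsto _).mono_left nhdsWithin_le_nhds
  -- the integrand over the full time interval, with the times before `τ` removed
  set G : ℝ → Plane × ℝ → ℝ × Plane → F := fun τ q =>
    indicator (Ioc τ q.2 ×ˢ univ) fun p => heatKer hR 2 q.1 p.2 p.1 • f p.2 (q.2 - p.1) with hG
  have hGm : ∀ τ q, q.2 ≤ T → AEStronglyMeasurable (G τ q) (spaceTime R T) := by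
    intro τ q hq
    refine (aestronglyMeasurable_indicator_iff (measurableSet_Ioc.prod .univ)).2 ?_
    have h1 := (aestronglyMeasurable_heatKer hR 2 q.1 q.2).smul (hf.aestronglyMeasurable hq)
    rw [spaceTime_restrict hq] at h1
    exact h1.mono_measure (Measure.restrict_mono (prod_mono_left Ioc_subset_Iic_self) le_rfl)
  have hG0 : ∀ q : Plane × ℝ, q.1 ∈ Metric.ball (0 : Plane) R → q.2 ∈ Icc 0 T →
      potential hR f q.1 q.2 = ∫ p, G 0 q p ∂(spaceTime R T) := by
    intro q hqx hqt
    have e : ∫ p, G 0 q p ∂(spaceTime R T) =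
        ∫ p, indicator (Iic q.2 ×ˢ univ)
          (fun p => heatKer hR 2 q.1 p.2 p.1 • f p.2 (q.2 - p.1)) p ∂(spaceTime R T) := by
      refine integral_congr_ae ?_
      filter_upwards [ae_spaceTime R T] with p hp
      simp only [hG]
      by_cases h : p.1 ≤ q.2
      · rw [indicator_of_mem (by exact ⟨⟨hp.1.1, h⟩, trivial⟩),
          indicator_of_mem (by exact ⟨h, trivial⟩)]
      · rw [indicator_of_notMem (by exact fun h' => h h'.1.2),
          indicator_of_notMem (by exact fun h' => h h'.1)]
    rw [e, integral_indicator (measurableSet_Iic.prod .univ), ← spaceTime_restrict hqt.2]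
    rcases hqt.1.eq_or_lt with h | h
    · rw [← h, potential_zero]
      simp [spaceTime]
    · exact potential_eq_integral hR hf hqx h hqt.2
  have hGb : ∀ τ, 0 ≤ τ → ∀ q : Plane × ℝ, q.2 ∈ Icc 0 T → ∀ᵐ p ∂(spaceTime R T),
      ‖G τ q p‖ ≤ C * (heatKer hR 2 q.1 p.2 p.1 * weight p.2) := by
    intro τ hτ q hq
    filter_upwards [ae_spaceTime R T, ae_spaceTime_snd (t := T) hC] with p hp hp2
    have hH := heatKer_nonneg hR hp.1.1 q.1 p.2
    have hw := weight_nonneg p.2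
    by_cases h : p ∈ Ioc τ q.2 ×ˢ (univ : Set Plane)
    · simp only [hG]
      rw [indicator_of_mem h, norm_smul, Real.norm_of_nonneg hH]
      have := hp2 (q.2 - p.1) ⟨by linarith [h.1.2], by linarith [h.1.1, hq.2]⟩
      nlinarith
    · simp only [hG]
      rw [indicator_of_notMem h, norm_zero]
      positivity
  have hGi : ∀ τ, 0 ≤ τ → ∀ q : Plane × ℝ, q.1 ∈ Metric.ball (0 : Plane) R → q.2 ∈ Icc 0 T →
      Integrable (G τ q) (spaceTime R T) := fun τ hτ q hqx hq =>
    ((integrable_heatKer_weight hR hqx hT).1.const_mul C).mono' (hGm τ q hq.2) (hGb τ hτ q hq)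
  -- Removing the times before `τ` costs at most `C (τ + max defect 0)`, which is small for small
  -- `τ` uniformly for `x` near `x₀`.
  have htail : ∀ ε > 0, ∃ τ > 0, ∀ᶠ q in l,
      ‖∫ p, G 0 q p ∂(spaceTime R T) - ∫ p, G τ q p ∂(spaceTime R T)‖ ≤ ε := by
    intro ε hε
    have h1 : Tendsto (fun p : Plane × ℝ => C * (p.2 + max (heatDefect hR p.1 p.2) 0))
        (𝓝 x₀ ×ˢ 𝓝[>] 0) (𝓝 (C * (0 + max 0 0))) := by
      have h2 : Tendsto (fun p : Plane × ℝ => p.2) (𝓝 x₀ ×ˢ 𝓝[>] 0) (𝓝 0) :=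
        tendsto_snd.mono_right nhdsWithin_le_nhds
      exact (h2.add ((tendsto_heatDefect hR hx₀).max tendsto_const_nhds)).const_mul C
    rw [max_self, add_zero, mul_zero] at h1
    obtain ⟨pa, ha, pb, hb, hab⟩ := eventually_prod_iff.1 (h1.eventually (gt_mem_nhds hε))
    obtain ⟨τ, hτb, hτ0, hτT⟩ := (hb.and (Ioo_mem_nhdsGT hT)).exists
    refine ⟨τ, hτ0, ?_⟩
    filter_upwards [hlx, hlfst.eventually ha] with q hq hqa
    rw [← integral_sub (hGi 0 le_rfl q hq.1 hq.2) (hGi τ (le_of_lt hτ0) q hq.1 hq.2)]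
    have hI := integrable_heatKer_weight hR hq.1 hτ0
    have hint := hI.1.const_mul C
    rw [spaceTime_restrict hτT.le] at hint
    have hms : MeasurableSet (Iic τ ×ˢ (univ : Set Plane)) := measurableSet_Iic.prod .univ
    refine (norm_integral_le_of_norm_le ((integrable_indicator_iff hms).2 hint) ?_).trans ?_
    · filter_upwards [ae_spaceTime R T, hGb 0 le_rfl q hq.2] with p hp hpb
      by_cases h : p.1 ≤ τ
      · rw [indicator_of_mem (by exact ⟨h, trivial⟩)]
        have : G τ q p = 0 := indicator_of_notMem (fun h' => h.not_gt h'.1.1) _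
        rw [this, sub_zero]
        exact hpb
      · rw [indicator_of_notMem (fun h' => h h'.1)]
        have : G 0 q p = G τ q p := by
          simp only [hG]
          by_cases h' : p.1 ≤ q.2
          · rw [indicator_of_mem (by exact ⟨⟨hp.1.1, h'⟩, trivial⟩),
              indicator_of_mem (by exact ⟨⟨not_le.1 h, h'⟩, trivial⟩)]
          · rw [indicator_of_notMem (fun h'' => h' h''.1.2),
              indicator_of_notMem (fun h'' => h' h''.1.2)]
        rw [this, sub_self, norm_zero]
    · rw [integral_indicator hms, ← spaceTime_restrict hτT.le, integral_const_mul]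
      exact (mul_le_mul_of_nonneg_left hI.2 hC0).trans (hab hqa hτb).le
  -- Once `r > τ` the kernel is bounded, so the weight `1 + 1 / ‖y‖` is an integrable majorant.
  have hmain : ∀ τ > 0, Tendsto (fun q => ∫ p, G τ q p ∂(spaceTime R T)) l
      (𝓝 (∫ p, G τ (x₀, t₀) p ∂(spaceTime R T))) := by
    intro τ hτ
    have hker := continuousOn_heatKer_comp hR 2 (continuous_fst (X := Plane) (Y := Plane × ℝ))
      (continuous_fst.comp continuous_snd) (continuous_snd.comp continuous_snd)
    obtain ⟨D, hD⟩ := ((isCompact_closedBall x₀ 1).prod ((isCompact_closedBall (0 : Plane) R).prod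
      (isCompact_Icc (a := τ) (b := T)))).exists_bound_of_continuousOn
      (hker.mono fun p hp => hτ.trans_le hp.2.2.1)
    refine tendsto_integral_filter_of_dominated_convergence (fun p => |D| * (C * weight p.2)) ?_ ?_
      ?_ ?_
    · filter_upwards [hlx] with q hq using hGm τ q hq.2.2
    · filter_upwards [hlx, hlfst.eventually (Metric.closedBall_mem_nhds x₀ one_pos)] with q hq hq1
      filter_upwards [ae_spaceTime R T, ae_spaceTime_snd (t := T) hC] with p hp hp2
      have hw := weight_nonneg p.2
      by_cases h : p ∈ Ioc τ q.2 ×ˢ (univ : Set Plane)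
      · simp only [hG]
        rw [indicator_of_mem h, norm_smul]
        refine mul_le_mul ?_ (hp2 _ ⟨by linarith [h.1.2], by linarith [h.1.1, hq.2.2]⟩)
          (norm_nonneg _) (abs_nonneg _)
        exact (hD (q.1, p.2, p.1) ⟨hq1, Metric.ball_subset_closedBall hp.2, h.1.1.le,
          hp.1.2⟩).trans (le_abs_self _)
      · simp only [hG]
        rw [indicator_of_notMem h, norm_zero]
        positivity
    · have hwi : Integrable weight (discMeasure R) :=
        (integrable_const 1).add (integrableOn_inv_norm R)
      exact ((hwi.comp_snd (volume.restrict (Ioc 0 T))).const_mul C).const_mul |D|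
    -- The cut-off at the final time is discontinuous in `q` only where `r = t₀`, a null set.
    · have hne0 : ∀ᵐ r : ℝ, r ≠ t₀ := by simp [ae_iff]
      have hne : ∀ᵐ p ∂(spaceTime R T), p.1 ≠ t₀ :=
        (Measure.quasiMeasurePreserving_fst (μ := volume.restrict (Ioc 0 T))
          (ν := discMeasure R)).ae (ae_restrict_of_ae hne0)
      filter_upwards [ae_spaceTime R T, hne] with p hp hpne
      rcases le_or_gt p.1 τ with h1 | h1
      · have : ∀ q, G τ q p = 0 := fun q => indicator_of_notMem (fun h' => h1.not_gt h'.1.1) _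
        simp only [this]
        exact tendsto_const_nhds
      rcases lt_or_gt_of_ne hpne with h2 | h2
      · have hlim : Tendsto (fun q : Plane × ℝ =>
            heatKer hR 2 q.1 p.2 p.1 • f p.2 (q.2 - p.1)) l
            (𝓝 (heatKer hR 2 x₀ p.2 p.1 • f p.2 (t₀ - p.1))) := by
          have hc : Continuous fun z => heatKer hR 2 z p.2 p.1 := by
            simp only [heatKer_symm hR 2 _ p.2]
            exact continuous_heatKer_right hR 2 hp.1.1 p.2
          refine ((hc.tendsto x₀).comp hlfst).smul ?_
          have hcf := hf.continuousOn hp.2 (t₀ - p.1) ⟨by linarith, by linarith [ht₀.2, hp.1.1]⟩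
          refine hcf.tendsto.comp (tendsto_nhdsWithin_iff.2
            ⟨hlsnd.sub tendsto_const_nhds, ?_⟩)
          filter_upwards [hlx, hlsnd.eventually (lt_mem_nhds h2)] with q hq hq2
          exact ⟨by linarith, by linarith [hq.2.2, hp.1.1]⟩
        simp only [hG]
        rw [indicator_of_mem (by exact ⟨⟨h1, h2.le⟩, trivial⟩)]
        refine hlim.congr' ?_
        filter_upwards [hlsnd.eventually (lt_mem_nhds h2)] with q hq2
        rw [indicator_of_mem (by exact ⟨⟨h1, hq2.le⟩, trivial⟩)]
      · simp only [hG]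
        rw [indicator_of_notMem (fun h' => h2.not_ge h'.1.2)]
        refine tendsto_const_nhds.congr' ?_
        filter_upwards [hlsnd.eventually (gt_mem_nhds h2)] with q hq2
        rw [indicator_of_notMem (fun h' => (not_le.2 hq2) h'.1.2)]
  have hself : ∀ ε > 0, ∃ τ > 0, (∀ᶠ q in l,
      ‖∫ p, G 0 q p ∂(spaceTime R T) - ∫ p, G τ q p ∂(spaceTime R T)‖ ≤ ε) ∧
      ‖∫ p, G 0 (x₀, t₀) p ∂(spaceTime R T) - ∫ p, G τ (x₀, t₀) p ∂(spaceTime R T)‖ ≤ ε := by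
    intro ε hε
    obtain ⟨τ, hτ, h⟩ := htail ε hε
    exact ⟨τ, hτ, h, h.self_of_nhdsWithin ⟨hx₀, ht₀⟩⟩
  rw [ContinuousWithinAt, Metric.tendsto_nhds]
  intro ε hε
  obtain ⟨τ, hτ, h1, h2⟩ := hself (ε / 4) (by positivity)
  filter_upwards [hlx, h1, Metric.tendsto_nhds.1 (hmain τ hτ) (ε / 4) (by positivity)]
    with q hq hq1 hq2
  rw [hG0 q hq.1 hq.2, hG0 (x₀, t₀) hx₀ ht₀]
  rw [← dist_eq_norm] at hq1 h2
  rw [dist_comm] at h2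
  have := dist_triangle4 (∫ p, G 0 q p ∂(spaceTime R T)) (∫ p, G τ q p ∂(spaceTime R T))
    (∫ p, G τ (x₀, t₀) p ∂(spaceTime R T)) (∫ p, G 0 (x₀, t₀) p ∂(spaceTime R T))
  linarith

end potential

section semigroup

variable {F : Type*} [NormedAddCommGroup F] {R : ℝ}

lemma integrable_of_bdd {ψ : Plane → F} (hm : AEStronglyMeasurable ψ (discMeasure R)) {B : ℝ}
    (hB : ∀ y ∈ Metric.ball (0 : Plane) R, ‖ψ y‖ ≤ B) : Integrable ψ (discMeasure R) := by
  refine Integrable.of_bound hm B ?_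
  filter_upwards [ae_restrict_mem Metric.isOpen_ball.measurableSet] with y hy using hB y hy

variable [NormedSpace ℝ F] (hR : 0 < R)

/-! ### The semigroup and the evolution of potentials -/

/-- The Dirichlet heat semigroup, written with `heatKer`. -/
def semigroup (ψ : Plane → F) (x : Plane) (t : ℝ) : F :=
  if t = 0 then ψ x else ∫ y, heatKer hR 2 x y t • ψ y ∂(discMeasure R)

lemma semigroup_zero (ψ : Plane → F) (x : Plane) : semigroup hR ψ x 0 = ψ x := if_pos rfl

lemma semigroup_of_pos (ψ : Plane → F) (x : Plane) {t : ℝ} (ht : 0 < t) :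
    semigroup hR ψ x t = ∫ y, heatKer hR 2 x y t • ψ y ∂(discMeasure R) := if_neg ht.ne'

lemma norm_semigroup_le {ψ : Plane → F} {B : ℝ}
    (hB : ∀ y ∈ Metric.ball (0 : Plane) R, ‖ψ y‖ ≤ B) {x : Plane}
    (hx : x ∈ Metric.ball (0 : Plane) R) {t : ℝ} (ht : 0 ≤ t) : ‖semigroup hR ψ x t‖ ≤ B := by
  rcases ht.eq_or_lt with rfl | ht
  · rw [semigroup_zero]; exact hB x hx
  · rw [semigroup_of_pos hR ψ x ht]
    refine norm_integral_heatKer_smul_le hR ht x ((norm_nonneg _).trans (hB x hx)) ?_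
    filter_upwards [ae_restrict_mem Metric.isOpen_ball.measurableSet] with y hy using hB y hy

lemma continuousOn_semigroup [CompleteSpace F] {ψ : Plane → F}
    (hψ : ContinuousOn ψ (Metric.ball 0 R))
    {B : ℝ} (hB : ∀ y ∈ Metric.ball (0 : Plane) R, ‖ψ y‖ ≤ B) :
    ContinuousOn (fun p : Plane × ℝ => semigroup hR ψ p.1 p.2) (Metric.ball 0 R ×ˢ Ici 0) := by
  have hm := hψ.aestronglyMeasurable (μ := volume) Metric.isOpen_ball.measurableSet
  rintro ⟨x₀, t₀⟩ ⟨hx₀, ht₀⟩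
  simp only [mem_Ici] at hx₀ ht₀
  rcases ht₀.eq_or_lt with rfl | ht₀
  · have h1 := tendsto_integral_heatKer_smul hR hx₀ hm hB
      (hψ.continuousAt (Metric.isOpen_ball.mem_nhds hx₀))
    have h2 : Tendsto ψ (𝓝 x₀) (𝓝 (ψ x₀)) := hψ.continuousAt (Metric.isOpen_ball.mem_nhds hx₀)
    rw [ContinuousWithinAt, semigroup_zero]
    rw [Metric.tendsto_nhds]
    intro ε hε
    obtain ⟨pa, ha, pb, hb, hab⟩ := eventually_prod_iff.1 (Metric.tendsto_nhds.1 h1 ε hε)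
    have hb' := eventually_nhdsWithin_iff.1 hb
    filter_upwards [self_mem_nhdsWithin, nhdsWithin_le_nhds ((continuous_fst.tendsto (x₀, (0 : ℝ))).eventually
      (ha.and (Metric.tendsto_nhds.1 h2 ε hε))),
      nhdsWithin_le_nhds ((continuous_snd.tendsto (x₀, (0 : ℝ))).eventually hb')]
    rintro ⟨x, t⟩ ⟨-, ht⟩ ⟨hax, hx⟩ hbt
    simp only [mem_Ici] at ht
    rcases ht.eq_or_lt with rfl | ht
    · rw [semigroup_zero]; exact hx
    · rw [semigroup_of_pos hR ψ x ht]
      exact hab hax (hbt ht)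
  · refine ContinuousAt.continuousWithinAt ?_
    have hmem : {q : Plane × ℝ | 0 < q.2} ∈ 𝓝 (x₀, t₀) :=
      (isOpen_lt continuous_const continuous_snd).mem_nhds ht₀
    have hc : ContinuousAt (fun q : Plane × ℝ => ∫ y, heatKer hR 2 q.1 y q.2 • ψ y ∂(discMeasure R))
        (x₀, t₀) := by
      have hker := continuousOn_heatKer_comp hR 2 (continuous_fst (X := Plane) (Y := Plane × ℝ))
        (continuous_fst.comp continuous_snd) (continuous_snd.comp continuous_snd)
      obtain ⟨D, hD⟩ := ((isCompact_closedBall x₀ 1).prod ((isCompact_closedBall (0 : Plane) R).prod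
        (isCompact_Icc (a := t₀ / 2) (b := 2 * t₀)))).exists_bound_of_continuousOn
        (hker.mono fun p hp => (half_pos ht₀).trans_le hp.2.2.1)
      have hnear : ∀ᶠ q : Plane × ℝ in 𝓝 (x₀, t₀), q.1 ∈ Metric.closedBall x₀ 1 ∧
          q.2 ∈ Icc (t₀ / 2) (2 * t₀) :=
        ((continuous_fst.tendsto (x₀, t₀)).eventually
          (Metric.closedBall_mem_nhds x₀ one_pos)).and
        ((continuous_snd.tendsto (x₀, t₀)).eventually
          (Icc_mem_nhds (half_lt_self ht₀) (by linarith)))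
      refine tendsto_integral_filter_of_dominated_convergence (fun y => D * B) ?_ ?_
        (integrable_const _) ?_
      · filter_upwards [hmem] with q hq
        exact (continuous_heatKer_right hR 2 hq q.1).aestronglyMeasurable.smul hm
      · filter_upwards [hnear] with q hq
        filter_upwards [ae_restrict_mem Metric.isOpen_ball.measurableSet] with y hy
        have := hD (q.1, y, q.2) ⟨hq.1, Metric.ball_subset_closedBall hy, hq.2⟩
        rw [norm_smul]
        exact mul_le_mul this (hB y hy) (norm_nonneg _) ((norm_nonneg _).trans this)
      · refine Eventually.of_forall fun y => Tendsto.smul_const ?_ _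
        have h := continuousOn_heatKer_comp hR 2 (continuous_fst (X := Plane) (Y := ℝ))
          (continuous_const (y := y)) continuous_snd
        exact h.continuousAt hmem
    refine hc.congr ?_
    filter_upwards [hmem] with q hq using (semigroup_of_pos hR ψ q.1 hq).symm

lemma integral_heatKer_smul_heatKer [CompleteSpace F] {s t : ℝ} (hs : 0 < s) (ht : 0 < t) (x y : Plane) (v : F) :
    ∫ z, heatKer hR 2 x z t • heatKer hR 2 z y s • v ∂(discMeasure R) =
      heatKer hR 2 x y (t + s) • v := by
  simp only [smul_smul]
  rw [integral_smul_const, integral_heatKer_mul_heatKer hR hs ht]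

/-- Chapman-Kolmogorov and Fubini; for positive times the product of kernels is bounded on the disc.
-/
lemma semigroup_add [CompleteSpace F] {ψ : Plane → F} (hm : AEStronglyMeasurable ψ (discMeasure R)) {B : ℝ}
    (hB : ∀ y ∈ Metric.ball (0 : Plane) R, ‖ψ y‖ ≤ B) (x : Plane) {s t : ℝ} (hs : 0 ≤ s)
    (ht : 0 < t) :
    ∫ z, heatKer hR 2 x z t • semigroup hR ψ z s ∂(discMeasure R) = semigroup hR ψ x (t + s) := by
  rcases hs.eq_or_lt with rfl | hs
  · simp only [semigroup_zero, add_zero, semigroup_of_pos hR ψ x ht]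
  simp only [semigroup_of_pos hR ψ _ hs, semigroup_of_pos hR ψ _ (add_pos ht hs)]
  have hψ := integrable_of_bdd hm hB
  have hcont : Continuous fun p : Plane × Plane => heatKer hR 2 x p.1 t * heatKer hR 2 p.1 p.2 s := by
    have h1 := (continuous_heatKer_right hR 2 ht x).comp (continuous_fst (X := Plane) (Y := Plane))
    have h2 := continuousOn_heatKer_comp hR 2 (continuous_fst (X := Plane) (Y := Plane))
      continuous_snd (continuous_const (y := s))
    simp only [hs, ofPred_true, continuousOn_univ] at h2
    exact h1.mul h2
  have hint : Integrable (Function.uncurry fun z y =>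
      (heatKer hR 2 x z t * heatKer hR 2 z y s) • ψ y) ((discMeasure R).prod (discMeasure R)) := by
    obtain ⟨D, hD⟩ := ((isCompact_closedBall (0 : Plane) R).prod
      (isCompact_closedBall (0 : Plane) R)).exists_bound_of_continuousOn hcont.continuousOn
    refine (hψ.comp_snd (discMeasure R)).bdd_smul D hcont.aestronglyMeasurable ?_
    have hae : ∀ᵐ p ∂((discMeasure R).prod (discMeasure R)),
        p ∈ Metric.ball (0 : Plane) R ×ˢ Metric.ball (0 : Plane) R := by
      rw [Measure.prod_restrict]
      exact ae_restrict_mem (Metric.isOpen_ball.measurableSet.prod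
        Metric.isOpen_ball.measurableSet)
    filter_upwards [hae] with p hp
    exact hD p ⟨Metric.ball_subset_closedBall hp.1, Metric.ball_subset_closedBall hp.2⟩
  have hswap := integral_integral_swap hint
  simp only [mul_smul] at hswap
  simp only [integral_smul, integral_heatKer_smul_heatKer hR hs ht] at hswap
  exact hswap

/-- Chapman-Kolmogorov applied inside the space-time integral. Exchanging the integrals is allowed
because the absolute potentials are bounded by `C (s + R)` uniformly in `z`. -/
lemma integral_potential_add [CompleteSpace F] {T : ℝ} {f : Plane → ℝ → F} (hf : IsSource R T f) {x : Plane}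
    {s t : ℝ} (hs : 0 < s) (hsT : s ≤ T) (ht : 0 < t) :
    Integrable (fun p : ℝ × Plane => heatKer hR 2 x p.2 (t + p.1) • f p.2 (s - p.1))
        (spaceTime R s) ∧
    ∫ z, heatKer hR 2 x z t • potential hR f z s ∂(discMeasure R) =
      ∫ p, heatKer hR 2 x p.2 (t + p.1) • f p.2 (s - p.1) ∂(spaceTime R s) := by
  obtain ⟨C, hC0, hC⟩ := hf.exists_bound
  have hm : AEStronglyMeasurable (Function.uncurry fun (z : Plane) (p : ℝ × Plane) =>
      heatKer hR 2 x z t • heatKer hR 2 z p.2 p.1 • f p.2 (s - p.1))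
      ((discMeasure R).prod (spaceTime R s)) := by
    have h1 : AEStronglyMeasurable (fun q : Plane × ℝ × Plane => heatKer hR 2 q.1 q.2.2 q.2.1)
        ((discMeasure R).prod (spaceTime R s)) := by
      rw [spaceTime_eq, Measure.prod_restrict]
      refine ContinuousOn.aestronglyMeasurable ?_
        (Metric.isOpen_ball.measurableSet.prod (measurableSet_spaceTime R s))
      exact (continuousOn_heatKer_comp hR 2 continuous_fst (continuous_snd.comp continuous_snd)
        (continuous_fst.comp continuous_snd)).mono fun q hq => hq.2.1.1
    exact ((continuous_heatKer_right hR 2 ht x).aestronglyMeasurable.comp_fst).smul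
      (h1.smul (hf.aestronglyMeasurable hsT).comp_snd)
  have hint : Integrable (Function.uncurry fun (z : Plane) (p : ℝ × Plane) =>
      heatKer hR 2 x z t • heatKer hR 2 z p.2 p.1 • f p.2 (s - p.1))
      ((discMeasure R).prod (spaceTime R s)) := by
    refine (integrable_prod_iff hm).2 ⟨?_, ?_⟩
    · filter_upwards [ae_restrict_mem Metric.isOpen_ball.measurableSet] with z hz
      exact (integrable_potential hR hf hC hz hs hsT).1.smul (heatKer hR 2 x z t)
    · refine ((integrable_heatKer hR ht x).mul_const (C * (s + R))).mono'
        hm.norm.integral_prod_right' ?_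
      filter_upwards [ae_restrict_mem Metric.isOpen_ball.measurableSet] with z hz
      rw [Real.norm_of_nonneg (integral_nonneg fun _ => norm_nonneg _)]
      simp only [Function.uncurry, norm_smul (heatKer hR 2 x z t),
        Real.norm_of_nonneg (heatKer_nonneg hR ht x z)]
      rw [integral_const_mul]
      refine mul_le_mul_of_nonneg_left ?_ (heatKer_nonneg hR ht x z)
      refine (integrable_potential hR hf hC hz hs hsT).2.trans ?_
      rw [integral_const_mul]
      refine mul_le_mul_of_nonneg_left ((integrable_heatKer_weight hR hz hs).2.trans ?_) hC0
      gcongr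
      exact max_le (heatDefect_le hR hs) hR.le
  have hcomp : ∀ᵐ p ∂(spaceTime R s),
      ∫ z, heatKer hR 2 x z t • heatKer hR 2 z p.2 p.1 • f p.2 (s - p.1) ∂(discMeasure R) =
        heatKer hR 2 x p.2 (t + p.1) • f p.2 (s - p.1) := by
    filter_upwards [ae_spaceTime R s] with p hp
    exact integral_heatKer_smul_heatKer hR hp.1.1 ht x p.2 _
  refine ⟨(integrable_congr hcomp).1 hint.integral_prod_right, ?_⟩
  rw [← integral_congr_ae hcomp, ← integral_integral_swap hint]
  refine setIntegral_congr_fun Metric.isOpen_ball.measurableSet fun z hz => ?_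
  rw [potential_eq_integral hR hf hz hs hsT, ← integral_smul]

/-- Evolving a potential by the semigroup. -/
lemma potential_add [CompleteSpace F] {T : ℝ} {f : Plane → ℝ → F} (hf : IsSource R T f) {x : Plane}
    (hx : x ∈ Metric.ball (0 : Plane) R) {s t : ℝ} (hs : 0 ≤ s) (ht : 0 < t) (hst : s + t ≤ T) :
    potential hR f x (s + t) =
      ∫ z, heatKer hR 2 x z t • potential hR f z s ∂(discMeasure R) +
        potential hR (fun y r => f y (s + r)) x t := by
  rcases hs.eq_or_lt with rfl | hs
  · simp [potential_zero]
  obtain ⟨C, hC0, hC⟩ := hf.exists_bound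
  obtain ⟨hI, he⟩ := integral_potential_add hR hf (x := x) hs (by linarith) ht
  have hI2 := (integrable_potential hR hf hC hx (add_pos hs ht) hst).1
  have hi : IntervalIntegrable (fun r => ∫ y, heatKer hR 2 x y r • f y (s + t - r) ∂(discMeasure R))
      volume 0 (s + t) := by
    rw [intervalIntegrable_iff_integrableOn_Ioc_of_le (by positivity)]
    exact hI2.integral_prod_left
  rw [he, integral_spaceTime_eq hs.le hI, potential, potential]
  have h1 : IntervalIntegrable (fun r => ∫ y, heatKer hR 2 x y r • f y (s + t - r) ∂(discMeasure R))
      volume 0 t := hi.mono_set (by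
        rw [uIcc_of_le ht.le, uIcc_of_le (by positivity)]; exact Icc_subset_Icc_right (by linarith))
  have h2 : IntervalIntegrable (fun r => ∫ y, heatKer hR 2 x y r • f y (s + t - r) ∂(discMeasure R))
      volume t (s + t) := hi.mono_set (by
        rw [uIcc_of_le (by linarith), uIcc_of_le (by positivity)]
        exact Icc_subset_Icc_left ht.le)
  -- Elapsed times below `t` belong to the source after the restart; those above `t` are the earlier
  -- potential evolved for the time `t`.
  rw [← intervalIntegral.integral_add_adjacent_intervals h1 h2, add_comm]
  congr 1
  · have := intervalIntegral.integral_comp_add_left (a := 0) (b := s)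
      (fun r => ∫ y, heatKer hR 2 x y r • f y (s + t - r) ∂(discMeasure R)) t
    rw [add_zero, add_comm t s] at this
    rw [← this]
    refine intervalIntegral.integral_congr fun r _ => ?_
    simp only
    rw [show s + t - (t + r) = s - r by ring]
  · refine intervalIntegral.integral_congr fun r _ => ?_
    simp only [add_sub_assoc]

end semigroup

/-! ### Comparison with supersolutions -/

/-- Integration by parts for the absolutely continuous product of the exponential and the primitive;
`a` is only assumed integrable, since the spatial integrals of singular sources are not known to be
continuous in time. -/
lemma integral_exp_mul_sub_primitive {a : ℝ → ℝ} {t : ℝ} (lam : ℝ)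
    (ha : IntervalIntegrable a volume 0 t) :
    ∫ r in (0 : ℝ)..t, (Real.exp (-(lam * r)) * a r -
      lam * Real.exp (-(lam * r)) * ∫ s in (0 : ℝ)..r, a s) =
      Real.exp (-(lam * t)) * ∫ s in (0 : ℝ)..t, a s := by
  have hE : AbsolutelyContinuousOnInterval (fun r => Real.exp (-(lam * r))) 0 t :=
    ContDiffOn.absolutelyContinuousOnInterval (by fun_prop)
  have hA := ha.absolutelyContinuousOnInterval_intervalIntegral (c := 0) left_mem_uIcc
  have h := (hE.fun_mul hA).integral_deriv_eq_sub
  simp only [intervalIntegral.integral_same, mul_zero, sub_zero] at h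
  rw [← h]
  refine intervalIntegral.integral_congr_ae ?_
  filter_upwards [ha.ae_hasDerivAt_integral] with r hr hrt
  have h1 := hr (uIoc_subset_uIcc hrt) 0 left_mem_uIcc
  have h2 : HasDerivAt (fun r => Real.exp (-(lam * r))) (Real.exp (-(lam * r)) * -(lam * 1)) r :=
    (((hasDerivAt_id r).const_mul lam).neg).exp
  rw [(h2.fun_mul h1).deriv]
  ring

section comparison

variable {R : ℝ} (hR : 0 < R)

/-- The mild solution of the heat equation with source `f`, initial value `ψ` and zero boundary
values. -/
def mild {F : Type*} [NormedAddCommGroup F] [NormedSpace ℝ F] (f : Plane → ℝ → F) (ψ : Plane → F)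
    (x : Plane) (t : ℝ) : F :=
  potential hR f x t + semigroup hR ψ x t

lemma integrable_weight (R : ℝ) : Integrable weight (discMeasure R) :=
  (integrable_const 1).add (integrableOn_inv_norm R)

section source

variable {F : Type*} [NormedAddCommGroup F] {T : ℝ}

lemma IsSource.integrable {f : Plane → ℝ → F} (hf : IsSource R T f) {s : ℝ} (hs : s ∈ Icc 0 T) :
    Integrable (fun y => f y s) (discMeasure R) := by
  obtain ⟨C, -, hC⟩ := hf.exists_bound
  obtain ⟨g, b, C', -, hgc, -, hbm, -, h⟩ := hf
  have h1 : ContinuousOn (fun y => g y s) (Metric.ball 0 R) :=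
    hgc.comp (f := fun y => (y, s)) (by fun_prop) fun y hy => ⟨hy, hs⟩
  refine ((integrable_weight R).const_mul C).mono' ?_ (hC.mono fun y hy => hy s hs)
  refine ((h1.aestronglyMeasurable Metric.isOpen_ball.measurableSet).add hbm).congr ?_
  filter_upwards [ae_restrict_mem Metric.isOpen_ball.measurableSet] with y hy
  exact (h y hy s hs).symm

lemma isSource_of_bddCont_add {g : Plane → ℝ → F} {b : Plane → F} {B C : ℝ} (hB : 0 ≤ B) (hC : 0 ≤ C)
    (hgc : ContinuousOn (fun p : Plane × ℝ => g p.1 p.2) (Metric.ball 0 R ×ˢ Icc 0 T))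
    (hg : ∀ y ∈ Metric.ball (0 : Plane) R, ∀ s ∈ Icc 0 T, ‖g y s‖ ≤ B)
    (hbm : AEStronglyMeasurable b (discMeasure R))
    (hb : ∀ᵐ y ∂(discMeasure R), ‖b y‖ ≤ C * weight y) :
    IsSource R T fun y s => g y s + b y := by
  refine ⟨g, b, B + C, by positivity, hgc, fun y hy s hs => by linarith [hg y hy s hs], hbm, ?_,
    fun _ _ _ _ => rfl⟩
  filter_upwards [hb] with y hy
  nlinarith [weight_nonneg y]

lemma IsSource.add_bddCont {f h : Plane → ℝ → F} (hf : IsSource R T f)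
    (hh : ContinuousOn (fun p : Plane × ℝ => h p.1 p.2) (Metric.ball 0 R ×ˢ Icc 0 T)) {B : ℝ}
    (hB : ∀ y ∈ Metric.ball (0 : Plane) R, ∀ s ∈ Icc 0 T, ‖h y s‖ ≤ B) :
    IsSource R T fun y s => f y s + h y s := by
  obtain ⟨g, b, C, hC, hgc, hg, hbm, hb, h'⟩ := hf
  have h1 := isSource_of_bddCont_add (g := fun y s => g y s + h y s) (B := C + |B|) (by positivity) hC
    (hgc.add hh) (fun y hy s hs => (norm_add_le _ _).trans
      (add_le_add (hg y hy s hs) ((hB y hy s hs).trans (le_abs_self B)))) hbm hb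
  obtain ⟨g', b', C', hC', hgc', hg', hbm', hb', h''⟩ := h1
  exact ⟨g', b', C', hC', hgc', hg', hbm', hb', fun y hy s hs => by
    have e := h'' y hy s hs
    simp only at e ⊢
    rw [h' y hy s hs, ← e]
    abel⟩

lemma IsSource.clm_comp {F' : Type*} [NormedAddCommGroup F'] [NormedSpace ℝ F] [NormedSpace ℝ F']
    (L : F →L[ℝ] F') {f : Plane → ℝ → F} (hf : IsSource R T f) :
    IsSource R T fun y s => L (f y s) := by
  obtain ⟨g, b, C, hC, hgc, hg, hbm, hb, h'⟩ := hf
  refine ⟨fun y s => L (g y s), fun y => L (b y), ‖L‖ * C, by positivity,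
    L.continuous.comp_continuousOn hgc, fun y hy s hs => ?_,
    L.continuous.comp_aestronglyMeasurable hbm, ?_, fun y hy s hs => by
    simp only
    rw [h' y hy s hs, map_add]⟩
  · exact (L.le_opNorm _).trans (mul_le_mul_of_nonneg_left (hg y hy s hs) (norm_nonneg _))
  · filter_upwards [hb] with y hy
    rw [mul_assoc]
    exact (L.le_opNorm _).trans (mul_le_mul_of_nonneg_left hy (norm_nonneg _))

variable [NormedSpace ℝ F]

lemma IsSource.intervalIntegrable {f : Plane → ℝ → F} (hf : IsSource R T f) {x : Plane}
    (hx : x ∈ Metric.ball (0 : Plane) R) {t : ℝ} (ht0 : 0 < t) (ht : t ≤ T) :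
    IntervalIntegrable (fun r => ∫ y, heatKer hR 2 x y r • f y (t - r) ∂(discMeasure R))
      volume 0 t := by
  obtain ⟨C, -, hC⟩ := hf.exists_bound
  rw [intervalIntegrable_iff_integrableOn_Ioc_of_le ht0.le]
  exact (integrable_potential hR hf hC hx ht0 ht).1.integral_prod_left

lemma exists_norm_mild_le {f : Plane → ℝ → F} (hf : IsSource R T f) {ψ : Plane → F} {B : ℝ}
    (hB : ∀ y ∈ Metric.ball (0 : Plane) R, ‖ψ y‖ ≤ B) :
    ∃ C, 0 ≤ C ∧ ∀ x ∈ Metric.ball (0 : Plane) R, ∀ t ∈ Icc 0 T,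
      ‖mild hR f ψ x t‖ ≤ C * (t + R) + B := by
  obtain ⟨C, hC0, hC⟩ := hf.exists_bound
  refine ⟨C, hC0, fun x hx t ht => (norm_add_le _ _).trans
    (add_le_add ?_ (norm_semigroup_le hR hB hx ht.1))⟩
  rcases ht.1.eq_or_lt with h | h
  · rw [← h, potential_zero, norm_zero]; positivity
  · exact norm_potential_le hR hf hC0 hC hx h ht.2

variable [CompleteSpace F]

lemma continuousOn_mild {f : Plane → ℝ → F} (hf : IsSource R T f) {ψ : Plane → F}
    (hψ : ContinuousOn ψ (Metric.ball 0 R)) {B : ℝ}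
    (hB : ∀ y ∈ Metric.ball (0 : Plane) R, ‖ψ y‖ ≤ B) :
    ContinuousOn (fun p : Plane × ℝ => mild hR f ψ p.1 p.2) (Metric.ball 0 R ×ˢ Icc 0 T) :=
  (continuousOn_potential hR hf).add
    ((continuousOn_semigroup hR hψ hB).mono (prod_mono_right Icc_subset_Ici_self))

/-- Mild solutions evolve by restarting at an intermediate time. -/
lemma mild_add {f : Plane → ℝ → F} (hf : IsSource R T f) {ψ : Plane → F}
    (hψ : ContinuousOn ψ (Metric.ball 0 R)) {B : ℝ}
    (hB : ∀ y ∈ Metric.ball (0 : Plane) R, ‖ψ y‖ ≤ B) {x : Plane}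
    (hx : x ∈ Metric.ball (0 : Plane) R) {s t : ℝ} (hs : 0 ≤ s) (ht : 0 ≤ t) (hst : s + t ≤ T) :
    mild hR f ψ x (s + t) = mild hR (fun y r => f y (s + r)) (fun z => mild hR f ψ z s) x t := by
  rcases ht.eq_or_lt with rfl | ht
  · simp [mild, potential_zero, semigroup_zero]
  have hsT : s ∈ Icc 0 T := ⟨hs, by linarith⟩
  have hmeas : MeasurableSet (Metric.ball (0 : Plane) R) := Metric.isOpen_ball.measurableSet
  have hc := continuousOn_mild hR hf hψ hB
  obtain ⟨C, hC0, hC⟩ := exists_norm_mild_le hR hf hB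
  have h0 : ∀ y ∈ Metric.ball (0 : Plane) R, ‖(0 : F)‖ ≤ 0 := fun _ _ => norm_zero.le
  have i1 : Integrable (fun z => potential hR f z s) (discMeasure R) := by
    obtain ⟨C', hC0', hC'⟩ := hf.exists_bound
    refine integrable_of_bdd (B := C' * (s + R)) (ContinuousOn.aestronglyMeasurable
      ((continuousOn_potential hR hf).comp (f := fun z => (z, s)) (by fun_prop)
        fun z hz => ⟨hz, hsT⟩) hmeas) fun z hz => ?_
    rcases hs.eq_or_lt with rfl | hs
    · rw [potential_zero, norm_zero]; positivity
    · exact norm_potential_le hR hf hC0' hC' hz hs hsT.2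
  have i2 : Integrable (fun z => semigroup hR ψ z s) (discMeasure R) :=
    integrable_of_bdd (ContinuousOn.aestronglyMeasurable
      ((continuousOn_semigroup hR hψ hB).comp (f := fun z => (z, s)) (by fun_prop)
        fun z hz => ⟨hz, hs⟩) hmeas) fun z hz => norm_semigroup_le hR hB hz hs
  unfold mild
  rw [semigroup_of_pos hR _ x ht, potential_add hR hf hx hs ht hst]
  simp only [smul_add]
  rw [integral_add (integrable_heatKer_smul hR ht x i1) (integrable_heatKer_smul hR ht x i2),
    semigroup_add hR (hψ.aestronglyMeasurable hmeas) hB x hs ht, add_comm t s]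
  abel

end source

variable {T lam : ℝ}

/-- Exponentially weighted form of the mild formulation. -/
lemma mild_eq_integral_exp {f : Plane → ℝ → ℝ} (hf : IsSource R T f) {ψ : Plane → ℝ}
    (hψ : ContinuousOn ψ (Metric.ball 0 R)) {B : ℝ}
    (hB : ∀ y ∈ Metric.ball (0 : Plane) R, ‖ψ y‖ ≤ B) {x : Plane}
    (hx : x ∈ Metric.ball (0 : Plane) R) {t : ℝ} (ht0 : 0 < t) (ht : t ≤ T) (lam : ℝ) :
    mild hR f ψ x t = (∫ r in (0 : ℝ)..t, Real.exp (-(lam * r)) *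
        ∫ y, heatKer hR 2 x y r * (f y (t - r) + lam * mild hR f ψ y (t - r)) ∂(discMeasure R)) +
      Real.exp (-(lam * t)) * semigroup hR ψ x t := by
  set a : ℝ → ℝ := fun r => ∫ y, heatKer hR 2 x y r • f y (t - r) ∂(discMeasure R) with ha
  have hai : IntervalIntegrable a volume 0 t := hf.intervalIntegrable hR hx ht0 ht
  have hAt : ∫ s in (0 : ℝ)..t, a s = potential hR f x t := rfl
  obtain ⟨C, hC0, hC⟩ := exists_norm_mild_le hR hf hB
  have hc := continuousOn_mild hR hf hψ hB
  -- Restarting at time `t - r` expresses the evolution of `mild` over the time `r` as `mild` at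
  -- time `t` minus the contribution of the source up to elapsed time `r`.
  have key : ∀ r ∈ Ioc 0 t,
      ∫ y, heatKer hR 2 x y r * (f y (t - r) + lam * mild hR f ψ y (t - r)) ∂(discMeasure R) =
        a r + lam * (mild hR f ψ x t - ∫ s in (0 : ℝ)..r, a s) := by
    intro r hr
    have hmem : t - r ∈ Icc 0 T := ⟨by linarith [hr.2], by linarith [hr.1]⟩
    have i1 := integrable_heatKer_smul hR hr.1 x (hf.integrable hmem)
    have i2 : Integrable (fun y => mild hR f ψ y (t - r)) (discMeasure R) :=
      integrable_of_bdd (B := C * (t - r + R) + B) (ContinuousOn.aestronglyMeasurable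
        (hc.comp (f := fun y => (y, t - r)) (by fun_prop) fun y hy => ⟨hy, hmem⟩)
        Metric.isOpen_ball.measurableSet) fun y hy => hC y hy _ hmem
    have i3 := (integrable_heatKer_smul hR hr.1 x i2).const_mul lam
    have e : mild hR f ψ x t = (∫ s in (0 : ℝ)..r, a s) +
        ∫ y, heatKer hR 2 x y r • mild hR f ψ y (t - r) ∂(discMeasure R) := by
      have := mild_add hR hf hψ hB hx (s := t - r) (t := r) hmem.1 hr.1.le (by linarith)
      rw [sub_add_cancel] at this
      rw [this, mild, semigroup_of_pos hR _ x hr.1]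
      congr 1
      refine intervalIntegral.integral_congr fun s _ => ?_
      simp only [ha]
      rw [show t - r + (r - s) = t - s by ring]
    rw [e, add_sub_cancel_left, ← integral_const_mul, ← integral_add i1 i3]
    refine integral_congr_ae (Eventually.of_forall fun y => ?_)
    simp only [smul_eq_mul]
    ring
  have hexp : ∫ r in (0 : ℝ)..t, lam * Real.exp (-(lam * r)) = 1 - Real.exp (-(lam * t)) := by
    have h1 : ∀ r ∈ uIcc 0 t, HasDerivAt (fun r => -Real.exp (-(lam * r)))
        (lam * Real.exp (-(lam * r))) r := fun r _ => by
      have h2 : HasDerivAt (fun r => Real.exp (-(lam * r)))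
        (Real.exp (-(lam * r)) * -(lam * 1)) r := (((hasDerivAt_id r).const_mul lam).neg).exp
      exact h2.fun_neg.congr_deriv (by ring)
    rw [intervalIntegral.integral_eq_sub_of_hasDerivAt h1
      ((by fun_prop : Continuous fun r => lam * Real.exp (-(lam * r))).intervalIntegrable _ _)]
    simp
    ring
  have hcongr : ∫ r in (0 : ℝ)..t, Real.exp (-(lam * r)) *
        ∫ y, heatKer hR 2 x y r * (f y (t - r) + lam * mild hR f ψ y (t - r)) ∂(discMeasure R) =
      ∫ r in (0 : ℝ)..t, ((Real.exp (-(lam * r)) * a r -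
        lam * Real.exp (-(lam * r)) * ∫ s in (0 : ℝ)..r, a s) +
        lam * Real.exp (-(lam * r)) * mild hR f ψ x t) := by
    refine intervalIntegral.integral_congr_ae (Eventually.of_forall fun r hr => ?_)
    rw [uIoc_of_le ht0.le] at hr
    rw [key r hr]
    ring
  have hE : Continuous fun r => Real.exp (-(lam * r)) := by fun_prop
  have hlE : Continuous fun r => lam * Real.exp (-(lam * r)) := by fun_prop
  rw [hcongr, intervalIntegral.integral_add, integral_exp_mul_sub_primitive lam hai,
    intervalIntegral.integral_mul_const, hexp, hAt, mild]
  · ring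
  · refine (hai.continuousOn_mul hE.continuousOn).sub (ContinuousOn.intervalIntegrable ?_)
    exact hlE.continuousOn.mul (intervalIntegral.continuousOn_primitive_interval' hai left_mem_uIcc)
  · exact (hlE.mul_const _).intervalIntegrable _ _

/-- Mild solutions stay below functions satisfying an integrated supersolution inequality. -/
theorem mild_le_of_supersolution {f : Plane → ℝ → ℝ} (hf : IsSource R T f) {ψ : Plane → ℝ}
    (hψ : ContinuousOn ψ (Metric.ball 0 R)) {B : ℝ}
    (hB : ∀ y ∈ Metric.ball (0 : Plane) R, ‖ψ y‖ ≤ B) {g G : Plane → ℝ}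
    (hg : Integrable g (discMeasure R)) (hGm : AEStronglyMeasurable G (discMeasure R)) {C : ℝ}
    (hC : 0 ≤ C) (hG : ∀ᵐ y ∂(discMeasure R), |G y| ≤ C * weight y)
    (hψg : ∀ y ∈ Metric.ball (0 : Plane) R, ψ y ≤ g y)
    (hfg : ∀ᵐ y ∂(discMeasure R), ∀ s ∈ Icc 0 T, f y s + lam * mild hR f ψ y s ≤ G y)
    {x : Plane} (hx : x ∈ Metric.ball (0 : Plane) R) {t : ℝ} (ht0 : 0 < t) (ht : t ≤ T)
    (hsup : Real.exp (-(lam * t)) * ∫ y, heatKer hR 2 x y t * g y ∂(discMeasure R) +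
      ∫ r in (0 : ℝ)..t, Real.exp (-(lam * r)) *
        ∫ y, heatKer hR 2 x y r * G y ∂(discMeasure R) ≤ g x) :
    mild hR f ψ x t ≤ g x := by
  refine le_trans ?_ hsup
  rw [mild_eq_integral_exp hR hf hψ hB hx ht0 ht lam, add_comm]
  have hmeas : MeasurableSet (Metric.ball (0 : Plane) R) := Metric.isOpen_ball.measurableSet
  obtain ⟨C', hC0', hC'⟩ := exists_norm_mild_le hR hf hB
  have hc := continuousOn_mild hR hf hψ hB
  have hs1 : IsSource R T fun y s => f y s + lam * mild hR f ψ y s := by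
    refine hf.add_bddCont (B := |lam| * (C' * (T + R) + B)) (continuousOn_const.mul hc)
      fun y hy s hs => ?_
    rw [norm_mul, Real.norm_eq_abs lam]
    refine mul_le_mul_of_nonneg_left ((hC' y hy s hs).trans ?_) (abs_nonneg _)
    have := hs.2
    gcongr
  have hs2 : IsSource R T fun (y : Plane) (_ : ℝ) => G y := by
    have := isSource_of_bddCont_add (g := fun _ _ => (0 : ℝ)) (T := T) le_rfl hC continuousOn_const
      (fun _ _ _ _ => norm_zero.le) hGm hG
    simpa using this
  have hE : Continuous fun r => Real.exp (-(lam * r)) := by fun_prop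
  refine add_le_add ?_ ?_
  · rw [semigroup_of_pos hR ψ x ht0]
    refine mul_le_mul_of_nonneg_left ?_ (Real.exp_pos _).le
    refine integral_mono_ae (integrable_heatKer_smul hR ht0 x
      (integrable_of_bdd (hψ.aestronglyMeasurable hmeas) hB)) (integrable_heatKer_smul hR ht0 x hg) ?_
    filter_upwards [ae_restrict_mem hmeas] with y hy
    exact mul_le_mul_of_nonneg_left (hψg y hy) (heatKer_nonneg hR ht0 x y)
  · refine intervalIntegral.integral_mono_on_of_le_Ioo ht0.le
      ((hs1.intervalIntegrable hR hx ht0 ht).continuousOn_mul hE.continuousOn)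
      ((hs2.intervalIntegrable hR hx ht0 ht).continuousOn_mul hE.continuousOn) fun r hr => ?_
    have hmem : t - r ∈ Icc 0 T := ⟨by linarith [hr.2], by linarith [hr.1]⟩
    refine mul_le_mul_of_nonneg_left ?_ (Real.exp_pos _).le
    refine integral_mono_ae (integrable_heatKer_smul hR hr.1 x (hs1.integrable hmem))
      (integrable_heatKer_smul hR hr.1 x (hs2.integrable hmem)) ?_
    filter_upwards [hfg] with y hy
    exact mul_le_mul_of_nonneg_left (hy _ hmem) (heatKer_nonneg hR hr.1 x y)

end comparison

/-! ### The a priori bound for mild solutions -/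

/-- `V` is a continuous limit of `C²` functions bounded by `B`, whose Laplacians are dominated by a
multiple of `1 + 1 / ‖y‖` and converge to `G` almost everywhere. -/
structure IsRegularLimit (R B : ℝ) (V G : Plane → Plane) : Prop where
  continuousOn : ContinuousOn V (Metric.ball 0 R)
  exists_seq : ∃ (v : ℕ → Plane → Plane) (C : ℝ), 0 ≤ C ∧
    (∀ n, ContDiffOn ℝ 2 (v n) (Metric.ball 0 R)) ∧
    (∀ n, ∀ y ∈ Metric.ball (0 : Plane) R, ‖v n y‖ ≤ B) ∧
    (∀ n, ∃ N, ∀ y ∈ Metric.ball (0 : Plane) R, ‖laplacian (v n) y‖ ≤ N) ∧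
    (∀ n, ∀ᵐ y ∂(discMeasure R), ‖laplacian (v n) y‖ ≤ C * weight y) ∧
    (∀ y ∈ Metric.ball (0 : Plane) R, Tendsto (fun n => v n y) atTop (𝓝 (V y))) ∧
    ∀ᵐ y ∂(discMeasure R), Tendsto (fun n => laplacian (v n) y) atTop (𝓝 (G y))

section apriori

variable {R B : ℝ} {V G : Plane → Plane}

lemma IsRegularLimit.norm_le (h : IsRegularLimit R B V G) :
    ∀ y ∈ Metric.ball (0 : Plane) R, ‖V y‖ ≤ B := by
  obtain ⟨v, C, -, -, hB, -, -, hv, -⟩ := h.exists_seq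
  exact fun y hy => le_of_tendsto (hv y hy).norm (Eventually.of_forall fun n => hB n y hy)

lemma aestronglyMeasurable_laplacian {v : Plane → Plane} (hv : ContDiffOn ℝ 2 v (Metric.ball 0 R)) :
    AEStronglyMeasurable (laplacian v) (discMeasure R) :=
  (continuousOn_laplacian Metric.isOpen_ball hv).aestronglyMeasurable
    Metric.isOpen_ball.measurableSet

lemma IsRegularLimit.laplacian_bound (h : IsRegularLimit R B V G) :
    AEStronglyMeasurable G (discMeasure R) ∧
      ∃ C, 0 ≤ C ∧ ∀ᵐ y ∂(discMeasure R), ‖G y‖ ≤ C * weight y := by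
  obtain ⟨v, C, hC, hv2, -, -, hvC, -, hG⟩ := h.exists_seq
  refine ⟨aestronglyMeasurable_of_tendsto_ae atTop
    (fun n => aestronglyMeasurable_laplacian (hv2 n)) hG, C, hC, ?_⟩
  filter_upwards [hG, ae_all_iff.2 hvC] with y hy hyC
  exact le_of_tendsto hy.norm (Eventually.of_forall hyC)

/-- Dominated convergence in space-time, with the kernel times the weight `1 + 1 / ‖y‖` as majorant.
-/
lemma tendsto_integral_heatKer_mul (hR : 0 < R) {x : Plane}
    (hx : x ∈ Metric.ball (0 : Plane) R) {t : ℝ} (ht : 0 < t) {lam : ℝ} (hl : 0 ≤ lam)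
    {u : ℕ → Plane → ℝ} {w : Plane → ℝ} {C : ℝ}
    (hm : ∀ n, AEStronglyMeasurable (u n) (discMeasure R))
    (hb : ∀ n, ∀ᵐ y ∂(discMeasure R), |u n y| ≤ C * weight y)
    (hlim : ∀ᵐ y ∂(discMeasure R), Tendsto (fun n => u n y) atTop (𝓝 (w y))) :
    Tendsto (fun n => ∫ r in (0 : ℝ)..t, Real.exp (-(lam * r)) *
        ∫ y, heatKer hR 2 x y r * u n y ∂(discMeasure R)) atTop
      (𝓝 (∫ r in (0 : ℝ)..t, Real.exp (-(lam * r)) *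
        ∫ y, heatKer hR 2 x y r * w y ∂(discMeasure R))) := by
  have hwm : AEStronglyMeasurable w (discMeasure R) := aestronglyMeasurable_of_tendsto_ae atTop hm hlim
  have hwb : ∀ᵐ y ∂(discMeasure R), |w y| ≤ C * weight y := by
    filter_upwards [hlim, ae_all_iff.2 hb] with y hy hyC
    exact le_of_tendsto hy.abs (Eventually.of_forall hyC)
  have hwt := ((integrable_heatKer_weight hR hx ht).1).const_mul C
  have hE : Continuous fun p : ℝ × Plane => Real.exp (-(lam * p.1)) := by fun_prop
  have hmeas : ∀ {z : Plane → ℝ}, AEStronglyMeasurable z (discMeasure R) →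
      AEStronglyMeasurable (fun p : ℝ × Plane =>
        Real.exp (-(lam * p.1)) * (heatKer hR 2 x p.2 p.1 * z p.2)) (spaceTime R t) := fun hz =>
    hE.aestronglyMeasurable.mul ((aestronglyMeasurable_heatKer hR 2 x t).mul
      (hz.comp_snd (μ := volume.restrict (Ioc 0 t))))
  have hbd : ∀ {z : Plane → ℝ}, (∀ᵐ y ∂(discMeasure R), |z y| ≤ C * weight y) →
      ∀ᵐ p ∂(spaceTime R t), ‖Real.exp (-(lam * p.1)) * (heatKer hR 2 x p.2 p.1 * z p.2)‖ ≤
        C * (heatKer hR 2 x p.2 p.1 * weight p.2) := by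
    intro z hz
    filter_upwards [ae_spaceTime R t, ae_spaceTime_snd (t := t) hz] with p hp hp2
    have hH := heatKer_nonneg hR hp.1.1 x p.2
    have h1 : Real.exp (-(lam * p.1)) ≤ 1 :=
      Real.exp_le_one_iff.2 (neg_nonpos.2 (mul_nonneg hl hp.1.1.le))
    rw [norm_mul, norm_mul, Real.norm_of_nonneg hH, Real.norm_of_nonneg (Real.exp_pos _).le,
      Real.norm_eq_abs]
    calc _ ≤ 1 * (heatKer hR 2 x p.2 p.1 * (C * weight p.2)) := by gcongr
      _ = _ := by ring
  have heq : ∀ {z : Plane → ℝ}, AEStronglyMeasurable z (discMeasure R) →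
      (∀ᵐ y ∂(discMeasure R), |z y| ≤ C * weight y) →
      ∫ p, Real.exp (-(lam * p.1)) * (heatKer hR 2 x p.2 p.1 * z p.2) ∂(spaceTime R t) =
      ∫ r in (0 : ℝ)..t, Real.exp (-(lam * r)) *
        ∫ y, heatKer hR 2 x y r * z y ∂(discMeasure R) := by
    intro z hz hzb
    rw [integral_spaceTime_eq ht.le (hwt.mono' (hmeas hz) (hbd hzb))]
    simp only [integral_const_mul]
  simp only [← heq hwm hwb, ← heq (hm _) (hb _)]
  refine tendsto_integral_of_dominated_convergence _ (fun n => hmeas (hm n)) hwt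
    (fun n => hbd (hb n)) ?_
  filter_upwards [ae_spaceTime_snd (t := t) hlim] with p hp
  exact (hp.const_mul _).const_mul _

/-- The functions `ρ - ⟪e, V⟫` are supersolutions in the integrated sense. -/
lemma IsRegularLimit.supersolution (h : IsRegularLimit R B V G) (hR : 0 < R) {ρ : ℝ} (hρ : B ≤ ρ)
    {e : Plane} (he : ‖e‖ ≤ 1) {lam : ℝ} (hl : 0 ≤ lam) {x : Plane}
    (hx : x ∈ Metric.ball (0 : Plane) R) {t : ℝ} (ht : 0 < t) :
    Real.exp (-(lam * t)) * ∫ y, heatKer hR 2 x y t * (ρ - inner ℝ e (V y)) ∂(discMeasure R) +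
      ∫ r in (0 : ℝ)..t, Real.exp (-(lam * r)) * ∫ y, heatKer hR 2 x y r *
        (lam * (ρ - inner ℝ e (V y)) + inner ℝ e (G y)) ∂(discMeasure R) ≤
      ρ - inner ℝ e (V x) := by
  obtain ⟨v, C, hC, hv2, hvB, hvN, hvC, hvV, hvG⟩ := h.exists_seq
  have hB0 : 0 ≤ B := (norm_nonneg _).trans (hvB 0 x hx)
  have hmeas : MeasurableSet (Metric.ball (0 : Plane) R) := Metric.isOpen_ball.measurableSet
  have hin : ∀ z : Plane, |inner ℝ e z| ≤ ‖z‖ := fun z =>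
    (abs_real_inner_le_norm e z).trans (mul_le_of_le_one_left (norm_nonneg _) he)
  -- The inequality is applied to the `C²` approximants, whose Laplacians are bounded for each `n`.
  -- The bound `B ≤ ρ` makes these functions nonnegative.
  set f : ℕ → Plane → ℝ := fun n y => ρ - inner ℝ e (v n y) with hf
  have hf2 : ∀ n, ContDiffOn ℝ 2 (f n) (Metric.ball 0 R) := fun n =>
    contDiffOn_const.sub (contDiffOn_const.inner ℝ (hv2 n))
  have hlap : ∀ n, ∀ y ∈ Metric.ball (0 : Plane) R,
      laplacian (f n) y = -inner ℝ e (laplacian (v n) y) := by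
    intro n y hy
    have hvn := (hv2 n).contDiffAt (Metric.isOpen_ball.mem_nhds hy)
    have h1 : laplacian (fun y => inner ℝ e (v n y)) y = inner ℝ e (laplacian (v n) y) :=
      ContDiffAt.laplacian_CLM_comp_left (l := innerSL ℝ e) hvn
    have h2 : laplacian (fun _ : Plane => ρ) y = 0 := by
      rw [laplacian_eq_sum]
      simp
    simp only [hf]
    rw [laplacian_fun_sub contDiffAt_const (contDiffAt_const.inner ℝ hvn), h1, h2, zero_sub]
  have hf0 : ∀ n, ∀ y ∈ Metric.ball (0 : Plane) R, 0 ≤ f n y := fun n y hy => by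
    have := (le_abs_self _).trans ((hin (v n y)).trans (hvB n y hy))
    simp only [hf]; linarith
  have hfB : ∀ n, ∀ y ∈ Metric.ball (0 : Plane) R, |f n y| ≤ ρ + B := fun n y hy => by
    have := abs_le.1 ((hin (v n y)).trans (hvB n y hy))
    rw [abs_of_nonneg (hf0 n y hy)]
    simp only [hf]; linarith
  have hineq : ∀ n, Real.exp (-(lam * t)) * ∫ y, heatKer hR 2 x y t * f n y ∂(discMeasure R) +
      ∫ r in (0 : ℝ)..t, Real.exp (-(lam * r)) * ∫ y, heatKer hR 2 x y r *
        (lam * f n y - laplacian (f n) y) ∂(discMeasure R) ≤ f n x := by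
    intro n
    obtain ⟨N, hN⟩ := hvN n
    exact heatKer_supersolution hR (hf2 n) (hf0 n) (hfB n) (N := N) (fun y hy => by
      rw [hlap n y hy, abs_neg]; exact (hin _).trans (hN y hy)) hl hx ht
  have hlimf : ∀ y ∈ Metric.ball (0 : Plane) R,
      Tendsto (fun n => f n y) atTop (𝓝 (ρ - inner ℝ e (V y))) := fun y hy =>
    tendsto_const_nhds.sub (tendsto_const_nhds.inner (hvV y hy))
  have hball := ae_restrict_mem (μ := volume) hmeas
  have hlim1 : Tendsto (fun n => ∫ y, heatKer hR 2 x y t * f n y ∂(discMeasure R)) atTop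
      (𝓝 (∫ y, heatKer hR 2 x y t * (ρ - inner ℝ e (V y)) ∂(discMeasure R))) := by
    refine tendsto_integral_of_dominated_convergence (fun y => heatKer hR 2 x y t * (ρ + B))
      (fun n => (continuous_heatKer_right hR 2 ht x).aestronglyMeasurable.mul
        ((hf2 n).continuousOn.aestronglyMeasurable hmeas))
      ((integrable_heatKer hR ht x).mul_const _) (fun n => ?_) ?_
    · filter_upwards [hball] with y hy
      rw [norm_mul, Real.norm_of_nonneg (heatKer_nonneg hR ht x y)]
      exact mul_le_mul_of_nonneg_left (hfB n y hy) (heatKer_nonneg hR ht x y)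
    · filter_upwards [hball] with y hy using (hlimf y hy).const_mul _
  have hlim2 := tendsto_integral_heatKer_mul hR hx ht hl (C := lam * (ρ + B) + C)
    (u := fun n y => lam * f n y - laplacian (f n) y)
    (w := fun y => lam * (ρ - inner ℝ e (V y)) + inner ℝ e (G y))
    (fun n => (((hf2 n).continuousOn.aestronglyMeasurable hmeas).const_mul lam).sub
      ((continuousOn_laplacian Metric.isOpen_ball (hf2 n)).aestronglyMeasurable hmeas))
    (fun n => by
      filter_upwards [hball, hvC n] with y hy hyC
      rw [hlap n y hy, sub_neg_eq_add]
      refine (abs_add_le _ _).trans ?_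
      rw [abs_mul, abs_of_nonneg hl]
      have h1 := mul_le_mul_of_nonneg_left (hfB n y hy) hl
      have h2 := (hin _).trans hyC
      have h3 : 0 ≤ lam * (ρ + B) := by have : 0 ≤ ρ := hB0.trans hρ; positivity
      nlinarith [one_le_weight y])
    (by
      filter_upwards [hball, hvG] with y hy hyG
      have h1 : Tendsto (fun n => lam * f n y + inner ℝ e (laplacian (v n) y)) atTop
          (𝓝 (lam * (ρ - inner ℝ e (V y)) + inner ℝ e (G y))) :=
        ((hlimf y hy).const_mul lam).add (tendsto_const_nhds.inner hyG)
      refine h1.congr fun n => ?_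
      rw [hlap n y hy, sub_neg_eq_add])
  exact le_of_tendsto_of_tendsto' ((hlim1.const_mul _).add hlim2) (hlimf x hx) hineq

/-- The kernel is scalar, so linear functionals pass through the integrals and vector problems
reduce to scalar ones. -/
lemma inner_mild (hR : 0 < R) {T : ℝ} {f : Plane → ℝ → Plane} (hf : IsSource R T f)
    {ψ : Plane → Plane} (hψ : ContinuousOn ψ (Metric.ball 0 R)) {D : ℝ}
    (hD : ∀ y ∈ Metric.ball (0 : Plane) R, ‖ψ y‖ ≤ D) {x : Plane}
    (hx : x ∈ Metric.ball (0 : Plane) R) {t : ℝ} (ht : t ∈ Icc 0 T) (L : Plane →L[ℝ] ℝ) :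
    L (mild hR f ψ x t) = mild hR (fun y s => L (f y s)) (fun y => L (ψ y)) x t := by
  unfold mild
  rcases ht.1.eq_or_lt with rfl | h0
  · simp [potential_zero, semigroup_zero]
  obtain ⟨C, -, hC⟩ := hf.exists_bound
  rw [map_add, potential_eq_integral hR hf hx h0 ht.2,
    potential_eq_integral hR (hf.clm_comp L) hx h0 ht.2, semigroup_of_pos hR _ x h0,
    semigroup_of_pos hR _ x h0,
    ← L.integral_comp_comm (integrable_potential hR hf hC hx h0 ht.2).1,
    ← L.integral_comp_comm (integrable_heatKer_smul hR h0 x (integrable_of_bdd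
      (hψ.aestronglyMeasurable Metric.isOpen_ball.measurableSet) hD))]
  simp only [map_smul]

/-- Mild solutions of `∂ₜ v = Δ v + N(v)` remain in the ball of radius `ρ` if they start in it and
if `v ↦ N v + lam v` maps into the ball of radius `lam ρ`. -/
theorem IsRegularLimit.norm_mild_add_le (h : IsRegularLimit R B V G) (hR : 0 < R) {ρ : ℝ} (hρ : B ≤ ρ)
    {lam : ℝ} (hl : 0 ≤ lam) {N : Plane → Plane} (hN : ∀ v, ‖N v + lam • v‖ ≤ lam * ρ) {T : ℝ}
    {f : Plane → ℝ → Plane} (hf : IsSource R T f) {ψ : Plane → Plane}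
    (hψ : ContinuousOn ψ (Metric.ball 0 R)) {D : ℝ}
    (hD : ∀ y ∈ Metric.ball (0 : Plane) R, ‖ψ y‖ ≤ D)
    (hψV : ∀ y ∈ Metric.ball (0 : Plane) R, ‖ψ y + V y‖ ≤ ρ)
    (hfN : ∀ y ∈ Metric.ball (0 : Plane) R, ∀ s ∈ Icc 0 T,
      f y s = N (mild hR f ψ y s + V y) + G y)
    {x : Plane} (hx : x ∈ Metric.ball (0 : Plane) R) {t : ℝ} (ht : t ∈ Icc 0 T) :
    ‖mild hR f ψ x t + V x‖ ≤ ρ := by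
  rcases ht.1.eq_or_lt with rfl | h0
  · simpa [mild, potential_zero, semigroup_zero] using hψV x hx
  have hmeas : MeasurableSet (Metric.ball (0 : Plane) R) := Metric.isOpen_ball.measurableSet
  set z := mild hR f ψ x t + V x with hz
  rcases eq_or_ne z 0 with hz0 | hz0
  · rw [hz0, norm_zero]
    exact (norm_nonneg _).trans (hψV x hx)
  -- The direction is frozen at the one point `(x, t)` under consideration. The scalar problem for
  -- `⟨e, ·⟩` then has constant coefficients in this direction, and at that point the component is
  -- the full norm.
  set e : Plane := ‖z‖⁻¹ • z with he
  have he1 : ‖e‖ = 1 := norm_smul_inv_norm (𝕜 := ℝ) hz0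
  have hez : inner ℝ e z = ‖z‖ := by
    rw [he, real_inner_smul_left, real_inner_self_eq_norm_sq, sq,
      inv_mul_cancel_left₀ (norm_ne_zero_iff.2 hz0)]
  have hin : ∀ z : Plane, |inner ℝ e z| ≤ ‖z‖ := fun z =>
    (abs_real_inner_le_norm e z).trans_eq (by rw [he1, one_mul])
  obtain ⟨hGm, C, hC0, hC⟩ := h.laplacian_bound
  have hVB := h.norm_le
  have hB0 : 0 ≤ B := (norm_nonneg _).trans (hVB x hx)
  have hg : ∀ y ∈ Metric.ball (0 : Plane) R, |ρ - inner ℝ e (V y)| ≤ ρ + B := fun y hy => by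
    have := abs_le.1 ((hin (V y)).trans (hVB y hy))
    rw [abs_le]; constructor <;> linarith
  have hgc : ContinuousOn (fun y => ρ - inner ℝ e (V y)) (Metric.ball 0 R) :=
    continuousOn_const.sub (continuousOn_const.inner h.continuousOn)
  have hmild := fun y hy s hs => inner_mild hR hf hψ hD (x := y) hy (t := s) hs (innerSL ℝ e)
  simp only [innerSL_apply_apply] at hmild
  have key := mild_le_of_supersolution hR (hf.clm_comp (innerSL ℝ e)) (lam := lam)
    (ψ := fun y => inner ℝ e (ψ y)) (continuousOn_const.inner hψ) (B := D)
    (fun y hy => (hin _).trans (hD y hy)) (g := fun y => ρ - inner ℝ e (V y))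
    (G := fun y => lam * (ρ - inner ℝ e (V y)) + inner ℝ e (G y))
    (integrable_of_bdd (hgc.aestronglyMeasurable hmeas) hg)
    (((hgc.aestronglyMeasurable hmeas).const_mul lam).add
      (AEStronglyMeasurable.inner aestronglyMeasurable_const hGm))
    (C := lam * (ρ + B) + C) (by have : 0 ≤ ρ := hB0.trans hρ; positivity) (by
      filter_upwards [ae_restrict_mem hmeas, hC] with y hy hyC
      refine (abs_add_le _ _).trans ?_
      rw [abs_mul, abs_of_nonneg hl]
      have h1 := mul_le_mul_of_nonneg_left (hg y hy) hl
      have h2 := (hin _).trans hyC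
      have h3 : 0 ≤ lam * (ρ + B) := by have : 0 ≤ ρ := hB0.trans hρ; positivity
      nlinarith [one_le_weight y])
    (fun y hy => by
      have := (le_abs_self _).trans ((hin _).trans (hψV y hy))
      rw [inner_add_right] at this
      linarith)
    (by
      filter_upwards [ae_restrict_mem hmeas] with y hy s hs
      simp only [innerSL_apply_apply]
      rw [← hmild y hy s hs, hfN y hy s hs]
      -- The source plus `lam` times the solution is controlled by `⟨e, N(k + V) + lam (k + V)⟩ ≤
      -- lam ρ`, which is exactly the hypothesis on `N`.
      set k := mild hR f ψ y s
      have := (le_abs_self _).trans ((hin _).trans (hN (k + V y)))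
      rw [inner_add_right, inner_smul_right, inner_add_right] at this
      rw [inner_add_right]
      linarith)
    hx h0 ht.2 (h.supersolution hR hρ he1.le hl hx h0)
  simp only [innerSL_apply_apply] at key
  rw [← hmild x hx t ht] at key
  rw [← hez, hz, inner_add_right]
  linarith

end apriori

/-! ### Existence, uniqueness and stability of mild solutions -/

section existence

variable {R : ℝ} (hR : 0 < R)

section general

variable {F : Type*} [NormedAddCommGroup F] [NormedSpace ℝ F] {T : ℝ}

lemma mild_congr {f₁ f₂ : Plane → ℝ → F} (ψ : Plane → F) {t : ℝ} (ht : 0 ≤ t)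
    (h : ∀ y ∈ Metric.ball (0 : Plane) R, ∀ s ∈ Icc 0 t, f₁ y s = f₂ y s) (x : Plane) :
    mild hR f₁ ψ x t = mild hR f₂ ψ x t := by
  unfold mild potential
  congr 1
  refine intervalIntegral.integral_congr fun r hr => ?_
  rw [uIcc_of_le ht] at hr
  refine setIntegral_congr_fun Metric.isOpen_ball.measurableSet fun y hy => ?_
  simp only [h y hy (t - r) ⟨by linarith [hr.2], by linarith [hr.1]⟩]

lemma norm_mild_sub_le {f₁ f₂ : Plane → ℝ → F} (hf₁ : IsSource R T f₁)
    (hf₂ : IsSource R T f₂) {ψ₁ ψ₂ : Plane → F} (hψ₁ : ContinuousOn ψ₁ (Metric.ball 0 R))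
    (hψ₂ : ContinuousOn ψ₂ (Metric.ball 0 R)) {B₁ B₂ D : ℝ}
    (hB₁ : ∀ y ∈ Metric.ball (0 : Plane) R, ‖ψ₁ y‖ ≤ B₁)
    (hB₂ : ∀ y ∈ Metric.ball (0 : Plane) R, ‖ψ₂ y‖ ≤ B₂)
    (hD : ∀ y ∈ Metric.ball (0 : Plane) R, ‖ψ₁ y - ψ₂ y‖ ≤ D) {x : Plane}
    (hx : x ∈ Metric.ball (0 : Plane) R) {t : ℝ} (ht : t ∈ Icc 0 T) {β : ℝ → ℝ} (hβ : Continuous β)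
    (hb : ∀ y ∈ Metric.ball (0 : Plane) R, ∀ s ∈ Icc 0 t, ‖f₁ y s - f₂ y s‖ ≤ β s) :
    ‖mild hR f₁ ψ₁ x t - mild hR f₂ ψ₂ x t‖ ≤ (∫ s in (0 : ℝ)..t, β s) + D := by
  have hm : MeasurableSet (Metric.ball (0 : Plane) R) := Metric.isOpen_ball.measurableSet
  have hs : semigroup hR ψ₁ x t - semigroup hR ψ₂ x t =
      semigroup hR (fun y => ψ₁ y - ψ₂ y) x t := by
    rcases ht.1.eq_or_lt with rfl | h0
    · simp only [semigroup_zero]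
    · simp only [semigroup_of_pos hR _ x h0, smul_sub]
      exact (integral_sub (integrable_heatKer_smul hR h0 x (integrable_of_bdd
        (hψ₁.aestronglyMeasurable hm) hB₁)) (integrable_heatKer_smul hR h0 x (integrable_of_bdd
        (hψ₂.aestronglyMeasurable hm) hB₂))).symm
  unfold mild
  rw [add_sub_add_comm, hs]
  exact (norm_add_le _ _).trans (add_le_add
    (norm_potential_sub_le hR hf₁ hf₂ hx ht.1 ht.2 hβ hb) (norm_semigroup_le hR hD hx ht.1))

/-- The rate `2 lip` is twice the Lipschitz constant, so integrating `lip A exp (2 lip s)` gains the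
factor one half. Hence the map contracts on arbitrarily long time intervals. -/
lemma norm_mild_sub_le_exp {f₁ f₂ : Plane → ℝ → F} (hf₁ : IsSource R T f₁)
    (hf₂ : IsSource R T f₂) {ψ : Plane → F} (hψ : ContinuousOn ψ (Metric.ball 0 R)) {B : ℝ}
    (hB : ∀ y ∈ Metric.ball (0 : Plane) R, ‖ψ y‖ ≤ B) {lip A : ℝ} (hA : 0 ≤ A)
    {x : Plane} (hx : x ∈ Metric.ball (0 : Plane) R) {t : ℝ} (ht : t ∈ Icc 0 T)
    (hb : ∀ y ∈ Metric.ball (0 : Plane) R, ∀ s ∈ Icc 0 t,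
      ‖f₁ y s - f₂ y s‖ ≤ lip * (A * Real.exp (2 * lip * s))) :
    ‖mild hR f₁ ψ x t - mild hR f₂ ψ x t‖ ≤ A / 2 * Real.exp (2 * lip * t) := by
  refine (norm_mild_sub_le hR hf₁ hf₂ hψ hψ hB hB (D := 0)
    (fun y _ => by rw [sub_self, norm_zero]) hx ht (by fun_prop) hb).trans ?_
  have h1 : ∀ s ∈ uIcc 0 t, HasDerivAt (fun s => A / 2 * Real.exp (2 * lip * s))
      (lip * (A * Real.exp (2 * lip * s))) s := fun s _ => by
    have h2 : HasDerivAt (fun s => Real.exp (2 * lip * s))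
      (Real.exp (2 * lip * s) * (2 * lip * 1)) s := ((hasDerivAt_id s).const_mul (2 * lip)).exp
    exact (h2.const_mul (A / 2)).congr_deriv (by ring)
  rw [intervalIntegral.integral_eq_sub_of_hasDerivAt h1
    ((by fun_prop : Continuous fun s => lip * (A * Real.exp (2 * lip * s))).intervalIntegrable _ _)]
  simp only [mul_zero, Real.exp_zero]
  linarith

/-- The difference is halved by every application of the estimate and is therefore zero. -/
lemma eq_of_mild_eq {f₁ f₂ k₁ k₂ : Plane → ℝ → F} (hf₁ : IsSource R T f₁)
    (hf₂ : IsSource R T f₂) {ψ : Plane → F} (hψ : ContinuousOn ψ (Metric.ball 0 R)) {B : ℝ}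
    (hB : ∀ y ∈ Metric.ball (0 : Plane) R, ‖ψ y‖ ≤ B) {lip A : ℝ} (hlip : 0 < lip) (hA : 0 ≤ A)
    (hk₁ : ∀ x ∈ Metric.ball (0 : Plane) R, ∀ t ∈ Icc 0 T, k₁ x t = mild hR f₁ ψ x t)
    (hk₂ : ∀ x ∈ Metric.ball (0 : Plane) R, ∀ t ∈ Icc 0 T, k₂ x t = mild hR f₂ ψ x t)
    (hkA : ∀ x ∈ Metric.ball (0 : Plane) R, ∀ t ∈ Icc 0 T, ‖k₁ x t - k₂ x t‖ ≤ A)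
    (hfk : ∀ x ∈ Metric.ball (0 : Plane) R, ∀ t ∈ Icc 0 T,
      ‖f₁ x t - f₂ x t‖ ≤ lip * ‖k₁ x t - k₂ x t‖)
    {x : Plane} (hx : x ∈ Metric.ball (0 : Plane) R) {t : ℝ} (ht : t ∈ Icc 0 T) :
    k₁ x t = k₂ x t := by
  have key : ∀ n : ℕ, ∀ x ∈ Metric.ball (0 : Plane) R, ∀ t ∈ Icc 0 T,
      ‖k₁ x t - k₂ x t‖ ≤ A / 2 ^ n * Real.exp (2 * lip * t) := by
    intro n
    induction n with
    | zero =>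
      intro x hx t ht
      have h0 := ht.1
      have : 1 ≤ Real.exp (2 * lip * t) := Real.one_le_exp (by positivity)
      rw [pow_zero, div_one]
      exact (hkA x hx t ht).trans (le_mul_of_one_le_right hA this)
    | succ n ih =>
      intro x hx t ht
      rw [hk₁ x hx t ht, hk₂ x hx t ht, pow_succ, ← div_div]
      refine norm_mild_sub_le_exp hR hf₁ hf₂ hψ hB (by positivity) hx ht fun y hy s hs => ?_
      have hs' : s ∈ Icc 0 T := ⟨hs.1, hs.2.trans ht.2⟩
      exact (hfk y hy s hs').trans (mul_le_mul_of_nonneg_left (ih y hy s hs') hlip.le)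
  have hlim : Tendsto (fun n : ℕ => A / 2 ^ n * Real.exp (2 * lip * t)) atTop (𝓝 0) := by
    have := ((tendsto_pow_atTop_nhds_zero_of_lt_one (r := (1 / 2 : ℝ)) (by norm_num)
      (by norm_num)).const_mul A).mul_const (Real.exp (2 * lip * t))
    rw [mul_zero, zero_mul] at this
    refine this.congr fun n => ?_
    rw [one_div, inv_pow, div_eq_mul_inv]
  exact sub_eq_zero.1 (norm_le_zero_iff.1 (ge_of_tendsto' hlim fun n => key n x hx t ht))

end general

/-- Continuous functions on the disc for all nonnegative times, bounded on bounded time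
intervals. -/
def IsLocBdd {F : Type*} [NormedAddCommGroup F] (R : ℝ) (k : Plane → ℝ → F) : Prop :=
  ∀ T, ContinuousOn (fun p : Plane × ℝ => k p.1 p.2) (Metric.ball 0 R ×ˢ Icc 0 T) ∧
    ∃ C, ∀ x ∈ Metric.ball (0 : Plane) R, ∀ t ∈ Icc 0 T, ‖k x t‖ ≤ C

lemma continuousOn_Ici_of_Icc {F : Type*} [TopologicalSpace F] {S : Set Plane} {k : Plane → ℝ → F}
    (h : ∀ T, ContinuousOn (fun p : Plane × ℝ => k p.1 p.2) (S ×ˢ Icc 0 T)) :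
    ContinuousOn (fun p : Plane × ℝ => k p.1 p.2) (S ×ˢ Ici 0) := by
  rintro ⟨x, t⟩ ⟨hx, ht⟩
  refine ((h (t + 1)) (x, t) ⟨hx, ht, by simp⟩).mono_of_mem_nhdsWithin ?_
  filter_upwards [self_mem_nhdsWithin, nhdsWithin_le_nhds
    ((continuous_snd.tendsto (x, t)).eventually (gt_mem_nhds (lt_add_one t)))] with p hp hpt
  exact ⟨hp.1, hp.2, hpt.le⟩

section nonlinear

variable {B : ℝ} {V G : Plane → Plane} {N : Plane → Plane}

lemma IsRegularLimit.isSource (h : IsRegularLimit R B V G) (hN : Continuous N) {T : ℝ}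
    {k : Plane → ℝ → Plane}
    (hk : ContinuousOn (fun p : Plane × ℝ => k p.1 p.2) (Metric.ball 0 R ×ˢ Icc 0 T))
    {C : ℝ} (hC : ∀ x ∈ Metric.ball (0 : Plane) R, ∀ t ∈ Icc 0 T, ‖k x t‖ ≤ C) :
    IsSource R T fun y s => N (k y s + V y) + G y := by
  obtain ⟨hGm, C', hC', hG⟩ := h.laplacian_bound
  obtain ⟨D, hD⟩ := (isCompact_closedBall (0 : Plane) (C + B)).exists_bound_of_continuousOn
    hN.continuousOn
  refine isSource_of_bddCont_add (B := |D|) (abs_nonneg _) hC' ?_ (fun y hy s hs => ?_) hGm hG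
  · exact hN.comp_continuousOn (hk.add (h.continuousOn.comp continuousOn_fst fun p hp => hp.1))
  · refine (hD _ ?_).trans (le_abs_self D)
    rw [mem_closedBall_zero_iff]
    exact (norm_add_le _ _).trans (add_le_add (hC y hy s hs) (h.norm_le y hy))

/-- Global existence for Lipschitz nonlinearities. -/
theorem IsRegularLimit.exists_mild (h : IsRegularLimit R B V G) {lip : ℝ} (hlip : 0 < lip)
    (hN : ∀ v w, ‖N v - N w‖ ≤ lip * ‖v - w‖) {ψ : Plane → Plane}
    (hψ : ContinuousOn ψ (Metric.ball 0 R)) {D : ℝ}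
    (hD : ∀ y ∈ Metric.ball (0 : Plane) R, ‖ψ y‖ ≤ D) :
    ∃ k : Plane → ℝ → Plane, IsLocBdd R k ∧ ∀ x ∈ Metric.ball (0 : Plane) R, ∀ t, 0 ≤ t →
      k x t = mild hR (fun y s => N (k y s + V y) + G y) ψ x t := by
  have hNc : Continuous N := by
    have : LipschitzWith lip.toNNReal N := LipschitzWith.of_dist_le_mul fun v w => by
      rw [Real.coe_toNNReal _ hlip.le, dist_eq_norm, dist_eq_norm]; exact hN v w
    exact this.continuous
  have h0 : (0 : Plane) ∈ Metric.ball (0 : Plane) R := by simpa using hR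
  have hD0 : 0 ≤ D := (norm_nonneg _).trans (hD 0 h0)
  set Φ : (Plane → ℝ → Plane) → Plane → ℝ → Plane := fun k =>
    mild hR (fun y s => N (k y s + V y) + G y) ψ with hΦ
  have hsrc : ∀ {k}, IsLocBdd R k → ∀ T, IsSource R T fun y s => N (k y s + V y) + G y := by
    intro k hk T
    obtain ⟨hc, C, hC⟩ := hk T
    exact h.isSource hNc hc hC
  have hΦloc : ∀ {k}, IsLocBdd R k → IsLocBdd R (Φ k) := by
    intro k hk T
    refine ⟨continuousOn_mild hR (hsrc hk T) hψ hD, ?_⟩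
    obtain ⟨C, hC0, hC⟩ := exists_norm_mild_le hR (hsrc hk T) hD
    refine ⟨C * (T + R) + D, fun x hx t ht => (hC x hx t ht).trans ?_⟩
    have := ht.2
    gcongr
  have hcontr : ∀ {k k' : Plane → ℝ → Plane}, IsLocBdd R k → IsLocBdd R k' → ∀ A, 0 ≤ A →
      (∀ x ∈ Metric.ball (0 : Plane) R, ∀ t, 0 ≤ t →
        ‖k x t - k' x t‖ ≤ A * Real.exp (2 * lip * t)) →
      ∀ x ∈ Metric.ball (0 : Plane) R, ∀ t, 0 ≤ t →
        ‖Φ k x t - Φ k' x t‖ ≤ A / 2 * Real.exp (2 * lip * t) := by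
    intro k k' hk hk' A hA hkk x hx t ht
    refine norm_mild_sub_le_exp hR (hsrc hk t) (hsrc hk' t) hψ hD hA hx ⟨ht, le_rfl⟩ ?_
    intro y hy s hs
    rw [add_sub_add_right_eq_sub]
    refine (hN _ _).trans (mul_le_mul_of_nonneg_left ?_ hlip.le)
    rw [add_sub_add_right_eq_sub]
    exact hkk y hy s hs.1
  obtain ⟨k, hkz, hksucc⟩ : ∃ k : ℕ → Plane → ℝ → Plane, (∀ x t, k 0 x t = 0) ∧
      ∀ n, k (n + 1) = Φ (k n) :=
    ⟨fun n => Φ^[n] 0, fun _ _ => rfl, fun n => Function.iterate_succ_apply' Φ n 0⟩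
  have hk0 : IsLocBdd R (k 0) := fun T => by
    simp only [hkz]
    exact ⟨continuousOn_const, 0, fun _ _ _ _ => norm_zero.le⟩
  have hkloc : ∀ n, IsLocBdd R (k n) := by
    intro n
    induction n with
    | zero => exact hk0
    | succ n ih => rw [hksucc]; exact hΦloc ih
  -- The first iterate grows at most linearly in time, so it is bounded by a multiple of `exp (2 lip
  -- t)`; this uses `t ≤ exp (2 lip t) / (2 lip)`.
  obtain ⟨A, hA, hA1⟩ : ∃ A, 0 ≤ A ∧ ∀ x ∈ Metric.ball (0 : Plane) R, ∀ t, 0 ≤ t →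
      ‖k 0 x t - k 1 x t‖ ≤ A * Real.exp (2 * lip * t) := by
    obtain ⟨hGm, C', hC', hG⟩ := h.laplacian_bound
    obtain ⟨E, hE⟩ := (isCompact_closedBall (0 : Plane) B).exists_bound_of_continuousOn
      hNc.continuousOn
    have hb : ∀ᵐ y ∂(discMeasure R), ∀ s : ℝ, ‖N (k 0 y s + V y) + G y‖ ≤ (|E| + C') * weight y := by
      filter_upwards [hG, ae_restrict_mem Metric.isOpen_ball.measurableSet] with y hy hyR s
      have h1 : ‖N (k 0 y s + V y)‖ ≤ E := hE _ (by
        rw [mem_closedBall_zero_iff, hkz, zero_add]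
        exact h.norm_le y hyR)
      refine (norm_add_le _ _).trans ?_
      nlinarith [one_le_weight y, abs_nonneg E, le_abs_self E]
    refine ⟨(|E| + C') * (1 / (2 * lip) + R) + D, by positivity, fun x hx t ht => ?_⟩
    have hexp : 2 * lip * t + 1 ≤ Real.exp (2 * lip * t) := Real.add_one_le_exp _
    have h1 : ‖k 1 x t‖ ≤ (|E| + C') * (t + R) + D := by
      rw [show k 1 = Φ (k 0) from hksucc 0]
      refine (norm_add_le _ _).trans (add_le_add ?_ (norm_semigroup_le hR hD hx ht))
      rcases ht.eq_or_lt with rfl | ht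
      · rw [potential_zero, norm_zero]; positivity
      · exact norm_potential_le hR (hsrc hk0 t) (by positivity) (hb.mono fun y hy s _ => hy s) hx ht
          le_rfl
    rw [hkz, zero_sub, norm_neg]
    refine h1.trans ?_
    have h3 : t ≤ 1 / (2 * lip) * Real.exp (2 * lip * t) := by
      rw [div_mul_eq_mul_div, one_mul, le_div_iff₀ (by positivity)]
      linarith
    have h4 : 1 ≤ Real.exp (2 * lip * t) := Real.one_le_exp (by positivity)
    have h5 : t + R ≤ (1 / (2 * lip) + R) * Real.exp (2 * lip * t) := by nlinarith
    have h6 := mul_le_mul_of_nonneg_left h5 (show 0 ≤ |E| + C' by positivity)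
    nlinarith
  have hstep : ∀ n : ℕ, ∀ x ∈ Metric.ball (0 : Plane) R, ∀ t, 0 ≤ t →
      ‖k n x t - k (n + 1) x t‖ ≤ A / 2 ^ n * Real.exp (2 * lip * t) := by
    intro n
    induction n with
    | zero => simpa only [pow_zero, div_one, zero_add] using hA1
    | succ n ih =>
      have e := hcontr (hkloc n) (hkloc (n + 1)) (A / 2 ^ n) (by positivity) ih
      rwa [← hksucc, ← hksucc, div_div, ← pow_succ] at e
  -- The same estimate in the form `C / 2 / 2 ^ n`, whose tails sum to `C / 2 ^ n`.
  have hstep' : ∀ x ∈ Metric.ball (0 : Plane) R, ∀ t, 0 ≤ t → ∀ n,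
      dist (k n x t) (k (n + 1) x t) ≤ 2 * A * Real.exp (2 * lip * t) / 2 / 2 ^ n := by
    intro x hx t ht n
    rw [dist_eq_norm]
    refine (hstep n x hx t ht).trans_eq ?_
    ring
  have hex : ∀ x t, ∃ z, x ∈ Metric.ball (0 : Plane) R → 0 ≤ t →
      Tendsto (fun n => k n x t) atTop (𝓝 z) := by
    intro x t
    by_cases hxt : x ∈ Metric.ball (0 : Plane) R ∧ 0 ≤ t
    · obtain ⟨z, hz⟩ := cauchySeq_tendsto_of_complete
        (cauchySeq_of_le_geometric_two (hstep' x hxt.1 t hxt.2))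
      exact ⟨z, fun _ _ => hz⟩
    · exact ⟨0, fun h1 h2 => absurd ⟨h1, h2⟩ hxt⟩
  choose K hK using hex
  have hdist : ∀ n, ∀ x ∈ Metric.ball (0 : Plane) R, ∀ t, 0 ≤ t →
      ‖k n x t - K x t‖ ≤ 2 * A / 2 ^ n * Real.exp (2 * lip * t) := by
    intro n x hx t ht
    rw [← dist_eq_norm]
    refine (dist_le_of_le_geometric_two_of_tendsto (hstep' x hx t ht) (hK x t hx ht) n).trans_eq ?_
    ring
  have hgeom : ∀ c : ℝ, Tendsto (fun n : ℕ => 2 * A / 2 ^ n * c) atTop (𝓝 0) := by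
    intro c
    have := ((tendsto_pow_atTop_nhds_zero_of_lt_one (r := (1 / 2 : ℝ)) (by norm_num)
      (by norm_num)).const_mul (2 * A)).mul_const c
    rw [mul_zero, zero_mul] at this
    refine this.congr fun n => ?_
    rw [one_div, inv_pow, div_eq_mul_inv]
  have hKloc : IsLocBdd R K := by
    intro T
    have hle : ∀ n, ∀ x ∈ Metric.ball (0 : Plane) R, ∀ t ∈ Icc 0 T,
        ‖k n x t - K x t‖ ≤ 2 * A / 2 ^ n * Real.exp (2 * lip * T) := fun n x hx t ht => by
      refine (hdist n x hx t ht.1).trans ?_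
      have := ht.2
      gcongr
    constructor
    · have hu : TendstoUniformlyOn (fun n (p : Plane × ℝ) => k n p.1 p.2) (fun p => K p.1 p.2) atTop
          (Metric.ball 0 R ×ˢ Icc 0 T) := by
        rw [Metric.tendstoUniformlyOn_iff]
        intro ε hε
        filter_upwards [(hgeom (Real.exp (2 * lip * T))).eventually (gt_mem_nhds hε)] with n hn p hp
        rw [dist_comm, dist_eq_norm]
        exact (hle n p.1 hp.1 p.2 hp.2).trans_lt hn
      exact hu.continuousOn (Eventually.of_forall fun n => (hkloc n T).1).frequently
    · refine ⟨2 * A / 2 ^ 0 * Real.exp (2 * lip * T), fun x hx t ht => ?_⟩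
      have := hle 0 x hx t ht
      rwa [hkz, zero_sub, norm_neg] at this
  refine ⟨K, hKloc, fun x hx t ht => ?_⟩
  have h1 : Tendsto (fun n => k (n + 1) x t) atTop (𝓝 (K x t)) :=
    (hK x t hx ht).comp (tendsto_add_atTop_nat 1)
  refine tendsto_nhds_unique h1 (tendsto_iff_norm_sub_tendsto_zero.2 ?_)
  refine squeeze_zero (fun _ => norm_nonneg _) (fun n => ?_) ((hgeom (Real.exp (2 * lip * t))).div_const 2
    |>.trans (by rw [zero_div]))
  rw [hksucc]
  refine (hcontr (hkloc n) hKloc _ (by positivity) (hdist n) x hx t ht).trans_eq ?_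
  ring

end nonlinear

end existence

/-! ### The potential -/

section wells

variable {W : Plane → ℝ} {c : Fin 3 → Plane}

lemma inner_gradient {f : Plane → ℝ} {x : Plane} (v : Plane) :
    inner ℝ (gradient f x) v = fderiv ℝ f x v := by
  rw [gradient, InnerProductSpace.toDual_symm_apply]

lemma IsThreeWell.contDiff_gradient (hW : IsThreeWell W c) : ContDiff ℝ 2 (gradient W) := by
  have h : ContDiff ℝ 2 (fderiv ℝ W) := hW.contDiff.fderiv_right (by norm_num)
  exact (InnerProductSpace.toDual ℝ Plane).symm.toContinuousLinearEquiv.contDiff.comp h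

lemma IsThreeWell.continuous_gradient (hW : IsThreeWell W c) : Continuous (gradient W) :=
  hW.contDiff_gradient.continuous

/-- By the mean value theorem the derivative is positive somewhere between `a` and `b`, and it is
increasing beyond `a`. -/
lemma hasDerivAt_pos_of_convex {g g₁ g₂ : ℝ → ℝ} {a b : ℝ} (hab : a < b)
    (hg : ∀ τ, HasDerivAt g (g₁ τ) τ) (hg₁ : ∀ τ, HasDerivAt g₁ (g₂ τ) τ)
    (h : ∀ τ, a < τ → 0 ≤ g₂ τ) (hlt : g a < g b) : 0 < g₁ b := by
  have hmono : MonotoneOn g₁ (Ici a) := by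
    refine monotoneOn_of_deriv_nonneg (convex_Ici a)
      (fun τ _ => (hg₁ τ).continuousAt.continuousWithinAt)
      (fun τ _ => (hg₁ τ).differentiableAt.differentiableWithinAt) fun τ hτ => ?_
    rw [interior_Ici] at hτ
    rw [(hg₁ τ).deriv]
    exact h τ hτ
  obtain ⟨ξ, hξ, hξe⟩ := exists_hasDerivAt_eq_slope g g₁ hab
    (fun τ _ => (hg τ).continuousAt.continuousWithinAt) fun τ _ => hg τ
  have h2 : 0 < g₁ ξ := by
    rw [hξe]
    exact div_pos (sub_pos.2 hlt) (sub_pos.2 hab)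
  exact h2.trans_le (hmono (show ξ ∈ Ici a from hξ.1.le) (show b ∈ Ici a from hab.le) hξ.2.le)

/-- Far out, the gradient of the potential points outwards. -/
lemma IsThreeWell.exists_inner_gradient_pos (hW : IsThreeWell W c) :
    ∃ r, 0 < r ∧ ∀ v : Plane, r ≤ ‖v‖ → 0 < inner ℝ (gradient W v) v := by
  obtain ⟨K, hK, hconv⟩ := hW.hessian_nonneg
  obtain ⟨K₁, K₂, m, p, hK₁, hK₂, hm, hp, hgr⟩ := hW.growth
  obtain ⟨r₁, hr₁K, hr₁m⟩ : ∃ r₁, K < r₁ ∧ m < r₁ :=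
    ⟨max K m + 1, (le_max_left _ _).trans_lt (lt_add_one _),
      (le_max_right _ _).trans_lt (lt_add_one _)⟩
  have htop : Tendsto (fun s : ℝ => K₁ * s ^ p) atTop atTop :=
    (tendsto_rpow_atTop (by linarith)).const_mul_atTop hK₁
  -- For `‖v‖ ≥ r` the lower growth bound at `v` exceeds the upper one at radius `r₁` on the same
  -- ray, so `W` increases from there to `v`. Beyond `r₁` it is convex along the ray.
  obtain ⟨r, hr⟩ := eventually_atTop.1 ((htop.eventually_gt_atTop (K₂ * r₁ ^ p)).and
    (eventually_gt_atTop r₁))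
  refine ⟨r, by linarith [(hr r le_rfl).2], fun v hv => ?_⟩
  obtain ⟨hbig, hrv⟩ := hr _ hv
  have hr₁0 : 0 < r₁ := hK.trans hr₁K
  have hs0 : 0 < ‖v‖ := by linarith
  obtain ⟨e, he1, hse⟩ : ∃ e : Plane, ‖e‖ = 1 ∧ ‖v‖ • e = v :=
    ⟨‖v‖⁻¹ • v, norm_smul_inv_norm (𝕜 := ℝ) (norm_pos_iff.1 hs0), by
      rw [smul_smul, mul_inv_cancel₀ hs0.ne', one_smul]⟩
  have hline : ∀ τ : ℝ, HasDerivAt (fun τ : ℝ => τ • e) e τ := fun τ =>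
    ((hasDerivAt_id τ).smul_const e).congr_deriv (one_smul _ _)
  have hg : ∀ τ : ℝ, HasDerivAt (fun τ : ℝ => W (τ • e)) (fderiv ℝ W (τ • e) e) τ := fun τ =>
    ((hW.contDiff.differentiable (by norm_num)) (τ • e)).hasFDerivAt.comp_hasDerivAt τ (hline τ)
  have hg' : ∀ τ : ℝ, HasDerivAt (fun τ : ℝ => fderiv ℝ W (τ • e) e)
      (fderiv ℝ (fderiv ℝ W) (τ • e) e e) τ := fun τ => by
    have hd : Differentiable ℝ (fderiv ℝ W) :=
      (hW.contDiff.fderiv_right (m := 2) (by norm_num)).differentiable (by norm_num)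
    have h1 := (hd (τ • e)).hasFDerivAt.comp_hasDerivAt τ (hline τ)
    have h2 := h1.clm_apply (hasDerivAt_const τ e)
    rw [map_zero, add_zero] at h2
    exact h2
  have hnorm : ∀ τ : ℝ, 0 ≤ τ → ‖τ • e‖ = τ := fun τ hτ => by
    rw [norm_smul, he1, mul_one, Real.norm_of_nonneg hτ]
  have h := hasDerivAt_pos_of_convex hrv hg hg'
    (fun τ hτ => hconv _ (by rw [hnorm τ (hr₁0.trans hτ).le]; exact hr₁K.trans hτ) e) (by
      have hu := (hgr (r₁ • e) (by rw [hnorm _ hr₁0.le]; exact hr₁m.le)).2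
      have hl := (hgr (‖v‖ • e) (by rw [hnorm _ hs0.le]; linarith)).1
      rw [hnorm _ hr₁0.le] at hu
      rw [hnorm _ hs0.le] at hl
      linarith)
  rw [hse] at h
  rw [inner_gradient]
  nth_rw 2 [← hse]
  rw [map_smul, smul_eq_mul]
  exact mul_pos hs0 h

/-- The radial retraction onto the closed ball of radius `ρ`. -/
def retract (ρ : ℝ) (v : Plane) : Plane := (ρ / max ρ ‖v‖) • v

lemma retract_of_norm_le {ρ : ℝ} (hρ : 0 < ρ) {v : Plane} (hv : ‖v‖ ≤ ρ) : retract ρ v = v := by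
  rw [retract, max_eq_left hv, div_self hρ.ne', one_smul]

lemma norm_retract_le {ρ : ℝ} (hρ : 0 < ρ) (v : Plane) : ‖retract ρ v‖ ≤ ρ := by
  have hm : 0 < max ρ ‖v‖ := hρ.trans_le (le_max_left _ _)
  rw [retract, norm_smul, Real.norm_of_nonneg (by positivity), div_mul_eq_mul_div,
    div_le_iff₀ hm]
  exact mul_le_mul_of_nonneg_left (le_max_right _ _) hρ.le

/-- The difference splits into a change of the point and a change of the scaling factor, each at
most `‖v - w‖`. The constant two suffices. -/
lemma norm_retract_sub_le {ρ : ℝ} (hρ : 0 < ρ) (v w : Plane) :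
    ‖retract ρ v - retract ρ w‖ ≤ 2 * ‖v - w‖ := by
  set a := max ρ ‖v‖ with ha
  set b := max ρ ‖w‖ with hb
  have ha0 : 0 < a := hρ.trans_le (le_max_left _ _)
  have hb0 : 0 < b := hρ.trans_le (le_max_left _ _)
  have hab : |b - a| ≤ ‖v - w‖ := by
    have h1 : |b - a| ≤ |‖w‖ - ‖v‖| := by
      simpa [ha, hb] using abs_max_sub_max_le_max ρ ‖w‖ ρ ‖v‖
    rw [norm_sub_rev v w]
    exact h1.trans (abs_norm_sub_norm_le w v)
  have e : retract ρ v - retract ρ w = (ρ / a) • (v - w) + (ρ * (b - a) / (a * b)) • w := by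
    have : ρ * (b - a) / (a * b) = ρ / a - ρ / b := by field_simp
    rw [retract, retract, this, ← ha, ← hb]
    module
  have h1 : ‖(ρ / a) • (v - w)‖ ≤ ‖v - w‖ := by
    rw [norm_smul, Real.norm_of_nonneg (by positivity)]
    exact mul_le_of_le_one_left (norm_nonneg _) (div_le_one_of_le₀ (le_max_left _ _) ha0.le)
  have h2 : ‖(ρ * (b - a) / (a * b)) • w‖ ≤ ‖v - w‖ := by
    rw [norm_smul, norm_div, norm_mul, Real.norm_of_nonneg hρ.le,
      Real.norm_of_nonneg (mul_pos ha0 hb0).le, Real.norm_eq_abs, div_mul_eq_mul_div,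
      div_le_iff₀ (mul_pos ha0 hb0)]
    calc ρ * |b - a| * ‖w‖ ≤ a * ‖v - w‖ * b := by
          gcongr
          · exact le_max_left _ _
          · exact le_max_right _ _
      _ = _ := by ring
  rw [e]
  linarith [norm_add_le ((ρ / a) • (v - w)) ((ρ * (b - a) / (a * b)) • w)]

lemma exists_lipschitz_closedBall {f : Plane → Plane} (hf : ContDiff ℝ 1 f) (r : ℝ) :
    ∃ L, 0 < L ∧ ∀ v w : Plane, ‖v‖ ≤ r → ‖w‖ ≤ r → ‖f v - f w‖ ≤ L * ‖v - w‖ := by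
  obtain ⟨D, hD⟩ := (isCompact_closedBall (0 : Plane) r).exists_bound_of_continuousOn
    (hf.continuous_fderiv (by norm_num)).continuousOn
  refine ⟨|D| + 1, by positivity, fun v w hv hw => ?_⟩
  refine (convex_closedBall (0 : Plane) r).norm_image_sub_le_of_norm_fderiv_le (𝕜 := ℝ)
    (fun x _ => hf.differentiable (by norm_num) x)
    (fun x hx => (hD x hx).trans ((le_abs_self D).trans (le_add_of_nonneg_right zero_le_one)))
    (mem_closedBall_zero_iff.2 hw) (mem_closedBall_zero_iff.2 hv)

/-- The reaction term of the gradient flow. -/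
def reaction (W : Plane → ℝ) (v : Plane) : Plane := -((1 / 2 : ℝ) • gradient W v)

lemma IsThreeWell.contDiff_reaction (hW : IsThreeWell W c) : ContDiff ℝ 2 (reaction W) :=
  (hW.contDiff_gradient.const_smul (1 / 2 : ℝ)).neg

/-- On large balls, `v ↦ v - ∇W(v) / (2 lam)` maps the ball into itself if `lam` is large. -/
lemma IsThreeWell.exists_reaction_add_le (hW : IsThreeWell W c) :
    ∃ r, 0 < r ∧ ∀ ρ, r < ρ → ∃ lam, 0 < lam ∧ ∀ v : Plane, ‖v‖ ≤ ρ →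
      ‖reaction W v + lam • v‖ ≤ lam * ρ := by
  obtain ⟨r, hr, hpos⟩ := hW.exists_inner_gradient_pos
  refine ⟨r, hr, fun ρ hρ => ?_⟩
  have hρ0 : 0 < ρ := hr.trans hρ
  obtain ⟨D, hD⟩ := (isCompact_closedBall (0 : Plane) ρ).exists_bound_of_continuousOn
    hW.continuous_gradient.continuousOn
  have hD0 : 0 ≤ D := (norm_nonneg _).trans (hD 0 (by simp [hρ0.le]))
  obtain ⟨κ, hκ, hκv⟩ : ∃ κ, 0 < κ ∧ ∀ v : Plane, r ≤ ‖v‖ → ‖v‖ ≤ ρ →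
      κ ≤ inner ℝ (gradient W v) v := by
    have hcpt : IsCompact (Metric.closedBall (0 : Plane) ρ ∩ {v | r ≤ ‖v‖}) :=
      (isCompact_closedBall _ _).inter_right (isClosed_le continuous_const continuous_norm)
    have hc : Continuous fun v => inner ℝ (gradient W v) v :=
      hW.continuous_gradient.inner continuous_id
    obtain ⟨κ, hκ, h⟩ := hcpt.exists_forall_le' (a := 0) hc.continuousOn fun v hv => hpos v hv.2
    exact ⟨κ, hκ, fun v h1 h2 => h v ⟨mem_closedBall_zero_iff.2 h2, h1⟩⟩
  -- The first term serves `r ≤ ‖v‖ ≤ ρ`, where the gain `lam κ` must cover `D² / 4`. The second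
  -- serves `‖v‖ < r`, where the room `lam (ρ - r)` must cover `D / 2`. The last makes the sum
  -- positive when `D = 0`.
  refine ⟨D ^ 2 / (4 * κ) + D / (2 * (ρ - r)) + 1, ?_, ?_⟩
  · have : 0 < ρ - r := sub_pos.2 hρ
    positivity
  set lam := D ^ 2 / (4 * κ) + D / (2 * (ρ - r)) + 1 with hlam
  have hρr : 0 < ρ - r := sub_pos.2 hρ
  have hl1 : D ^ 2 / (4 * κ) ≤ lam := by
    have : 0 ≤ D / (2 * (ρ - r)) := by positivity
    linarith
  have hl2 : D / (2 * (ρ - r)) ≤ lam := by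
    have : 0 ≤ D ^ 2 / (4 * κ) := by positivity
    linarith
  have hl0 : 0 < lam := by positivity
  rw [div_le_iff₀ (by positivity)] at hl1 hl2
  intro v hv
  have hDv := hD v (mem_closedBall_zero_iff.2 hv)
  rcases le_or_gt r ‖v‖ with h | h
  · refine abs_le_of_sq_le_sq' ?_ (by positivity) |>.2
    have e : ‖reaction W v + lam • v‖ ^ 2 = lam ^ 2 * ‖v‖ ^ 2 - lam * inner ℝ (gradient W v) v +
        ‖gradient W v‖ ^ 2 / 4 := by
      rw [reaction, norm_add_sq_real, norm_neg, norm_smul, norm_smul, inner_neg_left,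
        real_inner_smul_left, real_inner_smul_right, Real.norm_of_nonneg hl0.le,
        Real.norm_of_nonneg (by norm_num : (0 : ℝ) ≤ 1 / 2)]
      ring
    rw [e]
    have h1 := mul_le_mul_of_nonneg_left (hκv v h hv) hl0.le
    have h2 : ‖gradient W v‖ ^ 2 ≤ D ^ 2 := by gcongr
    have h3 : ‖v‖ ^ 2 ≤ ρ ^ 2 := by gcongr
    have h4 := mul_le_mul_of_nonneg_left h3 (sq_nonneg lam)
    nlinarith
  · refine (norm_add_le _ _).trans ?_
    rw [reaction, norm_neg, norm_smul, norm_smul, Real.norm_of_nonneg hl0.le,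
      Real.norm_of_nonneg (by norm_num : (0 : ℝ) ≤ 1 / 2)]
    have := mul_le_mul_of_nonneg_left h.le hl0.le
    nlinarith

/-- A globally Lipschitz modification of the reaction term for which the ball of radius `ρ` is
invariant. -/
lemma IsThreeWell.exists_truncation (hW : IsThreeWell W c) (r : ℝ) :
    ∃ ρ lam lip : ℝ, r ≤ ρ ∧ 0 < ρ ∧ 0 < lam ∧ 0 < lip ∧ ∃ N : Plane → Plane,
      (∀ v, ‖v‖ ≤ ρ → N v = reaction W v) ∧ (∀ v, ‖N v + lam • v‖ ≤ lam * ρ) ∧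
      ∀ v w, ‖N v - N w‖ ≤ lip * ‖v - w‖ := by
  obtain ⟨r₀, hr₀, hinv⟩ := hW.exists_reaction_add_le
  set ρ := max r (r₀ + 1) with hρ
  have hρr : r₀ < ρ := (lt_add_one r₀).trans_le (le_max_right _ _)
  have hρ0 : 0 < ρ := hr₀.trans hρr
  obtain ⟨lam, hlam, hle⟩ := hinv ρ hρr
  obtain ⟨L, hL, hlip⟩ := exists_lipschitz_closedBall (hW.contDiff_reaction.of_le one_le_two) ρ
  have hsplit : ∀ v w : Plane, reaction W (retract ρ v) + lam • (retract ρ v - v) -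
      (reaction W (retract ρ w) + lam • (retract ρ w - w)) =
      (reaction W (retract ρ v) - reaction W (retract ρ w)) +
        lam • ((retract ρ v - retract ρ w) - (v - w)) := fun v w => by module
  -- The truncation is arranged so that `N v + lam v` depends only on the retracted point, which
  -- makes the ball condition hold for all `v`. The constant combines `2 L` from the reaction and
  -- `lam (2 + 1)` from the correction.
  refine ⟨ρ, lam, 2 * L + lam * 3, le_max_left _ _, hρ0, hlam, by positivity,
    fun v => reaction W (retract ρ v) + lam • (retract ρ v - v), fun v hv => ?_, fun v => ?_,
    fun v w => ?_⟩
  · simp only [retract_of_norm_le hρ0 hv, sub_self, smul_zero, add_zero]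
  · have : reaction W (retract ρ v) + lam • (retract ρ v - v) + lam • v =
        reaction W (retract ρ v) + lam • retract ρ v := by module
    rw [this]
    exact hle _ (norm_retract_le hρ0 v)
  · rw [hsplit]
    have h1 := hlip _ _ (norm_retract_le hρ0 v) (norm_retract_le hρ0 w)
    have h2 := norm_retract_sub_le hρ0 v w
    have h3 : ‖lam • ((retract ρ v - retract ρ w) - (v - w))‖ ≤ lam * (3 * ‖v - w‖) := by
      rw [norm_smul, Real.norm_of_nonneg hlam.le]
      refine mul_le_mul_of_nonneg_left ((norm_sub_le _ _).trans ?_) hlam.le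
      linarith
    have h4 := mul_le_mul_of_nonneg_left h2 hL.le
    refine (norm_add_le _ _).trans ?_
    linarith

end wells

/-! ### The Duhamel map -/

section duhamel

variable {R : ℝ} (hR : 0 < R) {W : Plane → ℝ} {c : Fin 3 → Plane} {V ψ : Plane → Plane} {B : ℝ}

/-- Substitution of the elapsed time `r = t - s`, and replacement of the chosen kernel by the
constructed one. These agree for positive elapsed times only, so `s = t` is discarded as a null set.
-/
lemma duhamel_eq_mild (h : Plane → ℝ → Plane) {x : Plane} (hx : x ∈ Metric.ball (0 : Plane) R)
    {t : ℝ} (ht : 0 ≤ t) :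
    duhamel R W V ψ h x t =
      mild hR (fun y s => reaction W (h y s + V y) + laplacian V y) ψ x t := by
  have hm : MeasurableSet (Metric.ball (0 : Plane) R) := Metric.isOpen_ball.measurableSet
  unfold duhamel mild
  congr 1
  · have hrefl := intervalIntegral.integral_comp_sub_left (a := 0) (b := t)
      (fun r => ∫ y, heatKer hR 2 x y r •
        (reaction W (h y (t - r) + V y) + laplacian V y) ∂(discMeasure R)) t
    rw [sub_self, sub_zero] at hrefl
    rw [potential, ← hrefl]
    have hne : ∀ᵐ s : ℝ, s ≠ t := by simp [ae_iff]
    refine intervalIntegral.integral_congr_ae ?_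
    filter_upwards [hne] with s hs hst
    rw [uIoc_of_le ht] at hst
    have hpos : 0 < t - s := sub_pos.2 (lt_of_le_of_ne hst.2 hs)
    refine setIntegral_congr_fun hm fun y hy => ?_
    simp only [heatKernel_eq hR hx hy hpos, sub_sub_cancel, reaction]
  · unfold heatSemigroup semigroup
    split_ifs with h0
    · rfl
    · have hpos : 0 < t := lt_of_le_of_ne ht (Ne.symm h0)
      refine setIntegral_congr_fun hm fun y hy => ?_
      simp only [heatKernel_eq hR hx hy hpos]

variable (hW : IsThreeWell W c) (hV : IsRegularLimit R B V (laplacian V))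
  (hψ : ContinuousOn ψ (Metric.ball 0 R))

include hW hV in
lemma isSource_of_isBddCont {T : ℝ} {w : Plane → ℝ → Plane} (hw : IsBddCont R (Icc 0 T) w) :
    IsSource R T fun y s => reaction W (w y s + V y) + laplacian V y := by
  obtain ⟨hc, C, hC⟩ := hw
  exact hV.isSource hW.contDiff_reaction.continuous hc hC

include hR hW hV hψ in
lemma isBddCont_duhamel {D : ℝ} (hD : ∀ y ∈ Metric.ball (0 : Plane) R, ‖ψ y‖ ≤ D) {T : ℝ}
    {w : Plane → ℝ → Plane} (hw : IsBddCont R (Icc 0 T) w) :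
    IsBddCont R (Icc 0 T) (duhamel R W V ψ w) := by
  have hs := isSource_of_isBddCont hW hV hw
  have heq : ∀ x ∈ Metric.ball (0 : Plane) R, ∀ t ∈ Icc 0 T, duhamel R W V ψ w x t = _ :=
    fun x hx t ht => duhamel_eq_mild hR (W := W) (V := V) (ψ := ψ) w hx ht.1
  obtain ⟨C, hC0, hC⟩ := exists_norm_mild_le hR hs hD
  refine ⟨(continuousOn_mild hR hs hψ hD).congr fun p hp => heq p.1 hp.1 p.2 hp.2,
    C * (T + R) + D, fun x hx t ht => ?_⟩
  rw [heq x hx t ht]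
  refine (hC x hx t ht).trans ?_
  have := ht.2
  gcongr

lemma IsBddCont.mono {S S' : Set ℝ} (h : S' ⊆ S) {w : Plane → ℝ → Plane} (hw : IsBddCont R S w) :
    IsBddCont R S' w := by
  obtain ⟨hc, C, hC⟩ := hw
  exact ⟨hc.mono (prod_mono_right h), C, fun x hx t ht => hC x hx t (h ht)⟩

-- Both fixed points and `V` are bounded, so only the Lipschitz constant of the reaction on a fixed
-- ball matters and no global Lipschitz bound is required.
include hR hW hV hψ in
lemma eq_of_isFixedPointOn {D : ℝ} (hD : ∀ y ∈ Metric.ball (0 : Plane) R, ‖ψ y‖ ≤ D) {T : ℝ}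
    {g h : Plane → ℝ → Plane} (hg : IsFixedPointOn R W V ψ (Icc 0 T) g)
    (hh : IsFixedPointOn R W V ψ (Icc 0 T) h) {x : Plane} (hx : x ∈ Metric.ball (0 : Plane) R)
    {t : ℝ} (ht : t ∈ Icc 0 T) : g x t = h x t := by
  obtain ⟨A, hA⟩ := hg.1.2
  obtain ⟨A', hA'⟩ := hh.1.2
  have hA0 : 0 ≤ A := (norm_nonneg _).trans (hA x hx t ht)
  have hA0' : 0 ≤ A' := (norm_nonneg _).trans (hA' x hx t ht)
  have hVB := hV.norm_le
  obtain ⟨L, hL, hlip⟩ := exists_lipschitz_closedBall (hW.contDiff_reaction.of_le one_le_two)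
    (A + A' + B)
  refine eq_of_mild_eq hR (isSource_of_isBddCont hW hV hg.1) (isSource_of_isBddCont hW hV hh.1)
    hψ hD hL (A := A + A') (by positivity)
    (fun x hx t ht => by rw [← duhamel_eq_mild hR g hx ht.1, hg.2 x hx t ht])
    (fun x hx t ht => by rw [← duhamel_eq_mild hR h hx ht.1, hh.2 x hx t ht])
    (fun x hx t ht => (norm_sub_le _ _).trans (add_le_add (hA x hx t ht) (hA' x hx t ht)))
    (fun x hx t ht => ?_) hx ht
  rw [add_sub_add_right_eq_sub]
  refine (hlip _ _ ?_ ?_).trans_eq (by rw [add_sub_add_right_eq_sub])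
  · exact (norm_add_le _ _).trans (by linarith [hA x hx t ht, hVB x hx])
  · exact (norm_add_le _ _).trans (by linarith [hA' x hx t ht, hVB x hx])

include hR hV hψ in
/-- A global fixed point of the Duhamel map exists and stays in an invariant ball. -/
lemma exists_isFixedPointOn {ρ lam lip : ℝ} (hlam : 0 < lam) (hlip : 0 < lip) {N : Plane → Plane}
    (hNW : ∀ v, ‖v‖ ≤ ρ → N v = reaction W v) (hNinv : ∀ v, ‖N v + lam • v‖ ≤ lam * ρ)
    (hNlip : ∀ v w, ‖N v - N w‖ ≤ lip * ‖v - w‖) (hBρ : B ≤ ρ) {D : ℝ}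
    (hD : ∀ y ∈ Metric.ball (0 : Plane) R, ‖ψ y‖ ≤ D) (hDρ : D + B ≤ ρ) :
    ∃ h, IsFixedPointOn R W V ψ (Ici 0) h ∧
      ∀ x ∈ Metric.ball (0 : Plane) R, ∀ t ∈ Ici (0 : ℝ), ‖h x t + V x‖ ≤ ρ := by
  obtain ⟨k, hk, hkm⟩ := hV.exists_mild hR hlip hNlip hψ hD
  have hVB := hV.norm_le
  have hNc : Continuous N := by
    have : LipschitzWith lip.toNNReal N := LipschitzWith.of_dist_le_mul fun v w => by
      rw [Real.coe_toNNReal _ hlip.le, dist_eq_norm, dist_eq_norm]; exact hNlip v w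
    exact this.continuous
  -- The invariance of the ball is proved for the truncated problem; inside the ball the truncation
  -- and the reaction coincide, so the solution is a fixed point of the original map.
  have hle : ∀ x ∈ Metric.ball (0 : Plane) R, ∀ t ∈ Ici (0 : ℝ), ‖k x t + V x‖ ≤ ρ := by
    intro x hx t ht
    obtain ⟨hc, C, hC⟩ := hk t
    rw [hkm x hx t ht]
    refine hV.norm_mild_add_le hR hBρ hlam.le hNinv (hV.isSource hNc hc hC) hψ hD
      (fun y hy => (norm_add_le _ _).trans (by linarith [hD y hy, hVB y hy]))
      (fun y hy s hs => by rw [← hkm y hy s hs.1]) hx (right_mem_Icc.2 ht)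
  refine ⟨k, ⟨⟨continuousOn_Ici_of_Icc fun T => (hk T).1, ρ + B, fun x hx t ht => ?_⟩,
    fun x hx t ht => ?_⟩, hle⟩
  · have := norm_sub_le (k x t + V x) (V x)
    rw [add_sub_cancel_right] at this
    linarith [hle x hx t ht, hVB x hx]
  · rw [duhamel_eq_mild hR k hx ht, hkm x hx t ht]
    refine (mild_congr hR ψ ht (fun y hy s hs => ?_) x).symm
    simp only [hNW _ (hle y hy s hs.1)]

lemma supNorm_le_ofReal {S : Set ℝ} {f : Plane → ℝ → Plane} {a : ℝ}
    (h : ∀ x ∈ Metric.ball (0 : Plane) R, ∀ t ∈ S, ‖f x t‖ ≤ a) :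
    supNorm R S f ≤ ENNReal.ofReal a :=
  iSup₂_le fun x hx => iSup₂_le fun t ht => by
    rw [← ofReal_norm]
    exact ENNReal.ofReal_le_ofReal (h x hx t ht)

lemma norm_le_toReal_supNorm {S : Set ℝ} {f : Plane → ℝ → Plane} (hfin : supNorm R S f ≠ ⊤)
    {x : Plane} (hx : x ∈ Metric.ball (0 : Plane) R) {t : ℝ} (ht : t ∈ S) :
    ‖f x t‖ ≤ (supNorm R S f).toReal := by
  have h1 : ‖f x t‖ₑ ≤ supNorm R S f :=
    (le_iSup₂ (f := fun t (_ : t ∈ S) => ‖f x t‖ₑ) t ht).trans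
      (le_iSup₂ (f := fun x (_ : x ∈ Metric.ball (0 : Plane) R) => ⨆ t ∈ S, ‖f x t‖ₑ) x hx)
  rw [← ofReal_norm] at h1
  exact (ENNReal.ofReal_le_iff_le_toReal hfin).1 h1

include hR hW hV hψ in
/-- Stability of the Duhamel fixed point on a short time window. -/
lemma supNorm_sub_le {ρ lip : ℝ} (hlip : 0 < lip)
    (hWlip : ∀ v w : Plane, ‖v‖ ≤ ρ → ‖w‖ ≤ ρ → ‖reaction W v - reaction W w‖ ≤ lip * ‖v - w‖)
    {D : ℝ} (hD : ∀ y ∈ Metric.ball (0 : Plane) R, ‖ψ y‖ ≤ D) {h : Plane → ℝ → Plane}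
    (hh : IsFixedPointOn R W V ψ (Ici 0) h)
    (hhρ : ∀ x ∈ Metric.ball (0 : Plane) R, ∀ t ∈ Ici (0 : ℝ), ‖h x t + V x‖ ≤ ρ)
    {T τ : ℝ} (hT : 0 ≤ T) (hτ : lip * τ ≤ 1 / 2) (hτ0 : 0 ≤ τ) {w : Plane → ℝ → Plane}
    (hw : ContinuousOn (fun p : Plane × ℝ => w p.1 p.2) (Metric.ball 0 R ×ˢ Icc 0 (T + τ)))
    {K : ℝ} (hwK : ∀ x ∈ Metric.ball (0 : Plane) R, ∀ t ∈ Icc 0 (T + τ), ‖w x t‖ ≤ K)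
    (hKρ : K + B ≤ ρ) :
    supNorm R (Icc T (T + τ)) (fun x t => w x t - h x t) ≤
      ENNReal.ofReal 2 *
        (2 * supNorm R (Icc T (T + τ)) (fun x t => duhamel R W V ψ w x t - w x t) +
          supNorm R {T} (fun x t => w x t - h x t)) := by
  have hVB := hV.norm_le
  have hsub : Icc T (T + τ) ⊆ Icc 0 (T + τ) := Icc_subset_Icc_left hT
  have hwρ : ∀ x ∈ Metric.ball (0 : Plane) R, ∀ t ∈ Icc 0 (T + τ), ‖w x t + V x‖ ≤ ρ :=
    fun x hx t ht => (norm_add_le _ _).trans (by linarith [hwK x hx t ht, hVB x hx])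
  have hh' : IsBddCont R (Icc 0 (T + τ)) h := hh.1.mono Icc_subset_Ici_self
  have hw' : IsBddCont R (Icc 0 (T + τ)) w := ⟨hw, K, hwK⟩
  have hsw := isSource_of_isBddCont hW hV hw'
  have hsh := isSource_of_isBddCont hW hV hh'
  set a := supNorm R (Icc T (T + τ)) (fun x t => duhamel R W V ψ w x t - w x t) with ha
  set b := supNorm R {T} (fun x t => w x t - h x t) with hb
  set S := supNorm R (Icc T (T + τ)) (fun x t => w x t - h x t) with hS
  -- An infinite right-hand side is trivial. Otherwise the estimate is carried out with real
  -- numbers, where the absorption below is legitimate because `S` is finite by the boundedness of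
  -- `w` and `h`.
  rcases eq_or_ne a ⊤ with ha' | ha'
  · simp [ha']
  rcases eq_or_ne b ⊤ with hb' | hb'
  · simp [hb']
  obtain ⟨H, hH⟩ := hh'.2
  have hS' : S ≠ ⊤ := by
    refine ne_top_of_le_ne_top ENNReal.ofReal_ne_top (supNorm_le_ofReal (a := K + H)
      fun x hx t ht => (norm_sub_le _ _).trans
        (add_le_add (hwK x hx t (hsub ht)) (hH x hx t (hsub ht))))
  have hle : ∀ x ∈ Metric.ball (0 : Plane) R, ∀ t ∈ Icc T (T + τ),
      ‖w x t - h x t‖ ≤ 2 * a.toReal + b.toReal + S.toReal / 2 := by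
    intro x hx t ht
    have ht0 : t ∈ Icc 0 (T + τ) := hsub ht
    have hTm : T ∈ Icc T (T + τ) := ⟨le_rfl, by linarith⟩
    -- Both evolutions are restarted at `T`. The data at `T` differ by at most `a + b`, and the
    -- reaction terms contribute at most `lip r S ≤ S / 2`. The second `a` in the final bound is the
    -- distance from `F(w)` back to `w`.
    have hmain : ‖duhamel R W V ψ w x t - h x t‖ ≤ S.toReal / 2 + (a.toReal + b.toReal) := by
      rw [← hh.2 x hx t ht0.1, duhamel_eq_mild hR w hx ht0.1, duhamel_eq_mild hR h hx ht0.1]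
      obtain ⟨r, hr0, rfl⟩ : ∃ r, 0 ≤ r ∧ t = T + r := ⟨t - T, by linarith [ht.1], by ring⟩
      have hrτ : r ≤ τ := by linarith [ht.2]
      rw [mild_add hR hsw hψ hD hx hT hr0 ht.2, mild_add hR hsh hψ hD hx hT hr0 ht.2]
      obtain ⟨C₁, hC₁0, hC₁⟩ := exists_norm_mild_le hR hsw hD
      obtain ⟨C₂, hC₂0, hC₂⟩ := exists_norm_mild_le hR hsh hD
      have hslice : ∀ {f : Plane → ℝ → Plane}, IsSource R (T + τ) f →
          ContinuousOn (fun z => mild hR f ψ z T) (Metric.ball 0 R) := fun hf =>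
        (continuousOn_mild hR hf hψ hD).comp (f := fun z => (z, T)) (by fun_prop)
          fun z hz => ⟨hz, hsub hTm⟩
      have hshift : T + τ - T = τ := add_sub_cancel_left _ _
      have hsw' := hsw.shift hT
      have hsh' := hsh.shift hT
      rw [hshift] at hsw' hsh'
      refine (norm_mild_sub_le hR hsw' hsh' (hslice hsw) (hslice hsh)
        (fun y hy => hC₁ y hy T (hsub hTm)) (fun y hy => hC₂ y hy T (hsub hTm))
        (D := a.toReal + b.toReal) (fun y hy => ?_) hx ⟨hr0, hrτ⟩
        (continuous_const (y := lip * S.toReal)) fun y hy s hs => ?_).trans ?_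
      · rw [← duhamel_eq_mild hR w hy hT, ← duhamel_eq_mild hR h hy hT, hh.2 y hy T hT]
        have h1 := norm_le_toReal_supNorm ha' hy hTm
        have h2 := norm_le_toReal_supNorm hb' hy (mem_singleton T)
        have := norm_add_le (duhamel R W V ψ w y T - w y T) (w y T - h y T)
        rw [sub_add_sub_cancel] at this
        linarith
      · have hTs : T + s ∈ Icc T (T + τ) := ⟨by linarith [hs.1], by linarith [hs.2]⟩
        rw [add_sub_add_right_eq_sub]
        refine (hWlip _ _ (hwρ y hy _ (hsub hTs)) (hhρ y hy _ (hsub hTs).1)).trans ?_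
        rw [add_sub_add_right_eq_sub]
        exact mul_le_mul_of_nonneg_left (norm_le_toReal_supNorm hS' hy hTs) hlip.le
      · rw [intervalIntegral.integral_const, sub_zero, smul_eq_mul]
        have h1 : lip * r ≤ 1 / 2 := (mul_le_mul_of_nonneg_left hrτ hlip.le).trans hτ
        have h2 := mul_le_mul_of_nonneg_right h1 (ENNReal.toReal_nonneg (a := S))
        linarith
    have h1 := norm_le_toReal_supNorm ha' hx ht
    have := norm_sub_le (duhamel R W V ψ w x t - h x t) (duhamel R W V ψ w x t - w x t)
    rw [sub_sub_sub_cancel_left] at this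
    linarith
  -- Half of `S` is absorbed on the left, which doubles the remaining terms; this is the factor `2 =
  -- 1 / (1 - β)`.
  have hSle : S.toReal ≤ 2 * a.toReal + b.toReal + S.toReal / 2 := by
    have h0 : 0 ≤ 2 * a.toReal + b.toReal + S.toReal / 2 := by positivity
    exact ENNReal.toReal_le_of_le_ofReal h0 (supNorm_le_ofReal hle)
  rw [← ENNReal.ofReal_toReal hS', ← ENNReal.ofReal_toReal ha', ← ENNReal.ofReal_toReal hb',
    show (2 : ℝ≥0∞) = ENNReal.ofReal 2 by simp, ← ENNReal.ofReal_mul zero_le_two,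
    ← ENNReal.ofReal_add (by positivity) (by positivity), ← ENNReal.ofReal_mul zero_le_two]
  exact ENNReal.ofReal_le_ofReal (by linarith)

end duhamel

/-! ### Radial interpolation between two functions -/

/-- Interpolation between `φ` and `v` with the radial weight `F`; for `k ≠ 0` the norm is
regularised at the origin. -/
def blend (F : ℝ → ℝ) (φ v : Plane → Plane) (k : ℝ) (y : Plane) : Plane :=
  F (regNorm k y) • φ y + (1 - F (regNorm k y)) • v y

lemma contDiff_deriv {F : ℝ → ℝ} (hF : ContDiff ℝ 2 F) : ContDiff ℝ 1 (deriv F) :=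
  ((contDiff_succ_iff_deriv (n := 1)).1 (hF.of_le one_add_one_eq_two.le)).2.2

section blend

variable {F : ℝ → ℝ} {φ v : Plane → Plane} {r S : ℝ}

lemma blend_eq (k : ℝ) :
    blend F φ v k = fun y => v y + F (regNorm k y) • (φ y - v y) := by
  funext y
  unfold blend
  module

lemma blend_eventuallyEq (hF1 : ∀ s, r ≤ s → F s = 1) {k : ℝ} {y : Plane} (h : r < regNorm k y) :
    blend F φ v k =ᶠ[𝓝 y] φ := by
  filter_upwards [(continuous_regNorm k).continuousAt.eventually (lt_mem_nhds h)] with z hz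
  simp [blend, hF1 _ hz.le]

lemma contDiffAt_blend (hF : ContDiff ℝ 2 F) (hφ : ContDiff ℝ 2 φ)
    (hv : ContDiffOn ℝ 2 v (Metric.ball 0 S)) {k : ℝ} {y : Plane}
    (hy : y ∈ Metric.ball (0 : Plane) S) (h : 0 < regNorm k y) :
    ContDiffAt ℝ 2 (blend F φ v k) y := by
  have hvy := hv.contDiffAt (Metric.isOpen_ball.mem_nhds hy)
  have hFy : ContDiffAt ℝ 2 (fun z => F (regNorm k z)) y :=
    hF.contDiffAt.comp y (contDiffAt_regNorm h)
  rw [blend_eq]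
  exact hvy.add (hFy.smul (hφ.contDiffAt.sub hvy))

lemma laplacian_blend (hF : ContDiff ℝ 2 F) (hφ : ContDiff ℝ 2 φ)
    (hv : ContDiffOn ℝ 2 v (Metric.ball 0 S)) {k : ℝ} {y : Plane}
    (hy : y ∈ Metric.ball (0 : Plane) S) (h : 0 < regNorm k y) :
    laplacian (blend F φ v k) y = laplacian v y +
      (F (regNorm k y) • (laplacian φ y - laplacian v y) +
      (2 : ℝ) • ∑ i, (deriv F (regNorm k y) * (y i * (regNorm k y)⁻¹)) •
        (fderiv ℝ φ y (basisVec i) - fderiv ℝ v y (basisVec i)) +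
      (deriv (deriv F) (regNorm k y) * ∑ i, (y i * (regNorm k y)⁻¹) ^ 2 +
        deriv F (regNorm k y) * ((regNorm k y)⁻¹ + k ^ 2 * (regNorm k y)⁻¹ ^ 3)) •
        (φ y - v y)) := by
  have hvy := hv.contDiffAt (Metric.isOpen_ball.mem_nhds hy)
  have hρ : ContDiffAt ℝ 2 (regNorm k) y := contDiffAt_regNorm h
  have hFy : ContDiffAt ℝ 2 (fun z => F (regNorm k z)) y := hF.contDiffAt.comp y hρ
  have hw : ContDiffAt ℝ 2 (fun z => φ z - v z) y := hφ.contDiffAt.sub hvy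
  have hdF : ∀ i, fderiv ℝ (fun z => F (regNorm k z)) y (basisVec i) =
      deriv F (regNorm k y) * (y i * (regNorm k y)⁻¹) := fun i => by
    have := ((hF.differentiable (by norm_num) _).hasDerivAt.comp_hasFDerivAt y
      (hρ.differentiableAt (by norm_num)).hasFDerivAt).fderiv
    simp only [Function.comp_def] at this
    rw [this, smul_apply, smul_eq_mul, fderiv_regNorm_basisVec h]
  have hdw : ∀ i, fderiv ℝ (fun z => φ z - v z) y (basisVec i) =
      fderiv ℝ φ y (basisVec i) - fderiv ℝ v y (basisVec i) := fun i => by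
    rw [fderiv_fun_sub (hφ.differentiable (by norm_num) y) (hvy.differentiableAt (by norm_num))]
    rfl
  rw [blend_eq, laplacian_fun_add (g := fun z => F (regNorm k z) • (φ z - v z)) hvy (hFy.smul hw),
    laplacian_smul_fun hFy hw, laplacian_fun_sub hφ.contDiffAt hvy,
    laplacian_comp hF.contDiffAt hρ, laplacian_regNorm h]
  simp only [hdF, hdw, fderiv_regNorm_basisVec h]

/-- Two singularities are controlled. The radial weight contributes `F' / ρ` near the origin, hence
the factor `1 + 1 / regNorm`. Near the circle of radius `S` the gradient of `v` may grow like `1 /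
(S - ‖y‖)`, but `F'` vanishes beyond `r ≤ S` and compensates it. -/
lemma norm_laplacian_blend_le (hF : ContDiff ℝ 2 F) (hF1 : ∀ s, r ≤ s → F s = 1) (hrS : r ≤ S)
    (hφ : ContDiff ℝ 2 φ) (hv : ContDiffOn ℝ 2 v (Metric.ball 0 S)) {Cv N G : ℝ} (hG : 0 ≤ G)
    (hCv : ∀ y ∈ Metric.ball (0 : Plane) S, ‖v y‖ ≤ Cv)
    (hN : ∀ y ∈ Metric.ball (0 : Plane) S, ‖laplacian v y‖ ≤ N)
    (hvG : ∀ y ∈ Metric.ball (0 : Plane) S, ∀ i,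
      ‖fderiv ℝ v y (basisVec i)‖ ≤ G / (S - ‖y‖)) (R : ℝ) :
    ∃ C, 0 ≤ C ∧ ∀ k ∈ Ioc (0 : ℝ) 1, ∀ y ∈ Metric.ball (0 : Plane) R,
      ‖laplacian (blend F φ v k) y‖ ≤ C * (1 + (regNorm k y)⁻¹) := by
  have hdF : ContDiff ℝ 1 (deriv F) := contDiff_deriv hF
  have hddF : Continuous (deriv (deriv F)) := hdF.continuous_deriv (by norm_num)
  have hcd : IsCompact (Metric.closedBall (0 : Plane) R) := isCompact_closedBall _ _
  obtain ⟨P₀, hP₀⟩ := hcd.exists_bound_of_continuousOn hφ.continuous.continuousOn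
  obtain ⟨P₁, hP₁⟩ := hcd.exists_bound_of_continuousOn
    (hφ.continuous_fderiv (by norm_num)).continuousOn
  obtain ⟨P₂, hP₂⟩ := hcd.exists_bound_of_continuousOn
    ((continuousOn_laplacian isOpen_univ hφ.contDiffOn).mono (subset_univ _))
  set J : Set ℝ := Icc 0 (max (R + 1) r) with hJ
  have hcJ : IsCompact J := isCompact_Icc
  obtain ⟨Q₀, hQ₀⟩ := hcJ.exists_bound_of_continuousOn hF.continuous.continuousOn
  obtain ⟨Q₁, hQ₁⟩ := hcJ.exists_bound_of_continuousOn hdF.continuous.continuousOn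
  obtain ⟨Q₂, hQ₂⟩ := hcJ.exists_bound_of_continuousOn hddF.continuousOn
  obtain ⟨P, hP, hP₀', hP₁', hP₂'⟩ : ∃ P, 0 ≤ P ∧ P₀ ≤ P ∧ P₁ ≤ P ∧ P₂ ≤ P :=
    ⟨|P₀| + |P₁| + |P₂|, by positivity, by linarith [le_abs_self P₀, abs_nonneg P₁, abs_nonneg P₂],
      by linarith [le_abs_self P₁, abs_nonneg P₀, abs_nonneg P₂],
      by linarith [le_abs_self P₂, abs_nonneg P₁, abs_nonneg P₀]⟩
  obtain ⟨Q, hQ, hQ₀', hQ₁', hQ₂'⟩ : ∃ Q, 0 ≤ Q ∧ Q₀ ≤ Q ∧ Q₁ ≤ Q ∧ Q₂ ≤ Q :=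
    ⟨|Q₀| + |Q₁| + |Q₂|, by positivity, by linarith [le_abs_self Q₀, abs_nonneg Q₁, abs_nonneg Q₂],
      by linarith [le_abs_self Q₁, abs_nonneg Q₀, abs_nonneg Q₂],
      by linarith [le_abs_self Q₂, abs_nonneg Q₁, abs_nonneg Q₀]⟩
  have hdF0 : ∀ s, r ≤ s → deriv F s = 0 := by
    have h1 : EqOn (deriv F) 0 (Ioi r) := fun s hs => by
      have : F =ᶠ[𝓝 s] fun _ => 1 := by
        filter_upwards [Ioi_mem_nhds hs] with τ hτ using hF1 τ (le_of_lt hτ)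
      rw [this.deriv_eq, deriv_const, Pi.zero_apply]
    have h2 := h1.closure hdF.continuous continuous_const
    rw [closure_Ioi] at h2
    exact fun s hs => h2 hs
  -- The derivative of `F` vanishes at `r` and its slope is bounded by `Q`, so it is at most linear
  -- in the distance to `r`.
  have hdFle : ∀ s ∈ J, s ≤ r → |deriv F s| ≤ Q * (r - s) := by
    intro s hs hsr
    have hsub : Icc s r ⊆ J := Icc_subset_Icc hs.1 (le_max_right _ _)
    have := (convex_Icc s r).norm_image_sub_le_of_norm_deriv_le (f := deriv F) (C := Q)
      (fun τ _ => hdF.differentiable (by norm_num) τ) (fun τ hτ => (hQ₂ τ (hsub hτ)).trans hQ₂')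
      (right_mem_Icc.2 hsr) (left_mem_Icc.2 hsr)
    rw [hdF0 r le_rfl, sub_zero, norm_sub_rev s r, Real.norm_of_nonneg (sub_nonneg.2 hsr)] at this
    exact this
  have hN' : 0 ≤ max N 0 := le_max_right _ _
  have hCv' : 0 ≤ max Cv 0 := le_max_right _ _
  refine ⟨max N 0 + Q * (P + max N 0) + 4 * (Q * (P + G)) + 2 * (Q * (P + max Cv 0)) + P,
    by positivity, fun k hk y hy => ?_⟩
  have hρ := regNorm_pos hk.1 y
  have hyR := Metric.ball_subset_closedBall hy
  have hi : 0 < (regNorm k y)⁻¹ := inv_pos.2 hρ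
  rcases lt_or_ge ‖y‖ S with hyS | hyS
  swap
  -- For `‖y‖ ≥ S ≥ r` the inequality is strict because `k > 0`, so the interpolation equals `φ`
  -- near `y` and the missing regularity of `v` there is irrelevant.
  · have hρr : r < regNorm k y := by
      refine lt_of_le_of_lt (hrS.trans hyS) (Real.lt_sqrt_of_sq_lt ?_)
      have := hk.1
      nlinarith
    rw [laplacian_congr (blend_eventuallyEq hF1 hρr)]
    have h1 := (hP₂ y hyR).trans hP₂'
    have h2 : 0 ≤ max N 0 + Q * (P + max N 0) + 4 * (Q * (P + G)) + 2 * (Q * (P + max Cv 0)) := by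
      positivity
    nlinarith
  have hyb : y ∈ Metric.ball (0 : Plane) S := mem_ball_zero_iff.2 hyS
  have hρJ : regNorm k y ∈ J := ⟨hρ.le, (regNorm_le hk.1.le y).trans
    ((add_le_add (mem_ball_zero_iff.1 hy).le hk.2).trans (le_max_left _ _))⟩
  rw [laplacian_blend hF hφ hv hyb hρ]
  set ρ := regNorm k y with hρd
  have hyρ : ∀ i, |y i * ρ⁻¹| ≤ 1 := fun i => by
    rw [abs_mul, abs_of_pos hi, ← div_eq_mul_inv, div_le_one hρ]
    exact (abs_apply_le_norm y i).trans (norm_le_regNorm k y)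
  have hlapv := (hN y hyb).trans (le_max_left N 0)
  have hvb := (hCv y hyb).trans (le_max_left Cv 0)
  have hφb := (hP₀ y hyR).trans hP₀'
  have hlapφ := (hP₂ y hyR).trans hP₂'
  have hdφ : ∀ i, ‖fderiv ℝ φ y (basisVec i)‖ ≤ P := fun i => by
    refine ((fderiv ℝ φ y).le_opNorm _).trans ?_
    rw [show ‖basisVec i‖ = 1 by simp [basisVec], mul_one]
    exact (hP₁ y hyR).trans hP₁'
  have hFb : ‖F ρ‖ ≤ Q := (hQ₀ ρ hρJ).trans hQ₀'
  have hF'b : ‖deriv F ρ‖ ≤ Q := (hQ₁ ρ hρJ).trans hQ₁'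
  have hF''b : ‖deriv (deriv F) ρ‖ ≤ Q := (hQ₂ ρ hρJ).trans hQ₂'
  have hSy : 0 < S - ‖y‖ := sub_pos.2 hyS
  have hF'v : ∀ i, ‖deriv F ρ‖ * ‖fderiv ℝ v y (basisVec i)‖ ≤ Q * G := fun i => by
    have h1 : ‖deriv F ρ‖ ≤ Q * (S - ‖y‖) := by
      rcases le_total r ρ with h | h
      · rw [hdF0 ρ h, norm_zero]; positivity
      · refine (hdFle ρ hρJ h).trans (mul_le_mul_of_nonneg_left ?_ hQ)
        linarith [norm_le_regNorm k y]
    calc _ ≤ Q * (S - ‖y‖) * (G / (S - ‖y‖)) := by gcongr; exact hvG y hyb i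
      _ = Q * G := by field_simp
  have t1 : ‖F ρ • (laplacian φ y - laplacian v y)‖ ≤ Q * (P + max N 0) := by
    rw [norm_smul]
    exact mul_le_mul hFb ((norm_sub_le _ _).trans (add_le_add hlapφ hlapv)) (norm_nonneg _) hQ
  have t2 : ‖(2 : ℝ) • ∑ i, (deriv F ρ * (y i * ρ⁻¹)) •
      (fderiv ℝ φ y (basisVec i) - fderiv ℝ v y (basisVec i))‖ ≤ 4 * (Q * (P + G)) := by
    have h1 : ∀ i, ‖(deriv F ρ * (y i * ρ⁻¹)) •
        (fderiv ℝ φ y (basisVec i) - fderiv ℝ v y (basisVec i))‖ ≤ Q * (P + G) := fun i => by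
      rw [norm_smul, norm_mul]
      calc _ ≤ ‖deriv F ρ‖ * 1 *
            (‖fderiv ℝ φ y (basisVec i)‖ + ‖fderiv ℝ v y (basisVec i)‖) := by
            gcongr
            · exact hyρ i
            · exact norm_sub_le _ _
        _ = ‖deriv F ρ‖ * ‖fderiv ℝ φ y (basisVec i)‖ +
            ‖deriv F ρ‖ * ‖fderiv ℝ v y (basisVec i)‖ := by ring
        _ ≤ Q * P + Q * G := add_le_add (mul_le_mul hF'b (hdφ i) (norm_nonneg _) hQ) (hF'v i)
        _ = _ := by ring
    rw [norm_smul, Real.norm_of_nonneg zero_le_two, Fin.sum_univ_two]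
    linarith [norm_add_le ((deriv F ρ * (y 0 * ρ⁻¹)) •
      (fderiv ℝ φ y (basisVec 0) - fderiv ℝ v y (basisVec 0))) ((deriv F ρ * (y 1 * ρ⁻¹)) •
      (fderiv ℝ φ y (basisVec 1) - fderiv ℝ v y (basisVec 1))), h1 0, h1 1]
  have t3 : ‖(deriv (deriv F) ρ * ∑ i, (y i * ρ⁻¹) ^ 2 +
      deriv F ρ * (ρ⁻¹ + k ^ 2 * ρ⁻¹ ^ 3)) • (φ y - v y)‖ ≤
      2 * (Q * (P + max Cv 0)) * (1 + ρ⁻¹) := by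
    have h1 : ∑ i, (y i * ρ⁻¹) ^ 2 ≤ 2 := by
      rw [Fin.sum_univ_two]
      have := sq_le_one_iff_abs_le_one _ |>.2 (hyρ 0)
      have := sq_le_one_iff_abs_le_one _ |>.2 (hyρ 1)
      linarith
    have h1' : 0 ≤ ∑ i, (y i * ρ⁻¹) ^ 2 := Finset.sum_nonneg fun i _ => sq_nonneg _
    have h2 : ρ⁻¹ + k ^ 2 * ρ⁻¹ ^ 3 ≤ 2 * ρ⁻¹ := by
      have h3 : (k * ρ⁻¹) ^ 2 ≤ 1 := by
        refine pow_le_one₀ (mul_nonneg hk.1.le hi.le) ?_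
        rw [← div_eq_mul_inv, div_le_one hρ]
        exact le_regNorm k y
      have h4 := mul_le_mul_of_nonneg_right h3 hi.le
      have h5 : k ^ 2 * ρ⁻¹ ^ 3 = (k * ρ⁻¹) ^ 2 * ρ⁻¹ := by ring
      linarith
    have h2' : 0 ≤ ρ⁻¹ + k ^ 2 * ρ⁻¹ ^ 3 := by positivity
    rw [norm_smul]
    have h6 : ‖deriv (deriv F) ρ * ∑ i, (y i * ρ⁻¹) ^ 2 +
        deriv F ρ * (ρ⁻¹ + k ^ 2 * ρ⁻¹ ^ 3)‖ ≤ Q * 2 + Q * (2 * ρ⁻¹) := by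
      refine (norm_add_le _ _).trans (add_le_add ?_ ?_)
      · rw [norm_mul, Real.norm_of_nonneg h1']
        exact mul_le_mul hF''b h1 h1' hQ
      · rw [norm_mul, Real.norm_of_nonneg h2']
        exact mul_le_mul hF'b h2 h2' hQ
    calc _ ≤ (Q * 2 + Q * (2 * ρ⁻¹)) * (P + max Cv 0) :=
          mul_le_mul h6 ((norm_sub_le _ _).trans (add_le_add hφb hvb)) (norm_nonneg _)
            (by positivity)
      _ = _ := by ring
  refine (norm_add_le _ _).trans ((add_le_add hlapv ((norm_add₃_le).trans
    (add_le_add_three t1 t2 t3))).trans ?_)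
  have h7 : 0 ≤ max N 0 + Q * (P + max N 0) + 4 * (Q * (P + G)) := by positivity
  nlinarith

lemma tendsto_laplacian_blend (hF : ContDiff ℝ 2 F) (hφ : ContDiff ℝ 2 φ)
    (hv : ContDiffOn ℝ 2 v (Metric.ball 0 S)) {y : Plane}
    (hy : y ∈ Metric.ball (0 : Plane) S) (h : y ≠ 0) :
    Tendsto (fun k => laplacian (blend F φ v k) y) (𝓝 0) (𝓝 (laplacian (blend F φ v 0) y)) := by
  have hdF : ContDiff ℝ 1 (deriv F) := contDiff_deriv hF
  have hpos : ∀ k, 0 < regNorm k y := fun k =>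
    (norm_pos_iff.2 h).trans_le (norm_le_regNorm k y)
  simp only [laplacian_blend hF hφ hv hy (hpos _)]
  have hρ : Continuous fun k => regNorm k y := by unfold regNorm; fun_prop
  have hi : Continuous fun k => (regNorm k y)⁻¹ := hρ.inv₀ fun k => (hpos k).ne'
  have h0 : Continuous fun k => F (regNorm k y) := hF.continuous.comp hρ
  have h1 : Continuous fun k => deriv F (regNorm k y) := hdF.continuous.comp hρ
  have h2 : Continuous fun k => deriv (deriv F) (regNorm k y) :=
    (hdF.continuous_deriv (by norm_num)).comp hρ
  refine Continuous.tendsto ?_ 0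
  fun_prop

end blend

section blend

variable {F : ℝ → ℝ} {φ v : Plane → Plane} {r S : ℝ}

lemma contDiffAt_blend_of_pos (hF : ContDiff ℝ 2 F) (hF1 : ∀ s, r ≤ s → F s = 1) (hrS : r ≤ S)
    (hφ : ContDiff ℝ 2 φ) (hv : ContDiffOn ℝ 2 v (Metric.ball 0 S)) {k : ℝ} (hk : 0 < k)
    (y : Plane) : ContDiffAt ℝ 2 (blend F φ v k) y := by
  rcases lt_or_ge ‖y‖ S with hyS | hyS
  · exact contDiffAt_blend hF hφ hv (mem_ball_zero_iff.2 hyS) (regNorm_pos hk y)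
  · have hρr : r < regNorm k y := by
      refine lt_of_le_of_lt (hrS.trans hyS) (Real.lt_sqrt_of_sq_lt ?_)
      nlinarith
    exact hφ.contDiffAt.congr_of_eventuallyEq (blend_eventuallyEq hF1 hρr)

lemma blend_of_le (hF1 : ∀ s, r ≤ s → F s = 1) {k : ℝ} {y : Plane} (h : r ≤ ‖y‖) :
    blend F φ v k y = φ y := by
  simp [blend, hF1 _ (h.trans (norm_le_regNorm k y))]

lemma norm_blend_le (hF1 : ∀ s, r ≤ s → F s = 1) (hrS : r ≤ S) {X Cφ Cv : ℝ}
    (hX : ∀ s, |F s| ≤ X) (hCφ : ∀ y, ‖φ y‖ ≤ Cφ) (hCv0 : 0 ≤ Cv)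
    (hCv : ∀ y ∈ Metric.ball (0 : Plane) S, ‖v y‖ ≤ Cv) (k : ℝ) (y : Plane) :
    ‖blend F φ v k y‖ ≤ (1 + X) * (Cφ + Cv) := by
  have hX0 : 0 ≤ X := (abs_nonneg _).trans (hX 0)
  have hCφ0 : 0 ≤ Cφ := (norm_nonneg _).trans (hCφ 0)
  rcases lt_or_ge ‖y‖ S with hyS | hyS
  · rw [blend_eq]
    have h1 := hCv y (mem_ball_zero_iff.2 hyS)
    have h2 : ‖F (regNorm k y) • (φ y - v y)‖ ≤ X * (Cφ + Cv) := by
      rw [norm_smul]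
      exact mul_le_mul (hX _) ((norm_sub_le _ _).trans (add_le_add (hCφ y) h1)) (norm_nonneg _) hX0
    exact (norm_add_le _ _).trans (by linarith)
  · rw [blend_of_le hF1 (hrS.trans hyS)]
    nlinarith [hCφ y]

/-- Radial interpolations with a weight that becomes constant before `v` loses its regularity are
regular limits. -/
theorem isRegularLimit_blend (hF : ContDiff ℝ 2 F) (hF1 : ∀ s, r ≤ s → F s = 1) (hrS : r ≤ S)
    {X Cφ Cv N G : ℝ} (hX : ∀ s, |F s| ≤ X) (hφ : ContDiff ℝ 2 φ) (hCφ : ∀ y, ‖φ y‖ ≤ Cφ)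
    (hv : ContDiffOn ℝ 2 v (Metric.ball 0 S)) (hCv0 : 0 ≤ Cv) (hG : 0 ≤ G)
    (hCv : ∀ y ∈ Metric.ball (0 : Plane) S, ‖v y‖ ≤ Cv)
    (hN : ∀ y ∈ Metric.ball (0 : Plane) S, ‖laplacian v y‖ ≤ N)
    (hvG : ∀ y ∈ Metric.ball (0 : Plane) S, ∀ i,
      ‖fderiv ℝ v y (basisVec i)‖ ≤ G / (S - ‖y‖)) (R : ℝ) :
    IsRegularLimit R ((1 + X) * (Cφ + Cv)) (blend F φ v 0) (laplacian (blend F φ v 0)) := by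
  have hCφ0 : 0 ≤ Cφ := (norm_nonneg _).trans (hCφ 0)
  set κ : ℕ → ℝ := fun n => 1 / ((n : ℝ) + 1) with hκ
  have hκ0 : ∀ n, 0 < κ n := fun n => by positivity
  have hκ1 : ∀ n, κ n ≤ 1 := fun n => by
    rw [hκ]
    exact div_le_one_of_le₀ (by linarith [n.cast_nonneg (α := ℝ)]) (by positivity)
  have hκlim : Tendsto κ atTop (𝓝 0) := tendsto_one_div_add_atTop_nhds_zero_nat
  obtain ⟨C, hC0, hC⟩ := norm_laplacian_blend_le hF hF1 hrS hφ hv hG hCv hN hvG R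
  have hsmooth : ∀ n y, ContDiffAt ℝ 2 (blend F φ v (κ n)) y := fun n y =>
    contDiffAt_blend_of_pos hF hF1 hrS hφ hv (hκ0 n) y
  obtain ⟨D, hD⟩ := (isCompact_Icc (a := 0) (b := R + 1)).exists_bound_of_continuousOn
    (contDiff_deriv hF).continuous.continuousOn
  have hunif : ∀ n, ∀ y ∈ Metric.ball (0 : Plane) R,
      ‖blend F φ v (κ n) y - blend F φ v 0 y‖ ≤ |D| * (Cφ + Cv) * κ n := by
    intro n y hy
    rcases lt_or_ge ‖y‖ S with hyS | hyS
    swap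
    · rw [blend_of_le hF1 (hrS.trans hyS), blend_of_le hF1 (hrS.trans hyS), sub_self, norm_zero]
      exact mul_nonneg (by positivity) (hκ0 n).le
    have h0 : regNorm 0 y = ‖y‖ := by simp [regNorm]
    have e : blend F φ v (κ n) y - blend F φ v 0 y =
        (F (regNorm (κ n) y) - F ‖y‖) • (φ y - v y) := by
      simp only [blend_eq, h0]
      module
    have hyR := mem_ball_zero_iff.1 hy
    have h1 := norm_le_regNorm (κ n) y
    have h2 := regNorm_le (hκ0 n).le y
    have h3 := (convex_Icc (0 : ℝ) (R + 1)).norm_image_sub_le_of_norm_deriv_le (f := F) (C := |D|)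
      (fun τ _ => hF.differentiable (by norm_num) τ) (fun τ hτ => (hD τ hτ).trans (le_abs_self D))
      (x := ‖y‖) (y := regNorm (κ n) y) ⟨norm_nonneg y, by linarith⟩
      ⟨(norm_nonneg y).trans h1, by linarith [hκ1 n]⟩
    rw [Real.norm_of_nonneg (sub_nonneg.2 h1)] at h3
    rw [e, norm_smul]
    calc _ ≤ |D| * κ n * (Cφ + Cv) := by
          refine mul_le_mul (h3.trans (mul_le_mul_of_nonneg_left (by linarith) (abs_nonneg D)))
            ((norm_sub_le _ _).trans (add_le_add (hCφ y) (hCv y (mem_ball_zero_iff.2 hyS))))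
            (norm_nonneg _) (mul_nonneg (abs_nonneg D) (hκ0 n).le)
      _ = _ := by ring
  have hlim0 : Tendsto (fun n => |D| * (Cφ + Cv) * κ n) atTop (𝓝 0) := by
    simpa using hκlim.const_mul (|D| * (Cφ + Cv))
  refine ⟨?_, fun n => blend F φ v (κ n), C, hC0, fun n y _ => (hsmooth n y).contDiffWithinAt,
    fun n y _ => norm_blend_le hF1 hrS hX hCφ hCv0 hCv _ y, fun n => ⟨C * (1 + (κ n)⁻¹),
    fun y hy => (hC _ ⟨hκ0 n, hκ1 n⟩ y hy).trans ?_⟩, fun n => ?_, fun y hy => ?_, ?_⟩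
  · have hu : TendstoUniformlyOn (fun n => blend F φ v (κ n)) (blend F φ v 0) atTop
        (Metric.ball 0 R) := by
      rw [Metric.tendstoUniformlyOn_iff]
      intro ε hε
      filter_upwards [hlim0.eventually (gt_mem_nhds hε)] with n hn y hy
      rw [dist_comm, dist_eq_norm]
      exact (hunif n y hy).trans_lt hn
    exact hu.continuousOn (Eventually.of_forall fun n y _ =>
      (hsmooth n y).continuousAt.continuousWithinAt).frequently
  · have := le_regNorm (κ n) y
    have := hκ0 n
    gcongr
  · filter_upwards [ae_restrict_mem Metric.isOpen_ball.measurableSet, ae_ne R 0] with y hy hy0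
    refine (hC _ ⟨hκ0 n, hκ1 n⟩ y hy).trans (mul_le_mul_of_nonneg_left ?_ hC0)
    have h1 : 0 < ‖y‖ := norm_pos_iff.2 hy0.symm
    have := norm_le_regNorm (κ n) y
    unfold weight
    gcongr
  · exact tendsto_iff_norm_sub_tendsto_zero.2
      (squeeze_zero (fun _ => norm_nonneg _) (fun n => hunif n y hy) hlim0)
  -- Away from the origin and from the circle of radius `r`, both null sets, either all functions
  -- involved are smooth enough or the interpolation is locally `φ`.
  · have hsph : ∀ᵐ y ∂(discMeasure R), y ∉ Metric.sphere (0 : Plane) r := by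
      rw [ae_iff]
      simp only [not_not]
      rcases eq_or_ne r 0 with rfl | hr0
      · rw [Metric.sphere_zero]
        have := ae_iff.1 (ae_ne R 0)
        refine le_antisymm ((measure_mono fun y hy => ?_).trans_eq this) zero_le
        simpa using hy
      · refine le_antisymm ((Measure.restrict_le_self _).trans_eq ?_) zero_le
        exact Measure.addHaar_sphere_of_ne_zero volume 0 hr0
    filter_upwards [ae_ne R 0, hsph] with y hy0 hyr
    rw [mem_sphere_zero_iff_norm] at hyr
    rcases lt_or_gt_of_ne hyr with h | h
    · exact (tendsto_laplacian_blend hF hφ hv (mem_ball_zero_iff.2 (h.trans_le hrS))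
        hy0.symm).comp hκlim
    · have h1 : ∀ k, laplacian (blend F φ v k) y = laplacian φ y := fun k =>
        laplacian_congr (blend_eventuallyEq hF1 (h.trans_le (norm_le_regNorm k y)))
      simp only [h1]
      exact tendsto_const_nhds

end blend

/-! ### Regularity of the junction function `φ` -/

section junction

/-- The argument jumps across the negative real axis. Near that axis it is replaced by `arg (-w) +
π`, which is smooth there and differs from `arg w` by a multiple of the period. -/
lemma contDiffAt_comp_arg {f : ℝ → ℝ} (hf : ContDiff ℝ 2 f)
    (hp : Function.Periodic f (2 * Real.pi)) {z : ℂ} (hz : z ≠ 0) :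
    ContDiffAt ℝ 2 (fun z : ℂ => f z.arg) z := by
  have harg : ∀ w : ℂ, w ∈ Complex.slitPlane → ContDiffAt ℝ 2 Complex.arg w := fun w hw => by
    have h1 : ContDiffAt ℝ 2 Complex.log w := (Complex.contDiffAt_log hw).restrict_scalars ℝ
    have h2 : ContDiffAt ℝ 2 (fun w => Complex.imCLM (Complex.log w)) w :=
      Complex.imCLM.contDiff.contDiffAt.comp w h1
    simpa only [Complex.imCLM_apply, Complex.log_im] using h2
  by_cases h : z ∈ Complex.slitPlane
  · exact hf.contDiffAt.comp z (harg z h)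
  · have hneg : -z ∈ Complex.slitPlane := by
      simp only [Complex.mem_slitPlane_iff, not_or, not_lt, not_not] at h ⊢
      left
      rw [Complex.neg_re, neg_pos]
      refine lt_of_le_of_ne h.1 fun h0 => hz (Complex.ext h0 h.2)
    have h1 : ContDiffAt ℝ 2 (fun w : ℂ => f ((-w).arg + Real.pi)) z :=
      hf.contDiffAt.comp z (((harg (-z) hneg).comp z contDiff_neg.contDiffAt).add contDiffAt_const)
    refine h1.congr_of_eventuallyEq ?_
    filter_upwards [isOpen_ne.mem_nhds hz] with w hw
    have h2 : ((w.arg : ℝ) : Real.Angle) = (((-w).arg + Real.pi : ℝ) : Real.Angle) := by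
      rw [Real.Angle.coe_add, Complex.arg_neg_coe_angle hw, add_assoc, Real.Angle.coe_pi_add_coe_pi,
        add_zero]
    obtain ⟨n, hn⟩ := Real.Angle.angle_eq_iff_two_pi_dvd_sub.1 h2
    rw [sub_eq_iff_eq_add'.1 hn, mul_comm]
    exact hp.int_mul n _

lemma contDiffAt_comp_polarAngle {f : ℝ → ℝ} (hf : ContDiff ℝ 2 f)
    (hp : Function.Periodic f (2 * Real.pi)) {x : Plane} (hx : x ≠ 0) :
    ContDiffAt ℝ 2 (fun x => f (polarAngle x)) x := by
  have hz : (⟨x 0, x 1⟩ : ℂ) ≠ 0 := fun h => hx (by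
    have h0 := congrArg Complex.re h
    have h1 := congrArg Complex.im h
    ext i
    fin_cases i
    · exact h0
    · exact h1)
  have hlin : ContDiff ℝ 2 (fun x : Plane => (⟨x 0, x 1⟩ : ℂ)) := by
    have : (fun x : Plane => (⟨x 0, x 1⟩ : ℂ)) =
        fun x : Plane => Complex.ofRealCLM (x 0) + Complex.ofRealCLM (x 1) * Complex.I := by
      funext x
      apply Complex.ext <;> simp
    rw [this]
    fun_prop
  exact ContDiffAt.comp (g := fun z : ℂ => f z.arg) (f := fun x : Plane => (⟨x 0, x 1⟩ : ℂ)) x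
    (contDiffAt_comp_arg hf hp hz) hlin.contDiffAt

variable {W : Plane → ℝ} {c : Fin 3 → Plane} (d : JunctionData W c)

/-- The polar angle is singular only at the origin, near which the cut-off makes the function zero;
elsewhere periodicity removes the jump of the angle. -/
lemma JunctionData.contDiff_phi : ContDiff ℝ 2 d.phi := by
  rw [contDiff_iff_contDiffAt]
  intro x
  have hη : ContDiffAt ℝ 2 d.η x := (contDiff_two_of_infty d.η_smooth).contDiffAt
  rcases eq_or_ne x 0 with rfl | hx
  · have : d.phi =ᶠ[𝓝 0] fun _ => 0 := by
      filter_upwards [Metric.ball_mem_nhds (0 : Plane) (show (0 : ℝ) < 1 / 2 by norm_num)] with y hy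
      simp [JunctionData.phi, d.η_one y (mem_ball_zero_iff.1 hy).le]
    exact contDiffAt_const.congr_of_eventuallyEq this
  refine (contDiffAt_const.sub hη).smul (ContDiffAt.sum fun i _ => ?_)
  have hray := contDiffAt_comp_polarAngle (contDiff_two_of_infty (d.ray_smooth i))
    (d.ray_periodic i) hx
  have hsec := contDiffAt_comp_polarAngle (contDiff_two_of_infty (d.sector_smooth i))
    (d.sector_periodic i) hx
  have hdist : ContDiff ℝ 2 (signedDist (d.θ i.succ)) := by
    unfold signedDist
    fun_prop
  exact (hray.smul ((d.ζ_connection i).contDiff.comp hdist).contDiffAt).add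
    (hsec.smul contDiffAt_const)

lemma exists_bound_of_tendsto {ζ : ℝ → Plane} (hζ : Continuous ζ) {a b : Plane}
    (ha : Tendsto ζ atBot (𝓝 a)) (hb : Tendsto ζ atTop (𝓝 b)) : ∃ C, ∀ τ, ‖ζ τ‖ ≤ C := by
  obtain ⟨l, hl⟩ := eventually_atBot.1 (ha.norm.eventually (gt_mem_nhds (lt_add_one _)))
  obtain ⟨r, hr⟩ := eventually_atTop.1 (hb.norm.eventually (gt_mem_nhds (lt_add_one _)))
  obtain ⟨M, hM⟩ := (isCompact_Icc (a := l) (b := r)).exists_bound_of_continuousOn hζ.continuousOn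
  refine ⟨max (max (‖a‖ + 1) (‖b‖ + 1)) M, fun τ => ?_⟩
  by_cases h1 : τ ≤ l
  · exact (hl τ h1).le.trans ((le_max_left _ _).trans (le_max_left _ _))
  by_cases h2 : r ≤ τ
  · exact (hr τ h2).le.trans ((le_max_right _ _).trans (le_max_left _ _))
  · exact (hM τ ⟨(not_le.1 h1).le, (not_le.1 h2).le⟩).trans (le_max_right _ _)

lemma JunctionData.exists_norm_phi_le : ∃ C, ∀ x, ‖d.phi x‖ ≤ C := by
  obtain ⟨E, hE⟩ := (isCompact_closedBall (0 : Plane) 1).exists_bound_of_continuousOn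
    d.η_smooth.continuous.continuousOn
  have hη : ∀ x, |1 - d.η x| ≤ 1 + |E| := fun x => by
    refine (abs_sub _ _).trans ?_
    rw [abs_one]
    refine add_le_add_right ?_ 1
    rcases le_total ‖x‖ 1 with h | h
    · exact (hE x (mem_closedBall_zero_iff.2 h)).trans (le_abs_self E)
    · rw [d.η_zero x h, abs_zero]; positivity
  choose Z hZ using fun i => exists_bound_of_tendsto (d.ζ_connection i).contDiff.continuous
    (d.ζ_connection i).tendsto_atBot (d.ζ_connection i).tendsto_atTop
  have hle : ∀ i t, d.ray i t ≤ 1 ∧ d.sector i t ≤ 1 := fun i t => by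
    have h1 := Finset.single_le_sum (f := fun i => d.ray i t + d.sector i t)
      (fun j _ => add_nonneg (d.ray_nonneg j t) (d.sector_nonneg j t)) (Finset.mem_univ i)
    rw [d.sum_eq_one t] at h1
    have h2 := d.ray_nonneg i t
    have h3 := d.sector_nonneg i t
    constructor <;> linarith
  refine ⟨(1 + |E|) * ∑ i, (Z i + ‖c i‖), fun x => ?_⟩
  rw [JunctionData.phi, norm_smul]
  refine mul_le_mul (hη x) ((norm_sum_le _ _).trans (Finset.sum_le_sum fun i _ =>
    (norm_add_le _ _).trans (add_le_add ?_ ?_))) (norm_nonneg _) (by positivity)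
  · rw [norm_smul, Real.norm_of_nonneg (d.ray_nonneg i _)]
    exact (mul_le_of_le_one_left (norm_nonneg _) (hle i _).1).trans (hZ i _)
  · rw [norm_smul, Real.norm_of_nonneg (d.sector_nonneg i _)]
    exact mul_le_of_le_one_left (norm_nonneg _) (hle i _).2

end junction

/-! ### Bounds for the elliptic solutions -/

section elliptic

/-- The gradient term is nonnegative, so `|u|²` is subharmonic wherever `⟨u, Δu⟩ ≥ 0`. -/
lemma laplacian_norm_sq_comp {u : Plane → Plane} {x : Plane} (hu : ContDiffAt ℝ 2 u x) :
    laplacian (fun y => ‖u y‖ ^ 2) x =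
      2 * inner ℝ (u x) (laplacian u x) + 2 * ∑ i, ‖fderiv ℝ u x (basisVec i)‖ ^ 2 := by
  have hd := hu.differentiableAt (by norm_num)
  rw [laplacian_eq_of_hasFDerivAt (hu.norm_sq ℝ)
    (g := fun i y => 2 * inner ℝ (u y) (fderiv ℝ u y (basisVec i)))]
  · have h1 : ∀ i : Fin 2, fderiv ℝ (fun y => 2 * inner ℝ (u y) (fderiv ℝ u y (basisVec i))) x
        (basisVec i) = 2 * (inner ℝ (u x) (fderiv ℝ (fderiv ℝ u) x (basisVec i) (basisVec i)) +
          ‖fderiv ℝ u x (basisVec i)‖ ^ 2) := by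
      intro i
      have hd' : DifferentiableAt ℝ (fun y => fderiv ℝ u y (basisVec i)) x :=
        (differentiableAt_fderiv hu).clm_apply (differentiableAt_const _)
      rw [fderiv_const_mul (hd.inner ℝ hd'), smul_apply, fderiv_inner_apply ℝ hd hd',
        fderiv_fderiv_apply hu, real_inner_self_eq_norm_sq, smul_eq_mul]
    simp only [h1, laplacian_eq_sum u, inner_sum, Finset.mul_sum, ← Finset.sum_add_distrib, mul_add]
  · intro i
    filter_upwards [eventually_differentiableAt hu] with y hy
    have := (hy.hasFDerivAt.norm_sq).fderiv
    rw [this]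
    simp

lemma laplacian_comp_smul {F : Type*} [NormedAddCommGroup F] [NormedSpace ℝ F] (f : Plane → F)
    (s : ℝ) (x : Plane) : laplacian (fun y => f (s • y)) x = s ^ 2 • laplacian f (s • x) := by
  have h1 : fderiv ℝ (fun y => f (s • y)) = fun y => s • fderiv ℝ f (s • y) :=
    funext fun y => fderiv_comp_smul s
  have h2 : fderiv ℝ (fun y => s • fderiv ℝ f (s • y)) x =
      s • s • fderiv ℝ (fderiv ℝ f) (s • x) := by
    have h3 := congrFun (fderiv_const_smul_field (𝕜 := ℝ) (f := fun y => fderiv ℝ f (s • y)) s) x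
    rw [Pi.smul_apply, fderiv_comp_smul (f := fderiv ℝ f) s] at h3
    exact h3
  rw [laplacian_eq_sum, laplacian_eq_sum, h1, h2, Finset.smul_sum]
  refine Finset.sum_congr rfl fun i _ => ?_
  simp only [smul_apply, smul_smul, sq]

variable {W : Plane → ℝ} {φ u : Plane → Plane} {σ : ℝ}

lemma IsEllipticSolution.laplacian_eq (hu : IsEllipticSolution W φ σ u) {x : Plane}
    (hx : x ∈ Metric.ball (0 : Plane) 1) :
    laplacian u x = (1 / (2 * σ ^ 2)) • gradient W (u x) := by
  have := hu.equation x hx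
  rwa [neg_add_eq_zero] at this

/-- Elliptic solutions are bounded in terms of their boundary values. -/
lemma IsEllipticSolution.norm_le (hu : IsEllipticSolution W φ σ u) {r C : ℝ} (hr : 0 < r)
    (hW : ∀ v : Plane, r ≤ ‖v‖ → 0 < inner ℝ (gradient W v) v) (hC : ∀ x, ‖φ x‖ ≤ C) :
    ∀ x ∈ Metric.closedBall (0 : Plane) 1, ‖u x‖ ≤ max r C := by
  have hb : IsOpen (Metric.ball (0 : Plane) 1) := Metric.isOpen_ball
  have hcb : ContinuousOn u (Metric.ball 0 1) :=
    hu.continuousOn.mono Metric.ball_subset_closedBall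
  -- On this set the gradient of `W` points outwards, so `‖u‖²` is subharmonic; off it, `‖u‖` is at
  -- most `r` or equals a boundary value of `φ`.
  set U : Set Plane := Metric.ball 0 1 ∩ u ⁻¹' {v | r < ‖v‖} with hU
  have hUo : IsOpen U := hcb.isOpen_inter_preimage hb (isOpen_lt continuous_const continuous_norm)
  have hUK : U ⊆ Metric.closedBall 0 1 := inter_subset_left.trans Metric.ball_subset_closedBall
  have hm0 : 0 < max r C := lt_max_of_lt_left hr
  have key := le_of_laplacian_nonneg (isCompact_closedBall (0 : Plane) 1) hUo hUK
    (f := fun x => ‖u x‖ ^ 2) (m := max r C ^ 2) (hu.continuousOn.norm.pow 2)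
    ((hu.contDiffOn.mono inter_subset_left).norm_sq ℝ)
    (fun x hx => by
      rw [laplacian_norm_sq_comp (hu.contDiffOn.contDiffAt (hb.mem_nhds hx.1)),
        hu.laplacian_eq hx.1, real_inner_smul_right, real_inner_comm]
      have h1 := (hW (u x) (le_of_lt hx.2)).le
      positivity)
    (fun x hx => by
      gcongr
      by_cases hxb : x ∈ Metric.ball (0 : Plane) 1
      · have : ¬ r < ‖u x‖ := fun h => hx.2 ⟨hxb, h⟩
        exact (not_lt.1 this).trans (le_max_left _ _)
      · have hxs : x ∈ Metric.sphere (0 : Plane) 1 := by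
          rw [← Metric.closedBall_sdiff_ball]; exact ⟨hx.1, hxb⟩
        rw [hu.boundary x hxs]
        exact (hC _).trans (le_max_right _ _))
  intro x hx
  exact (pow_le_pow_iff_left₀ (norm_nonneg _) hm0.le two_ne_zero).1 (key x hx)

lemma norm_le_abs_add_abs (z : Plane) : ‖z‖ ≤ |z 0| + |z 1| := by
  refine abs_le_of_sq_le_sq' ?_ (by positivity) |>.2
  rw [norm_sq_eq, ← sq_abs (z 0), ← sq_abs (z 1)]
  nlinarith [abs_nonneg (z 0), abs_nonneg (z 1)]

/-- Interior gradient bound for vector valued functions with bounded Laplacian on a disc. -/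
lemma exists_norm_fderiv_le {v : Plane → Plane} {S M N : ℝ} (hS : 0 < S) (hM0 : 0 ≤ M) (hN0 : 0 ≤ N)
    (hv : ContDiffOn ℝ 2 v (Metric.ball 0 S))
    (hM : ∀ y ∈ Metric.ball (0 : Plane) S, ‖v y‖ ≤ M)
    (hN : ∀ y ∈ Metric.ball (0 : Plane) S, ‖laplacian v y‖ ≤ N) :
    ∃ G, 0 ≤ G ∧ ∀ y ∈ Metric.ball (0 : Plane) S, ∀ i,
      ‖fderiv ℝ v y (basisVec i)‖ ≤ G / (S - ‖y‖) := by
  -- The scalar gradient estimate is used on the disc of radius `(S - ‖y‖) / 2` about `y`, once for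
  -- each of the two components of `v`.
  refine ⟨2 * (8 * M + N * S ^ 2 / 2), by positivity, fun y hy i => ?_⟩
  have hyS := mem_ball_zero_iff.1 hy
  have hd : 0 < (S - ‖y‖) / 2 := by linarith
  have hsub : Metric.closedBall y ((S - ‖y‖) / 2) ⊆ Metric.ball 0 S := fun z hz => by
    rw [mem_ball_zero_iff]
    have h1 := mem_closedBall_iff_norm.1 hz
    have h2 := norm_add_le (z - y) y
    rw [sub_add_cancel] at h2
    linarith
  have hcomp : ∀ j : Fin 2, |(fderiv ℝ v y (basisVec i)) j| ≤
      (8 * M + N * S ^ 2 / 2) / (S - ‖y‖) := by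
    intro j
    set p : Plane →L[ℝ] ℝ := EuclideanSpace.proj j with hp
    have hpa : ∀ z : Plane, p z = z j := fun _ => rfl
    have hlap : ∀ z ∈ Metric.ball (0 : Plane) S,
        laplacian (fun z => p (v z)) z = p (laplacian v z) := fun z hz =>
      ContDiffAt.laplacian_CLM_comp_left (l := p)
        (hv.contDiffAt (Metric.isOpen_ball.mem_nhds hz))
    have h := norm_fderiv_le_of_laplacian (f := fun z => p (v z)) hd Metric.isOpen_ball hsub
      (p.contDiff.comp_contDiffOn hv) (M := M) (N := N)
      (fun z hz => (abs_apply_le_norm (v z) j).trans (hM z (hsub hz)))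
      (fun z hz => by
        rw [hlap z (hsub hz)]
        exact (abs_apply_le_norm _ j).trans (hN z (hsub hz)))
    have hvd : DifferentiableAt ℝ v y :=
      (hv.contDiffAt (Metric.isOpen_ball.mem_nhds hy)).differentiableAt (by norm_num)
    have e : fderiv ℝ (fun z => p (v z)) y = p.comp (fderiv ℝ v y) :=
      (p.hasFDerivAt.comp y hvd.hasFDerivAt).fderiv
    have h2 : |(fderiv ℝ v y (basisVec i)) j| ≤ ‖fderiv ℝ (fun z => p (v z)) y‖ := by
      have h3 := (fderiv ℝ (fun z => p (v z)) y).le_opNorm (basisVec i)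
      rw [show ‖basisVec i‖ = 1 by simp [basisVec], mul_one, e] at h3
      rw [e]
      exact h3
    refine h2.trans (h.trans ?_)
    have hpos : 0 < S - ‖y‖ := by linarith
    have h4 : (S - ‖y‖) ^ 2 ≤ S ^ 2 := by
      have := norm_nonneg y
      gcongr
      linarith
    rw [le_div_iff₀ hpos]
    have h5 : (4 * M / ((S - ‖y‖) / 2) + N * ((S - ‖y‖) / 2)) * (S - ‖y‖) =
        8 * M + N * (S - ‖y‖) ^ 2 / 2 := by
      field_simp
      ring
    rw [h5]
    gcongr
  refine (norm_le_abs_add_abs _).trans ((add_le_add (hcomp 0) (hcomp 1)).trans_eq ?_)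
  ring

end elliptic

/-! ### The approximate solution `V_q` -/

lemma IsCutoff.exists_bound {χ : ℝ → ℝ} (hχ : IsCutoff χ) : ∃ X, ∀ s, |χ s| ≤ X := by
  obtain ⟨X, hX⟩ := (isCompact_Icc (a := (1 / 2 : ℝ)) (b := 1)).exists_bound_of_continuousOn
    hχ.smooth.continuous.continuousOn
  refine ⟨max X 1, fun s => ?_⟩
  by_cases h1 : s ≤ 1 / 2
  · rw [hχ.eq_zero s h1, abs_zero]; positivity
  by_cases h2 : 1 ≤ s
  · rw [hχ.eq_one s h2, abs_one]; exact le_max_right _ _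
  · exact (hX s ⟨(not_le.1 h1).le, (not_le.1 h2).le⟩).trans (le_max_left _ _)

/-- The functions `V_q` are regular limits, with a bound that does not depend on the parameters. -/
theorem exists_isRegularLimit_approxSol {W : Plane → ℝ} {c : Fin 3 → Plane} (hW : IsThreeWell W c)
    (d : JunctionData W c) {χ : ℝ → ℝ} (hχ : IsCutoff χ) :
    ∃ B, ∀ q ∈ paramSet, ∀ L : ℝ, 0 < L → ∀ u : Plane → Plane,
      IsEllipticSolution W d.phi q.2.1 u → ∀ R,
        IsRegularLimit R B (approxSol d.phi χ L q u) (laplacian (approxSol d.phi χ L q u)) := by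
  obtain ⟨X, hX⟩ := hχ.exists_bound
  obtain ⟨Cφ, hCφ⟩ := d.exists_norm_phi_le
  obtain ⟨r₀, hr₀, hpos⟩ := hW.exists_inner_gradient_pos
  set Cv := max r₀ Cφ with hCv
  have hCv0 : 0 ≤ Cv := hr₀.le.trans (le_max_left _ _)
  obtain ⟨D, hD⟩ := (isCompact_closedBall (0 : Plane) Cv).exists_bound_of_continuousOn
    hW.continuous_gradient.continuousOn
  refine ⟨(1 + X) * (Cφ + Cv), ?_⟩
  rintro ⟨ε, σ, α⟩ ⟨hε, hσ, hα, hσε⟩ L hL u hu R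
  simp only at hε hσ hα hσε hu
  have hε0 : 0 < ε := hε.1
  have hσ0 : 0 < σ := hσ.1
  set r := ε ^ (α - 1) with hr
  -- This is the constraint `σ ≤ ε ^ (1 - α)`: the cut-off reaches one no later than the circle up
  -- to which `u (σ y)` solves its equation.
  have hrS : r ≤ σ⁻¹ := by
    rw [hr, show α - 1 = -(1 - α) by ring, Real.rpow_neg hε0.le]
    exact inv_anti₀ hσ0 hσε
  -- At `s = ε ^ (α - 1)` the argument of `χ` equals one.
  set F : ℝ → ℝ := fun s => χ (ε / (2 * L) * s + 1 - ε ^ α / (2 * L)) with hF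
  have hF2 : ContDiff ℝ 2 F := (contDiff_two_of_infty hχ.smooth).comp (by fun_prop)
  have hF1 : ∀ s, r ≤ s → F s = 1 := fun s hs => by
    refine hχ.eq_one _ ?_
    have h1 : ε ^ α = ε * r := by
      rw [hr, Real.rpow_sub_one hε0.ne']
      field_simp
    have h2 : ε * r / (2 * L) ≤ ε / (2 * L) * s := by
      rw [div_mul_eq_mul_div]
      gcongr
    rw [h1]
    linarith
  set v : Plane → Plane := fun y => u (σ • y) with hv
  have hmaps : ∀ y ∈ Metric.ball (0 : Plane) σ⁻¹, σ • y ∈ Metric.ball (0 : Plane) 1 := fun y hy => by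
    rw [mem_ball_zero_iff] at hy ⊢
    rw [norm_smul, Real.norm_of_nonneg hσ0.le]
    calc σ * ‖y‖ < σ * σ⁻¹ := by gcongr
      _ = 1 := mul_inv_cancel₀ hσ0.ne'
  have hv2 : ContDiffOn ℝ 2 v (Metric.ball 0 σ⁻¹) :=
    hu.contDiffOn.comp (contDiff_const_smul σ).contDiffOn hmaps
  have hvC : ∀ y ∈ Metric.ball (0 : Plane) σ⁻¹, ‖v y‖ ≤ Cv := fun y hy =>
    hu.norm_le hr₀ hpos hCφ _ (Metric.ball_subset_closedBall (hmaps y hy))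
  have hvN : ∀ y ∈ Metric.ball (0 : Plane) σ⁻¹, ‖laplacian v y‖ ≤ |D| := fun y hy => by
    rw [hv, laplacian_comp_smul, hu.laplacian_eq (hmaps y hy), smul_smul,
      show σ ^ 2 * (1 / (2 * σ ^ 2)) = 1 / 2 by field_simp, norm_smul,
      Real.norm_of_nonneg (by norm_num : (0 : ℝ) ≤ 1 / 2)]
    have := (hD (u (σ • y)) (mem_closedBall_zero_iff.2 (hvC y hy))).trans (le_abs_self D)
    linarith [norm_nonneg (gradient W (u (σ • y)))]
  -- The gradient constant depends on `σ`, but it only enters the auxiliary constant of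
  -- `IsRegularLimit`; the uniform bound involves `X`, `Cφ` and `Cv` alone.
  obtain ⟨G, hG, hvG⟩ := exists_norm_fderiv_le (inv_pos.2 hσ0) hCv0 (abs_nonneg D) hv2 hvC hvN
  have hreg := isRegularLimit_blend hF2 hF1 hrS (fun s => hX _) d.contDiff_phi hCφ hv2 hCv0 hG
    hvC hvN hvG R
  have e : blend F d.phi v 0 = approxSol d.phi χ L (ε, σ, α) u := by
    funext y
    have h0 : regNorm 0 y = ‖y‖ := by simp [regNorm]
    simp only [blend, approxSol, radialCutoff, h0, hF, hv]
  rwa [e] at hreg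

end AllenCahn

end

/-! ### The fixed point and the stability estimate -/

theorem lemma4p2 (W : AllenCahn.Plane → ℝ) (c : Fin 3 → AllenCahn.Plane)
    (hW : AllenCahn.IsThreeWell W c) (d : AllenCahn.JunctionData W c)
    (χ : ℝ → ℝ) (hχ : AllenCahn.IsCutoff χ) :
    -- `F` maps bounded continuous functions to such functions and has a unique global fixed point
    (∀ q ∈ AllenCahn.paramSet, ∀ L : ℝ, 0 < L → ∀ u : AllenCahn.Plane → AllenCahn.Plane,
      AllenCahn.IsEllipticSolution W d.phi q.2.1 u →
      ∀ ψ : AllenCahn.Plane → AllenCahn.Plane,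
      ContinuousOn ψ (Metric.ball 0 (1 / q.1)) →
      (∃ C : ℝ, ∀ x ∈ Metric.ball (0 : AllenCahn.Plane) (1 / q.1), ‖ψ x‖ ≤ C) →
        (∀ T : ℝ, 0 < T → ∀ w : AllenCahn.Plane → ℝ → AllenCahn.Plane,
          AllenCahn.IsBddCont (1 / q.1) (Icc 0 T) w →
          AllenCahn.IsBddCont (1 / q.1) (Icc 0 T)
            (AllenCahn.duhamel (1 / q.1) W (AllenCahn.approxSol d.phi χ L q u) ψ w)) ∧
        ∃ h : AllenCahn.Plane → ℝ → AllenCahn.Plane,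
          AllenCahn.IsFixedPointOn (1 / q.1) W (AllenCahn.approxSol d.phi χ L q u) ψ (Ici 0) h ∧
          ∀ T : ℝ, 0 < T → ∀ g : AllenCahn.Plane → ℝ → AllenCahn.Plane,
            AllenCahn.IsFixedPointOn (1 / q.1) W (AllenCahn.approxSol d.phi χ L q u) ψ
              (Icc 0 T) g →
            ∀ x ∈ Metric.ball (0 : AllenCahn.Plane) (1 / q.1), ∀ t ∈ Icc 0 T, g x t = h x t) ∧
    -- stability estimate on time windows, with constants independent of the parameters
    (∀ K Λ : ℝ, 0 < K → 0 < Λ → ∃ M β : ℝ, 0 < M ∧ 0 < β ∧ β < 1 ∧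
      ∀ q ∈ AllenCahn.paramSet, ∀ L : ℝ, 0 < L → ∀ u : AllenCahn.Plane → AllenCahn.Plane,
      AllenCahn.IsEllipticSolution W d.phi q.2.1 u →
      ∀ ψ : AllenCahn.Plane → AllenCahn.Plane,
      ContinuousOn ψ (Metric.ball 0 (1 / q.1)) →
      (∀ x ∈ Metric.ball (0 : AllenCahn.Plane) (1 / q.1), ‖ψ x‖ ≤ Λ) →
      ∀ h : AllenCahn.Plane → ℝ → AllenCahn.Plane,
      AllenCahn.IsFixedPointOn (1 / q.1) W (AllenCahn.approxSol d.phi χ L q u) ψ (Ici 0) h →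
      ∀ T : ℝ, 0 ≤ T → ∀ w : AllenCahn.Plane → ℝ → AllenCahn.Plane,
      ContinuousOn (fun p : AllenCahn.Plane × ℝ => w p.1 p.2)
        (Metric.ball 0 (1 / q.1) ×ˢ Icc 0 (T + 2 * β / M)) →
      (∀ x ∈ Metric.ball (0 : AllenCahn.Plane) (1 / q.1), ∀ t ∈ Icc 0 (T + 2 * β / M),
        ‖w x t‖ ≤ K) →
        AllenCahn.supNorm (1 / q.1) (Icc T (T + 2 * β / M)) (fun x t => w x t - h x t) ≤
          ENNReal.ofReal (1 / (1 - β)) *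
            (2 * AllenCahn.supNorm (1 / q.1) (Icc T (T + 2 * β / M)) (fun x t =>
                AllenCahn.duhamel (1 / q.1) W (AllenCahn.approxSol d.phi χ L q u) ψ w x t -
                  w x t) +
              AllenCahn.supNorm (1 / q.1) {T} (fun x t => w x t - h x t))) := by
  obtain ⟨B, hB⟩ := AllenCahn.exists_isRegularLimit_approxSol hW d hχ
  refine ⟨fun q hq L hL u hu ψ hψ ⟨D, hD⟩ => ?_, fun K Λ hK hΛ => ?_⟩
  · have hR : 0 < 1 / q.1 := one_div_pos.2 hq.1.1
    have hV := hB q hq L hL u hu (1 / q.1)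
    refine ⟨fun T _ w hw => AllenCahn.isBddCont_duhamel hR hW hV hψ hD hw, ?_⟩
    -- The ball has to contain the background `V` and the initial values `ψ + V`.
    obtain ⟨ρ, lam, lip, hρ, -, hlam, hlip, N, hNW, hNinv, hNlip⟩ :=
      hW.exists_truncation (max B (D + B))
    obtain ⟨h, hh, -⟩ := AllenCahn.exists_isFixedPointOn hR hV hψ hlam hlip hNW hNinv hNlip
      ((le_max_left _ _).trans hρ) hD ((le_max_right _ _).trans hρ)
    refine ⟨h, hh, fun T _ g hg x hx t ht => AllenCahn.eq_of_isFixedPointOn hR hW hV hψ hD hg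
      ⟨hh.1.mono Icc_subset_Ici_self, fun x hx t ht => hh.2 x hx t ht.1⟩ hx ht⟩
  -- The ball also has to contain `w + V`. Its radius involves only `K`, `Λ` and the uniform bound
  -- `B`, and is fixed before the parameters are introduced.
  · obtain ⟨ρ, lam, lip, hρ, -, hlam, hlip, N, hNW, hNinv, hNlip⟩ :=
      hW.exists_truncation (max B (max (K + B) (Λ + B)))
    have hBρ : B ≤ ρ := (le_max_left _ _).trans hρ
    have hKρ : K + B ≤ ρ := (le_max_left _ _).trans ((le_max_right _ _).trans hρ)
    have hΛρ : Λ + B ≤ ρ := (le_max_right _ _).trans ((le_max_right _ _).trans hρ)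
    -- With these values the window length `2 β / M` is `1 / (2 lip)`, on which the reaction changes
    -- differences by at most one half.
    refine ⟨2 * lip, 1 / 2, by positivity, by norm_num, by norm_num, ?_⟩
    intro q hq L hL u hu ψ hψ hψΛ h hh T hT w hw hwK
    have hR : 0 < 1 / q.1 := one_div_pos.2 hq.1.1
    have hV := hB q hq L hL u hu (1 / q.1)
    obtain ⟨k, hk, hkρ⟩ := AllenCahn.exists_isFixedPointOn hR hV hψ hlam hlip hNW hNinv hNlip
      hBρ hψΛ hΛρ
    -- The invariant ball is known for the constructed fixed point `k`; uniqueness on `[0, t]`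
    -- transfers it to the given `h`.
    have hhρ : ∀ x ∈ Metric.ball (0 : AllenCahn.Plane) (1 / q.1), ∀ t ∈ Ici (0 : ℝ),
        ‖h x t + AllenCahn.approxSol d.phi χ L q u x‖ ≤ ρ := by
      intro x hx t ht
      rw [AllenCahn.eq_of_isFixedPointOn hR hW hV hψ hψΛ (T := t)
        ⟨hh.1.mono Icc_subset_Ici_self, fun x hx t ht => hh.2 x hx t ht.1⟩
        ⟨hk.1.mono Icc_subset_Ici_self, fun x hx t ht => hk.2 x hx t ht.1⟩ hx ⟨ht, le_rfl⟩]
      exact hkρ x hx t ht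
    have hτ : lip * (2 * (1 / 2) / (2 * lip)) ≤ 1 / 2 := by
      apply le_of_eq
      field_simp
    have key := AllenCahn.supNorm_sub_le hR hW hV hψ hlip (ρ := ρ)
      (fun v w hv hw => by rw [← hNW v hv, ← hNW w hw]; exact hNlip v w) hψΛ hh hhρ hT hτ
      (by positivity) hw hwK hKρ
    rwa [show (1 : ℝ) / (1 - 1 / 2) = 2 by norm_num]
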